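/- Fix an integer $d\neq 0$. Let $H$ be the Hilbert space of functions $w$ on $(0,\infty)$ with weak derivative $w'$ and norm $\|w\|_H^2=\int_0^\infty [(w')^2+w^2]\,r\,dr<\infty$, and let $X$ be the space of $u\in H$ with $\|u\|_X^2=\int_0^\infty [(u')^2+u^2+u^2/r^2]\,r\,dr<\infty$. There is a positive solution $\tilde f_\infty$ of $$-f''-\tfrac1r f'+\tfrac{d^2}{r^2}f=(1-f^2)f \quad\text{on }(0,\infty),\qquad f(0)=0,\quad f(r)\to1\ (r\to\infty).$$ Let $\tilde f_\infty$ be any such solution (it is in fact unique), let $Z=\{(\tilde f_\infty+u,m): u\in X,\ m\in H\}$, an affine space over $X\times H$, and put $$g_\infty^*=-\inf_{w\in H\setminus\{0\}}\frac{\int_0^\infty[(w')^2-(1-\tilde f_\infty^2)w^2]\,r\,dr}{\int_0^\infty w^2\,r\,dr}.$$ For $g>0$, a pair $(f,m)$ of functions on $[0,\infty)$ is called an admissible solution of (GL)$_{\infty,g}$ if it is a classical ($C^2$) solution of $$-f''-\tfrac1r f'+\tfrac{d^2}{r^2}f=(1-f^2-m^2)f,\qquad -m''-\tfrac1r m'+gm=(1-f^2-m^2)m$$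 on $(0,\infty)$, if $f\ge0$ and $m\ge0$ on $[0,\infty)$, $m'(0)=0$, and if its energy $$\tfrac12\int_0^\infty\Big\{(f')^2+(m')^2+gm^2+\tfrac{d^2}{r^2}(f^2-\tilde f_\infty^2)+\tfrac12(1-f^2-m^2)^2\Big\}\,r\,dr$$ is finite. Then $g_\infty^*>0$, and every admissible solution $(f,m)$ of (GL)$_{\infty,g}$ with $g>0$ and $m>0$ on $[0,\infty)$ belongs to $Z$. Let $$\Sigma=\{(f,m,g): g>0,\ (f,m)\text{ is an admissible solution of (GL)}_{\infty,g}\text{ with } m>0\}\subset Z\times\mathbb R,\qquad \mathcal C=\Sigma\cup\{(\tilde f_\infty,0,g_\infty^*)\}.$$ Then: 1. $\mathcal C$ is a connected $C^1$ curve in $Z\times\mathbb R$ with end point $(\tilde f_\infty,0,g_\infty^*)$: it is the homeomorphic image of $[0,\infty)$ under a $C^1$ map with nowhere vanishing derivative that sends $0$ to $(\tilde f_\infty,0,g_\infty^*)$. 2. $\mathcal C$ is parametrized by $g\in(0,g_\infty^*]$: there is a map $\Phi:(0,g_\infty^*]\to Z$, continuous on $(0,g_\infty^*]$ and $C^1$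 on $(0,g_\infty^*)$, such that $\mathcal C=\{(\Phi(g),g): 0<g\le g_\infty^*\}$. 3. For every $g_0>0$, the set $\mathcal C\cap\{g\ge g_0\}$ is compact in $Z\times\mathbb R$. -/

import Mathlib

open MeasureTheory Set Filter Topology
open scoped ContDiff

noncomputable section

namespace VortexGL

/-- The measure `r dr` on the half-line `(0, ∞)`. -/
def radialMeasure : Measure ℝ :=
  (volume.restrict (Ioi (0 : ℝ))).withDensity (fun r => ENNReal.ofReal r)

/-- The Hilbert space `L²_r = L²((0, ∞), r dr)`. -/
abbrev L2r : Type := Lp ℝ 2 radialMeasure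

/-- `v` is the weak derivative of `u` on the open half-line `(0, ∞)`. -/
def HasWeakDeriv (u v : ℝ → ℝ) : Prop :=
  ∀ φ : ℝ → ℝ, ContDiff ℝ ∞ φ → HasCompactSupport φ → tsupport φ ⊆ Ioi 0 →
    ∫ r in Ioi (0 : ℝ), u r * deriv φ r = - ∫ r in Ioi (0 : ℝ), v r * φ r

theorem ae_restrict_of_ae_radial {p : ℝ → Prop} (h : ∀ᵐ r ∂radialMeasure, p r) :
    ∀ᵐ r ∂(volume.restrict (Ioi (0 : ℝ))), p r := by
  rw [radialMeasure, ae_withDensity_iff ENNReal.measurable_ofReal] at h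
  filter_upwards [h, ae_restrict_mem measurableSet_Ioi] with r hr hr0
  exact hr (by simpa using hr0)

instance : IsLocallyFiniteMeasure radialMeasure := by
  unfold radialMeasure
  exact IsLocallyFiniteMeasure.withDensity_ofReal continuous_id

/-- Elements of `L²_r` can be tested against continuous functions with compact support
in `(0, ∞)`. -/
theorem integrableOn_mul_test (u : L2r) {ψ : ℝ → ℝ} (hψ : Continuous ψ)
    (hc : HasCompactSupport ψ) (hs : tsupport ψ ⊆ Ioi 0) :
    IntegrableOn (fun r => u r * ψ r) (Ioi 0) := by
  have hcont : Continuous (fun r => ψ r / r) := by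
    rw [continuous_iff_continuousAt]
    intro r
    by_cases hr : r = 0
    · have h0 : ψ =ᶠ[𝓝 r] 0 := by
        rw [← notMem_tsupport_iff_eventuallyEq]
        intro h
        have := hs h
        simp [hr] at this
      have h1 : (fun r => ψ r / r) =ᶠ[𝓝 r] fun _ => 0 := by
        filter_upwards [h0] with s hs'
        simp [hs']
      exact continuousAt_const.congr h1.symm
    · exact hψ.continuousAt.div continuousAt_id hr
  have hcs : HasCompactSupport (fun r => ψ r / r) := by
    apply hc.mono
    intro r hr h
    apply hr
    simp [h]
  have hmem : MemLp (fun r => ψ r / r) 2 radialMeasure :=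
    hcont.memLp_of_hasCompactSupport hcs
  have hint : Integrable (fun r => u r * (ψ r / r)) radialMeasure :=
    (Lp.memLp u).integrable_mul hmem
  have hint' := (integrable_withDensity_iff_integrable_smul'
    (μ := volume.restrict (Ioi (0 : ℝ))) ENNReal.measurable_ofReal (by simp)).1 hint
  refine hint'.congr ?_
  filter_upwards [ae_restrict_mem measurableSet_Ioi] with r hr
  have hr' : (0 : ℝ) < r := hr
  rw [ENNReal.toReal_ofReal hr'.le, smul_eq_mul]
  field_simp

theorem HasWeakDeriv.zero : HasWeakDeriv (0 : L2r) (0 : L2r) := by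
  intro φ _ _ _
  have h := ae_restrict_of_ae_radial (Lp.coeFn_zero ℝ 2 radialMeasure)
  rw [integral_congr_ae (g := fun _ => (0 : ℝ)) (h.mono fun r hr => by simp only [hr]; simp),
    integral_congr_ae (f := fun r => (0 : L2r) r * φ r) (g := fun _ => (0 : ℝ))
      (h.mono fun r hr => by simp only [hr]; simp)]
  simp

theorem HasWeakDeriv.add {u v u' v' : L2r} (h : HasWeakDeriv u v) (h' : HasWeakDeriv u' v') :
    HasWeakDeriv (u + u' : L2r) (v + v' : L2r) := by
  intro φ hφ hc hs
  have hφ' : Continuous (deriv φ) := hφ.continuous_deriv (by simp)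
  have hs' : tsupport (deriv φ) ⊆ Ioi 0 := (tsupport_deriv_subset).trans hs
  have e1 := ae_restrict_of_ae_radial (Lp.coeFn_add u u')
  have e2 := ae_restrict_of_ae_radial (Lp.coeFn_add v v')
  rw [integral_congr_ae (f := fun r => (u + u' : L2r) r * deriv φ r)
      (g := fun r => u r * deriv φ r + u' r * deriv φ r)
      (e1.mono fun r hr => by simp only [hr, Pi.add_apply, add_mul]),
    integral_congr_ae (f := fun r => (v + v' : L2r) r * φ r)
      (g := fun r => v r * φ r + v' r * φ r)
      (e2.mono fun r hr => by simp only [hr, Pi.add_apply, add_mul]),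
    integral_add (integrableOn_mul_test u hφ' hc.deriv hs')
      (integrableOn_mul_test u' hφ' hc.deriv hs'),
    integral_add (integrableOn_mul_test v hφ.continuous hc hs)
      (integrableOn_mul_test v' hφ.continuous hc hs), h φ hφ hc hs, h' φ hφ hc hs]
  ring

theorem HasWeakDeriv.smul {u v : L2r} (c : ℝ) (h : HasWeakDeriv u v) :
    HasWeakDeriv (c • u : L2r) (c • v : L2r) := by
  intro φ hφ hc hs
  have e1 := ae_restrict_of_ae_radial (Lp.coeFn_smul c u)
  have e2 := ae_restrict_of_ae_radial (Lp.coeFn_smul c v)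
  rw [integral_congr_ae (f := fun r => (c • u : L2r) r * deriv φ r)
      (g := fun r => c * (u r * deriv φ r))
      (e1.mono fun r hr => by simp only [hr, Pi.smul_apply, smul_eq_mul, mul_assoc]),
    integral_congr_ae (f := fun r => (c • v : L2r) r * φ r)
      (g := fun r => c * (v r * φ r))
      (e2.mono fun r hr => by simp only [hr, Pi.smul_apply, smul_eq_mul, mul_assoc]),
    integral_const_mul, integral_const_mul, h φ hφ hc hs]
  ring

/-- The radial Sobolev space `H = H¹_r`, realised as the space of pairs `(w, w')` in
`L²_r × L²_r`; its norm is `‖w‖_H² = ∫ [(w')² + w²] r dr`. -/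
def H : Submodule ℝ (PiLp 2 (fun _ : Fin 2 => L2r)) where
  carrier := {w | HasWeakDeriv (w 0) (w 1)}
  zero_mem' := HasWeakDeriv.zero
  add_mem' := fun h h' => HasWeakDeriv.add h h'
  smul_mem' := fun c _ h => HasWeakDeriv.smul c h

/-- The space `X = {u ∈ H : ∫ (u² / r²) r dr < ∞}`, realised as the space of triples
`(u, u', u / r)` in `L²_r × L²_r × L²_r`; its norm is
`‖u‖_X² = ∫ [(u')² + u² + u² / r²] r dr`. -/
def X : Submodule ℝ (PiLp 2 (fun _ : Fin 3 => L2r)) where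
  carrier := {u | HasWeakDeriv (u 0) (u 1) ∧ ∀ᵐ r ∂radialMeasure, u 2 r = u 0 r / r}
  zero_mem' := by
    refine ⟨HasWeakDeriv.zero, ?_⟩
    filter_upwards [Lp.coeFn_zero ℝ 2 radialMeasure] with r hr
    simp only [PiLp.zero_apply, hr]
    simp
  add_mem' := by
    rintro a b ⟨ha, ha'⟩ ⟨hb, hb'⟩
    refine ⟨HasWeakDeriv.add ha hb, ?_⟩
    filter_upwards [ha', hb', Lp.coeFn_add (a 0) (b 0), Lp.coeFn_add (a 2) (b 2)]
      with r h1 h2 h3 h4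
    simp only [PiLp.add_apply, h3, h4, Pi.add_apply, h1, h2]
    ring
  smul_mem' := by
    rintro c a ⟨ha, ha'⟩
    refine ⟨HasWeakDeriv.smul c ha, ?_⟩
    filter_upwards [ha', Lp.coeFn_smul c (a 0), Lp.coeFn_smul c (a 2)] with r h1 h2 h3
    simp only [PiLp.smul_apply, h2, h3, Pi.smul_apply, h1, smul_eq_mul]
    ring

/-- The function (an a.e. class on `(0, ∞)`) underlying an element of `X`. -/
def X.fn (u : X) : L2r := (u : PiLp 2 (fun _ : Fin 3 => L2r)) 0

/-- The function (an a.e. class on `(0, ∞)`) underlying an element of `H`. -/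
def H.fn (w : H) : L2r := (w : PiLp 2 (fun _ : Fin 2 => L2r)) 0

/-- The weak derivative of an element of `H`. -/
def H.der (w : H) : L2r := (w : PiLp 2 (fun _ : Fin 2 => L2r)) 1

/-- The space `Z₀ = X × H`. A point `(u, w)` of `Z₀` stands for the point `(f̃ + u, w)` of the
affine space `Z = (f̃, 0) + Z₀`. -/
abbrev Z₀ : Type := X × H

/-- `ft` is a normal core profile `f̃_∞` of degree `d`: a positive solution of
`-f'' - f'/r + (d²/r²) f = (1 - f²) f` on `(0, ∞)` with `f(0) = 0` and `f(r) → 1`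
as `r → ∞`. -/
structure IsNormalCore (d : ℤ) (ft : ℝ → ℝ) : Prop where
  contDiffOn : ContDiffOn ℝ 2 ft (Ioi 0)
  eqn : ∀ r > 0, - deriv (deriv ft) r - (1 / r) * deriv ft r + ((d : ℝ) ^ 2 / r ^ 2) * ft r
    = (1 - ft r ^ 2) * ft r
  pos : ∀ r > 0, 0 < ft r
  at_zero : ft 0 = 0
  continuous_zero : ContinuousWithinAt ft (Ici 0) 0
  at_infty : Tendsto ft atTop (𝓝 1)

/-- The density (with respect to `r dr`, and up to the factor `1/2`) of the energy
`ℰ_{∞,g}(f, m)`, in which the divergent term `d² f̃² / r²` is subtracted. -/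
def energyDensity (d : ℤ) (ft : ℝ → ℝ) (g : ℝ) (f m : ℝ → ℝ) (r : ℝ) : ℝ :=
  (deriv f r) ^ 2 + (deriv m r) ^ 2 + g * (m r) ^ 2
    + ((d : ℝ) ^ 2 / r ^ 2) * ((f r) ^ 2 - (ft r) ^ 2)
    + (1 / 2) * (1 - (f r) ^ 2 - (m r) ^ 2) ^ 2

/-- `(f, m)` is an admissible solution of `(GL)_{∞,g}`: a classical solution on `(0, ∞)`, of
finite energy, with `f, m ≥ 0` on `[0, ∞)` and `m'(0) = 0`. Only the values on `[0, ∞)` matter.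
For `g > 0` the negative part of `r` times the energy density is always integrable on `(0, ∞)`,
so that the energy is finite exactly if this function is integrable. -/
structure IsAdmissible (d : ℤ) (ft : ℝ → ℝ) (g : ℝ) (f m : ℝ → ℝ) : Prop where
  contDiffOn_f : ContDiffOn ℝ 2 f (Ioi 0)
  contDiffOn_m : ContDiffOn ℝ 2 m (Ioi 0)
  eqn_f : ∀ r > 0, - deriv (deriv f) r - (1 / r) * deriv f r + ((d : ℝ) ^ 2 / r ^ 2) * f r
    = (1 - f r ^ 2 - m r ^ 2) * f r
  eqn_m : ∀ r > 0, - deriv (deriv m) r - (1 / r) * deriv m r + g * m r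
    = (1 - f r ^ 2 - m r ^ 2) * m r
  finite_energy : IntegrableOn (fun r => energyDensity d ft g f m r * r) (Ioi 0)
  nonneg_f : ∀ r ≥ 0, 0 ≤ f r
  nonneg_m : ∀ r ≥ 0, 0 ≤ m r
  deriv_m_zero : HasDerivWithinAt m 0 (Ici 0) 0

/-- The point `(u, w)` of `Z₀` represents the pair of functions `(f, m)`: `f = f̃ + u` and
`m = w` almost everywhere on `(0, ∞)`. -/
def Represents (ft : ℝ → ℝ) (z : Z₀) (f m : ℝ → ℝ) : Prop :=
  (∀ᵐ r ∂radialMeasure, f r = ft r + X.fn z.1 r) ∧ (∀ᵐ r ∂radialMeasure, m r = H.fn z.2 r)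

/-- The Rayleigh quotient of the Schrödinger operator `-Δ_r - (1 - f̃²)`. -/
def rayleigh (ft : ℝ → ℝ) (w : H) : ℝ :=
  (∫ r, ((H.der w r) ^ 2 - (1 - ft r ^ 2) * (H.fn w r) ^ 2) ∂radialMeasure)
    / ∫ r, (H.fn w r) ^ 2 ∂radialMeasure

/-- The bifurcation value `g*_∞`. -/
def gStar (ft : ℝ → ℝ) : ℝ := - sInf {q : ℝ | ∃ w : H, w ≠ 0 ∧ q = rayleigh ft w}

/-- The set `Σ` of the triples `(f, m, g)`, `g > 0`, where `(f, m)` is an admissible solution of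
`(GL)_{∞,g}` with `m > 0`, as a subset of `Z × ℝ`. -/
def solutionSet (d : ℤ) (ft : ℝ → ℝ) : Set (Z₀ × ℝ) :=
  {p | 0 < p.2 ∧ ∃ f m : ℝ → ℝ, IsAdmissible d ft p.2 f m ∧ (∀ r ≥ 0, 0 < m r) ∧
    Represents ft p.1 f m}

/-- The bifurcation point `(f̃_∞, 0, g*_∞)` of `Z × ℝ`. -/
def bifurcationPoint (ft : ℝ → ℝ) : Z₀ × ℝ := (0, gStar ft)

/-- The set `𝒞 = Σ ∪ {(f̃_∞, 0, g*_∞)}`. -/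
def solutionCurve (d : ℤ) (ft : ℝ → ℝ) : Set (Z₀ × ℝ) :=
  solutionSet d ft ∪ {bifurcationPoint ft}

/-- `C` is an embedded (regular) `C¹` curve with end point `p`: there is a `C¹` map on `[0, ∞)`
with nowhere vanishing derivative which is a homeomorphism onto `C` and starts at `p`. -/
def IsC1CurveFrom {E : Type*} [NormedAddCommGroup E] [NormedSpace ℝ E] (p : E) (C : Set E) :
    Prop :=
  ∃ γ : ℝ → E, ContDiffOn ℝ 1 γ (Ici 0) ∧ (∀ t ≥ 0, derivWithin γ (Ici 0) t ≠ 0) ∧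
    IsEmbedding ((Ici (0 : ℝ)).domRestrict γ) ∧ γ 0 = p ∧ γ '' Ici 0 = C

/-- `C` is parametrized by its second coordinate `g`, which ranges over `(0, b]`: it is the graph
of a function which is continuous on `(0, b]` and `C¹` on `(0, b)`. -/
def IsGraphOver {E : Type*} [NormedAddCommGroup E] [NormedSpace ℝ E] (b : ℝ) (C : Set (E × ℝ)) :
    Prop :=
  ∃ Φ : ℝ → E, ContinuousOn Φ (Ioc 0 b) ∧ ContDiffOn ℝ 1 Φ (Ioo 0 b) ∧
    C = (fun g => (Φ g, g)) '' Ioc 0 b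

end VortexGL

end

open MeasureTheory Set Filter Topology
open scoped ContDiff

noncomputable section

namespace VortexGL

/-! ### The radial measure -/

/-! The system is studied in weak form on `Z₀`: `eqn g z = 0`, where `z = (u, w)` stands for `f = f̃
+ u`, `m = w`. Everything rests on one structural fact: both equations are linear Schrödinger
equations with the same potential `aa z = 1 - f² - m²`, and `f` and `m` are positive solutions of
them. By Picone's inequality the forms `QX d (aa z)` and `QH g (aa z)` are therefore non-negative.
The first has trivial kernel, because `f → 1` while elements of `X` tend to `0`; the kernel of the
second is the line spanned by `m`.

The nonlinear part of the energy is the square of the norm of `hh z = f² + m² - f̃²`. Hence two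
solutions satisfy an exact identity, `two_solution_identity`: both forms evaluated at the
difference, plus `‖hh z₁ - hh z₂‖²`, plus `(g₁ - g₂)(‖m₁‖² - ‖m₂‖²)`, add up to zero. All but the
last of these terms are non-negative. This gives uniqueness for fixed `g`, the bound `g < g*`
(comparison with the normal core at `g*`), and the monotonicity of `‖m‖` in `g`.

The linearisation at a positive solution is the same form plus `2‖N z ζ‖²`. It is positive definite,
and it is coercive because it differs from a coercive form by a weakly continuous one. The implicit
function theorem then continues each positive solution locally in `g` (`IsPosSol.exists_branch`).
The energy of a positive solution is non-positive, which bounds solutions for `g ≥ g₀ > 0`; weak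
limits from above are again positive solutions, since monotonicity of `‖m‖` prevents `m` from
disappearing (`exists_isPosSol_of_tendsto`).

At `g*` the operator `-Δ - (1 - f̃²)` has a positive ground state `w`. With `m = s (w + ...)` and
the second equation divided by `s`, the implicit function theorem yields a `C¹` branch leaving the
normal core (`exists_bifurcation`). The abstract structure `IsBranch` collects these facts: the
values of `g` that occur fill `(0, g*)`, uniqueness makes the solution set a graph that is `C¹`
inside and continuous at `g*`, and the curve is obtained by gluing the local branch to a
reparametrized graph. Since `C` is a continuous graph over `(0, g*]`, its part over `[g₀, g*]` is
compact.

Three further ingredients are density of test functions supported away from the origin (a point has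
zero capacity in the plane), the equivalence of weak and classical solutions including the behaviour
of `m` at `0`, and the existence of the normal core, by minimization of a renormalized energy. -/

theorem ae_radial_iff {p : ℝ → Prop} :
    (∀ᵐ r ∂radialMeasure, p r) ↔ ∀ᵐ r ∂(volume.restrict (Ioi (0 : ℝ))), p r := by
  refine ⟨ae_restrict_of_ae_radial, fun h => ?_⟩
  rw [radialMeasure, ae_withDensity_iff ENNReal.measurable_ofReal]
  exact h.mono fun r hr _ => hr

theorem ae_radial_pos : ∀ᵐ r ∂radialMeasure, 0 < r :=
  ae_radial_iff.2 (ae_restrict_mem measurableSet_Ioi)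

theorem integral_radial (g : ℝ → ℝ) :
    ∫ r, g r ∂radialMeasure = ∫ r in Ioi (0 : ℝ), r * g r := by
  rw [radialMeasure, integral_withDensity_eq_integral_toReal_smul ENNReal.measurable_ofReal
    (by simp)]
  refine setIntegral_congr_fun measurableSet_Ioi fun r hr => ?_
  have hr' : (0 : ℝ) < r := hr
  simp [ENNReal.toReal_ofReal hr'.le]

theorem integrable_radial_iff {g : ℝ → ℝ} :
    Integrable g radialMeasure ↔ IntegrableOn (fun r => r * g r) (Ioi 0) := by
  rw [radialMeasure, integrable_withDensity_iff_integrable_smul' ENNReal.measurable_ofReal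
    (by simp), IntegrableOn]
  refine integrable_congr ?_
  filter_upwards [ae_restrict_mem measurableSet_Ioi] with r hr
  have hr' : (0 : ℝ) < r := hr
  simp [ENNReal.toReal_ofReal hr'.le]

theorem aestronglyMeasurable_radial {g : ℝ → ℝ}
    (hg : AEStronglyMeasurable g (volume.restrict (Ioi 0))) :
    AEStronglyMeasurable g radialMeasure :=
  hg.mono_ac (withDensity_absolutelyContinuous _ _)

theorem aestronglyMeasurable_of_radial {g : ℝ → ℝ}
    (hg : AEStronglyMeasurable g radialMeasure) :
    AEStronglyMeasurable g (volume.restrict (Ioi 0)) := by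
  obtain ⟨g', h1, h2⟩ := hg
  exact ⟨g', h1, ae_restrict_of_ae_radial h2⟩

theorem memLp_two_radial {g : ℝ → ℝ}
    (hg : AEStronglyMeasurable g (volume.restrict (Ioi 0)))
    (hi : IntegrableOn (fun r => r * g r ^ 2) (Ioi 0)) : MemLp g 2 radialMeasure :=
  (memLp_two_iff_integrable_sq (aestronglyMeasurable_radial hg)).2 (integrable_radial_iff.2 hi)

theorem memLp_two_radial_of_continuousOn {g : ℝ → ℝ} (hg : ContinuousOn g (Ioi 0))
    (hi : IntegrableOn (fun r => r * g r ^ 2) (Ioi 0)) : MemLp g 2 radialMeasure :=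
  memLp_two_radial (hg.aestronglyMeasurable measurableSet_Ioi) hi

theorem MemLp.integrableOn_sq_radial {g : ℝ → ℝ} (hg : MemLp g 2 radialMeasure) :
    IntegrableOn (fun r => r * g r ^ 2) (Ioi 0) :=
  integrable_radial_iff.1 hg.integrable_sq

/-- Away from the origin both `r g²` and `1/r` are integrable on compact intervals, and `2|g| ≤ r g²
+ 1/r` by the arithmetic-geometric inequality. -/
theorem MemLp.intervalIntegrable_radial {g : ℝ → ℝ} (hg : MemLp g 2 radialMeasure) {a b : ℝ}
    (ha : 0 < a) (hb : 0 < b) : IntervalIntegrable g volume a b := by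
  have hs : uIcc a b ⊆ Ioi 0 := fun x hx => lt_of_lt_of_le (lt_min ha hb) hx.1
  have hm := (aestronglyMeasurable_of_radial hg.1).mono_set hs
  have hi := (MemLp.integrableOn_sq_radial hg).mono_set hs
  rw [intervalIntegrable_iff']
  have h1 : IntegrableOn (fun r => 1 / r) (uIcc a b) :=
    (ContinuousOn.integrableOn_compact isCompact_uIcc
      (continuousOn_const.div continuousOn_id fun x hx => (hs hx).ne'))
  refine Integrable.mono (hi.add h1) hm ?_
  filter_upwards [ae_restrict_mem measurableSet_uIcc] with r hr
  have hr' : 0 < r := hs hr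
  simp only [Pi.add_apply, Real.norm_eq_abs]
  rw [abs_of_nonneg (a := r * g r ^ 2 + 1 / r) (by positivity)]
  have h2 : |g r| ≤ (r * g r ^ 2 + 1 / r) / 2 := by
    rw [le_div_iff₀ two_pos, ← sq_abs (g r)]
    have : r * |g r| ^ 2 + 1 / r - |g r| * 2 = (r * |g r| - 1) ^ 2 / r := by field_simp; ring
    have h3 : 0 ≤ (r * |g r| - 1) ^ 2 / r := by positivity
    linarith
  have h3 : 0 ≤ r * g r ^ 2 + 1 / r := by positivity
  linarith

theorem locallyIntegrableOn_of_intervalIntegrable {g : ℝ → ℝ}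
    (hg : ∀ a b : ℝ, 0 < a → 0 < b → IntervalIntegrable g volume a b) :
    LocallyIntegrableOn g (Ioi 0) := by
  rw [locallyIntegrableOn_iff isOpen_Ioi.isLocallyClosed]
  intro k hk hkc
  rcases k.eq_empty_or_nonempty with rfl | hne
  · simp
  have ha : 0 < sInf k := hk (hkc.sInf_mem hne)
  have hb : 0 < sSup k := hk (hkc.sSup_mem hne)
  have h := hg _ _ ha hb
  rw [intervalIntegrable_iff'] at h
  refine h.mono_set fun x hx => ?_
  exact Icc_subset_uIcc ⟨csInf_le hkc.bddBelow hx, le_csSup hkc.bddAbove hx⟩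

/-! ### Absolutely continuous representatives -/

/-- A function is the primitive of `v` on the half-line. -/
def IsPrimitive (w v : ℝ → ℝ) : Prop :=
  ∀ a b : ℝ, 0 < a → 0 < b → IntervalIntegrable v volume a b ∧ w b - w a = ∫ r in a..b, v r

theorem IsPrimitive.eqOn_integral {w v : ℝ → ℝ} (h : IsPrimitive w v) {a b : ℝ}
    (ha : 0 < a) (hb : 0 < b) : EqOn w (fun r => (∫ s in a..r, v s) + w a) (uIcc a b) := by
  intro x hx
  have hx0 : 0 < x := lt_of_lt_of_le (lt_min ha hb) hx.1
  have := (h a x ha hx0).2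
  simp only
  linarith

theorem AbsolutelyContinuousOnInterval_congr {f g : ℝ → ℝ} {a b : ℝ}
    (hf : AbsolutelyContinuousOnInterval f a b) (h : EqOn f g (uIcc a b)) :
    AbsolutelyContinuousOnInterval g a b := by
  rw [absolutelyContinuousOnInterval_iff] at hf ⊢
  intro ε hε
  obtain ⟨δ, hδ, H⟩ := hf ε hε
  refine ⟨δ, hδ, fun E hE hs => ?_⟩
  have := H E hE hs
  refine lt_of_eq_of_lt (Finset.sum_congr rfl fun i hi => ?_) this
  have := hE.1 i hi
  rw [h this.1, h this.2]

theorem IsPrimitive.absolutelyContinuous {w v : ℝ → ℝ} (h : IsPrimitive w v) {a b : ℝ}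
    (ha : 0 < a) (hb : 0 < b) : AbsolutelyContinuousOnInterval w a b := by
  have h1 := (h a b ha hb).1.absolutelyContinuousOnInterval_intervalIntegral
    (c := a) left_mem_uIcc
  have h2 : AbsolutelyContinuousOnInterval (fun _ : ℝ => w a) a b :=
    (contDiff_const (n := 1) (𝕜 := ℝ)).contDiffOn.absolutelyContinuousOnInterval
  exact AbsolutelyContinuousOnInterval_congr (h1.add h2) fun x hx =>
    (h.eqOn_integral ha hb hx).symm

theorem IsPrimitive.continuousOn {w v : ℝ → ℝ} (h : IsPrimitive w v) :
    ContinuousOn w (Ioi 0) := by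
  intro r hr
  have hr' : (0 : ℝ) < r := hr
  have h1 := (h.absolutelyContinuous (a := r / 2) (b := 2 * r) (by linarith)
    (by linarith)).continuousOn
  refine (h1.continuousAt ?_).continuousWithinAt
  rw [uIcc_of_le (by linarith)]
  exact Icc_mem_nhds (by linarith) (by linarith)

theorem IsPrimitive.ae_hasDerivAt {w v : ℝ → ℝ} (h : IsPrimitive w v) {a b : ℝ}
    (ha : 0 < a) (hb : 0 < b) : ∀ᵐ x, x ∈ uIoo a b → HasDerivAt w (v x) x := by
  filter_upwards [(h a b ha hb).1.ae_hasDerivAt_integral] with x hx hxm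
  have hx' := hx (uIoo_subset_uIcc_self hxm) a left_mem_uIcc
  refine (hx'.add_const (w a)).congr_of_eventuallyEq ?_
  filter_upwards [isOpen_Ioo.mem_nhds hxm] with y hy
  exact h.eqOn_integral ha hb (uIoo_subset_uIcc_self hy)

/-- Integration by parts for absolutely continuous functions. The given densities agree almost
everywhere with the derivatives, by Lebesgue differentiation. -/
theorem IsPrimitive.integral_mul {w v w' v' : ℝ → ℝ} (h : IsPrimitive w v)
    (h' : IsPrimitive w' v') {a b : ℝ} (ha : 0 < a) (hb : 0 < b) :
    ∫ r in a..b, (v r * w' r + w r * v' r) = w b * w' b - w a * w' a := by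
  rw [← (h.absolutelyContinuous ha hb).integral_deriv_mul_eq_sub (h'.absolutelyContinuous ha hb)]
  refine intervalIntegral.integral_congr_ae_restrict ?_
  rw [uIoc, ← Measure.restrict_congr_set (Ioo_ae_eq_Ioc (a := min a b) (b := max a b))]
  rw [EventuallyEq, ae_restrict_iff' measurableSet_Ioo]
  filter_upwards [h.ae_hasDerivAt ha hb, h'.ae_hasDerivAt ha hb] with x h1 h2 hx
  rw [(h1 hx).deriv, (h2 hx).deriv]

theorem IsPrimitive.mul {w v w' v' : ℝ → ℝ} (h : IsPrimitive w v) (h' : IsPrimitive w' v') :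
    IsPrimitive (fun r => w r * w' r) (fun r => v r * w' r + w r * v' r) := by
  intro a b ha hb
  have hs : uIcc a b ⊆ Ioi 0 := fun x hx => lt_of_lt_of_le (lt_min ha hb) hx.1
  refine ⟨((h a b ha hb).1.mul_continuousOn (h'.continuousOn.mono hs)).add
    ((h' a b ha hb).1.continuousOn_mul (h.continuousOn.mono hs)), ?_⟩
  exact (h.integral_mul h' ha hb).symm

theorem IsPrimitive.of_hasDerivAt {w v : ℝ → ℝ} (h : ∀ r > 0, HasDerivAt w (v r) r)
    (hv : ContinuousOn v (Ioi 0)) : IsPrimitive w v := by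
  intro a b ha hb
  have hs : uIcc a b ⊆ Ioi 0 := fun x hx => lt_of_lt_of_le (lt_min ha hb) hx.1
  have hi : IntervalIntegrable v volume a b := (hv.mono hs).intervalIntegrable
  exact ⟨hi, (intervalIntegral.integral_eq_sub_of_hasDerivAt (fun x hx => h x (hs hx)) hi).symm⟩

theorem IsPrimitive.hasDerivAt {w v : ℝ → ℝ} (h : IsPrimitive w v) {r : ℝ} (hr : 0 < r)
    (hv : ContinuousOn v (Ioi 0)) : HasDerivAt w (v r) r := by
  have h1 : HasDerivAt (fun x => ∫ s in r..x, v s) (v r) r := by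
    refine intervalIntegral.integral_hasDerivAt_right (h r r hr hr).1 ?_
      (hv.continuousAt (Ioi_mem_nhds hr))
    exact hv.stronglyMeasurableAtFilter isOpen_Ioi r hr
  refine (h1.add_const (w r)).congr_of_eventuallyEq ?_
  filter_upwards [Ioi_mem_nhds hr] with y hy
  exact h.eqOn_integral hr hy right_mem_uIcc

theorem IsPrimitive.congr_ae {w v v' : ℝ → ℝ} (h : IsPrimitive w v)
    (hv : ∀ᵐ r ∂(volume.restrict (Ioi (0 : ℝ))), v r = v' r) : IsPrimitive w v' := by
  intro a b ha hb
  have hs : uIoc a b ⊆ Ioi 0 := fun x hx => (lt_min ha hb).trans hx.1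
  have he : v =ᵐ[volume.restrict (uIoc a b)] v' := ae_mono (Measure.restrict_mono hs le_rfl) hv
  exact ⟨(h a b ha hb).1.congr_ae he, by
    rw [(h a b ha hb).2, intervalIntegral.integral_congr_ae_restrict he]⟩

/-- The normalisation `a < 1 < b` keeps the interval non-empty even if `φ = 0`, and makes any two
such intervals overlap, so that minima of left and maxima of right end points stay ordered. -/
theorem exists_Icc_of_test {φ : ℝ → ℝ} (hc : HasCompactSupport φ) (hs : tsupport φ ⊆ Ioi 0) :
    ∃ a b : ℝ, 0 < a ∧ a < 1 ∧ 1 < b ∧ tsupport φ ⊆ Ioo a b := by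
  rcases (tsupport φ).eq_empty_or_nonempty with h | hne
  · exact ⟨1 / 2, 2, by norm_num, by norm_num, by norm_num, by simp [h]⟩
  have h1 := hs (hc.sInf_mem hne)
  have h2 := hs (hc.sSup_mem hne)
  simp only [mem_Ioi] at h1 h2
  refine ⟨min (sInf (tsupport φ)) 1 / 2, max (sSup (tsupport φ)) 1 + 1, ?_, ?_, ?_, ?_⟩
  · have := lt_min h1 one_pos; linarith
  · have := min_le_right (sInf (tsupport φ)) 1; linarith
  · have := le_max_right (sSup (tsupport φ)) 1; linarith
  · intro x hx
    have h3 := csInf_le hc.bddBelow hx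
    have h4 := le_csSup hc.bddAbove hx
    have h5 := lt_min h1 one_pos
    have h6 := min_le_left (sInf (tsupport φ)) 1
    have h7 := le_max_left (sSup (tsupport φ)) 1
    constructor <;> linarith

theorem setIntegral_eq_of_support {F : ℝ → ℝ} {a b : ℝ} (ha : 0 < a) (hab : a ≤ b)
    (h : ∀ r, r ∉ Ioo a b → F r = 0) : ∫ r in Ioi (0 : ℝ), F r = ∫ r in a..b, F r := by
  rw [intervalIntegral.integral_of_le hab]
  refine (setIntegral_eq_of_subset_of_forall_sdiff_eq_zero measurableSet_Ioi
    (fun x hx => ha.trans hx.1) fun x hx => h x fun hx' => hx.2 ⟨hx'.1, hx'.2.le⟩)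

theorem IsPrimitive.hasWeakDeriv {w v : ℝ → ℝ} (h : IsPrimitive w v) : HasWeakDeriv w v := by
  intro φ hφ hc hs
  obtain ⟨a, b, ha, ha1, hb1, hab⟩ := exists_Icc_of_test hc hs
  have hab' : a ≤ b := (ha1.trans hb1).le
  have hb : 0 < b := by linarith
  have hz : ∀ r, r ∉ Ioo a b → φ r = 0 := fun r hr =>
    image_eq_zero_of_notMem_tsupport fun hx => hr (hab hx)
  have hz' : ∀ r, r ∉ Ioo a b → deriv φ r = 0 := fun r hr =>
    image_eq_zero_of_notMem_tsupport fun hx => hr (hab (tsupport_deriv_subset hx))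
  rw [setIntegral_eq_of_support (a := a) (b := b) ha hab' (fun r hr => by simp [hz' r hr]),
    setIntegral_eq_of_support (a := a) (b := b) ha hab' (fun r hr => by simp [hz r hr])]
  have hφp : IsPrimitive φ (deriv φ) :=
    IsPrimitive.of_hasDerivAt (fun r _ => (hφ.differentiable (by simp) r).hasDerivAt)
      (hφ.continuous_deriv (by simp)).continuousOn
  have h1 := h.integral_mul hφp ha hb
  rw [hz a (by simp), hz b (by simp)] at h1
  have hs' : uIcc a b ⊆ Ioi 0 := fun x hx => lt_of_lt_of_le (lt_min ha hb) hx.1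
  rw [intervalIntegral.integral_add
    ((h a b ha hb).1.mul_continuousOn (hφ.continuous.continuousOn))
    ((hφp a b ha hb).1.continuousOn_mul (h.continuousOn.mono hs'))] at h1
  linarith

/-- The du Bois-Reymond lemma on the half-line. -/
theorem ae_eq_const_of_integral_deriv {D : ℝ → ℝ}
    (hD : ∀ a b : ℝ, 0 < a → 0 < b → IntervalIntegrable D volume a b)
    (h : ∀ φ : ℝ → ℝ, ContDiff ℝ ∞ φ → HasCompactSupport φ → tsupport φ ⊆ Ioi 0 →
      ∫ r in Ioi (0 : ℝ), D r * deriv φ r = 0) :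
    ∃ k : ℝ, ∀ᵐ r ∂(volume.restrict (Ioi (0 : ℝ))), D r = k := by
  let B : ContDiffBump (2 : ℝ) := ⟨1 / 2, 1, by norm_num, by norm_num⟩
  let χ : ℝ → ℝ := B.normed volume
  have hχ : ContDiff ℝ ∞ χ := B.contDiff_normed
  have hχc : HasCompactSupport χ := B.hasCompactSupport_normed
  have hχt : tsupport χ ⊆ Ioi 0 := by
    rw [B.tsupport_normed_eq]
    intro x hx
    have h2 : dist x 2 ≤ 1 := by simpa [B] using hx
    rw [Real.dist_eq, abs_le] at h2
    simp only [mem_Ioi]; linarith [h2.1]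
  have hχ1 : ∫ x, χ x = 1 := B.integral_normed
  have hint : ∀ g : ℝ → ℝ, Continuous g → HasCompactSupport g → tsupport g ⊆ Ioi 0 →
      IntegrableOn (fun r => D r * g r) (Ioi 0) := by
    intro g hg hgc hgs
    obtain ⟨a, b, ha, ha1, hb1, hab⟩ := exists_Icc_of_test hgc hgs
    have hi : IntegrableOn (fun r => D r * g r) (Ioc a b) := by
      have := (hD a b ha (by linarith)).mul_continuousOn (hg.continuousOn (s := uIcc a b))
      rwa [intervalIntegrable_iff_integrableOn_Ioc_of_le (by linarith)] at this
    refine (hi.of_forall_sdiff_eq_zero (t := Ioi 0) measurableSet_Ioi fun x hx => ?_)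
    rw [image_eq_zero_of_notMem_tsupport (f := g), mul_zero]
    exact fun hx' => hx.2 ⟨(hab hx').1, (hab hx').2.le⟩
  refine ⟨∫ r in Ioi (0 : ℝ), D r * χ r, ?_⟩
  set k := ∫ r in Ioi (0 : ℝ), D r * χ r with hk
  have key := isOpen_Ioi.ae_eq_zero_of_integral_contDiff_smul_eq_zero (μ := volume)
    (f := fun r => D r - k) (U := Ioi (0 : ℝ))
    ((locallyIntegrableOn_of_intervalIntegrable fun a b ha hb =>
      (hD a b ha hb).sub (intervalIntegrable_const))) ?_
  · rw [ae_restrict_iff' measurableSet_Ioi]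
    filter_upwards [key] with x hx hx0
    linarith [hx hx0]
  intro g hg hgc hgs
  set c := ∫ x, g x with hc
  obtain ⟨a, b, ha, ha1, hb1, hab⟩ := exists_Icc_of_test hgc hgs
  obtain ⟨a', b', ha', ha1', hb1', hab'⟩ := exists_Icc_of_test hχc hχt
  set α := min a a' with hα
  set β := max b b' with hβ
  have hα0 : 0 < α := lt_min ha ha'
  have hα1 : α < 1 := (min_le_left _ _).trans_lt ha1
  have hβ1 : 1 < β := hb1.trans_le (le_max_left _ _)
  -- Subtracting the multiple `c χ` of the normalised bump makes the integral vanish, so the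
  -- primitive of `ψ` is again a test function and the hypothesis applies to it. This is why the
  -- constant is the mean of `D` against `χ`.
  let ψ : ℝ → ℝ := fun r => g r - c * χ r
  have hψ : ContDiff ℝ ∞ ψ := hg.sub (contDiff_const.mul hχ)
  have hψz : ∀ r, r ∉ Ioo α β → ψ r = 0 := by
    intro r hr
    have h1 : g r = 0 := image_eq_zero_of_notMem_tsupport fun hx => hr
      ⟨(min_le_left _ _).trans_lt (hab hx).1, (hab hx).2.trans_le (le_max_left _ _)⟩
    have h2 : χ r = 0 := image_eq_zero_of_notMem_tsupport fun hx => hr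
      ⟨(min_le_right _ _).trans_lt (hab' hx).1, (hab' hx).2.trans_le (le_max_right _ _)⟩
    simp [ψ, h1, h2]
  let φ : ℝ → ℝ := fun r => ∫ s in α..r, ψ s
  have hφd : ∀ r, HasDerivAt φ (ψ r) r := fun r =>
    intervalIntegral.integral_hasDerivAt_right (hψ.continuous.intervalIntegrable _ _)
      (hψ.continuous.stronglyMeasurableAtFilter _ _) hψ.continuous.continuousAt
  have hφd' : deriv φ = ψ := funext fun r => (hφd r).deriv
  have hφs : ContDiff ℝ ∞ φ := by
    have h0 : (∞ : WithTop ℕ∞) = (∞ : WithTop ℕ∞) + 1 := rfl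
    rw [h0, contDiff_succ_iff_deriv]
    exact ⟨fun r => (hφd r).differentiableAt, by simp, by rw [hφd']; exact hψ⟩
  have hψtot : ∫ s in α..β, ψ s = 0 := by
    have h1 : ∫ s, ψ s = 0 := by
      rw [integral_sub (hg.continuous.integrable_of_hasCompactSupport hgc)
        ((hχ.continuous.integrable_of_hasCompactSupport hχc).const_mul c), integral_const_mul,
        hχ1, ← hc]
      ring
    rw [← h1, intervalIntegral.integral_of_le (by linarith)]
    refine setIntegral_eq_integral_of_forall_compl_eq_zero fun x hx => hψz x fun hx' => hx ?_
    exact ⟨hx'.1, hx'.2.le⟩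
  have hφz : ∀ r, r ∉ Icc α β → φ r = 0 := by
    intro r hr
    rcases lt_or_ge r α with h1 | h1
    · refine (intervalIntegral.integral_congr (g := fun _ => (0 : ℝ)) fun x hx => ?_).trans
        (by simp)
      rw [uIcc_of_ge h1.le] at hx
      exact hψz x fun hx' => by linarith [hx.2, hx'.1]
    · have h2 : β < r := by
        by_contra h2
        exact hr ⟨h1, not_lt.1 h2⟩
      have h3 : ∫ s in β..r, ψ s = 0 := by
        refine (intervalIntegral.integral_congr (g := fun _ => (0 : ℝ)) fun x hx => ?_).trans
          (by simp)
        rw [uIcc_of_le h2.le] at hx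
        exact hψz x fun hx' => by linarith [hx.1, hx'.2]
      have h4 := intervalIntegral.integral_add_adjacent_intervals
        (hψ.continuous.intervalIntegrable (μ := volume) α β)
        (hψ.continuous.intervalIntegrable (μ := volume) β r)
      simp only [φ]; linarith
  have hφt : tsupport φ ⊆ Icc α β :=
    closure_minimal (fun x hx => by by_contra hx'; exact hx (hφz x hx')) isClosed_Icc
  have h1 := h φ hφs (HasCompactSupport.of_support_subset_isCompact isCompact_Icc
    (subset_tsupport φ |>.trans hφt)) (hφt.trans fun x hx => hα0.trans_le hx.1)
  rw [hφd'] at h1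
  have i1 := hint g hg.continuous hgc hgs
  have i2 := hint χ hχ.continuous hχc hχt
  have h2 : ∫ r in Ioi (0 : ℝ), D r * ψ r = (∫ r in Ioi (0 : ℝ), D r * g r) - c * k := by
    rw [hk, ← integral_const_mul, ← integral_sub i1 (i2.const_mul c)]
    congr 1; ext r; simp only [ψ]; ring
  have hgI : Integrable g := hg.continuous.integrable_of_hasCompactSupport hgc
  have h3 : ∫ r, g r • (D r - k) = ∫ r in Ioi (0 : ℝ), (D r * g r - k * g r) := by
    have : ∀ r, g r • (D r - k) = D r * g r - k * g r := fun r => by simp only [smul_eq_mul]; ring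
    simp_rw [this]
    symm
    refine setIntegral_eq_integral_of_forall_compl_eq_zero fun x hx => ?_
    rw [image_eq_zero_of_notMem_tsupport (f := g) (fun h => hx (hgs h))]; ring
  have h4 : ∫ r in Ioi (0 : ℝ), g r = c := by
    rw [hc]
    exact setIntegral_eq_integral_of_forall_compl_eq_zero fun x hx =>
      image_eq_zero_of_notMem_tsupport (f := g) (fun h => hx (hgs h))
  rw [h3, integral_sub i1 (hgI.integrableOn.const_mul k), integral_const_mul, h4]
  linarith

/-- The difference between `u` and the integral of `v` has weak derivative zero, hence is constant
by the du Bois-Reymond lemma. -/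
theorem HasWeakDeriv.exists_primitive {u v : ℝ → ℝ}
    (hu : ∀ a b : ℝ, 0 < a → 0 < b → IntervalIntegrable u volume a b)
    (hv : ∀ a b : ℝ, 0 < a → 0 < b → IntervalIntegrable v volume a b) (h : HasWeakDeriv u v) :
    ∃ w, IsPrimitive w v ∧ ∀ᵐ r ∂(volume.restrict (Ioi (0 : ℝ))), u r = w r := by
  let U : ℝ → ℝ := fun r => ∫ s in (1 : ℝ)..r, v s
  have hU : IsPrimitive U v := fun a b ha hb => ⟨hv a b ha hb, by
    simp only [U]
    rw [intervalIntegral.integral_interval_sub_left (hv 1 b one_pos hb) (hv 1 a one_pos ha)]⟩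
  have hUi : ∀ a b : ℝ, 0 < a → 0 < b → IntervalIntegrable U volume a b := fun a b ha hb =>
    (hU.continuousOn.mono fun x hx => lt_of_lt_of_le (lt_min ha hb) hx.1).intervalIntegrable
  obtain ⟨k, hk⟩ := ae_eq_const_of_integral_deriv (D := fun r => u r - U r)
    (fun a b ha hb => (hu a b ha hb).sub (hUi a b ha hb)) (by
      intro φ hφ hc hs
      have h1 := h φ hφ hc hs
      have h2 := hU.hasWeakDeriv φ hφ hc hs
      obtain ⟨a, b, ha, ha1, hb1, hab⟩ := exists_Icc_of_test hc hs
      have hz : ∀ r, r ∉ Ioo a b → deriv φ r = 0 := fun r hr =>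
        image_eq_zero_of_notMem_tsupport fun hx => hr (hab (tsupport_deriv_subset hx))
      have e : ∀ F : ℝ → ℝ, ∫ r in Ioi (0 : ℝ), F r * deriv φ r
          = ∫ r in a..b, F r * deriv φ r := fun F =>
        setIntegral_eq_of_support ha (by linarith) fun r hr => by simp [hz r hr]
      rw [e] at h1 h2 ⊢
      have hφ' : ContinuousOn (deriv φ) (uIcc a b) :=
        (hφ.continuous_deriv (by simp)).continuousOn
      simp_rw [sub_mul]
      rw [intervalIntegral.integral_sub ((hu a b ha (by linarith)).mul_continuousOn hφ')
        ((hUi a b ha (by linarith)).mul_continuousOn hφ')]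
      linarith)
  refine ⟨fun r => U r + k, fun a b ha hb => ⟨hv a b ha hb, ?_⟩, ?_⟩
  · rw [← (hU a b ha hb).2]; ring
  · filter_upwards [hk] with r hr
    linarith

theorem eq_of_ae_eq_of_continuousOn {w w' : ℝ → ℝ} (hw : ContinuousOn w (Ioi 0))
    (hw' : ContinuousOn w' (Ioi 0))
    (h : ∀ᵐ r ∂(volume.restrict (Ioi (0 : ℝ))), w r = w' r) : EqOn w w' (Ioi 0) :=
  Measure.eqOn_open_of_ae_eq h isOpen_Ioi hw hw'

/-! ### Weak sequential compactness in Hilbert spaces -/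

/-- Weak convergence of a sequence in a real normed space. -/
def WeakTendsto {E : Type*} [NormedAddCommGroup E] [NormedSpace ℝ E] (x : ℕ → E) (y : E) : Prop :=
  ∀ L : E →L[ℝ] ℝ, Tendsto (fun n => L (x n)) atTop (𝓝 (L y))

theorem WeakTendsto.map {E F : Type*} [NormedAddCommGroup E] [NormedSpace ℝ E]
    [NormedAddCommGroup F] [NormedSpace ℝ F] {x : ℕ → E} {y : E} (h : WeakTendsto x y)
    (T : E →L[ℝ] F) : WeakTendsto (fun n => T (x n)) (T y) :=
  fun L => h (L.comp T)

theorem WeakTendsto.comp {E : Type*} [NormedAddCommGroup E] [NormedSpace ℝ E] {x : ℕ → E} {y : E}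
    (h : WeakTendsto x y) {φ : ℕ → ℕ} (hφ : StrictMono φ) : WeakTendsto (x ∘ φ) y :=
  fun L => (h L).comp hφ.tendsto_atTop

theorem WeakTendsto.sub_const {E : Type*} [NormedAddCommGroup E] [NormedSpace ℝ E] {x : ℕ → E}
    {y : E} (h : WeakTendsto x y) : WeakTendsto (fun n => x n - y) 0 := by
  intro L
  have := (h L).sub_const (L y)
  simpa using this

/-- The sequential Banach-Alaoglu theorem in the dual of a separable space, transported by the Riesz
isomorphism. -/
theorem exists_weakTendsto_subseq {E : Type*} [NormedAddCommGroup E] [InnerProductSpace ℝ E]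
    [CompleteSpace E] [TopologicalSpace.SeparableSpace E] {x : ℕ → E} {C : ℝ}
    (hx : ∀ n, ‖x n‖ ≤ C) : ∃ y, ∃ φ : ℕ → ℕ, StrictMono φ ∧ WeakTendsto (x ∘ φ) y := by
  let J := InnerProductSpace.toDual ℝ E
  have hmem : ∀ n, (StrongDual.toWeakDual (J (x n)) : WeakDual ℝ E) ∈
      WeakDual.toStrongDual ⁻¹' Metric.closedBall (0 : StrongDual ℝ E) C := by
    intro n
    rw [mem_preimage, mem_closedBall_zero_iff]
    exact (LinearIsometryEquiv.norm_map J (x n)).trans_le (hx n)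
  obtain ⟨y, -, φ, hφ, hy⟩ := WeakDual.isSeqCompact_closedBall ℝ E 0 C hmem
  refine ⟨J.symm (WeakDual.toStrongDual y), φ, hφ, fun L => ?_⟩
  have h1 := (WeakDual.eval_continuous (𝕜 := ℝ) (J.symm L)).continuousAt.tendsto.comp hy
  have e : ∀ z : E, L z = inner ℝ z (J.symm L) := fun z => by
    rw [real_inner_comm, ← InnerProductSpace.toDual_apply_apply (𝕜 := ℝ)]
    simp [J]
  have e2 : L (J.symm (WeakDual.toStrongDual y)) = y (J.symm L) := by
    rw [e, ← InnerProductSpace.toDual_apply_apply (𝕜 := ℝ)]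
    simp [J]
  rw [e2]
  refine h1.congr fun n => ?_
  rw [Function.comp_apply, Function.comp_apply, Function.comp_apply, e]
  exact InnerProductSpace.toDual_apply_apply (𝕜 := ℝ)

/-! ### Multiplication operators on `L²_r` -/

theorem memLp_mul_of_abs_le_one {b : ℝ → ℝ} (hm : AEStronglyMeasurable b radialMeasure)
    (hb : ∀ᵐ r ∂radialMeasure, |b r| ≤ 1) (u : L2r) :
    MemLp (fun r => b r * u r) 2 radialMeasure :=
  (Lp.memLp u).of_le (hm.mul (Lp.aestronglyMeasurable u)) (by
    filter_upwards [hb] with r hr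
    rw [norm_mul, Real.norm_eq_abs]
    exact mul_le_of_le_one_left (norm_nonneg _) hr)

/-- Multiplication by a function bounded by `1`. -/
def mulOne (b : ℝ → ℝ) (hm : AEStronglyMeasurable b radialMeasure)
    (hb : ∀ᵐ r ∂radialMeasure, |b r| ≤ 1) : L2r →L[ℝ] L2r :=
  LinearMap.mkContinuous
    { toFun := fun u => (memLp_mul_of_abs_le_one hm hb u).toLp _
      map_add' := fun u v => by
        rw [← MemLp.toLp_add]
        refine MemLp.toLp_congr _ _ ?_
        filter_upwards [Lp.coeFn_add u v] with r hr
        simp only [hr, Pi.add_apply, mul_add]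
      map_smul' := fun c u => by
        rw [RingHom.id_apply, ← MemLp.toLp_const_smul]
        refine MemLp.toLp_congr _ _ ?_
        filter_upwards [Lp.coeFn_smul c u] with r hr
        simp only [hr, Pi.smul_apply, smul_eq_mul]
        ring } 1 (fun u => by
      rw [one_mul]
      refine Lp.norm_le_norm_of_ae_le ?_
      filter_upwards [hb, (memLp_mul_of_abs_le_one hm hb u).coeFn_toLp] with r hr hr'
      simp only [LinearMap.coe_mk, AddHom.coe_mk]
      rw [hr', norm_mul, Real.norm_eq_abs]
      exact mul_le_of_le_one_left (norm_nonneg _) hr)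

theorem coeFn_mulOne {b : ℝ → ℝ} (hm : AEStronglyMeasurable b radialMeasure)
    (hb : ∀ᵐ r ∂radialMeasure, |b r| ≤ 1) (u : L2r) :
    ∀ᵐ r ∂radialMeasure, mulOne b hm hb u r = b r * u r :=
  (memLp_mul_of_abs_le_one hm hb u).coeFn_toLp

/-! ### The spaces `H` and `X` -/

theorem memLp_div_of_test {ψ : ℝ → ℝ} (hψ : Continuous ψ)
    (hc : HasCompactSupport ψ) (hs : tsupport ψ ⊆ Ioi 0) :
    MemLp (fun r => ψ r / r) 2 radialMeasure := by
  obtain ⟨a, b, ha, ha1, hb1, hab⟩ := exists_Icc_of_test hc hs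
  have hcont : ContinuousOn (fun r => ψ r / r) (Ioi 0) :=
    hψ.continuousOn.div continuousOn_id fun x hx => (ne_of_gt hx)
  refine memLp_two_radial_of_continuousOn hcont ?_
  have hi : IntegrableOn (fun r => r * (ψ r / r) ^ 2) (Icc a b) :=
    ContinuousOn.integrableOn_compact isCompact_Icc
      (continuousOn_id.mul ((hcont.mono fun x hx => ha.trans_le hx.1).pow 2))
  refine hi.of_forall_sdiff_eq_zero measurableSet_Ioi fun x hx => ?_
  rw [image_eq_zero_of_notMem_tsupport (f := ψ) fun h => hx.2 ⟨(hab h).1.le, (hab h).2.le⟩]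
  simp

/-- Weak derivatives are tested against Lebesgue measure while the norm carries the weight `r`;
pairing with `ψ` is the inner product of `L²_r` with `ψ / r`. Its continuity makes the weak
derivative relation closed, and hence `H` and `X` complete. -/
theorem continuous_integral_test {ψ : ℝ → ℝ} (hψ : Continuous ψ)
    (hc : HasCompactSupport ψ) (hs : tsupport ψ ⊆ Ioi 0) :
    Continuous fun u : L2r => ∫ r in Ioi (0 : ℝ), u r * ψ r := by
  have hm := memLp_div_of_test hψ hc hs
  have e : (fun u : L2r => ∫ r in Ioi (0 : ℝ), u r * ψ r)
      = fun u => inner ℝ (hm.toLp _) u := by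
    ext u
    rw [L2.inner_def, integral_radial]
    refine setIntegral_congr_ae measurableSet_Ioi ?_
    rw [← ae_restrict_iff' measurableSet_Ioi]
    filter_upwards [ae_restrict_of_ae_radial hm.coeFn_toLp, ae_restrict_mem measurableSet_Ioi]
      with r hr hr0
    have hr0' : (0 : ℝ) < r := hr0
    rw [hr]
    simp only [RCLike.inner_apply, conj_trivial]
    field_simp
  rw [e]
  fun_prop

theorem isClosed_hasWeakDeriv :
    IsClosed {p : L2r × L2r | HasWeakDeriv p.1 p.2} := by
  simp only [HasWeakDeriv, ofPred_forall]
  refine isClosed_iInter fun φ => isClosed_iInter fun hφ => isClosed_iInter fun hc =>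
    isClosed_iInter fun hs => isClosed_eq ?_ ?_
  · exact (continuous_integral_test (hφ.continuous_deriv (by simp)) hc.deriv
      (tsupport_deriv_subset.trans hs)).comp continuous_fst
  · exact ((continuous_integral_test hφ.continuous hc hs).comp continuous_snd).neg

theorem isClosed_H : IsClosed (H : Set (PiLp 2 (fun _ : Fin 2 => L2r))) := by
  have : (H : Set (PiLp 2 (fun _ : Fin 2 => L2r)))
      = (fun w => (w 0, w 1)) ⁻¹' {p : L2r × L2r | HasWeakDeriv p.1 p.2} := rfl
  rw [this]
  exact isClosed_hasWeakDeriv.preimage (by fun_prop)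

/-- Division by `r` is unbounded on `L²_r`. Dividing the relation `u₂ = u₀ / r` by `1 + 1/r` turns
it into `r/(1+r) u₂ = 1/(1+r) u₀`, an equation between bounded multiplication operators. -/
theorem isClosed_X : IsClosed (X : Set (PiLp 2 (fun _ : Fin 3 => L2r))) := by
  have m1 : AEStronglyMeasurable (fun r : ℝ => r / (1 + r)) radialMeasure :=
    (measurable_id.div (measurable_const.add measurable_id)).aestronglyMeasurable
  have m2 : AEStronglyMeasurable (fun r : ℝ => 1 / (1 + r)) radialMeasure :=
    (measurable_const.div (measurable_const.add measurable_id)).aestronglyMeasurable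
  have b1 : ∀ᵐ r ∂radialMeasure, |r / (1 + r)| ≤ 1 := by
    filter_upwards [ae_radial_pos] with r hr
    rw [abs_of_pos (by positivity), div_le_one (by positivity)]; linarith
  have b2 : ∀ᵐ r ∂radialMeasure, |1 / (1 + r)| ≤ 1 := by
    filter_upwards [ae_radial_pos] with r hr
    rw [abs_of_pos (by positivity), div_le_one (by positivity)]; linarith
  have : (X : Set (PiLp 2 (fun _ : Fin 3 => L2r)))
      = (fun w => (w 0, w 1)) ⁻¹' {p : L2r × L2r | HasWeakDeriv p.1 p.2} ∩
        {w | mulOne _ m1 b1 (w 2) = mulOne _ m2 b2 (w 0)} := by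
    ext w
    refine and_congr Iff.rfl ?_
    constructor
    · intro h
      refine Lp.ext ?_
      filter_upwards [h, coeFn_mulOne m1 b1 (w 2), coeFn_mulOne m2 b2 (w 0), ae_radial_pos]
        with r h1 h2 h3 h4
      rw [h2, h3, h1]
      field_simp
    · intro h
      filter_upwards [coeFn_mulOne m1 b1 (w 2), coeFn_mulOne m2 b2 (w 0), ae_radial_pos]
        with r h2 h3 h4
      rw [show mulOne _ m1 b1 (w 2) = mulOne _ m2 b2 (w 0) from h, h3] at h2
      field_simp at h2 ⊢
      linarith
  rw [this]
  exact (isClosed_hasWeakDeriv.preimage (by fun_prop)).inter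
    (isClosed_eq (by fun_prop) (by fun_prop))

instance : CompleteSpace H := isClosed_H.completeSpace_coe

instance : CompleteSpace X := isClosed_X.completeSpace_coe

instance : SecondCountableTopology L2r :=
  have : Fact ((2 : ENNReal) ≠ ⊤) := ⟨by simp⟩
  inferInstance

instance : TopologicalSpace.SeparableSpace H := by
  have : SecondCountableTopology (PiLp 2 (fun _ : Fin 2 => L2r)) :=
    (PiLp.homeomorph 2 (fun _ : Fin 2 => L2r)).secondCountableTopology
  infer_instance

instance : TopologicalSpace.SeparableSpace X := by
  have : SecondCountableTopology (PiLp 2 (fun _ : Fin 3 => L2r)) :=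
    (PiLp.homeomorph 2 (fun _ : Fin 3 => L2r)).secondCountableTopology
  infer_instance

/-- `H.fn` as a continuous linear map. -/
def H.fnL : H →L[ℝ] L2r := (PiLp.proj 2 (fun _ : Fin 2 => L2r) 0).comp H.subtypeL
/-- `H.der` as a continuous linear map. -/
def H.derL : H →L[ℝ] L2r := (PiLp.proj 2 (fun _ : Fin 2 => L2r) 1).comp H.subtypeL
/-- `X.fn` as a continuous linear map. -/
def X.fnL : X →L[ℝ] L2r := (PiLp.proj 2 (fun _ : Fin 3 => L2r) 0).comp X.subtypeL
/-- The weak derivative of an element of `X`. -/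
def X.derL : X →L[ℝ] L2r := (PiLp.proj 2 (fun _ : Fin 3 => L2r) 1).comp X.subtypeL
/-- The quotient `u / r` of an element `u` of `X`. -/
def X.quoL : X →L[ℝ] L2r := (PiLp.proj 2 (fun _ : Fin 3 => L2r) 2).comp X.subtypeL

theorem H.fnL_apply (w : H) : H.fnL w = H.fn w := rfl
theorem H.derL_apply (w : H) : H.derL w = H.der w := rfl
theorem X.fnL_apply (w : X) : X.fnL w = X.fn w := rfl

theorem H.inner_eq (v w : H) : inner ℝ v w
    = inner ℝ (H.fnL v) (H.fnL w) + inner ℝ (H.derL v) (H.derL w) := by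
  rw [Submodule.coe_inner, PiLp.inner_apply, Fin.sum_univ_two]
  rfl

theorem H.norm_sq (w : H) : ‖w‖ ^ 2 = ‖H.fnL w‖ ^ 2 + ‖H.derL w‖ ^ 2 := by
  simp only [← real_inner_self_eq_norm_sq, H.inner_eq]

theorem X.inner_eq (v w : X) : inner ℝ v w = inner ℝ (X.fnL v) (X.fnL w)
    + inner ℝ (X.derL v) (X.derL w) + inner ℝ (X.quoL v) (X.quoL w) := by
  rw [Submodule.coe_inner, PiLp.inner_apply, Fin.sum_univ_three]
  rfl

theorem X.norm_sq (w : X) :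
    ‖w‖ ^ 2 = ‖X.fnL w‖ ^ 2 + ‖X.derL w‖ ^ 2 + ‖X.quoL w‖ ^ 2 := by
  simp only [← real_inner_self_eq_norm_sq, X.inner_eq]

theorem H.ext {v w : H} (h : H.fnL v = H.fnL w) (h' : H.derL v = H.derL w) : v = w := by
  have h1 : ‖v - w‖ ^ 2 = 0 := by rw [H.norm_sq]; simp [h, h']
  rwa [sq_eq_zero_iff, norm_eq_zero, sub_eq_zero] at h1

theorem H.hasWeakDeriv (w : H) : HasWeakDeriv (H.fnL w) (H.derL w) := w.2

theorem X.hasWeakDeriv (w : X) : HasWeakDeriv (X.fnL w) (X.derL w) := w.2.1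

theorem X.coeFn_quo (w : X) : ∀ᵐ r ∂radialMeasure, X.quoL w r = X.fnL w r / r := w.2.2

/-- The element of `H` with given function and derivative. -/
def H.mk (u v : L2r) (h : HasWeakDeriv u v) : H := ⟨WithLp.toLp 2 ![u, v], h⟩

theorem H.fnL_mk (u v : L2r) (h : HasWeakDeriv u v) : H.fnL (H.mk u v h) = u := rfl
theorem H.derL_mk (u v : L2r) (h : HasWeakDeriv u v) : H.derL (H.mk u v h) = v := rfl

/-- The element of `X` with given function, derivative and quotient. -/
def X.mk (u v q : L2r) (h : HasWeakDeriv u v) (hq : ∀ᵐ r ∂radialMeasure, q r = u r / r) : X :=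
  ⟨WithLp.toLp 2 ![u, v, q], h, hq⟩

/-- The inclusion of `X` in `H`. -/
def inclXH : X →L[ℝ] H :=
  LinearMap.mkContinuous
    { toFun := fun u => H.mk (X.fnL u) (X.derL u) (X.hasWeakDeriv u)
      map_add' := fun u v => H.ext
        ((X.fnL.map_add u v).trans (H.fnL.map_add (H.mk _ _ _) (H.mk _ _ _)).symm)
        ((X.derL.map_add u v).trans (H.derL.map_add (H.mk _ _ _) (H.mk _ _ _)).symm)
      map_smul' := fun c u => H.ext
        ((X.fnL.map_smul c u).trans (H.fnL.map_smul c (H.mk _ _ _)).symm)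
        ((X.derL.map_smul c u).trans (H.derL.map_smul c (H.mk _ _ _)).symm) } 1
    (fun u => by
      rw [one_mul]
      refine le_of_sq_le_sq ?_ (norm_nonneg _)
      rw [H.norm_sq, X.norm_sq]
      have := sq_nonneg ‖X.quoL u‖
      exact le_add_of_nonneg_right this)

theorem fnL_inclXH (u : X) : H.fnL (inclXH u) = X.fnL u := rfl
theorem derL_inclXH (u : X) : H.derL (inclXH u) = X.derL u := rfl

/-! ### Continuous representatives -/

theorem L2r.intervalIntegrable (u : L2r) {a b : ℝ} (ha : 0 < a) (hb : 0 < b) :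
    IntervalIntegrable u volume a b :=
  MemLp.intervalIntegrable_radial (Lp.memLp u) ha hb

theorem H.exists_ev (w : H) : ∃ e : ℝ → ℝ, IsPrimitive e (H.derL w) ∧
    ∀ᵐ r ∂(volume.restrict (Ioi (0 : ℝ))), H.fnL w r = e r :=
  (H.hasWeakDeriv w).exists_primitive (fun _ _ => L2r.intervalIntegrable _)
    (fun _ _ => L2r.intervalIntegrable _)

/-- The continuous representative of an element of `H`. -/
def ev (w : H) : ℝ → ℝ := Classical.choose (H.exists_ev w)

theorem ev_isPrimitive (w : H) : IsPrimitive (ev w) (H.derL w) :=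
  (Classical.choose_spec (H.exists_ev w)).1

theorem continuousOn_ev (w : H) : ContinuousOn (ev w) (Ioi 0) := (ev_isPrimitive w).continuousOn

theorem ae_eq_ev (w : H) : ∀ᵐ r ∂radialMeasure, H.fnL w r = ev w r :=
  ae_radial_iff.2 (Classical.choose_spec (H.exists_ev w)).2

theorem ev_eq_of_ae {w : H} {e : ℝ → ℝ} (he : ContinuousOn e (Ioi 0))
    (h : ∀ᵐ r ∂radialMeasure, H.fnL w r = e r) {r : ℝ} (hr : 0 < r) : ev w r = e r := by
  refine eq_of_ae_eq_of_continuousOn (continuousOn_ev w) he ?_ hr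
  filter_upwards [ae_radial_iff.1 (ae_eq_ev w), ae_radial_iff.1 h] with s h1 h2
  rw [← h1, h2]

theorem ev_add (v w : H) {r : ℝ} (hr : 0 < r) : ev (v + w) r = ev v r + ev w r := by
  refine ev_eq_of_ae (e := fun r => ev v r + ev w r)
    ((continuousOn_ev v).add (continuousOn_ev w)) ?_ hr
  filter_upwards [ae_eq_ev v, ae_eq_ev w, Lp.coeFn_add (H.fnL v) (H.fnL w)] with s h1 h2 h3
  rw [map_add, h3, Pi.add_apply, h1, h2]

theorem ev_smul (c : ℝ) (w : H) {r : ℝ} (hr : 0 < r) : ev (c • w) r = c * ev w r := by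
  refine ev_eq_of_ae (e := fun r => c * ev w r) (continuousOn_const.mul (continuousOn_ev w)) ?_ hr
  filter_upwards [ae_eq_ev w, Lp.coeFn_smul c (H.fnL w)] with s h1 h3
  rw [map_smul, h3, Pi.smul_apply, h1, smul_eq_mul]

theorem ev_sub (v w : H) {r : ℝ} (hr : 0 < r) : ev (v - w) r = ev v r - ev w r := by
  have : v - w = v + (-1 : ℝ) • w := by rw [neg_one_smul, sub_eq_add_neg]
  rw [this, ev_add _ _ hr, ev_smul _ _ hr]; ring

theorem ev_zero {r : ℝ} (hr : 0 < r) : ev 0 r = 0 := by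
  have := ev_smul 0 0 hr
  simpa using this

/-- An element of `H` is a pair, so the vanishing of the function has to be transferred to the
derivative; this is the fundamental lemma of the calculus of variations. -/
theorem eq_zero_of_ev {w : H} (h : ∀ r > 0, ev w r = 0) : w = 0 := by
  have h0 : H.fnL w = 0 := by
    refine Lp.ext ?_
    filter_upwards [ae_eq_ev w, ae_radial_pos, Lp.coeFn_zero ℝ 2 radialMeasure] with r h1 h2 h3
    rw [h1, h r h2, h3]; rfl
  have hp : IsPrimitive (ev w) (fun _ => 0) := by
    refine IsPrimitive.of_hasDerivAt (fun r hr => ?_) continuousOn_const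
    refine (hasDerivAt_const r (0 : ℝ)).congr_of_eventuallyEq ?_
    filter_upwards [Ioi_mem_nhds hr] with s hs
    exact h s hs
  refine H.ext (by rw [h0, map_zero]) ?_
  rw [map_zero]
  have key : ∀ᵐ r, r ∈ Ioi (0 : ℝ) → H.derL w r = 0 := by
    refine isOpen_Ioi.ae_eq_zero_of_integral_contDiff_smul_eq_zero
      (locallyIntegrableOn_of_intervalIntegrable fun a b ha hb =>
        L2r.intervalIntegrable _ ha hb) fun g hg hc hs => ?_
    have h1 := H.hasWeakDeriv w g hg hc hs
    have h2 : ∫ r in Ioi (0 : ℝ), H.fnL w r * deriv g r = 0 := by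
      rw [setIntegral_congr_ae (g := fun _ => (0 : ℝ)) measurableSet_Ioi, integral_zero]
      rw [← ae_restrict_iff' measurableSet_Ioi]
      filter_upwards [ae_restrict_of_ae_radial (ae_eq_ev w), ae_restrict_mem measurableSet_Ioi]
        with r h1 h2
      rw [h1, h r h2, zero_mul]
    rw [← setIntegral_eq_integral_of_forall_compl_eq_zero (s := Ioi (0 : ℝ)) fun x hx => by
      rw [image_eq_zero_of_notMem_tsupport (f := g) (fun h => hx (hs h)), zero_smul]]
    simp_rw [smul_eq_mul, mul_comm (g _)]
    linarith
  refine Lp.ext ?_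
  filter_upwards [ae_radial_iff.2 ((ae_restrict_iff' measurableSet_Ioi).2 key),
    Lp.coeFn_zero ℝ 2 radialMeasure] with r h1 h2
  rw [h1, h2]; rfl

theorem ext_ev {v w : H} (h : ∀ r > 0, ev v r = ev w r) : v = w := by
  rw [← sub_eq_zero]
  exact eq_zero_of_ev fun r hr => by rw [ev_sub _ _ hr, h r hr, sub_self]

theorem inclXH_injective : Function.Injective inclXH := by
  rw [injective_iff_map_eq_zero]
  intro u hu
  have h1 : X.fnL u = 0 := by rw [← fnL_inclXH, hu, map_zero]
  have h2 : X.derL u = 0 := by rw [← derL_inclXH, hu, map_zero]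
  have h3 : X.quoL u = 0 := by
    refine Lp.ext ?_
    filter_upwards [X.coeFn_quo u, Lp.coeFn_zero ℝ 2 radialMeasure] with r h4 h5
    rw [h4, h1, h5]; simp
  have h4 : ‖u‖ ^ 2 = 0 := by rw [X.norm_sq, h1, h2, h3]; simp
  rwa [sq_eq_zero_iff, norm_eq_zero] at h4

/-- The element of `H` given by a primitive. -/
theorem exists_H_of_isPrimitive {w v : ℝ → ℝ} (hp : IsPrimitive w v) (hw : MemLp w 2 radialMeasure)
    (hv : MemLp v 2 radialMeasure) : ∃ z : H, (∀ r > 0, ev z r = w r) ∧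
      (∀ᵐ r ∂radialMeasure, H.derL z r = v r) := by
  have h : HasWeakDeriv (hw.toLp w) (hv.toLp v) := by
    intro φ h1 h2 h3
    have := hp.hasWeakDeriv φ h1 h2 h3
    rw [integral_congr_ae (g := fun r => w r * deriv φ r), this,
      integral_congr_ae (f := fun r => (hv.toLp v) r * φ r) (g := fun r => v r * φ r)]
    · filter_upwards [ae_restrict_of_ae_radial hv.coeFn_toLp] with r hr
      rw [hr]
    · filter_upwards [ae_restrict_of_ae_radial hw.coeFn_toLp] with r hr
      simp only [hr]
  refine ⟨H.mk _ _ h, fun r hr => ev_eq_of_ae hp.continuousOn ?_ hr, ?_⟩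
  · rw [H.fnL_mk]
    exact hw.coeFn_toLp
  · rw [H.derL_mk]
    exact hv.coeFn_toLp

theorem exists_X_of_H {w : H} (hq : MemLp (fun r => ev w r / r) 2 radialMeasure) :
    ∃ u : X, inclXH u = w := by
  refine ⟨X.mk (H.fnL w) (H.derL w) (hq.toLp _) (H.hasWeakDeriv w) ?_, H.ext rfl rfl⟩
  filter_upwards [hq.coeFn_toLp, ae_eq_ev w] with r h1 h2
  rw [h1, h2]

theorem quoL_ae (u : X) : ∀ᵐ r ∂radialMeasure, X.quoL u r = ev (inclXH u) r / r := by
  filter_upwards [X.coeFn_quo u, ae_eq_ev (inclXH u)] with r h1 h2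
  rw [h1, ← h2, fnL_inclXH]

/-! ### Density of test functions -/

/-- Smooth functions with compact support in the open half-line. -/
structure IsTest (φ : ℝ → ℝ) : Prop where
  contDiff : ContDiff ℝ ∞ φ
  compact : HasCompactSupport φ
  subset : tsupport φ ⊆ Ioi 0

theorem IsTest.hasDerivAt {φ : ℝ → ℝ} (h : IsTest φ) (r : ℝ) : HasDerivAt φ (deriv φ r) r :=
  (h.contDiff.differentiable (by simp) r).hasDerivAt

theorem IsTest.continuous_deriv {φ : ℝ → ℝ} (h : IsTest φ) : Continuous (deriv φ) :=
  h.contDiff.continuous_deriv (by simp)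

theorem IsTest.isPrimitive {φ : ℝ → ℝ} (h : IsTest φ) : IsPrimitive φ (deriv φ) :=
  IsPrimitive.of_hasDerivAt (fun r _ => h.hasDerivAt r) h.continuous_deriv.continuousOn

theorem IsTest.exists_Ioo {φ : ℝ → ℝ} (h : IsTest φ) : ∃ a b : ℝ, 0 < a ∧ a < 1 ∧ 1 < b ∧
    (∀ r, r ∉ Ioo a b → φ r = 0) ∧ (∀ r, r ∉ Ioo a b → deriv φ r = 0) := by
  obtain ⟨a, b, ha, ha1, hb1, hab⟩ := exists_Icc_of_test h.compact h.subset
  exact ⟨a, b, ha, ha1, hb1,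
    fun r hr => image_eq_zero_of_notMem_tsupport fun hx => hr (hab hx),
    fun r hr => image_eq_zero_of_notMem_tsupport fun hx => hr (hab (tsupport_deriv_subset hx))⟩

theorem integrableOn_of_vanish {F : ℝ → ℝ} (hF : ContinuousOn F (Ioi 0)) {a b : ℝ} (ha : 0 < a)
    (hz : ∀ r, r ∉ Ioo a b → F r = 0) : IntegrableOn F (Ioi 0) := by
  have hi : IntegrableOn F (Icc a b) :=
    (hF.mono fun x hx => ha.trans_le hx.1).integrableOn_compact isCompact_Icc
  exact hi.of_forall_sdiff_eq_zero measurableSet_Ioi fun x hx =>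
    hz x fun h => hx.2 ⟨h.1.le, h.2.le⟩

theorem memLp_of_vanish {F : ℝ → ℝ} (hF : ContinuousOn F (Ioi 0)) {a b : ℝ} (ha : 0 < a)
    (hz : ∀ r, r ∉ Ioo a b → F r = 0) : MemLp F 2 radialMeasure :=
  memLp_two_radial_of_continuousOn hF
    (integrableOn_of_vanish (b := b) (continuousOn_id.mul (hF.pow 2)) ha fun r hr => by simp [hz r hr])

/-- `w` is given by the test function `φ`. -/
structure IsTestRep (w : H) (φ : ℝ → ℝ) : Prop where
  isTest : IsTest φ
  ev_eq : ∀ r > 0, ev w r = φ r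
  der_eq : ∀ᵐ r ∂radialMeasure, H.derL w r = deriv φ r

theorem IsTest.exists_H {φ : ℝ → ℝ} (h : IsTest φ) : ∃ w : H, IsTestRep w φ := by
  obtain ⟨a, b, ha, -, -, h1, h2⟩ := h.exists_Ioo
  obtain ⟨w, hw, hw'⟩ := exists_H_of_isPrimitive h.isPrimitive
    (memLp_of_vanish h.contDiff.continuous.continuousOn ha h1)
    (memLp_of_vanish h.continuous_deriv.continuousOn ha h2)
  exact ⟨w, h, hw, hw'⟩

theorem IsTest.exists_X {φ : ℝ → ℝ} (h : IsTest φ) : ∃ u : X, IsTestRep (inclXH u) φ := by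
  obtain ⟨w, hw⟩ := h.exists_H
  obtain ⟨a, b, ha, -, -, h1, h2⟩ := h.exists_Ioo
  obtain ⟨u, hu⟩ := exists_X_of_H (w := w) (by
    have := memLp_of_vanish (b := b) (F := fun r => φ r / r) (h.contDiff.continuous.continuousOn.div
      continuousOn_id fun x hx => ne_of_gt hx) ha (fun r hr => by simp [h1 r hr])
    refine this.ae_eq ?_
    filter_upwards [ae_radial_pos] with r hr
    rw [hw.ev_eq r hr])
  exact ⟨u, hu ▸ hw⟩

/-- The test functions in `H`. -/
def testH : Submodule ℝ H where
  carrier := {w | ∃ φ, IsTestRep w φ}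
  zero_mem' := by
    refine ⟨fun _ => 0, ⟨contDiff_const, HasCompactSupport.zero, ?_⟩, fun r hr => ev_zero hr, ?_⟩
    · have : tsupport (fun _ : ℝ => (0 : ℝ)) = ∅ := tsupport_eq_empty_iff.2 rfl
      simp [this]
    · filter_upwards [Lp.coeFn_zero ℝ 2 radialMeasure] with r hr
      rw [map_zero, hr]; simp
  add_mem' := by
    rintro v w ⟨φ, h1, h2, h3⟩ ⟨ψ, g1, g2, g3⟩
    refine ⟨φ + ψ, ⟨h1.1.add g1.1, h1.2.add g1.2, (tsupport_add _ _).trans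
      (union_subset h1.3 g1.3)⟩, fun r hr => by rw [ev_add _ _ hr, h2 r hr, g2 r hr]; rfl, ?_⟩
    filter_upwards [h3, g3, Lp.coeFn_add (H.derL v) (H.derL w)] with r e1 e2 e3
    rw [map_add, e3, Pi.add_apply, e1, e2, ((h1.hasDerivAt r).add (g1.hasDerivAt r)).deriv]
  smul_mem' := by
    rintro c w ⟨φ, h1, h2, h3⟩
    refine ⟨fun r => c * φ r, ⟨contDiff_const.mul h1.1, h1.2.mul_left, ?_⟩,
      fun r hr => by rw [ev_smul _ _ hr, h2 r hr], ?_⟩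
    · exact (closure_mono (Function.support_mul_subset_right _ _)).trans h1.3
    · filter_upwards [h3, Lp.coeFn_smul c (H.derL w)] with r e1 e3
      rw [map_smul, e3, Pi.smul_apply, e1, ((h1.hasDerivAt r).const_mul c).deriv, smul_eq_mul]

theorem inner_eq_setIntegral {u v : L2r} {f g : ℝ → ℝ} (hu : ∀ᵐ r ∂radialMeasure, u r = f r)
    (hv : ∀ᵐ r ∂radialMeasure, v r = g r) :
    inner ℝ u v = ∫ r in Ioi (0 : ℝ), r * (f r * g r) := by
  rw [L2.inner_def, integral_radial]
  refine setIntegral_congr_ae measurableSet_Ioi ?_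
  rw [← ae_restrict_iff' measurableSet_Ioi]
  filter_upwards [ae_restrict_of_ae_radial hu, ae_restrict_of_ae_radial hv] with r h1 h2
  simp only [h1, h2, RCLike.inner_apply, conj_trivial]
  ring

theorem integrableOn_mul_of_ae {u v : L2r} {f g : ℝ → ℝ} (hu : ∀ᵐ r ∂radialMeasure, u r = f r)
    (hv : ∀ᵐ r ∂radialMeasure, v r = g r) : IntegrableOn (fun r => r * (f r * g r)) (Ioi 0) := by
  refine integrable_radial_iff.1 (((Lp.memLp u).integrable_mul (Lp.memLp v)).congr ?_)
  filter_upwards [hu, hv] with r h1 h2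
  rw [Pi.mul_apply, h1, h2]

/-- Interior regularity: a weak solution of `(r w')' = k` with continuous `k` is classical. -/
theorem H.regularity {w : H} {k : ℝ → ℝ} (hk : ContinuousOn k (Ioi 0))
    (h : HasWeakDeriv (fun r => r * H.derL w r) k) :
    ∃ V : ℝ → ℝ, (∀ r > 0, HasDerivAt V (k r) r) ∧ (∀ r > 0, HasDerivAt (ev w) (V r / r) r) ∧
      ∀ᵐ r ∂radialMeasure, H.derL w r = V r / r := by
  obtain ⟨V, hV, hV'⟩ := h.exists_primitive
    (fun a b ha hb => (L2r.intervalIntegrable (H.derL w) ha hb).continuousOn_mul continuousOn_id)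
    (fun a b ha hb => (hk.mono fun x hx =>
      lt_of_lt_of_le (lt_min ha hb) hx.1).intervalIntegrable)
  have hd : ∀ᵐ r ∂(volume.restrict (Ioi (0 : ℝ))), H.derL w r = V r / r := by
    filter_upwards [hV', ae_restrict_mem measurableSet_Ioi] with r h1 h2
    have h2' : (0 : ℝ) < r := h2
    rw [← h1, id]; field_simp
  have hp := (ev_isPrimitive w).congr_ae hd
  have hc : ContinuousOn (fun r => V r / r) (Ioi 0) :=
    hV.continuousOn.div continuousOn_id fun x hx => ne_of_gt hx
  exact ⟨V, fun r hr => hV.hasDerivAt hr hk, fun r hr => hp.hasDerivAt hr hc,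
    ae_radial_iff.2 hd⟩

/-- A Liouville theorem, which yields the density of test functions: an element orthogonal to all of
them solves such an equation. Formally one tests the equation with `w` itself. The flux product `B =
r w w'` is non-decreasing and integrable, so it can only be negative near the origin; that is
excluded because finite Dirichlet energy in the plane does not see a single point. -/
theorem H.eq_zero_of_hasWeakDeriv {w : H} {c : ℝ → ℝ} (hc : ContinuousOn c (Ioi 0))
    (hc0 : ∀ r > 0, 0 < c r)
    (h : HasWeakDeriv (fun r => r * H.derL w r) (fun r => r * (c r * ev w r))) : w = 0 := by
  obtain ⟨V, hV, he, hd⟩ := H.regularity (k := fun r => r * (c r * ev w r))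
    (continuousOn_id.mul (hc.mul (continuousOn_ev w))) h
  set e := ev w with hedef
  let B : ℝ → ℝ := fun r => e r * V r
  have hB : ∀ r > 0, HasDerivAt B (V r ^ 2 / r + r * (c r * e r ^ 2)) r := fun r hr => by
    refine ((he r hr).mul (hV r hr)).congr_deriv ?_
    ring
  have hB0 : ∀ r > 0, 0 ≤ V r ^ 2 / r + r * (c r * e r ^ 2) := fun r hr => by
    have := hc0 r hr
    positivity
  have hmono : MonotoneOn B (Ioi 0) := by
    refine monotoneOn_of_deriv_nonneg (convex_Ioi 0)
      (fun r hr => (hB r hr).continuousAt.continuousWithinAt)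
      (fun r hr => (hB r (by simpa using hr)).differentiableAt.differentiableWithinAt)
      fun r hr => ?_
    rw [interior_Ioi] at hr
    rw [(hB r hr).deriv]
    exact hB0 r hr
  have hBi : IntegrableOn B (Ioi 0) := by
    refine (integrableOn_mul_of_ae (ae_eq_ev w) hd).congr_fun (fun r hr => ?_) measurableSet_Ioi
    have hr' : (0 : ℝ) < r := hr
    simp only [B, ← hedef]; field_simp
  -- A positive value of the monotone function `B` would persist up to infinity and contradict
  -- integrability.
  have hle : ∀ r > 0, B r ≤ 0 := by
    intro r hr
    by_contra hpos
    have hi : IntegrableOn (fun _ : ℝ => B r) (Ioi r) := by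
      refine Integrable.mono (hBi.mono_set (Ioi_subset_Ioi hr.le))
        aestronglyMeasurable_const ?_
      filter_upwards [ae_restrict_mem measurableSet_Ioi] with s hs
      have hs' : r < s := hs
      rw [Real.norm_of_nonneg (not_le.1 hpos).le]
      exact (hmono hr (hr.trans hs') hs'.le).trans (le_abs_self _)
    rw [integrableOn_const_iff] at hi
    rcases hi with h1 | h1
    · exact hpos (enorm_eq_zero.1 h1).le
    · simp at h1
  have hge : ∀ r > 0, B r = 0 := by
    intro r₀ hr₀
    by_contra hne
    have hneg : B r₀ < 0 := lt_of_le_of_ne (hle r₀ hr₀) hne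
    set β := -B r₀ with hβ
    have hβ0 : 0 < β := by linarith
    have hB' : ∀ r ∈ Ioc 0 r₀, B r ≤ -β := fun r hr => by
      have := hmono hr.1 hr₀ hr.2; linarith
    have hene : ∀ r ∈ Ioc 0 r₀, e r ≠ 0 := fun r hr h0 => by
      have := hB' r hr
      simp only [B, h0, zero_mul] at this
      linarith
    have hVi : IntegrableOn (fun r => V r ^ 2 / r) (Ioi 0) := by
      refine (integrableOn_mul_of_ae hd hd).congr_fun (fun r hr => ?_) measurableSet_Ioi
      have hr' : (0 : ℝ) < r := hr
      simp only; field_simp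
    have hVc : ContinuousOn (fun r => V r ^ 2 / r) (Ioi 0) :=
      ContinuousOn.div (ContinuousOn.pow (fun r hr => (hV r hr).continuousAt.continuousWithinAt) 2)
        continuousOn_id fun x hx => ne_of_gt hx
    let n : ℝ → ℝ := fun r => ∫ s in r₀..r, V s ^ 2 / s
    have hn : ∀ r > 0, HasDerivAt n (V r ^ 2 / r) r := fun r hr => by
      refine intervalIntegral.integral_hasDerivAt_right ?_
        (hVc.stronglyMeasurableAtFilter isOpen_Ioi r hr) (hVc.continuousAt (Ioi_mem_nhds hr))
      exact (hVc.mono fun x hx => lt_of_lt_of_le (lt_min hr₀ hr) hx.1).intervalIntegrable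
    set M := ∫ s in Ioi (0 : ℝ), V s ^ 2 / s with hM
    have hnM : ∀ r ∈ Ioc 0 r₀, -M ≤ n r := by
      intro r hr
      simp only [n]
      rw [intervalIntegral.integral_symm, neg_le_neg_iff, intervalIntegral.integral_of_le hr.2]
      refine setIntegral_mono_set hVi ?_ (Eventually.of_forall fun x hx => hr.1.trans hx.1)
      filter_upwards [ae_restrict_mem measurableSet_Ioi] with x hx
      have hx' : (0 : ℝ) < x := hx
      positivity
    -- Two monotone quantities lead to the contradiction. Since `B ≤ -β` near `0`, the function `Ψ`
    -- is non-decreasing, and as the integral `n` is bounded below this gives an upper bound for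
    -- `e²` near `0`.
    let Ψ : ℝ → ℝ := fun r => n r + β / 2 * Real.log (e r ^ 2)
    have hΨ : ∀ r ∈ Ioc 0 r₀, HasDerivAt Ψ (B r * (B r + β) / (r * e r ^ 2)) r := by
      intro r hr
      have hr' := hr.1
      have h0 := hene r hr
      have h1 := ((he r hr.1).pow 2).log (by simpa using h0)
      refine ((hn r hr.1).add (h1.const_mul (β / 2))).congr_deriv ?_
      simp only [B, Pi.pow_apply, Nat.cast_ofNat, Nat.add_one_sub_one, pow_one]
      field_simp
    have hΨm : MonotoneOn Ψ (Ioc 0 r₀) := by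
      refine monotoneOn_of_deriv_nonneg (convex_Ioc 0 r₀)
        (fun r hr => (hΨ r hr).continuousAt.continuousWithinAt)
        (fun r hr => (hΨ r (interior_subset hr)).differentiableAt.differentiableWithinAt)
        fun r hr => ?_
      have hr' := interior_subset hr
      rw [(hΨ r hr').deriv]
      have h1 := hB' r hr'
      refine div_nonneg (mul_nonneg_of_nonpos_of_nonpos (by linarith) (by linarith)) ?_
      have := hr'.1
      positivity
    -- In the opposite direction `(e²)' = 2 B / r ≤ -2β / r`, so `e²` grows at least like `-2β log
    -- r` as `r` tends to `0`.
    let Θ : ℝ → ℝ := fun r => e r ^ 2 + 2 * β * Real.log r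
    have hΘ : ∀ r ∈ Ioc 0 r₀, HasDerivAt Θ (2 * (B r + β) / r) r := by
      intro r hr
      have hr' := hr.1
      refine (((he r hr.1).pow 2).add ((Real.hasDerivAt_log hr.1.ne').const_mul
        (2 * β))).congr_deriv ?_
      simp only [B]
      field_simp
      ring
    have hΘm : AntitoneOn Θ (Ioc 0 r₀) := by
      refine antitoneOn_of_deriv_nonpos (convex_Ioc 0 r₀)
        (fun r hr => (hΘ r hr).continuousAt.continuousWithinAt)
        (fun r hr => (hΘ r (interior_subset hr)).differentiableAt.differentiableWithinAt)
        fun r hr => ?_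
      have hr' := interior_subset hr
      rw [(hΘ r hr').deriv]
      have h1 := hB' r hr'
      exact div_nonpos_of_nonpos_of_nonneg (by linarith) hr'.1.le
    have hr0mem : r₀ ∈ Ioc 0 r₀ := ⟨hr₀, le_rfl⟩
    have hbound : ∀ r ∈ Ioc 0 r₀, e r ^ 2 ≤ Real.exp (2 / β * (Ψ r₀ + M)) := by
      intro r hr
      have h1 := hΨm hr hr0mem hr.2
      have h2 := hnM r hr
      have h3 : Real.log (e r ^ 2) ≤ 2 / β * (Ψ r₀ + M) := by
        have h4 : β / 2 * Real.log (e r ^ 2) ≤ Ψ r₀ + M := by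
          simp only [Ψ] at h1 ⊢
          linarith
        have h5 := mul_le_mul_of_nonneg_left h4 (by positivity : 0 ≤ 2 / β)
        refine le_trans (le_of_eq ?_) h5
        field_simp
      have h0 : 0 < e r ^ 2 := by have := hene r hr; positivity
      rwa [← Real.log_le_iff_le_exp h0]
    have hlow : ∀ r ∈ Ioc 0 r₀, Θ r₀ - 2 * β * Real.log r ≤ Real.exp (2 / β * (Ψ r₀ + M)) := by
      intro r hr
      have h1 := hΘm hr hr0mem hr.2
      have h2 := hbound r hr
      simp only [Θ] at h1 ⊢
      linarith
    have hlim : Tendsto (fun r => Θ r₀ - 2 * β * Real.log r) (𝓝[>] 0) atTop := by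
      have := Real.tendsto_log_nhdsGT_zero.const_mul_atBot (by linarith : 0 < 2 * β)
      refine (tendsto_atTop_add_const_left _ (Θ r₀)
        (tendsto_neg_atBot_atTop.comp this)).congr fun r => ?_
      simp only [Function.comp_apply]; ring
    have hev := hlim.eventually_gt_atTop (Real.exp (2 / β * (Ψ r₀ + M)))
    obtain ⟨r, h1, h2⟩ := (hev.and (Ioc_mem_nhdsGT hr₀)).exists
    exact absurd (hlow r h2) (not_le.2 h1)
  refine eq_zero_of_ev fun r hr => ?_
  have h1 : HasDerivAt B 0 r := by
    refine (hasDerivAt_const r (0 : ℝ)).congr_of_eventuallyEq ?_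
    filter_upwards [Ioi_mem_nhds hr] with s hs
    exact hge s hs
  have h2 := (hB r hr).unique h1
  have h3 : 0 ≤ V r ^ 2 / r := by positivity
  have h4 := hc0 r hr
  have h5 : 0 ≤ r * (c r * e r ^ 2) := by positivity
  have h6 : r * (c r * e r ^ 2) = 0 := by linarith
  simpa [hr.ne', h4.ne'] using h6

/-- The orthogonal complement consists of weak solutions of `(r w')' = r w` in `H`, which vanish. No
condition at the origin is needed, although test functions vanish near it. -/
theorem dense_testH : testH.topologicalClosure = ⊤ := by
  rw [Submodule.topologicalClosure_eq_top_iff, Submodule.eq_bot_iff]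
  intro w hw
  refine H.eq_zero_of_hasWeakDeriv (c := fun _ => 1) continuousOn_const (fun _ _ => one_pos) ?_
  intro φ h1 h2 h3
  obtain ⟨z, hz⟩ := IsTest.exists_H ⟨h1, h2, h3⟩
  have h4 := (Submodule.mem_orthogonal _ _).1 hw z ⟨φ, hz⟩
  have a1 : ∀ᵐ r ∂radialMeasure, H.fnL z r = φ r := by
    filter_upwards [ae_eq_ev z, ae_radial_pos] with r e1 e2
    rw [e1, hz.ev_eq r e2]
  rw [H.inner_eq, inner_eq_setIntegral a1 (ae_eq_ev w),
    inner_eq_setIntegral hz.der_eq (Eventually.of_forall fun r => rfl)] at h4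
  have e1 : ∫ r in Ioi (0 : ℝ), r * H.derL w r * deriv φ r
      = ∫ r in Ioi (0 : ℝ), r * (deriv φ r * H.derL w r) := by
    congr 1; ext r; ring
  have e2 : ∫ r in Ioi (0 : ℝ), r * (1 * ev w r) * φ r
      = ∫ r in Ioi (0 : ℝ), r * (φ r * ev w r) := by
    congr 1; ext r; ring
  rw [e1, e2]
  linarith

/-- The argument used for `H`, with the coefficient `1 + 1/r²` coming from the extra term of the
norm of `X`. -/
theorem dense_testX : (testH.comap inclXH.toLinearMap).topologicalClosure = ⊤ := by
  rw [Submodule.topologicalClosure_eq_top_iff, Submodule.eq_bot_iff]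
  intro u hu
  apply inclXH_injective
  rw [map_zero]
  refine H.eq_zero_of_hasWeakDeriv (c := fun r => 1 + 1 / r ^ 2)
    (continuousOn_const.add (continuousOn_const.div (continuousOn_id.pow 2) fun x hx =>
      pow_ne_zero 2 (ne_of_gt hx))) (fun r hr => by positivity) ?_
  intro φ h1 h2 h3
  obtain ⟨z, hz⟩ := IsTest.exists_X ⟨h1, h2, h3⟩
  have h4 := (Submodule.mem_orthogonal _ _).1 hu z ⟨φ, hz⟩
  have a1 : ∀ᵐ r ∂radialMeasure, X.fnL z r = φ r := by
    filter_upwards [ae_eq_ev (inclXH z), ae_radial_pos] with r e1 e2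
    rw [← fnL_inclXH, e1, hz.ev_eq r e2]
  have a2 : ∀ᵐ r ∂radialMeasure, X.quoL z r = φ r / r := by
    filter_upwards [quoL_ae z, ae_radial_pos] with r e1 e2
    rw [e1, hz.ev_eq r e2]
  have a3 : ∀ᵐ r ∂radialMeasure, X.fnL u r = ev (inclXH u) r := ae_eq_ev (inclXH u)
  rw [X.inner_eq, inner_eq_setIntegral a1 a3,
    inner_eq_setIntegral (u := X.derL z) hz.der_eq (Eventually.of_forall fun r => rfl),
    inner_eq_setIntegral a2 (quoL_ae u)] at h4
  have i1 := integrableOn_mul_of_ae a1 a3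
  have i2 := integrableOn_mul_of_ae a2 (quoL_ae u)
  have e1 : ∫ r in Ioi (0 : ℝ), r * H.derL (inclXH u) r * deriv φ r
      = ∫ r in Ioi (0 : ℝ), r * (deriv φ r * X.derL u r) := by
    congr 1; ext r; rw [derL_inclXH]; ring
  have e2 : ∫ r in Ioi (0 : ℝ), r * ((1 + 1 / r ^ 2) * ev (inclXH u) r) * φ r
      = (∫ r in Ioi (0 : ℝ), r * (φ r * ev (inclXH u) r))
        + ∫ r in Ioi (0 : ℝ), r * (φ r / r * (ev (inclXH u) r / r)) := by
    rw [← integral_add i1 i2]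
    refine setIntegral_congr_fun measurableSet_Ioi fun r hr => ?_
    have hr' : (0 : ℝ) < r := hr
    field_simp
  rw [e1, e2]
  linarith

/-- A closed property of elements of `H` which holds for test functions holds everywhere. -/
theorem H.induction_test {p : H → Prop} (hp : IsClosed {w | p w})
    (h : ∀ w φ, IsTestRep w φ → p w) (w : H) : p w := by
  have hw : w ∈ testH.topologicalClosure := by rw [dense_testH]; trivial
  exact closure_minimal (fun z (hz : z ∈ testH) => hz.elim fun φ hφ => h z φ hφ) hp hw

/-- A closed property of elements of `X` which holds for test functions holds everywhere. -/
theorem X.induction_test {p : X → Prop} (hp : IsClosed {u | p u})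
    (h : ∀ u φ, IsTestRep (inclXH u) φ → p u) (u : X) : p u := by
  have hu : u ∈ (testH.comap inclXH.toLinearMap).topologicalClosure := by
    rw [dense_testX]; trivial
  exact closure_minimal (fun z (hz : inclXH z ∈ testH) => hz.elim fun φ hφ => h z φ hφ) hp hu

/-! ### Pointwise bounds -/

theorem integrableOn_Ioi_of_bounded {F : ℝ → ℝ} (hF : ContinuousOn F (Ioi 0))
    (h0 : ∀ r > 0, 0 ≤ F r) {I : ℝ} (h : ∀ a b : ℝ, 0 < a → a ≤ b → ∫ r in a..b, F r ≤ I) :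
    IntegrableOn F (Ioi 0) ∧ ∫ r in Ioi (0 : ℝ), F r ≤ I := by
  have ha : Tendsto (fun n : ℕ => 1 / ((n : ℝ) + 1)) atTop (𝓝 0) :=
    tendsto_one_div_add_atTop_nhds_zero_nat
  have hb : Tendsto (fun n : ℕ => (n : ℝ) + 1) atTop atTop :=
    tendsto_atTop_add_const_right _ _ tendsto_natCast_atTop_atTop
  have hcov : AECover (volume.restrict (Ioi (0 : ℝ))) atTop
      fun n : ℕ => Ioi (1 / ((n : ℝ) + 1)) ∩ Iic ((n : ℝ) + 1) :=
    (aecover_Ioi_of_Ioi ha).inter (aecover_Iic hb)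
  have hpos : ∀ n : ℕ, 0 < 1 / ((n : ℝ) + 1) := fun n => by positivity
  have hle : ∀ n : ℕ, 1 / ((n : ℝ) + 1) ≤ (n : ℝ) + 1 := fun n => by
    have : (1 : ℝ) ≤ (n : ℝ) + 1 := by linarith [n.cast_nonneg (α := ℝ)]
    exact ((div_le_one (by positivity)).2 this).trans this
  have hset : ∀ n : ℕ, (volume.restrict (Ioi (0 : ℝ))).restrict
      (Ioi (1 / ((n : ℝ) + 1)) ∩ Iic ((n : ℝ) + 1))
      = volume.restrict (Ioc (1 / ((n : ℝ) + 1)) ((n : ℝ) + 1)) := fun n => by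
    rw [Ioi_inter_Iic, Measure.restrict_restrict measurableSet_Ioc,
      inter_eq_self_of_subset_left (t := Ioi (0 : ℝ)) fun x hx => (hpos n).trans hx.1]
  have hint : ∀ n : ℕ, IntegrableOn F (Ioi (1 / ((n : ℝ) + 1)) ∩ Iic ((n : ℝ) + 1))
      (volume.restrict (Ioi (0 : ℝ))) := fun n => by
    rw [IntegrableOn, hset]
    exact ((hF.mono fun x hx => (hpos n).trans_le hx.1).integrableOn_compact
      isCompact_Icc).mono_set Ioc_subset_Icc_self
  have hFi : IntegrableOn F (Ioi 0) := by
    refine hcov.integrable_of_integral_norm_bounded I hint (Eventually.of_forall fun n => ?_)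
    rw [hset, ← intervalIntegral.integral_of_le (hle n)]
    refine le_trans (le_of_eq ?_) (h _ _ (hpos n) (hle n))
    refine intervalIntegral.integral_congr fun x hx => ?_
    rw [uIcc_of_le (hle n)] at hx
    exact Real.norm_of_nonneg (h0 x ((hpos n).trans_le hx.1))
  refine ⟨hFi, le_of_tendsto' (hcov.integral_tendsto_of_countably_generated hFi) fun n => ?_⟩
  rw [hset, ← intervalIntegral.integral_of_le (hle n)]
  exact h _ _ (hpos n) (hle n)

theorem H.integrableOn_fn (w : H) : IntegrableOn (fun r => r * ev w r ^ 2) (Ioi 0) := by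
  have := integrableOn_mul_of_ae (ae_eq_ev w) (ae_eq_ev w)
  simpa only [← sq] using this

theorem H.integral_fn (w : H) : ∫ r in Ioi (0 : ℝ), r * ev w r ^ 2 = ‖H.fnL w‖ ^ 2 := by
  rw [← real_inner_self_eq_norm_sq, inner_eq_setIntegral (ae_eq_ev w) (ae_eq_ev w)]
  simp only [← sq]

theorem L2r.integrableOn_sq (v : L2r) : IntegrableOn (fun r => r * v r ^ 2) (Ioi 0) :=
  MemLp.integrableOn_sq_radial (Lp.memLp v)

theorem L2r.integral_sq (v : L2r) : ∫ r in Ioi (0 : ℝ), r * v r ^ 2 = ‖v‖ ^ 2 := by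
  rw [← real_inner_self_eq_norm_sq,
    inner_eq_setIntegral (Eventually.of_forall fun r => rfl) (Eventually.of_forall fun r => rfl)]
  simp only [← sq]

theorem H.isPrimitive_mul_sq (w : H) : IsPrimitive (fun r => r * ev w r ^ 2)
    (fun r => ev w r ^ 2 + r * (2 * (ev w r * H.derL w r))) := by
  have h1 : IsPrimitive (fun r => r) (fun _ => 1) :=
    IsPrimitive.of_hasDerivAt (fun r _ => hasDerivAt_id r) continuousOn_const
  have h2 := h1.mul ((ev_isPrimitive w).mul (ev_isPrimitive w))
  intro a b ha hb
  have h3 := h2 a b ha hb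
  have e : (fun r => 1 * (ev w r * ev w r) + r * (H.derL w r * ev w r + ev w r * H.derL w r))
      = fun r => ev w r ^ 2 + r * (2 * (ev w r * H.derL w r)) := by ext r; ring
  simp only at h3
  rw [e] at h3
  refine ⟨h3.1, ?_⟩
  rw [← h3.2]
  ring

theorem H.abs_integral_le (w : H) {a b : ℝ} (ha : 0 < a) (hab : a ≤ b) :
    |∫ r in a..b, r * (2 * (ev w r * H.derL w r))| ≤ ‖w‖ ^ 2 := by
  have hi : IntegrableOn (fun r => r * ev w r ^ 2 + r * H.derL w r ^ 2) (Ioi 0) :=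
    (H.integrableOn_fn w).add (L2r.integrableOn_sq (H.derL w))
  have hs : Ioc a b ⊆ Ioi 0 := fun x hx => ha.trans hx.1
  have h1 : ∫ r in Ioi (0 : ℝ), (r * ev w r ^ 2 + r * H.derL w r ^ 2) = ‖w‖ ^ 2 := by
    rw [integral_add (H.integrableOn_fn w) (L2r.integrableOn_sq (H.derL w)), H.integral_fn,
      L2r.integral_sq, H.norm_sq]
  rw [← h1, ← Real.norm_eq_abs]
  refine (intervalIntegral.norm_integral_le_of_norm_le hab ?_
    (g := fun r => r * ev w r ^ 2 + r * H.derL w r ^ 2) ?_).trans ?_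
  · refine Eventually.of_forall fun r hr => ?_
    have hr' : 0 < r := hs hr
    rw [Real.norm_eq_abs, abs_mul, abs_of_pos hr', ← mul_add]
    refine mul_le_mul_of_nonneg_left ?_ hr'.le
    rw [abs_le]
    constructor <;> nlinarith [sq_nonneg (ev w r + H.derL w r), sq_nonneg (ev w r - H.derL w r)]
  · rw [intervalIntegrable_iff_integrableOn_Ioc_of_le hab]
    exact hi.mono_set hs
  · rw [intervalIntegral.integral_of_le hab]
    refine setIntegral_mono_set hi ?_ (Eventually.of_forall hs)
    filter_upwards [ae_restrict_mem measurableSet_Ioi] with x hx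
    have hx' : (0 : ℝ) < x := hx
    positivity

theorem H.integral_identity (w : H) {a b : ℝ} (ha : 0 < a) (hab : a ≤ b) :
    b * ev w b ^ 2 - a * ev w a ^ 2
      = (∫ r in a..b, ev w r ^ 2) + ∫ r in a..b, r * (2 * (ev w r * H.derL w r)) := by
  have hb : 0 < b := ha.trans_le hab
  have hs : uIcc a b ⊆ Ioi 0 := fun x hx => lt_of_lt_of_le (lt_min ha hb) hx.1
  have hc := (continuousOn_ev w).mono hs
  have hi : IntervalIntegrable (fun r => ev w r ^ 2) volume a b := (hc.pow 2).intervalIntegrable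
  rw [(H.isPrimitive_mul_sq w a b ha hb).2, intervalIntegral.integral_add hi]
  exact ((((L2r.intervalIntegrable (H.derL w) ha hb).continuousOn_mul hc).const_mul
    2).continuousOn_mul continuousOn_id)

/-- From `(r w²)' = w² + 2 r w w'` and `2 r |w w'| ≤ r (w² + w'²)`, an excess of `r w²` over `‖w‖²`
at one point would persist for all larger radii and contradict `r w² ∈ L¹`. -/
theorem H.mul_sq_ev_le (w : H) {r : ℝ} (hr : 0 < r) : r * ev w r ^ 2 ≤ ‖w‖ ^ 2 := by
  by_contra hlt
  rw [not_le] at hlt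
  set δ := r * ev w r ^ 2 - ‖w‖ ^ 2 with hδ
  have hδ0 : 0 < δ := by linarith
  have key : ∀ s > r, δ ≤ s * ev w s ^ 2 := by
    intro s hs
    have h1 := H.integral_identity w hr hs.le
    have h2 := (abs_le.1 (H.abs_integral_le w hr hs.le)).1
    have h3 : 0 ≤ ∫ t in r..s, ev w t ^ 2 :=
      intervalIntegral.integral_nonneg hs.le fun t _ => sq_nonneg _
    linarith
  have hi : IntegrableOn (fun _ : ℝ => δ) (Ioi r) := by
    refine Integrable.mono ((H.integrableOn_fn w).mono_set (Ioi_subset_Ioi hr.le))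
      aestronglyMeasurable_const ?_
    filter_upwards [ae_restrict_mem measurableSet_Ioi] with s hs
    rw [Real.norm_of_nonneg hδ0.le]
    exact (key s hs).trans (le_abs_self _)
  rw [integrableOn_const_iff] at hi
  rcases hi with h1 | h1
  · exact hδ0.ne' (enorm_eq_zero.1 h1)
  · simp at h1

/-- Integrating `(r w²)' = w² + 2 r w w'` bounds the unweighted integral of `w²` by the boundary
value `b w(b)²` and the norm. Compared with membership in `L²_r` this is a gain near the origin. -/
theorem H.integrableOn_sq (w : H) : IntegrableOn (fun r => ev w r ^ 2) (Ioi 0) ∧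
    ∫ r in Ioi (0 : ℝ), ev w r ^ 2 ≤ 2 * ‖w‖ ^ 2 := by
  refine integrableOn_Ioi_of_bounded (F := fun r => ev w r ^ 2) ((continuousOn_ev w).pow 2) (fun r _ => sq_nonneg _)
    fun a b ha hab => ?_
  have h1 := H.integral_identity w ha hab
  have h2 := (abs_le.1 (H.abs_integral_le w ha hab)).1
  have h3 := H.mul_sq_ev_le w (ha.trans_le hab)
  have h4 : 0 ≤ a * ev w a ^ 2 := by positivity
  linarith

/-- Evaluation at a point of the half-line. -/
def evL (r : ℝ) (hr : 0 < r) : H →L[ℝ] ℝ :=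
  LinearMap.mkContinuous
    { toFun := fun w => ev w r
      map_add' := fun v w => ev_add v w hr
      map_smul' := fun c w => ev_smul c w hr } (1 / Real.sqrt r) (fun w => by
    have h1 := H.mul_sq_ev_le w hr
    simp only [LinearMap.coe_mk, AddHom.coe_mk, Real.norm_eq_abs]
    rw [div_mul_eq_mul_div, one_mul, le_div_iff₀ (Real.sqrt_pos.2 hr)]
    refine le_of_sq_le_sq ?_ (norm_nonneg _)
    rw [mul_pow, Real.sq_sqrt hr.le, sq_abs]
    linarith)

theorem evL_apply {r : ℝ} (hr : 0 < r) (w : H) : evL r hr w = ev w r := rfl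

theorem abs_ev_le (w : H) {r : ℝ} (hr : 0 < r) : |ev w r| ≤ ‖w‖ / Real.sqrt r := by
  have := (evL r hr).le_of_opNorm_le (LinearMap.mkContinuous_norm_le _ (by positivity) _) w
  rw [evL_apply, Real.norm_eq_abs] at this
  rwa [div_mul_eq_mul_div, one_mul] at this

theorem tendsto_ev_atTop (w : H) : Tendsto (ev w) atTop (𝓝 0) := by
  refine squeeze_zero_norm' (a := fun r => ‖w‖ / Real.sqrt r) ?_
    (tendsto_const_nhds.div_atTop Real.tendsto_sqrt_atTop)
  filter_upwards [eventually_gt_atTop 0] with r hr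
  exact abs_ev_le w hr

theorem WeakTendsto.ev {x : ℕ → H} {y : H} (h : WeakTendsto x y) {r : ℝ} (hr : 0 < r) :
    Tendsto (fun n => ev (x n) r) atTop (𝓝 (ev y r)) :=
  h (evL r hr)

/-- Elements of `X` are bounded. -/
theorem X.abs_ev_le (u : X) {r : ℝ} (hr : 0 < r) : |ev (inclXH u) r| ≤ ‖u‖ := by
  revert u
  refine X.induction_test ?_ ?_
  · refine isClosed_le ?_ continuous_norm
    exact continuous_abs.comp ((evL r hr).continuous.comp inclXH.continuous)
  · intro u φ hu
    obtain ⟨a, b, ha, -, -, hz, -⟩ := hu.isTest.exists_Ioo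
    refine le_of_sq_le_sq ?_ (norm_nonneg _)
    rw [sq_abs]
    set e := ev (inclXH u) with he
    set α := min a r with hα
    have hα0 : 0 < α := lt_min ha hr
    have hαr : α ≤ r := min_le_right _ _
    have heα : e α = 0 := by
      rw [he, hu.ev_eq α hα0, hz]
      exact fun h => absurd h.1 (not_lt.2 (min_le_left _ _))
    -- As `e` vanishes at `α`, `e(r)²` is the integral of `2 e e'`, and `2 |e e'| ≤ s (e/s)² + s
    -- e'²` is dominated by the density of the norm of `X`.
    have h1 := (ev_isPrimitive (inclXH u)).integral_mul (ev_isPrimitive (inclXH u)) hα0 hr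
    rw [← he, heα, mul_zero, sub_zero, ← sq] at h1
    rw [← h1]
    have i1 := L2r.integrableOn_sq (X.quoL u)
    have i2 := L2r.integrableOn_sq (X.derL u)
    have hs : Ioc α r ⊆ Ioi 0 := fun x hx => hα0.trans hx.1
    have h2 : ∫ r in Ioi (0 : ℝ), (r * X.quoL u r ^ 2 + r * X.derL u r ^ 2) ≤ ‖u‖ ^ 2 := by
      rw [integral_add i1 i2, L2r.integral_sq, L2r.integral_sq, X.norm_sq]
      linarith [sq_nonneg ‖X.fnL u‖]
    refine le_trans ?_ h2
    refine (le_abs_self _).trans ?_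
    rw [← Real.norm_eq_abs]
    refine (intervalIntegral.norm_integral_le_of_norm_le hαr
      (g := fun r => r * X.quoL u r ^ 2 + r * X.derL u r ^ 2) ?_ ?_).trans ?_
    · have := quoL_ae u
      rw [ae_radial_iff, ae_restrict_iff' measurableSet_Ioi] at this
      filter_upwards [this] with s hs1 hs2
      have hs0 : 0 < s := hs hs2
      rw [hs1 hs0, ← he, derL_inclXH, Real.norm_eq_abs]
      have e1 : s * (e s / s) ^ 2 = (e s) ^ 2 / s := by field_simp
      rw [e1, abs_le]
      constructor
      · have : 0 ≤ (e s + s * X.derL u s) ^ 2 / s := by positivity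
        have e2 : (e s + s * X.derL u s) ^ 2 / s = e s ^ 2 / s + s * X.derL u s ^ 2
            + 2 * (e s * X.derL u s) := by field_simp; ring
        linarith
      · have : 0 ≤ (e s - s * X.derL u s) ^ 2 / s := by positivity
        have e2 : (e s - s * X.derL u s) ^ 2 / s = e s ^ 2 / s + s * X.derL u s ^ 2
            - 2 * (e s * X.derL u s) := by field_simp; ring
        linarith
    · rw [intervalIntegrable_iff_integrableOn_Ioc_of_le hαr]
      exact (i1.add i2).mono_set hs
    · rw [intervalIntegral.integral_of_le hαr]
      refine setIntegral_mono_set (i1.add i2) ?_ (Eventually.of_forall hs)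
      filter_upwards [ae_restrict_mem measurableSet_Ioi] with x hx
      have hx' : (0 : ℝ) < x := hx
      simp only [Pi.zero_apply]
      positivity

/-- By the sup bound and density, elements of `X` are uniform limits of functions that vanish near
the origin. -/
theorem X.tendsto_ev_zero (u : X) : Tendsto (ev (inclXH u)) (𝓝[>] 0) (𝓝 0) := by
  rw [Metric.tendsto_nhds]
  intro ε hε
  have hu : u ∈ closure ((testH.comap inclXH.toLinearMap : Submodule ℝ X) : Set X) := by
    rw [← Submodule.topologicalClosure_coe, dense_testX]; trivial
  obtain ⟨v, ⟨φ, hv⟩, huv⟩ := Metric.mem_closure_iff.1 hu ε hε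
  have hv' : IsTestRep (inclXH v) φ := hv
  obtain ⟨a, b, ha, -, -, hz, -⟩ := hv'.isTest.exists_Ioo
  filter_upwards [Ioc_mem_nhdsGT ha] with r hr
  have h1 := X.abs_ev_le (u - v) hr.1
  rw [map_sub, ev_sub _ _ hr.1, hv'.ev_eq r hr.1, hz r fun h => absurd h.1 (not_lt.2 hr.2)] at h1
  rw [dist_eq_norm] at huv
  rw [Real.dist_eq]
  exact h1.trans_lt huv

/-! ### Pointwise products -/

/-- One factor is controlled by `r w² ≤ ‖w‖²`, the other by the unweighted integrability of `v²`.
This is the embedding of `H` in `L⁴_r`, which makes the quartic term of the energy finite. -/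
theorem memLp_ev_mul (v w : H) : MemLp (fun r => ev v r * ev w r) 2 radialMeasure := by
  refine memLp_two_radial_of_continuousOn ((continuousOn_ev v).mul (continuousOn_ev w)) ?_
  refine Integrable.mono ((H.integrableOn_sq v).1.mul_const (‖w‖ ^ 2)) ?_ ?_
  · exact (continuousOn_id.mul (((continuousOn_ev v).mul
      (continuousOn_ev w)).pow 2)).aestronglyMeasurable measurableSet_Ioi
  · filter_upwards [ae_restrict_mem measurableSet_Ioi] with r hr
    have hr' : (0 : ℝ) < r := hr
    rw [Real.norm_of_nonneg (by positivity), Real.norm_of_nonneg (by positivity)]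
    calc r * (ev v r * ev w r) ^ 2 = ev v r ^ 2 * (r * ev w r ^ 2) := by ring
      _ ≤ _ := mul_le_mul_of_nonneg_left (H.mul_sq_ev_le w hr') (sq_nonneg _)

/-- The pointwise product `H × H → L²_r`. -/
def prodH : H →L[ℝ] H →L[ℝ] L2r :=
  LinearMap.mkContinuous₂
    (LinearMap.mk₂ ℝ (fun v w => (memLp_ev_mul v w).toLp _)
      (fun v v' w => by
        rw [← MemLp.toLp_add]
        refine MemLp.toLp_congr _ _ ?_
        filter_upwards [ae_radial_pos] with r hr
        simp only [Pi.add_apply, ev_add _ _ hr, add_mul])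
      (fun c v w => by
        rw [← MemLp.toLp_const_smul]
        refine MemLp.toLp_congr _ _ ?_
        filter_upwards [ae_radial_pos] with r hr
        simp only [Pi.smul_apply, ev_smul _ _ hr, smul_eq_mul, mul_assoc])
      (fun v w w' => by
        rw [← MemLp.toLp_add]
        refine MemLp.toLp_congr _ _ ?_
        filter_upwards [ae_radial_pos] with r hr
        simp only [Pi.add_apply, ev_add _ _ hr, mul_add])
      (fun c v w => by
        rw [← MemLp.toLp_const_smul]
        refine MemLp.toLp_congr _ _ ?_
        filter_upwards [ae_radial_pos] with r hr
        simp only [Pi.smul_apply, ev_smul _ _ hr, smul_eq_mul]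
        ring)) 2 (fun v w => by
    simp only [LinearMap.mk₂_apply]
    refine le_of_sq_le_sq ?_ (by positivity)
    rw [← L2r.integral_sq]
    have e : ∫ r in Ioi (0 : ℝ), r * ((memLp_ev_mul v w).toLp _) r ^ 2
        = ∫ r in Ioi (0 : ℝ), r * (ev v r * ev w r) ^ 2 := by
      refine integral_congr_ae ?_
      filter_upwards [ae_restrict_of_ae_radial (memLp_ev_mul v w).coeFn_toLp] with r hr
      simp only [hr]
    rw [e]
    have h1 : ∫ r in Ioi (0 : ℝ), r * (ev v r * ev w r) ^ 2
        ≤ ∫ r in Ioi (0 : ℝ), ev v r ^ 2 * ‖w‖ ^ 2 := by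
      refine setIntegral_mono_on (MemLp.integrableOn_sq_radial (memLp_ev_mul v w))
        ((H.integrableOn_sq v).1.mul_const _) measurableSet_Ioi fun r hr => ?_
      have hr' : (0 : ℝ) < r := hr
      calc r * (ev v r * ev w r) ^ 2 = ev v r ^ 2 * (r * ev w r ^ 2) := by ring
        _ ≤ _ := mul_le_mul_of_nonneg_left (H.mul_sq_ev_le w hr') (sq_nonneg _)
    rw [integral_mul_const] at h1
    have h2 := mul_le_mul_of_nonneg_right (H.integrableOn_sq v).2 (sq_nonneg ‖w‖)
    have h3 : 0 ≤ ‖v‖ ^ 2 * ‖w‖ ^ 2 := by positivity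
    nlinarith)

theorem coeFn_prodH (v w : H) : ∀ᵐ r ∂radialMeasure, prodH v w r = ev v r * ev w r :=
  (memLp_ev_mul v w).coeFn_toLp

theorem prodH_comm (v w : H) : prodH v w = prodH w v := by
  refine Lp.ext ?_
  filter_upwards [coeFn_prodH v w, coeFn_prodH w v] with r h1 h2
  rw [h1, h2, mul_comm]

theorem norm_prodH_le (v w : H) : ‖prodH v w‖ ≤ 2 * ‖v‖ * ‖w‖ := by
  refine (prodH.le_opNorm₂ v w).trans ?_
  gcongr
  exact LinearMap.mkContinuous₂_norm_le _ (by norm_num) _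

/-- Moves both copies of one factor to the same side, so that the norm of `v w` becomes a quadratic
form in `v` with the fixed weight `w²`. -/
theorem inner_prodH_prodH_swap (v w : H) :
    inner ℝ (prodH v w) (prodH v w) = inner ℝ (prodH w w) (prodH v v) := by
  rw [inner_eq_setIntegral (coeFn_prodH v w) (coeFn_prodH v w),
    inner_eq_setIntegral (coeFn_prodH w w) (coeFn_prodH v v)]
  congr 1; ext r; ring

/-- Lets a general kernel `κ` be replaced by one with compact support in the open half-line, where
pointwise convergence suffices. -/
theorem dense_fnL_testH (κ : L2r) : κ ∈ closure (H.fnL '' (testH : Set H)) := by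
  have h : (testH.map H.fnL.toLinearMap).topologicalClosure = ⊤ := by
    rw [Submodule.topologicalClosure_eq_top_iff, Submodule.eq_bot_iff]
    intro u hu
    have key : ∀ᵐ r, r ∈ Ioi (0 : ℝ) → r * u r = 0 := by
      refine isOpen_Ioi.ae_eq_zero_of_integral_contDiff_smul_eq_zero
        (locallyIntegrableOn_of_intervalIntegrable fun a b ha hb =>
          (L2r.intervalIntegrable u ha hb).continuousOn_mul continuousOn_id) fun φ h1 h2 h3 => ?_
      obtain ⟨z, hz⟩ := IsTest.exists_H ⟨h1, h2, h3⟩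
      have h4 := (Submodule.mem_orthogonal _ _).1 hu (H.fnL z) ⟨z, ⟨φ, hz⟩, rfl⟩
      have a1 : ∀ᵐ r ∂radialMeasure, H.fnL z r = φ r := by
        filter_upwards [ae_eq_ev z, ae_radial_pos] with r e1 e2
        rw [e1, hz.ev_eq r e2]
      rw [inner_eq_setIntegral a1 (Eventually.of_forall fun r => rfl)] at h4
      rw [← setIntegral_eq_integral_of_forall_compl_eq_zero (s := Ioi (0 : ℝ)) fun x hx => by
        rw [image_eq_zero_of_notMem_tsupport (f := φ) (fun h => hx (h3 h)), zero_smul]]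
      refine Eq.trans ?_ h4
      refine setIntegral_congr_fun measurableSet_Ioi fun r _ => ?_
      change φ r * (r * u r) = r * (φ r * u r)
      ring
    refine Lp.ext ?_
    filter_upwards [ae_radial_iff.2 ((ae_restrict_iff' measurableSet_Ioi).2 key),
      Lp.coeFn_zero ℝ 2 radialMeasure, ae_radial_pos] with r h1 h2 h3
    rw [h2]
    simpa [h3.ne'] using h1
  have h2 : κ ∈ (testH.map H.fnL.toLinearMap).topologicalClosure := by rw [h]; trivial
  exact h2

/-- Multiplication by an element of `L²_r` is a weakly continuous quadratic form on `H`. -/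
theorem tendsto_inner_prodH {x y : ℕ → H} {x' y' : H} (hx : WeakTendsto x x')
    (hy : WeakTendsto y y') {C : ℝ} (hxC : ∀ n, ‖x n‖ ≤ C) (hyC : ∀ n, ‖y n‖ ≤ C) (κ : L2r) :
    Tendsto (fun n => inner ℝ κ (prodH (x n) (y n))) atTop (𝓝 (inner ℝ κ (prodH x' y'))) := by
  have hC0 : 0 ≤ C := (norm_nonneg _).trans (hxC 0)
  -- For a test kernel, weak convergence gives pointwise convergence of the continuous
  -- representatives, and `r |x_n y_n| ≤ C²` provides the dominating function.
  have main : ∀ z ∈ testH, Tendsto (fun n => inner ℝ (H.fnL z) (prodH (x n) (y n))) atTop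
      (𝓝 (inner ℝ (H.fnL z) (prodH x' y'))) := by
    rintro z ⟨φ, hz⟩
    have a1 : ∀ᵐ r ∂radialMeasure, H.fnL z r = φ r := by
      filter_upwards [ae_eq_ev z, ae_radial_pos] with r e1 e2
      rw [e1, hz.ev_eq r e2]
    have e : ∀ v w : H, inner ℝ (H.fnL z) (prodH v w)
        = ∫ r in Ioi (0 : ℝ), r * (φ r * (ev v r * ev w r)) := fun v w =>
      inner_eq_setIntegral a1 (coeFn_prodH v w)
    simp_rw [e]
    obtain ⟨a, b, ha, -, -, hz0, -⟩ := hz.isTest.exists_Ioo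
    refine tendsto_integral_of_dominated_convergence (fun r => C ^ 2 * |φ r|) (fun n => ?_) ?_
      (fun n => ?_) ?_
    · exact (continuousOn_id.mul (hz.isTest.contDiff.continuous.continuousOn.mul
        ((continuousOn_ev _).mul (continuousOn_ev _)))).aestronglyMeasurable measurableSet_Ioi
    · exact (integrableOn_of_vanish (b := b) (hz.isTest.contDiff.continuous.abs.continuousOn) ha
        fun r hr => by simp [hz0 r hr]).const_mul _
    · filter_upwards [ae_restrict_mem measurableSet_Ioi] with r hr
      have hr' : (0 : ℝ) < r := hr
      have h1 : (r * |ev (x n) r| * |ev (y n) r|) ≤ C ^ 2 := by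
        refine le_of_sq_le_sq ?_ (by positivity)
        have g1 := (H.mul_sq_ev_le (x n) hr').trans (pow_le_pow_left₀ (norm_nonneg _) (hxC n) 2)
        have g2 := (H.mul_sq_ev_le (y n) hr').trans (pow_le_pow_left₀ (norm_nonneg _) (hyC n) 2)
        calc (r * |ev (x n) r| * |ev (y n) r|) ^ 2
            = (r * ev (x n) r ^ 2) * (r * ev (y n) r ^ 2) := by
              rw [mul_pow, mul_pow, sq_abs, sq_abs]; ring
          _ ≤ C ^ 2 * C ^ 2 := mul_le_mul g1 g2 (by positivity) (by positivity)
          _ = (C ^ 2) ^ 2 := by ring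
      rw [Real.norm_eq_abs, abs_mul, abs_mul, abs_mul, abs_of_pos hr']
      calc r * (|φ r| * (|ev (x n) r| * |ev (y n) r|))
          = (r * |ev (x n) r| * |ev (y n) r|) * |φ r| := by ring
        _ ≤ _ := mul_le_mul_of_nonneg_right h1 (abs_nonneg _)
    · filter_upwards [ae_restrict_mem measurableSet_Ioi] with r hr
      exact (((hx.ev hr).mul (hy.ev hr)).const_mul (φ r)).const_mul r
  rw [Metric.tendsto_nhds]
  intro ε hε
  -- `K` dominates the norms of all the products and of the limiting product, so an error `ε / (3
  -- K)` in the kernel costs at most `ε / 3` on either side.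
  set K := 2 * C * C + ‖prodH x' y'‖ + 1 with hK
  have hK0 : 0 < K := by positivity
  obtain ⟨_, ⟨z, hz, rfl⟩, hzκ⟩ := Metric.mem_closure_iff.1 (dense_fnL_testH κ) (ε / (3 * K))
    (by positivity)
  rw [dist_eq_norm] at hzκ
  filter_upwards [Metric.tendsto_nhds.1 (main z hz) (ε / 3) (by positivity)] with n hn
  rw [Real.dist_eq] at hn ⊢
  have b1 : |inner ℝ (κ - H.fnL z) (prodH (x n) (y n))| ≤ ε / 3 := by
    refine (abs_real_inner_le_norm _ _).trans ?_
    have h1 : ‖prodH (x n) (y n)‖ ≤ K := by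
      refine (norm_prodH_le _ _).trans ?_
      have : 2 * ‖x n‖ * ‖y n‖ ≤ 2 * C * C := by
        have := hxC n; have := hyC n; gcongr
      have := norm_nonneg (prodH x' y')
      linarith
    calc ‖κ - H.fnL z‖ * ‖prodH (x n) (y n)‖ ≤ ε / (3 * K) * K := by gcongr
      _ = ε / 3 := by field_simp
  have b2 : |inner ℝ (κ - H.fnL z) (prodH x' y')| < ε / 3 := by
    refine (abs_real_inner_le_norm _ _).trans_lt ?_
    have h1 : ‖prodH x' y'‖ < K := by
      have : 0 ≤ C * C := by positivity
      linarith
    calc ‖κ - H.fnL z‖ * ‖prodH x' y'‖ ≤ ε / (3 * K) * ‖prodH x' y'‖ := by gcongr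
      _ < ε / (3 * K) * K := by gcongr
      _ = ε / 3 := by field_simp
  rw [inner_sub_left, abs_le] at b1
  rw [inner_sub_left, abs_lt] at b2
  rw [abs_lt] at hn ⊢
  constructor <;> linarith [b1.1, b1.2, b2.1, b2.2, hn.1, hn.2]

/-! ### The absolute value -/

theorem abs_le_abs_of_hasDerivAt_abs {e : ℝ → ℝ} {x d d' : ℝ} (h : HasDerivAt e d x)
    (h' : HasDerivAt (fun y => |e y|) d' x) : |d'| ≤ |d| := by
  refine le_of_tendsto_of_tendsto' (hasDerivAt_iff_tendsto_slope.1 h').abs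
    (hasDerivAt_iff_tendsto_slope.1 h).abs fun y => ?_
  rw [slope_def_field, slope_def_field, abs_div, abs_div]
  exact div_le_div_of_nonneg_right (abs_abs_sub_abs_le _ _) (abs_nonneg _)

/-- Taking absolute values does not increase increments, so `|y|` is locally absolutely continuous
and its slopes are bounded by those of `y`. The density is taken to be `deriv`, which is measurable.
-/
theorem IsPrimitive.abs {y v : ℝ → ℝ} (hp : IsPrimitive y v) : ∃ v' : ℝ → ℝ, Measurable v' ∧
    IsPrimitive (fun r => |y r|) v' ∧ ∀ᵐ r ∂radialMeasure, ‖v' r‖ ≤ ‖v r‖ := by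
  have hac : ∀ a b : ℝ, 0 < a → 0 < b →
      AbsolutelyContinuousOnInterval (fun r => |y r|) a b := by
    intro a b ha hb
    have := hp.absolutelyContinuous ha hb
    rw [absolutelyContinuousOnInterval_iff] at this ⊢
    intro ε hε
    obtain ⟨δ, hδ, hE⟩ := this ε hε
    refine ⟨δ, hδ, fun E h1 h2 => lt_of_le_of_lt (Finset.sum_le_sum fun i _ => ?_) (hE E h1 h2)⟩
    rw [Real.dist_eq, Real.dist_eq]
    exact abs_abs_sub_abs_le _ _
  refine ⟨deriv fun r => |y r|, measurable_deriv _, fun a b ha hb =>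
    ⟨(hac a b ha hb).intervalIntegrable_deriv, (hac a b ha hb).integral_deriv_eq_sub.symm⟩, ?_⟩
  have hle' : ∀ n : ℕ, ∀ᵐ r, r ∈ Ioo (1 / ((n : ℝ) + 1)) ((n : ℝ) + 2) →
      |deriv (fun r => |y r|) r| ≤ |v r| := by
    intro n
    have h1 : 0 < 1 / ((n : ℝ) + 1) := by positivity
    have h2 : 0 < (n : ℝ) + 2 := by positivity
    have h3 : 1 / ((n : ℝ) + 1) ≤ (n : ℝ) + 2 := by
      have : (1 : ℝ) ≤ (n : ℝ) + 1 := by linarith [n.cast_nonneg (α := ℝ)]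
      exact ((div_le_one (by positivity)).2 this).trans (by linarith)
    filter_upwards [hp.ae_hasDerivAt h1 h2, (hac _ _ h1 h2).ae_differentiableAt] with r g1 g2 hr
    rw [uIoo_of_le h3] at g1
    rw [uIcc_of_le h3] at g2
    exact abs_le_abs_of_hasDerivAt_abs (g1 hr) (g2 (Ioo_subset_Icc_self hr)).hasDerivAt
  rw [ae_radial_iff, ae_restrict_iff' measurableSet_Ioi]
  filter_upwards [ae_all_iff.2 hle'] with r hr hr0
  have hr0' : (0 : ℝ) < r := hr0
  obtain ⟨n, hn⟩ := exists_nat_gt (max r (1 / r))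
  refine hr n ⟨?_, ?_⟩
  · have h1 : 1 / r < n := (le_max_right _ _).trans_lt hn
    rw [div_lt_comm₀ (by positivity) hr0']
    linarith
  · have h1 : r < n := (le_max_left _ _).trans_lt hn
    linarith

theorem H.exists_abs (w : H) : ∃ z : H, (∀ r > 0, ev z r = |ev w r|) ∧
    ‖H.derL z‖ ≤ ‖H.derL w‖ := by
  obtain ⟨v, hvm, hprim, hle⟩ := (ev_isPrimitive w).abs
  have hv : MemLp v 2 radialMeasure :=
    (Lp.memLp (H.derL w)).of_le hvm.aestronglyMeasurable hle
  have hw : MemLp (fun r => |ev w r|) 2 radialMeasure := by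
    refine (Lp.memLp (H.fnL w)).of_le (aestronglyMeasurable_radial
      ((continuousOn_ev w).abs.aestronglyMeasurable measurableSet_Ioi)) ?_
    filter_upwards [ae_eq_ev w] with r hr
    rw [hr, Real.norm_eq_abs, abs_abs, Real.norm_eq_abs]
  obtain ⟨z, hz, hz'⟩ := exists_H_of_isPrimitive hprim hw hv
  refine ⟨z, hz, Lp.norm_le_norm_of_ae_le ?_⟩
  filter_upwards [hz', hle] with r h1 h2
  rwa [h1]

/-! ### Radial ordinary differential equations -/

/-- `y` solves `y'' + y'/r = c y` on the half-line, and `V = r y'`. -/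
structure IsRadialSol (y V c : ℝ → ℝ) : Prop where
  hasDerivAt : ∀ r > 0, HasDerivAt y (V r / r) r
  hasDerivAt' : ∀ r > 0, HasDerivAt V (r * (c r * y r)) r

theorem IsRadialSol.continuousOn {y V c : ℝ → ℝ} (h : IsRadialSol y V c) :
    ContinuousOn y (Ioi 0) :=
  fun r hr => (h.hasDerivAt r hr).continuousAt.continuousWithinAt

theorem IsRadialSol.continuousOn' {y V c : ℝ → ℝ} (h : IsRadialSol y V c) :
    ContinuousOn V (Ioi 0) :=
  fun r hr => (h.hasDerivAt' r hr).continuousAt.continuousWithinAt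

theorem IsRadialSol.deriv_eq {y V c : ℝ → ℝ} (h : IsRadialSol y V c) {r : ℝ} (hr : 0 < r) :
    deriv y r = V r / r := (h.hasDerivAt r hr).deriv

theorem IsRadialSol.hasDerivAt_deriv {y V c : ℝ → ℝ} (h : IsRadialSol y V c) {r : ℝ}
    (hr : 0 < r) : HasDerivAt (deriv y) (c r * y r - 1 / r * deriv y r) r := by
  have h1 : HasDerivAt (fun s => V s / s) (c r * y r - 1 / r * deriv y r) r := by
    refine ((h.hasDerivAt' r hr).div (hasDerivAt_id r) hr.ne').congr_deriv ?_
    rw [h.deriv_eq hr]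
    simp only [id]
    field_simp
  refine h1.congr_of_eventuallyEq ?_
  filter_upwards [Ioi_mem_nhds hr] with s hs
  exact h.deriv_eq hs

theorem IsRadialSol.contDiffOn {y V c : ℝ → ℝ} (h : IsRadialSol y V c)
    (hc : ContinuousOn c (Ioi 0)) : ContDiffOn ℝ 2 y (Ioi 0) := by
  have h2 : (2 : WithTop ℕ∞) = 1 + 1 := by norm_num
  rw [h2, contDiffOn_succ_iff_deriv_of_isOpen isOpen_Ioi]
  refine ⟨fun r hr => (h.hasDerivAt r hr).differentiableAt.differentiableWithinAt, by simp, ?_⟩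
  have h1 : (1 : WithTop ℕ∞) = 0 + 1 := by norm_num
  rw [h1, contDiffOn_succ_iff_deriv_of_isOpen isOpen_Ioi]
  refine ⟨fun r hr => (h.hasDerivAt_deriv hr).differentiableAt.differentiableWithinAt, by simp,
    ?_⟩
  rw [contDiffOn_zero]
  have hd : ContinuousOn (deriv y) (Ioi 0) :=
    fun r hr => (h.hasDerivAt_deriv hr).continuousAt.continuousWithinAt
  refine ContinuousOn.congr (f := fun r => c r * y r - 1 / r * deriv y r) ?_
    fun r hr => (h.hasDerivAt_deriv hr).deriv
  exact (hc.mul h.continuousOn).sub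
    ((continuousOn_const.div continuousOn_id fun x hx => ne_of_gt hx).mul hd)

theorem IsRadialSol.of_contDiffOn {y c : ℝ → ℝ} (hy : ContDiffOn ℝ 2 y (Ioi 0))
    (h : ∀ r > 0, deriv (deriv y) r + 1 / r * deriv y r = c r * y r) :
    IsRadialSol y (fun r => r * deriv y r) c := by
  have h2 : (2 : WithTop ℕ∞) = 1 + 1 := by norm_num
  rw [h2, contDiffOn_succ_iff_deriv_of_isOpen isOpen_Ioi] at hy
  have hy' := hy.2.2.differentiableOn (by simp)
  refine ⟨fun r hr => ?_, fun r hr => ?_⟩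
  · refine ((hy.1 r hr).differentiableAt (Ioi_mem_nhds hr)).hasDerivAt.congr_deriv ?_
    field_simp
  · refine ((hasDerivAt_id r).mul
      ((hy' r hr).differentiableAt (Ioi_mem_nhds hr)).hasDerivAt).congr_deriv ?_
    rw [← h r hr]
    simp only [id]
    field_simp
    ring

/-- The second-order necessary condition at an interior minimum. -/
theorem nonneg_of_isLocalMin {y V v : ℝ → ℝ} (hy : ∀ r > 0, HasDerivAt y (V r / r) r)
    (hV : ∀ r > 0, HasDerivAt V (v r) r) {x : ℝ} (hx : 0 < x) (hmin : IsLocalMin y x) :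
    V x = 0 ∧ 0 ≤ v x := by
  have h0 : V x = 0 := by
    have := hmin.hasDerivAt_eq_zero (hy x hx)
    simpa [hx.ne'] using this
  refine ⟨h0, ?_⟩
  by_contra hneg
  rw [not_le] at hneg
  have h1 : ∀ᶠ r in 𝓝[>] x, V r < 0 := by
    have hs := (hasDerivAt_iff_tendsto_slope.1 (hV x hx)).mono_left
      (nhdsWithin_mono x fun r (hr : x < r) => hr.ne')
    filter_upwards [hs.eventually_lt_const hneg, self_mem_nhdsWithin] with r hr hxr
    have hxr' : x < r := hxr
    rw [slope_def_field, h0, sub_zero] at hr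
    by_contra hV0
    exact absurd hr (not_lt.2 (div_nonneg (not_lt.1 hV0) (by linarith)))
  obtain ⟨u, hu, hu'⟩ := (mem_nhdsGT_iff_exists_Ioo_subset).1 h1
  have hu0 : x < u := hu
  have hanti : StrictAntiOn y (Icc x ((x + u) / 2)) := by
    refine strictAntiOn_of_deriv_neg (convex_Icc _ _)
      (fun r hr => (hy r (hx.trans_le hr.1)).continuousAt.continuousWithinAt) fun r hr => ?_
    rw [interior_Icc] at hr
    have hr0 : 0 < r := hx.trans hr.1
    rw [(hy r hr0).deriv]
    exact div_neg_of_neg_of_pos (hu' ⟨hr.1, by linarith [hr.2]⟩) hr0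
  obtain ⟨r, hr1, hr2, hr3⟩ := ((hmin.filter_mono nhdsWithin_le_nhds).and
    (Ioc_mem_nhdsGT (show x < (x + u) / 2 by linarith))).exists
  exact absurd hr1 (not_le.2 (hanti ⟨le_rfl, by linarith⟩ ⟨hr2.le, hr3⟩ hr2))

/-- The form in which the maximum principle is used below: if `y` is smaller inside than at both
ends, there is an interior minimum, where the derivative `v` of the flux is non-negative; the
differential equation or a barrier then forces the opposite sign. -/
theorem exists_min_point {y V v : ℝ → ℝ} (hy : ∀ r > 0, HasDerivAt y (V r / r) r)
    (hV : ∀ r > 0, HasDerivAt V (v r) r) {a p b : ℝ} (ha : 0 < a) (hap : a < p) (hpb : p < b)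
    (h1 : y p < y a) (h2 : y p < y b) : ∃ x ∈ Ioo a b, y x ≤ y p ∧ 0 ≤ v x := by
  have hc : ContinuousOn y (Icc a b) := fun r hr =>
    (hy r (ha.trans_le hr.1)).continuousAt.continuousWithinAt
  obtain ⟨x, hx, hmin⟩ := isCompact_Icc.exists_isMinOn ⟨p, hap.le, hpb.le⟩ hc
  have hxp : y x ≤ y p := hmin ⟨hap.le, hpb.le⟩
  have hxa : a < x := lt_of_le_of_ne hx.1 fun h => by rw [← h] at hxp; linarith
  have hxb : x < b := lt_of_le_of_ne hx.2 fun h => by rw [h] at hxp; linarith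
  exact ⟨x, ⟨hxa, hxb⟩, hxp,
    (nonneg_of_isLocalMin hy hV (ha.trans hxa) (hmin.isLocalMin (Icc_mem_nhds hxa hxb))).2⟩

/-- Grönwall's argument in both directions: `exp(-K r) E` is non-increasing and `exp(K r) E` is
non-decreasing. -/
theorem eq_zero_of_abs_deriv_le {E E' : ℝ → ℝ} {a b K x₀ : ℝ} (hx₀ : x₀ ∈ Icc a b)
    (hE : ∀ r ∈ Icc a b, HasDerivAt E (E' r) r) (h0 : ∀ r ∈ Icc a b, 0 ≤ E r)
    (hK : ∀ r ∈ Icc a b, |E' r| ≤ K * E r) (hx : E x₀ = 0) : ∀ r ∈ Icc a b, E r = 0 := by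
  have hm : ∀ s : ℝ, |s| = K → ∀ r ∈ Icc a b,
      HasDerivAt (fun r => Real.exp (s * r) * E r) (Real.exp (s * r) * (s * E r + E' r)) r := by
    intro s _ r hr
    have h1 : HasDerivAt (fun r : ℝ => Real.exp (s * r)) (Real.exp (s * r) * s) r := by
      simpa using ((hasDerivAt_id r).const_mul s).exp
    refine (h1.mul (hE r hr)).congr_deriv ?_
    ring
  intro r hr
  have hK0 : 0 ≤ K ∨ E r = 0 := by
    by_contra hcon
    rw [not_or, not_le] at hcon
    have h1 := (abs_nonneg _).trans (hK r hr)
    have h2 := lt_of_le_of_ne (h0 r hr) (Ne.symm hcon.2)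
    nlinarith [hcon.1]
  rcases hK0 with hK0 | h
  swap; · exact h
  refine le_antisymm ?_ (h0 r hr)
  rcases le_total x₀ r with hle | hle
  · have hanti : AntitoneOn (fun r => Real.exp (-K * r) * E r) (Icc a b) := by
      have hd := hm (-K) (by rw [abs_neg, abs_of_nonneg hK0])
      refine antitoneOn_of_deriv_nonpos (convex_Icc _ _)
        (fun s hs => (hd s hs).continuousAt.continuousWithinAt)
        (fun s hs => (hd s (interior_subset hs)).differentiableAt.differentiableWithinAt)
        fun s hs => ?_
      rw [(hd s (interior_subset hs)).deriv]
      refine mul_nonpos_of_nonneg_of_nonpos (Real.exp_pos _).le ?_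
      linarith [(abs_le.1 (hK s (interior_subset hs))).2]
    have h1 := hanti hx₀ hr hle
    simp only [hx, mul_zero] at h1
    by_contra h2
    exact absurd h1 (not_le.2 (mul_pos (Real.exp_pos _) (not_le.1 h2)))
  · have hmono : MonotoneOn (fun r => Real.exp (K * r) * E r) (Icc a b) := by
      have hd := hm K (abs_of_nonneg hK0)
      refine monotoneOn_of_deriv_nonneg (convex_Icc _ _)
        (fun s hs => (hd s hs).continuousAt.continuousWithinAt)
        (fun s hs => (hd s (interior_subset hs)).differentiableAt.differentiableWithinAt)
        fun s hs => ?_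
      rw [(hd s (interior_subset hs)).deriv]
      refine mul_nonneg (Real.exp_pos _).le ?_
      linarith [(abs_le.1 (hK s (interior_subset hs))).1]
    have h1 := hmono hr hx₀ hle
    simp only [hx, mul_zero] at h1
    by_contra h2
    exact absurd h1 (not_le.2 (mul_pos (Real.exp_pos _) (not_le.1 h2)))

/-- The strong maximum principle. -/
theorem IsRadialSol.eq_zero {y V c : ℝ → ℝ} (h : IsRadialSol y V c) (hc : ContinuousOn c (Ioi 0))
    (h0 : ∀ r > 0, 0 ≤ y r) {x₀ : ℝ} (hx₀ : 0 < x₀) (hx : y x₀ = 0) : ∀ r > 0, y r = 0 := by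
  intro r hr
  have hmin : IsLocalMin y x₀ := by
    filter_upwards [Ioi_mem_nhds hx₀] with s hs
    rw [hx]; exact h0 s hs
  have hV0 := (nonneg_of_isLocalMin h.hasDerivAt h.hasDerivAt' hx₀ hmin).1
  set a := min x₀ r with ha
  set b := max x₀ r with hb
  have ha0 : 0 < a := lt_min hx₀ hr
  have hcI : ContinuousOn (fun s => |1 / s + s * c s|) (Icc a b) := by
    refine ContinuousOn.abs (ContinuousOn.mono (s := Ioi 0) ?_ fun s hs => ha0.trans_le hs.1)
    exact (continuousOn_const.div continuousOn_id fun x hx => ne_of_gt hx).add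
      (continuousOn_id.mul hc)
  obtain ⟨K, hK⟩ := isCompact_Icc.bddAbove_image hcI
  -- Uniqueness of the initial value problem: at a zero of `y ≥ 0` the flux vanishes too, and `y² +
  -- V²` satisfies a linear differential inequality on the compact interval.
  have hE : ∀ s ∈ Icc a b, HasDerivAt (fun s => y s ^ 2 + V s ^ 2)
      (2 * (y s * V s) * (1 / s + s * c s)) s := by
    intro s hs
    have hs0 : 0 < s := ha0.trans_le hs.1
    refine (((h.hasDerivAt s hs0).pow 2).add ((h.hasDerivAt' s hs0).pow 2)).congr_deriv ?_
    simp
    field_simp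
  have := eq_zero_of_abs_deriv_le (x₀ := x₀) (K := K) ⟨min_le_left _ _, le_max_left _ _⟩ hE
    (fun s _ => by positivity) (fun s hs => by
      rw [abs_mul]
      have h1 : |1 / s + s * c s| ≤ K := hK ⟨s, hs, rfl⟩
      have h2 : |2 * (y s * V s)| ≤ y s ^ 2 + V s ^ 2 := by
        rw [abs_le]
        constructor <;> nlinarith [sq_nonneg (y s + V s), sq_nonneg (y s - V s)]
      rw [mul_comm K]
      exact mul_le_mul h2 h1 (abs_nonneg _) (by positivity)) (by simp [hx, hV0]) r
      ⟨min_le_right _ _, le_max_right _ _⟩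
  nlinarith [sq_nonneg (y r), sq_nonneg (V r)]

theorem IsRadialSol.pos {y V c : ℝ → ℝ} (h : IsRadialSol y V c) (hc : ContinuousOn c (Ioi 0))
    (h0 : ∀ r > 0, 0 ≤ y r) (hne : ∃ r > 0, y r ≠ 0) : ∀ r > 0, 0 < y r := by
  intro r hr
  refine lt_of_le_of_ne (h0 r hr) fun heq => ?_
  obtain ⟨s, hs, hs'⟩ := hne
  exact hs' (h.eq_zero hc h0 hr heq.symm s hs)

/-- If `Y = r y'` stayed above `1`, then `y` would grow at least like `log r`. This controls
boundary terms at suitable large radii without any pointwise information on `y'`. -/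
theorem exists_ge_le_one {y Y : ℝ → ℝ} (hy : ∀ r > 0, HasDerivAt y (Y r / r) r) {M : ℝ}
    (hM : ∀ r > 0, |y r| ≤ M) (b₀ : ℝ) : ∃ b ≥ b₀, 0 < b ∧ Y b ≤ 1 := by
  by_contra hcon
  push Not at hcon
  set b₁ := max b₀ 1 with hb₁
  have hb1 : 0 < b₁ := one_pos.trans_le (le_max_right _ _)
  have hd : ∀ r ∈ Ici b₁, HasDerivAt (fun r => y r - Real.log r) ((Y r - 1) / r) r := by
    intro r hr
    have hr0 : 0 < r := hb1.trans_le hr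
    refine ((hy r hr0).sub (Real.hasDerivAt_log hr0.ne')).congr_deriv ?_
    field_simp
  have hm : MonotoneOn (fun r => y r - Real.log r) (Ici b₁) := by
    refine monotoneOn_of_deriv_nonneg (convex_Ici _)
      (fun s hs => (hd s hs).continuousAt.continuousWithinAt)
      (fun s hs => (hd s (interior_subset hs)).differentiableAt.differentiableWithinAt)
      fun s hs => ?_
    have hs' : b₁ ≤ s := interior_subset hs
    have hs0 : 0 < s := hb1.trans_le hs'
    rw [(hd s (interior_subset hs)).deriv]
    have := hcon s ((le_max_left _ _).trans hs') hs0
    exact div_nonneg (by linarith) hs0.le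
  obtain ⟨r, hr, hr'⟩ := ((Real.tendsto_log_atTop.eventually_gt_atTop
    (2 * M + Real.log b₁)).and (eventually_ge_atTop b₁)).exists
  have h1 := hm self_mem_Ici hr' hr'
  simp only at h1
  have h2 := abs_le.1 (hM r (hb1.trans_le hr'))
  have h3 := abs_le.1 (hM b₁ hb1)
  linarith [h2.1, h2.2, h3.1, h3.2]

/-- The substitution `r ↦ 1/r` interchanges the two ends of the half-line and changes the sign of `r
y'`. -/
theorem exists_le_neg_one_le {y Y : ℝ → ℝ} (hy : ∀ r > 0, HasDerivAt y (Y r / r) r) {M : ℝ}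
    (hM : ∀ r > 0, |y r| ≤ M) {a₀ : ℝ} (ha₀ : 0 < a₀) : ∃ a, 0 < a ∧ a ≤ a₀ ∧ -1 ≤ Y a := by
  have hz : ∀ r > 0, HasDerivAt (fun s => y s⁻¹) (-Y r⁻¹ / r) r := by
    intro r hr
    refine ((hy r⁻¹ (inv_pos.2 hr)).comp r (hasDerivAt_inv hr.ne')).congr_deriv ?_
    field_simp
  obtain ⟨b, hb, hb0, hb1⟩ := exists_ge_le_one (Y := fun r => -Y r⁻¹) hz
    (fun r hr => hM r⁻¹ (inv_pos.2 hr)) a₀⁻¹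
  exact ⟨b⁻¹, inv_pos.2 hb0, inv_le_of_inv_le₀ ha₀ hb, by linarith⟩

/-! ### The normal core -/

theorem IsNormalCore.isRadialSol {d : ℤ} {ft : ℝ → ℝ} (h : IsNormalCore d ft) :
    IsRadialSol ft (fun r => r * deriv ft r) (fun r => (d : ℝ) ^ 2 / r ^ 2 - (1 - ft r ^ 2)) :=
  IsRadialSol.of_contDiffOn h.contDiffOn fun r hr => by linarith [h.eqn r hr]

theorem IsNormalCore.tendsto_zero {d : ℤ} {ft : ℝ → ℝ} (h : IsNormalCore d ft) :
    Tendsto ft (𝓝[>] 0) (𝓝 0) := by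
  have := h.continuous_zero.mono_left (nhdsWithin_mono 0 Ioi_subset_Ici_self)
  rwa [h.at_zero] at this

theorem one_le_sq_int {d : ℤ} (hd : d ≠ 0) : (1 : ℝ) ≤ (d : ℝ) ^ 2 := by
  have : (0 : ℤ) < d ^ 2 := by positivity
  have : (1 : ℤ) ≤ d ^ 2 := this
  exact_mod_cast this

/-- At a maximum with value at least `1`, the right-hand side of `(r f')' = r (d²/r² - (1 - f²)) f`
is strictly positive, which is impossible. -/
theorem IsNormalCore.lt_one {d : ℤ} {ft : ℝ → ℝ} (hd : d ≠ 0) (h : IsNormalCore d ft) {r : ℝ}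
    (hr : 0 < r) : ft r < 1 := by
  have hd1 := one_le_sq_int hd
  have hs := h.isRadialSol
  have hy : ∀ r > 0, HasDerivAt (fun r => -ft r) (-(r * deriv ft r) / r) r := fun r hr =>
    (hs.hasDerivAt r hr).neg.congr_deriv (by ring)
  have hV : ∀ r > 0, HasDerivAt (fun r => -(r * deriv ft r))
      (-(r * (((d : ℝ) ^ 2 / r ^ 2 - (1 - ft r ^ 2)) * ft r))) r := fun r hr =>
    (hs.hasDerivAt' r hr).neg
  have hle : ∀ r > 0, ft r ≤ 1 := by
    intro p hp
    by_contra hlt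
    rw [not_le] at hlt
    obtain ⟨a, ha1, ha2⟩ := ((h.tendsto_zero.eventually_lt_const one_pos).and
      (Ioo_mem_nhdsGT hp)).exists
    obtain ⟨b, hb1, hb2⟩ := ((h.at_infty.eventually_lt_const hlt).and
      (eventually_gt_atTop p)).exists
    obtain ⟨x, hx, hx1, hx2⟩ := exists_min_point hy hV ha2.1 ha2.2 hb2
      (by linarith) (by linarith)
    have hx0 : 0 < x := ha2.1.trans hx.1
    have hfx : 1 < ft x := by linarith
    have : 0 < x * (((d : ℝ) ^ 2 / x ^ 2 - (1 - ft x ^ 2)) * ft x) := by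
      have h1 : 0 < (d : ℝ) ^ 2 / x ^ 2 := by positivity
      have h2 : 1 < ft x ^ 2 := by nlinarith
      have h3 : 0 < (d : ℝ) ^ 2 / x ^ 2 - (1 - ft x ^ 2) := by linarith
      positivity
    linarith
  refine lt_of_le_of_ne (hle r hr) fun heq => ?_
  have hmin : IsLocalMin (fun r => -ft r) r := by
    filter_upwards [Ioi_mem_nhds hr] with s hs
    rw [heq]; exact neg_le_neg (hle s hs)
  have h1 := (nonneg_of_isLocalMin hy hV hr hmin).2
  have : 0 < r * (((d : ℝ) ^ 2 / r ^ 2 - (1 - ft r ^ 2)) * ft r) := by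
    rw [heq]; simp; positivity
  linarith

/-- Comparison with the barrier `2 √r` on `(0, 1/2)`: there the potential is at least `(3/4)/r²`,
because `d² ≥ 1`, whereas `√r` corresponds to the coefficient `1/4`. The bound `f̃²/r ≤ 4` is what
the energy estimates near the origin require; it is not the sharp rate. -/
theorem IsNormalCore.sq_le {d : ℤ} {ft : ℝ → ℝ} (hd : d ≠ 0) (h : IsNormalCore d ft) {r : ℝ}
    (hr : 0 < r) : ft r ^ 2 ≤ 4 * r := by
  have hd1 := one_le_sq_int hd
  have hs := h.isRadialSol
  rcases le_or_gt (1 / 2) r with hr2 | hr2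
  · have := h.lt_one hd hr
    have := h.pos r hr
    nlinarith
  suffices hk : ft r ≤ 2 * Real.sqrt r by
    have h0 := h.pos r hr
    calc ft r ^ 2 ≤ (2 * Real.sqrt r) ^ 2 := pow_le_pow_left₀ h0.le hk 2
      _ = 4 * r := by rw [mul_pow, Real.sq_sqrt hr.le]; norm_num
  by_contra hlt
  rw [not_le] at hlt
  have hy : ∀ r > 0, HasDerivAt (fun r => 2 * Real.sqrt r - ft r)
      ((Real.sqrt r - r * deriv ft r) / r) r := fun r hr => by
    have hq := Real.sqrt_pos.2 hr
    refine (((Real.hasDerivAt_sqrt hr.ne').const_mul 2).sub (hs.hasDerivAt r hr)).congr_deriv ?_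
    have := Real.mul_self_sqrt hr.le
    field_simp
    nlinarith
  have hV : ∀ r > 0, HasDerivAt (fun r => Real.sqrt r - r * deriv ft r)
      (1 / (2 * Real.sqrt r) - r * (((d : ℝ) ^ 2 / r ^ 2 - (1 - ft r ^ 2)) * ft r)) r :=
    fun r hr => (Real.hasDerivAt_sqrt hr.ne').sub (hs.hasDerivAt' r hr)
  have hlim : Tendsto (fun r => 2 * Real.sqrt r - ft r) (𝓝[>] 0) (𝓝 0) := by
    have h1 : Tendsto (fun r : ℝ => 2 * Real.sqrt r) (𝓝[>] 0) (𝓝 (2 * Real.sqrt 0)) :=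
      ((Real.continuous_sqrt.tendsto 0).const_mul 2).mono_left nhdsWithin_le_nhds
    simpa using h1.sub h.tendsto_zero
  obtain ⟨a, ha1, ha2⟩ := ((hlim.eventually_const_lt
    (show 2 * Real.sqrt r - ft r < 0 by linarith)).and (Ioo_mem_nhdsGT hr)).exists
  have hb : 0 < 2 * Real.sqrt (1 / 2) - ft (1 / 2) := by
    have h1 := h.lt_one hd (show (0 : ℝ) < 1 / 2 by norm_num)
    have h2 : (1 / 2 : ℝ) ≤ Real.sqrt (1 / 2) := Real.le_sqrt_of_sq_le (by norm_num)
    linarith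
  obtain ⟨x, hx, hx1, hx2⟩ := exists_min_point hy hV ha2.1 ha2.2 hr2 ha1
    (by linarith)
  have hx0 : 0 < x := ha2.1.trans hx.1
  set q := Real.sqrt x with hq
  have hq0 : 0 < q := Real.sqrt_pos.2 hx0
  have hqx : q ^ 2 = x := Real.sq_sqrt hx0.le
  have hfx : 2 * q < ft x := by linarith
  have hxl : x < 1 / 2 := hx.2
  have h3 : 3 / 4 / x ^ 2 ≤ (d : ℝ) ^ 2 / x ^ 2 - (1 - ft x ^ 2) := by
    have h4 : 3 / 4 / x ^ 2 + 1 ≤ 1 / x ^ 2 := by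
      rw [div_add_one (by positivity), div_le_div_iff_of_pos_right (by positivity)]
      nlinarith
    have h5 : 1 / x ^ 2 ≤ (d : ℝ) ^ 2 / x ^ 2 := by gcongr
    nlinarith [sq_nonneg (ft x)]
  have h4 : x * (3 / 4 / x ^ 2 * (2 * q))
      ≤ x * (((d : ℝ) ^ 2 / x ^ 2 - (1 - ft x ^ 2)) * ft x) := by
    refine mul_le_mul_of_nonneg_left ?_ hx0.le
    exact mul_le_mul h3 hfx.le (by positivity) (le_trans (by positivity) h3)
  have h5 : x * (3 / 4 / x ^ 2 * (2 * q)) = 3 / (2 * q) := by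
    rw [← hqx]; field_simp; norm_num
  have h6 : 1 / (2 * q) < 3 / (2 * q) := by gcongr; norm_num
  linarith

/-- Comparison with the barrier `1 - K/r²`; the rate `r⁻²` is dictated by the term `d²/r² f`. -/
theorem IsNormalCore.exists_decay {d : ℤ} {ft : ℝ → ℝ} (hd : d ≠ 0) (h : IsNormalCore d ft) :
    ∃ K : ℝ, 0 < K ∧ ∀ r > 0, 1 - ft r ≤ K / r ^ 2 := by
  have hd1 := one_le_sq_int hd
  have hs := h.isRadialSol
  obtain ⟨R, hR⟩ := (((h.at_infty.eventually_const_lt (show (1 / 2 : ℝ) < 1 by norm_num)).and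
    (eventually_ge_atTop 4)).exists_forall_of_atTop)
  set R' := max R 4 with hR'
  have hR4 : 4 ≤ R' := le_max_right _ _
  -- `R'²` makes the barrier trivial up to `R'`, and `2 d²` lets half of `K/x²` absorb the angular
  -- term. With `R' ≥ 4` the Laplacian of `K/r²` costs at most another quarter, while `f > 1/2`
  -- gives `f (1 + f) ≥ 3/4`.
  set K := R' ^ 2 + 2 * (d : ℝ) ^ 2 with hK
  have hK0 : 0 < K := by positivity
  have hKR : R' ^ 2 ≤ K := by rw [hK]; linarith [sq_nonneg (d : ℝ)]
  have hsmall : ∀ r > 0, r ≤ R' → 0 < K / r ^ 2 - 1 + ft r := by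
    intro r hr hrR
    have h1 : 1 ≤ K / r ^ 2 := by
      rw [le_div_iff₀ (by positivity), one_mul]
      exact (pow_le_pow_left₀ hr.le hrR 2).trans hKR
    linarith [h.pos r hr]
  refine ⟨K, hK0, fun r hr => ?_⟩
  rcases le_or_gt r R' with hrR | hrR
  · linarith [hsmall r hr hrR]
  by_contra hlt
  rw [not_le] at hlt
  have hy : ∀ r > 0, HasDerivAt (fun r => K / r ^ 2 - 1 + ft r)
      ((-2 * K / r ^ 2 + r * deriv ft r) / r) r := fun r hr => by
    have h1 : HasDerivAt (fun r : ℝ => K / r ^ 2) (-2 * K / r ^ 3) r := by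
      refine ((hasDerivAt_const r K).div (hasDerivAt_pow 2 r)
        (pow_ne_zero 2 hr.ne')).congr_deriv ?_
      simp; field_simp
    refine ((h1.sub_const 1).add (hs.hasDerivAt r hr)).congr_deriv ?_
    field_simp
  have hV : ∀ r > 0, HasDerivAt (fun r => -2 * K / r ^ 2 + r * deriv ft r)
      (4 * K / r ^ 3 + r * (((d : ℝ) ^ 2 / r ^ 2 - (1 - ft r ^ 2)) * ft r)) r := fun r hr => by
    refine HasDerivAt.add ?_ (hs.hasDerivAt' r hr)
    refine ((hasDerivAt_const r (-2 * K)).div (hasDerivAt_pow 2 r)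
      (pow_ne_zero 2 hr.ne')).congr_deriv ?_
    simp; field_simp; norm_num
  have hlim : Tendsto (fun r => K / r ^ 2 - 1 + ft r) atTop (𝓝 0) := by
    have h1 : Tendsto (fun r : ℝ => K / r ^ 2) atTop (𝓝 0) :=
      tendsto_const_nhds.div_atTop (tendsto_pow_atTop two_ne_zero)
    simpa using (h1.sub_const 1).add h.at_infty
  obtain ⟨b, hb1, hb2⟩ := ((hlim.eventually_const_lt
    (show K / r ^ 2 - 1 + ft r < 0 by linarith)).and (eventually_gt_atTop r)).exists
  have hR0 : 0 < R' := by linarith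
  obtain ⟨x, hx, hx1, hx2⟩ := exists_min_point hy hV hR0 hrR hb2
    (by have := hsmall R' hR0 le_rfl; linarith) hb1
  have hx0 : 0 < x := hR0.trans hx.1
  have hx4 : 4 < x := hR4.trans_lt hx.1
  have hfx : 1 / 2 < ft x := (hR x ((le_max_left _ _).trans hx.1.le)).1
  have hfx1 := h.lt_one hd hx0
  have hneg : K / x ^ 2 < 1 - ft x := by linarith
  have e1 : 4 * K / x ^ 3 + x * (((d : ℝ) ^ 2 / x ^ 2 - (1 - ft x ^ 2)) * ft x)
      = x * (4 / x ^ 2 * (K / x ^ 2) + (d : ℝ) ^ 2 / x ^ 2 * ft x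
        - ft x * (1 + ft x) * (1 - ft x)) := by
    field_simp
    ring
  rw [e1] at hx2
  have h2 : 4 / x ^ 2 ≤ 1 / 4 := by
    rw [div_le_div_iff₀ (by positivity) (by norm_num)]; nlinarith
  have h3 : (d : ℝ) ^ 2 / x ^ 2 * ft x ≤ 1 / 2 * (K / x ^ 2) := by
    have : (d : ℝ) ^ 2 ≤ 1 / 2 * K := by rw [hK]; nlinarith [sq_nonneg R']
    calc (d : ℝ) ^ 2 / x ^ 2 * ft x ≤ (d : ℝ) ^ 2 / x ^ 2 * 1 := by gcongr
      _ ≤ (1 / 2 * K) / x ^ 2 * 1 := by gcongr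
      _ = _ := by ring
  have hKx : 0 < K / x ^ 2 := by positivity
  have h4 : 4 / x ^ 2 * (K / x ^ 2) ≤ 1 / 4 * (K / x ^ 2) := by gcongr
  have h5 : 3 / 4 * (1 - ft x) ≤ ft x * (1 + ft x) * (1 - ft x) := by
    refine mul_le_mul_of_nonneg_right ?_ (by linarith)
    nlinarith
  have h6 : 4 / x ^ 2 * (K / x ^ 2) + (d : ℝ) ^ 2 / x ^ 2 * ft x
      - ft x * (1 + ft x) * (1 - ft x) < 0 := by linarith
  exact absurd hx2 (not_le.2 (mul_neg_of_pos_of_neg hx0 h6))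

/-- The equation is multiplied by `f` on `(0, 1)` and by `1 - f` on `(1, ∞)` and integrated by
parts. The boundary terms are `r y'` for the bounded functions `f²/2` and `(1 - f)²/2`, hence under
control at suitable radii. -/
theorem IsNormalCore.integrableOn_deriv {d : ℤ} {ft : ℝ → ℝ} (hd : d ≠ 0)
    (h : IsNormalCore d ft) : IntegrableOn (fun r => r * deriv ft r ^ 2) (Ioi 0) := by
  have hs := h.isRadialSol
  obtain ⟨K, hK0, hK⟩ := h.exists_decay hd
  set V : ℝ → ℝ := fun r => r * deriv ft r with hV
  set c : ℝ → ℝ := fun r => (d : ℝ) ^ 2 / r ^ 2 - (1 - ft r ^ 2) with hc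
  have hF : ∀ r > 0, r * deriv ft r ^ 2 = V r ^ 2 / r := fun r hr => by
    simp only [hV]; field_simp
  have hFc : ContinuousOn (fun r => r * deriv ft r ^ 2) (Ioi 0) := by
    refine ContinuousOn.congr (f := fun r => V r ^ 2 / r) ?_ hF
    exact (hs.continuousOn'.pow 2).div continuousOn_id fun x hx => ne_of_gt hx
  have hf0 := h.pos
  have hf1 : ∀ r > 0, ft r < 1 := fun r hr => h.lt_one hd hr
  set D := ((d : ℝ) ^ 2 + 2 * K) * K with hD
  have hD0 : 0 ≤ D := by positivity
  -- The term `r²/2` compensates for the potential, since `c f² ≥ -1`; the derivative therefore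
  -- dominates `V²/r`.
  have hW1 : ∀ r > 0, HasDerivAt (fun r => V r * ft r + r ^ 2 / 2)
      (r * (c r * ft r) * ft r + V r * (V r / r) + r) r := fun r hr => by
    refine (((hs.hasDerivAt' r hr).mul (hs.hasDerivAt r hr)).add
      ((hasDerivAt_pow 2 r).div_const 2)).congr_deriv ?_
    simp
  -- The term `-D/(2 r²)` has derivative `D/r³`, which by the decay of `1 - f` exceeds `r c f (1 -
  -- f)`.
  have hW2 : ∀ r > 0, HasDerivAt (fun r => -(V r * (1 - ft r)) - D / 2 / r ^ 2)
      (-(r * (c r * ft r) * (1 - ft r) + V r * (-(V r / r))) + D / r ^ 3) r := fun r hr => by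
    have h1 : HasDerivAt (fun r : ℝ => D / 2 / r ^ 2) (-D / r ^ 3) r := by
      refine ((hasDerivAt_const r (D / 2)).div (hasDerivAt_pow 2 r)
        (pow_ne_zero 2 hr.ne')).congr_deriv ?_
      simp; field_simp
    refine ((((hs.hasDerivAt' r hr).mul ((hs.hasDerivAt r hr).const_sub 1)).neg).sub
      h1).congr_deriv ?_
    ring
  set I := (V 1 * ft 1 + 1 ^ 2 / 2 + 1) + (1 - (-(V 1 * (1 - ft 1)) - D / 2 / 1 ^ 2)) with hI
  refine (integrableOn_Ioi_of_bounded hFc (fun r hr => by positivity) (I := I)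
    fun a b ha hab => ?_).1
  have hb : 0 < b := ha.trans_le hab
  obtain ⟨a', ha'0, ha'1, ha'2⟩ := exists_le_neg_one_le (y := fun r => ft r ^ 2 / 2)
    (Y := fun r => V r * ft r) (fun r hr => by
      refine (((hs.hasDerivAt r hr).pow 2).div_const 2).congr_deriv ?_
      simp; ring) (M := 1) (fun r hr => by
      have h1 := hf0 r hr
      have h2 := hf1 r hr
      rw [abs_le]
      constructor <;> nlinarith) (lt_min ha one_pos)
  obtain ⟨b', hb'1, hb'0, hb'2⟩ := exists_ge_le_one (y := fun r => (1 - ft r) ^ 2 / 2)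
    (Y := fun r => -(V r * (1 - ft r))) (fun r hr => by
      refine ((((hs.hasDerivAt r hr).const_sub 1).pow 2).div_const 2).congr_deriv ?_
      simp; ring) (M := 1) (fun r hr => by
      have h1 := hf0 r hr
      have h2 := hf1 r hr
      rw [abs_le]
      constructor <;> nlinarith) (max b 1)
  have ha'a : a' ≤ a := ha'1.trans (min_le_left _ _)
  have ha'1' : a' ≤ 1 := ha'1.trans (min_le_right _ _)
  have hbb' : b ≤ b' := (le_max_left _ _).trans hb'1
  have h1b' : 1 ≤ b' := (le_max_right _ _).trans hb'1
  have hint : ∀ x y : ℝ, 0 < x → 0 < y →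
      IntervalIntegrable (fun r => r * deriv ft r ^ 2) volume x y := fun x y hx hy =>
    (hFc.mono fun t ht => lt_of_lt_of_le (lt_min hx hy) ht.1).intervalIntegrable
  have step1 : ∫ r in a..b, r * deriv ft r ^ 2 ≤ ∫ r in a'..b', r * deriv ft r ^ 2 := by
    refine intervalIntegral.integral_mono_interval ha'a hab hbb' ?_ (hint _ _ ha'0 hb'0)
    filter_upwards [ae_restrict_mem measurableSet_Ioc] with r hr
    have : 0 < r := ha'0.trans hr.1
    simp only [Pi.zero_apply]
    positivity
  have step2 : ∫ r in a'..1, r * deriv ft r ^ 2 ≤ (V 1 * ft 1 + 1 ^ 2 / 2)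
      - (V a' * ft a' + a' ^ 2 / 2) := by
    refine intervalIntegral.integral_le_sub_of_hasDeriv_right_of_le ha'1'
      (fun r hr => (hW1 r (ha'0.trans_le hr.1)).continuousAt.continuousWithinAt)
      (fun r hr => (hW1 r (ha'0.trans hr.1)).hasDerivWithinAt)
      ((hFc.mono fun r hr => ha'0.trans_le hr.1).integrableOn_compact isCompact_Icc)
      fun r hr => ?_
    have hr0 : 0 < r := ha'0.trans hr.1
    rw [hF r hr0]
    have h1 := hf0 r hr0
    have h2 := hf1 r hr0
    have h3 : -1 ≤ c r * ft r * ft r := by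
      have h4 : -1 ≤ c r := by
        have : 0 ≤ (d : ℝ) ^ 2 / r ^ 2 := by positivity
        simp only [hc]; nlinarith
      have h5 : ft r * ft r ≤ 1 := by nlinarith
      have h6 : 0 ≤ ft r * ft r := by positivity
      nlinarith
    have e : V r ^ 2 / r = V r * (V r / r) := by ring
    rw [e]
    nlinarith
  have step3 : ∫ r in (1 : ℝ)..b', r * deriv ft r ^ 2 ≤ (-(V b' * (1 - ft b')) - D / 2 / b' ^ 2)
      - (-(V 1 * (1 - ft 1)) - D / 2 / 1 ^ 2) := by
    refine intervalIntegral.integral_le_sub_of_hasDeriv_right_of_le h1b'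
      (fun r hr => (hW2 r (one_pos.trans_le hr.1)).continuousAt.continuousWithinAt)
      (fun r hr => (hW2 r (one_pos.trans hr.1)).hasDerivWithinAt)
      ((hFc.mono fun r hr => one_pos.trans_le hr.1).integrableOn_compact isCompact_Icc)
      fun r hr => ?_
    have hr0 : 0 < r := one_pos.trans hr.1
    rw [hF r hr0]
    have h1 := hf0 r hr0
    have h2 := hf1 r hr0
    have h3 := hK r hr0
    have h4 : c r ≤ ((d : ℝ) ^ 2 + 2 * K) / r ^ 2 := by
      have : 0 ≤ 2 * K / r ^ 2 := by positivity
      have h5 : 0 ≤ 1 - ft r ^ 2 := by nlinarith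
      simp only [hc]
      rw [add_div]
      linarith
    have h5 : r * (c r * ft r) * (1 - ft r) ≤ D / r ^ 3 := by
      have e : D / r ^ 3 = r * (((d : ℝ) ^ 2 + 2 * K) / r ^ 2 * 1) * (K / r ^ 2) := by
        rw [hD]; field_simp
      rw [e]
      have h6 : c r * ft r ≤ ((d : ℝ) ^ 2 + 2 * K) / r ^ 2 * 1 := by
        calc c r * ft r ≤ ((d : ℝ) ^ 2 + 2 * K) / r ^ 2 * ft r := by gcongr
          _ ≤ _ := by gcongr
      have h7 : 0 ≤ 1 - ft r := by linarith
      have h8 : r * (c r * ft r) ≤ r * (((d : ℝ) ^ 2 + 2 * K) / r ^ 2 * 1) :=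
        mul_le_mul_of_nonneg_left h6 hr0.le
      exact mul_le_mul h8 h3 h7 (by positivity)
    have e : V r ^ 2 / r = V r * (V r / r) := by ring
    rw [e]
    linarith
  have hsplit := intervalIntegral.integral_add_adjacent_intervals (hint a' 1 ha'0 one_pos)
    (hint 1 b' one_pos hb'0)
  have h9 : 0 ≤ D / 2 / b' ^ 2 := by positivity
  have h10 : 0 ≤ a' ^ 2 / 2 := by positivity
  rw [hI]
  linarith

/-! ### Picone's inequality -/

/-- The constant in Picone's inequality. -/
def piconeConst (y : ℝ → ℝ) (α β : ℝ) : ℝ := ∫ s in α..β, 1 / (s * y s ^ 2)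

theorem piconeConst_pos {y V c : ℝ → ℝ} (h : IsRadialSol y V c) (hy : ∀ r > 0, 0 < y r) {α β : ℝ}
    (hα : 0 < α) (hαβ : α < β) : 0 < piconeConst y α β := by
  refine intervalIntegral.intervalIntegral_pos_of_pos_on ?_ (fun s hs => ?_) hαβ
  · refine ContinuousOn.intervalIntegrable (ContinuousOn.mono (s := Ioi 0) ?_ ?_)
    · refine continuousOn_const.div (continuousOn_id.mul (h.continuousOn.pow 2)) fun s hs => ?_
      have h1 : (0 : ℝ) < s := hs
      have h2 := hy s hs
      positivity
    · rw [uIcc_of_le hαβ.le]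
      exact fun s hs => hα.trans_le hs.1
  · have h1 : 0 < s := hα.trans hs.1
    have h2 := hy s h1
    positivity

/-- With `p = φ' - φ V/(r y)` one has `r (φ'² + c φ²) = r p² + (φ² V / y)'`, and the total
derivative integrates to zero. Moreover `(φ/y)' = p/y`, so the Cauchy-Schwarz inequality bounds the
increment of `φ/y`. This quantitative version passes to limits: it gives the sign of the form and
also shows that `φ/y` is constant where the form vanishes. -/
theorem picone_test {y V c : ℝ → ℝ} (h : IsRadialSol y V c) (hc : ContinuousOn c (Ioi 0))
    (hy : ∀ r > 0, 0 < y r) {α β : ℝ} (hα : 0 < α) (hαβ : α < β) {φ : ℝ → ℝ} (hφ : IsTest φ) :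
    (φ β / y β - φ α / y α) ^ 2 ≤ piconeConst y α β *
      ∫ r in Ioi (0 : ℝ), r * (deriv φ r ^ 2 + c r * φ r ^ 2) := by
  obtain ⟨a₁, b₁, ha₁, -, -, hz1, hz2⟩ := hφ.exists_Ioo
  set a := min a₁ α with ha
  set b := max b₁ β with hb
  have ha0 : 0 < a := lt_min ha₁ hα
  have haα : a ≤ α := min_le_right _ _
  have hβb : β ≤ b := le_max_right _ _
  have hab : a ≤ b := haα.trans (hαβ.le.trans hβb)
  have hnot : ∀ r, r ∉ Ioo a b → r ∉ Ioo a₁ b₁ := fun r hr hr' =>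
    hr ⟨(min_le_left _ _).trans_lt hr'.1, hr'.2.trans_le (le_max_left _ _)⟩
  have hcy := h.continuousOn
  have hcV := h.continuousOn'
  have hcφ : ContinuousOn φ (Ioi 0) := hφ.contDiff.continuous.continuousOn
  have hcφ' : ContinuousOn (deriv φ) (Ioi 0) := hφ.continuous_deriv.continuousOn
  have hid : ContinuousOn (fun r : ℝ => r) (Ioi 0) := continuousOn_id
  have hne : ∀ r ∈ Ioi (0 : ℝ), r ≠ 0 := fun r hr => ne_of_gt hr
  have hyne : ∀ r ∈ Ioi (0 : ℝ), y r ≠ 0 := fun r hr => (hy r hr).ne'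
  let p : ℝ → ℝ := fun r => deriv φ r - φ r * V r / (r * y r)
  have hcp : ContinuousOn p (Ioi 0) := hcφ'.sub ((hcφ.mul hcV).div (hid.mul hcy)
    fun r hr => mul_ne_zero (hne r hr) (hyne r hr))
  have hbd : ∀ r > 0, HasDerivAt (fun r => φ r ^ 2 * V r / y r)
      (r * (deriv φ r ^ 2 + c r * φ r ^ 2) - r * p r ^ 2) r := by
    intro r hr
    have hy0 := (hy r hr).ne'
    refine ((((hφ.hasDerivAt r).pow 2).mul (h.hasDerivAt' r hr)).div (h.hasDerivAt r hr)
      hy0).congr_deriv ?_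
    simp [p]
    field_simp
    ring
  have hc1 : ContinuousOn (fun r => r * (deriv φ r ^ 2 + c r * φ r ^ 2)) (Ioi 0) :=
    hid.mul ((hcφ'.pow 2).add (hc.mul (hcφ.pow 2)))
  have hc2 : ContinuousOn (fun r => r * p r ^ 2) (Ioi 0) := hid.mul (hcp.pow 2)
  have hint : ∀ F : ℝ → ℝ, ContinuousOn F (Ioi 0) → ∀ x z : ℝ, 0 < x → x ≤ z →
      IntervalIntegrable F volume x z := fun F hF x z hx hxz =>
    (hF.mono fun t ht => by
      rw [uIcc_of_le hxz] at ht; exact hx.trans_le ht.1).intervalIntegrable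
  have hq : ∫ r in Ioi (0 : ℝ), r * (deriv φ r ^ 2 + c r * φ r ^ 2) = ∫ r in a..b, r * p r ^ 2 := by
    rw [setIntegral_eq_of_support ha0 hab fun r hr => by
      rw [hz1 r (hnot r hr), hz2 r (hnot r hr)]; simp]
    have h1 := intervalIntegral.integral_eq_sub_of_hasDerivAt (a := a) (b := b)
      (fun r hr => hbd r (by rw [uIcc_of_le hab] at hr; exact ha0.trans_le hr.1))
      (hint _ (hc1.sub hc2) a b ha0 hab)
    rw [intervalIntegral.integral_sub (hint _ hc1 a b ha0 hab) (hint _ hc2 a b ha0 hab),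
      hz1 a (hnot a (by simp)), hz1 b (hnot b (by simp))] at h1
    simp at h1
    linarith
  have hk : ∀ r > 0, HasDerivAt (fun r => φ r / y r) (p r / y r) r := by
    intro r hr
    have hy0 := (hy r hr).ne'
    refine ((hφ.hasDerivAt r).div (h.hasDerivAt r hr) hy0).congr_deriv ?_
    simp only [p]
    field_simp
  have hck : ContinuousOn (fun r => p r / y r) (Ioi 0) := hcp.div hcy hyne
  have hcC : ContinuousOn (fun s => 1 / (s * y s ^ 2)) (Ioi 0) :=
    continuousOn_const.div (hid.mul (hcy.pow 2)) fun s hs =>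
      mul_ne_zero (hne s hs) (pow_ne_zero 2 (hyne s hs))
  set C := piconeConst y α β with hC
  have hC0 : 0 < C := piconeConst_pos h hy hα hαβ
  set Dd := φ β / y β - φ α / y α with hDd
  have hD : ∫ r in α..β, p r / y r = Dd :=
    intervalIntegral.integral_eq_sub_of_hasDerivAt
      (fun r hr => hk r (by rw [uIcc_of_le hαβ.le] at hr; exact hα.trans_le hr.1))
      (hint _ hck α β hα hαβ.le)
  -- The optimal multiplier in `2 λ p/y ≤ r p² + λ²/(r y²)`; it turns the pointwise Young inequality
  -- into Cauchy-Schwarz.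
  set lam := Dd / C with hlam
  have hle : ∫ r in α..β, 2 * lam * (p r / y r)
      ≤ ∫ r in α..β, (r * p r ^ 2 + lam ^ 2 * (1 / (r * y r ^ 2))) := by
    refine intervalIntegral.integral_mono_on hαβ.le ((hint _ hck α β hα hαβ.le).const_mul _)
      ((hint _ hc2 α β hα hαβ.le).add ((hint _ hcC α β hα hαβ.le).const_mul _)) fun r hr => ?_
    have hr0 : 0 < r := hα.trans_le hr.1
    have hy0 := hy r hr0
    have e : r * p r ^ 2 + lam ^ 2 * (1 / (r * y r ^ 2)) - 2 * lam * (p r / y r)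
        = (r * y r * p r - lam) ^ 2 / (r * y r ^ 2) := by field_simp; ring
    have : 0 ≤ (r * y r * p r - lam) ^ 2 / (r * y r ^ 2) := by positivity
    linarith
  rw [intervalIntegral.integral_const_mul, hD, intervalIntegral.integral_add
    (hint _ hc2 α β hα hαβ.le) ((hint _ hcC α β hα hαβ.le).const_mul _),
    intervalIntegral.integral_const_mul] at hle
  have hsub : ∫ r in α..β, r * p r ^ 2 ≤ ∫ r in a..b, r * p r ^ 2 := by
    refine intervalIntegral.integral_mono_interval haα hαβ.le hβb ?_ (hint _ hc2 a b ha0 hab)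
    filter_upwards [ae_restrict_mem measurableSet_Ioc] with r hr
    have : 0 < r := ha0.trans hr.1
    simp only [Pi.zero_apply]
    positivity
  rw [hq]
  have hCdef : ∫ s in α..β, 1 / (s * y s ^ 2) = C := rfl
  rw [hCdef] at hle
  have e1 : 2 * lam * Dd - lam ^ 2 * C = Dd ^ 2 / C := by rw [hlam]; field_simp; ring
  have h2 : Dd ^ 2 / C ≤ ∫ r in a..b, r * p r ^ 2 := by linarith
  rw [div_le_iff₀ hC0] at h2
  linarith

/-! ### Abstract functional analysis -/

/-- Bounded sequences have weakly convergent subsequences. -/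
def WeakCompactBalls (E : Type*) [NormedAddCommGroup E] [NormedSpace ℝ E] : Prop :=
  ∀ (x : ℕ → E) (C : ℝ), (∀ n, ‖x n‖ ≤ C) → ∃ y, ∃ φ : ℕ → ℕ, StrictMono φ ∧ WeakTendsto (x ∘ φ) y

theorem weakCompactBalls_prod {E F : Type*} [NormedAddCommGroup E] [NormedSpace ℝ E]
    [NormedAddCommGroup F] [NormedSpace ℝ F] (hE : WeakCompactBalls E) (hF : WeakCompactBalls F) :
    WeakCompactBalls (E × F) := by
  intro x C hx
  obtain ⟨y, φ, hφ, hy⟩ := hE (fun n => (x n).1) C fun n => (norm_fst_le _).trans (hx n)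
  obtain ⟨z, ψ, hψ, hz⟩ := hF (fun n => (x (φ n)).2) C fun n => (norm_snd_le _).trans (hx _)
  refine ⟨(y, z), φ ∘ ψ, hφ.comp hψ, fun L => ?_⟩
  have h1 := (hy.comp hψ) (L.comp (ContinuousLinearMap.inl ℝ E F))
  have h2 := hz (L.comp (ContinuousLinearMap.inr ℝ E F))
  have e : ∀ p : E × F, L p = L.comp (ContinuousLinearMap.inl ℝ E F) p.1
      + L.comp (ContinuousLinearMap.inr ℝ E F) p.2 := fun p => by
    simp [← map_add]
  have h3 := h1.add h2
  rw [e (y, z)]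
  exact h3.congr fun n => (e _).symm

theorem weakCompactBalls_H : WeakCompactBalls H := fun _ _ hx => exists_weakTendsto_subseq hx

theorem weakCompactBalls_X : WeakCompactBalls X := fun _ _ hx => exists_weakTendsto_subseq hx

/-- Weak lower semicontinuity of a non-negative quadratic form, from `B (x_n - y) (x_n - y) ≥ 0`. -/
theorem le_of_weakTendsto {E : Type*} [NormedAddCommGroup E] [NormedSpace ℝ E]
    (B : E →L[ℝ] E →L[ℝ] ℝ) (hsymm : ∀ x y, B x y = B y x) (hB : ∀ x, 0 ≤ B x x) {x : ℕ → E}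
    {y : E} (hx : WeakTendsto x y) {a : ℕ → ℝ} {α : ℝ} (ha : Tendsto a atTop (𝓝 α))
    (hle : ∀ n, B (x n) (x n) ≤ a n) : B y y ≤ α := by
  have h1 : Tendsto (fun n => 2 * B y (x n) - B y y) atTop (𝓝 (2 * B y y - B y y)) :=
    ((hx (B y)).const_mul 2).sub_const _
  have h2 : 2 * B y y - B y y ≤ α := by
    refine le_of_tendsto_of_tendsto' h1 ha fun n => le_trans ?_ (hle n)
    have h3 := hB (x n - y)
    simp only [map_sub, sub_apply] at h3
    have h4 := hsymm (x n) y
    linarith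
  linarith

/-- A positive form which is a weakly continuous perturbation of a coercive one is coercive. -/
theorem coercive_of_pos {E : Type*} [NormedAddCommGroup E] [NormedSpace ℝ E]
    (hE : WeakCompactBalls E) (B : E →L[ℝ] E →L[ℝ] ℝ) (hsymm : ∀ x y, B x y = B y x) {c : ℝ}
    (hc : 0 < c) (hB : ∀ x, c * ‖x‖ ^ 2 ≤ B x x) (K : E → ℝ)
    (hom : ∀ (t : ℝ) x, K (t • x) = t ^ 2 * K x)
    (hK : ∀ (x : ℕ → E) (y : E) (C : ℝ), WeakTendsto x y → (∀ n, ‖x n‖ ≤ C) →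
      Tendsto (fun n => K (x n)) atTop (𝓝 (K y)))
    (hpos : ∀ x, x ≠ 0 → 0 < B x x - K x) :
    ∃ c' > 0, ∀ x, c' * ‖x‖ ^ 2 ≤ B x x - K x := by
  by_contra hcon
  push Not at hcon
  have h1 : ∀ n : ℕ, ∃ x : E, ‖x‖ = 1 ∧ B x x - K x < 1 / ((n : ℝ) + 1) := by
    intro n
    obtain ⟨x, hx⟩ := hcon (1 / ((n : ℝ) + 1)) (by positivity)
    have hx0 : x ≠ 0 := by
      rintro rfl
      have := hom 0 0
      simp at this hx
      linarith
    have hn := norm_pos_iff.2 hx0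
    refine ⟨‖x‖⁻¹ • x, by rw [norm_smul, norm_inv, norm_norm, inv_mul_cancel₀ hn.ne'], ?_⟩
    rw [hom]
    simp only [map_smul, smul_apply, smul_eq_mul]
    have e : ‖x‖⁻¹ * (‖x‖⁻¹ * B x x) - ‖x‖⁻¹ ^ 2 * K x = ‖x‖⁻¹ ^ 2 * (B x x - K x) := by ring
    rw [e]
    calc ‖x‖⁻¹ ^ 2 * (B x x - K x) < ‖x‖⁻¹ ^ 2 * (1 / ((n : ℝ) + 1) * ‖x‖ ^ 2) := by gcongr
      _ = 1 / ((n : ℝ) + 1) := by field_simp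
  choose x hx1 hx2 using h1
  -- The weak limit of the normalised sequence has `B y y ≤ K y`, so it is `0` by positivity; then
  -- `K (x_n)` tends to `0` and coercivity of `B` contradicts `‖x_n‖ = 1`.
  obtain ⟨y, φ, hφ, hy⟩ := hE x 1 fun n => (hx1 n).le
  have hKy := hK _ y 1 hy fun n => (hx1 _).le
  have hlim : Tendsto (fun n => 1 / ((φ n : ℝ) + 1) + K (x (φ n))) atTop (𝓝 (0 + K y)) :=
    (tendsto_one_div_add_atTop_nhds_zero_nat.comp hφ.tendsto_atTop).add hKy
  have hBy := le_of_weakTendsto B hsymm (fun z => le_trans (by positivity) (hB z)) hy hlim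
    fun n => by have := hx2 (φ n); simp only [Function.comp_apply]; linarith
  have hy0 : y = 0 := by
    by_contra hne
    have := hpos y hne
    linarith
  have hK0 : K y = 0 := by
    rw [hy0]
    have := hom 0 0
    simpa using this
  rw [hK0, add_zero] at hlim
  have : c ≤ 0 := by
    refine le_of_tendsto_of_tendsto' tendsto_const_nhds hlim fun n => ?_
    have h3 := hB (x (φ n))
    rw [hx1] at h3
    have := hx2 (φ n)
    linarith
  linarith

/-- The Lax-Milgram theorem combined with the Riesz isomorphism. -/
theorem bijective_of_coercive {E : Type*} [NormedAddCommGroup E] [InnerProductSpace ℝ E]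
    [CompleteSpace E] (B : E →L[ℝ] E →L[ℝ] ℝ) {c : ℝ} (hc : 0 < c)
    (hB : ∀ x, c * ‖x‖ ^ 2 ≤ B x x) : Function.Bijective B := by
  have hco : IsCoercive B := ⟨c, hc, fun x => by have := hB x; rw [sq] at this; linarith⟩
  constructor
  · rw [injective_iff_map_eq_zero]
    intro x hx
    have := hB x
    rw [hx, zero_apply] at this
    have h2 : ‖x‖ ^ 2 ≤ 0 := by nlinarith [sq_nonneg ‖x‖]
    have h3 : ‖x‖ ^ 2 = 0 := le_antisymm h2 (sq_nonneg _)
    simpa using h3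
  · intro L
    refine ⟨hco.continuousLinearEquivOfBilin.symm ((InnerProductSpace.toDual ℝ E).symm L), ?_⟩
    ext w
    rw [← hco.continuousLinearEquivOfBilin_apply, ContinuousLinearEquiv.apply_symm_apply,
      ← InnerProductSpace.toDual_apply_apply (𝕜 := ℝ), LinearIsometryEquiv.apply_symm_apply]

/-- The product `E × F` carries the sup norm, which is not Hilbertian; the statement is transported
from the equivalent `ℓ²` product. -/
theorem bijective_of_coercive_prod {E F : Type*} [NormedAddCommGroup E] [InnerProductSpace ℝ E]
    [CompleteSpace E] [NormedAddCommGroup F] [InnerProductSpace ℝ F] [CompleteSpace F]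
    (B : E × F →L[ℝ] E × F →L[ℝ] ℝ) {c : ℝ} (hc : 0 < c)
    (hB : ∀ x, c * ‖x‖ ^ 2 ≤ B x x) : Function.Bijective B := by
  let e := WithLp.prodContinuousLinearEquiv 2 ℝ E F
  let B' : WithLp 2 (E × F) →L[ℝ] WithLp 2 (E × F) →L[ℝ] ℝ :=
    ((ContinuousLinearMap.compL ℝ (WithLp 2 (E × F)) (E × F) ℝ).flip e.toContinuousLinearMap).comp
      (B.comp e.toContinuousLinearMap)
  have hB' : ∀ x y, B' x y = B (e x) (e y) := fun x y => rfl
  have hle : ∀ x, ‖x‖ ^ 2 ≤ 2 * ‖e x‖ ^ 2 := fun x => by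
    rw [WithLp.prod_norm_sq_eq_of_L2]
    have h1 : ‖x.fst‖ ≤ ‖e x‖ := norm_fst_le (e x)
    have h2 : ‖x.snd‖ ≤ ‖e x‖ := norm_snd_le (e x)
    have h3 := pow_le_pow_left₀ (norm_nonneg _) h1 2
    have h4 := pow_le_pow_left₀ (norm_nonneg _) h2 2
    linarith
  have hbij := bijective_of_coercive B' (c := c / 2) (by positivity) fun x => by
    rw [hB']
    have h1 := hB (e x)
    have h2 := hle x
    nlinarith
  constructor
  · intro x y hxy
    have : B' (e.symm x) = B' (e.symm y) := by
      ext z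
      rw [hB', hB', e.apply_symm_apply, e.apply_symm_apply, hxy]
    exact e.symm.injective (hbij.1 this)
  · intro L
    obtain ⟨x, hx⟩ := hbij.2 (L.comp e.toContinuousLinearMap)
    refine ⟨e x, ?_⟩
    refine ContinuousLinearMap.ext fun z => ?_
    have h1 := congrArg (fun M => M (e.symm z)) hx
    simp only [hB', e.apply_symm_apply] at h1
    rw [h1]
    simp

/-- The partial derivative is identified through derivatives along lines, so that in the
applications only polynomials in one real variable have to be differentiated. -/
theorem exists_implicit {E F : Type*} [NormedAddCommGroup E] [NormedSpace ℝ E] [CompleteSpace E]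
    [NormedAddCommGroup F] [NormedSpace ℝ F] [CompleteSpace F] {G : ℝ × E → F}
    (hG : ContDiff ℝ 1 G) {s₀ : ℝ} {z₀ : E} (h0 : G (s₀, z₀) = 0) (A : E →L[ℝ] F)
    (hA : ∀ v, HasDerivAt (fun t : ℝ => G (s₀, z₀ + t • v)) (A v) 0)
    (hbij : Function.Bijective A) :
    ∃ ζ : ℝ → E, ContDiffAt ℝ 1 ζ s₀ ∧ ζ s₀ = z₀ ∧ ∀ᶠ s in 𝓝 s₀, G (s, ζ s) = 0 := by
  have hcd : ContDiffAt ℝ 1 G (s₀, z₀) := hG.contDiffAt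
  have hfd : HasFDerivAt G (fderiv ℝ G (s₀, z₀)) (s₀, z₀) :=
    (hcd.differentiableAt one_ne_zero).hasFDerivAt
  have hAeq : fderiv ℝ G (s₀, z₀) ∘L .inr ℝ ℝ E = A := by
    ext v
    have hline : HasDerivAt (fun t : ℝ => (s₀, z₀ + t • v)) ((0 : ℝ), v) 0 := by
      have h1 : HasDerivAt (fun t : ℝ => z₀ + t • v) v 0 := by
        simpa using ((hasDerivAt_id (0 : ℝ)).smul_const v).const_add z₀
      exact (hasDerivAt_const (0 : ℝ) s₀).prodMk h1
    have hfd' : HasFDerivAt G (fderiv ℝ G (s₀, z₀)) (s₀, z₀ + (0 : ℝ) • v) := by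
      simpa using hfd
    have h2 := hfd'.comp_hasDerivAt (0 : ℝ) hline
    exact h2.unique (hA v)
  have hinv : (fderiv ℝ G (s₀, z₀) ∘L .inr ℝ ℝ E).IsInvertible := by
    rw [hAeq]
    exact ⟨ContinuousLinearEquiv.ofBijective A (LinearMap.ker_eq_bot.2 hbij.1)
      (LinearMap.range_eq_top.2 hbij.2), by ext; rfl⟩
  refine ⟨hcd.implicitFunction one_ne_zero hinv, hcd.contDiffAt_implicitFunction one_ne_zero hinv,
    hcd.implicitFunction_apply_self one_ne_zero hinv, ?_⟩
  filter_upwards [hcd.eventually_apply_implicitFunction one_ne_zero hinv] with s hs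
  rw [hs, h0]

/-! ### The weak Ginzburg-Landau system and its energy -/

/-- A normal core profile of non-zero degree. -/
structure CoreProfile (d : ℤ) (ft : ℝ → ℝ) : Prop where
  ne : d ≠ 0
  nc : IsNormalCore d ft

theorem IsNormalCore.continuousOn {d : ℤ} {ft : ℝ → ℝ} (h : IsNormalCore d ft) :
    ContinuousOn ft (Ioi 0) := h.contDiffOn.continuousOn

variable {d : ℤ} {ft : ℝ → ℝ}

theorem CoreProfile.abs_le_one (hC : CoreProfile d ft) : ∀ᵐ r ∂radialMeasure, |ft r| ≤ 1 := by
  filter_upwards [ae_radial_pos] with r hr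
  rw [abs_of_pos (hC.nc.pos r hr)]
  exact (hC.nc.lt_one hC.ne hr).le

theorem CoreProfile.aestronglyMeasurable (hC : CoreProfile d ft) :
    AEStronglyMeasurable ft radialMeasure :=
  aestronglyMeasurable_radial (hC.nc.continuousOn.aestronglyMeasurable measurableSet_Ioi)

/-- Multiplication by the profile on `L²_r`. -/
def CoreProfile.T (hC : CoreProfile d ft) : L2r →L[ℝ] L2r :=
  mulOne ft hC.aestronglyMeasurable hC.abs_le_one

theorem CoreProfile.coeFn_T (hC : CoreProfile d ft) (u : L2r) :
    ∀ᵐ r ∂radialMeasure, hC.T u r = ft r * u r := coeFn_mulOne _ _ u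

theorem CoreProfile.one_sub_sq_le (hC : CoreProfile d ft) :
    ∃ K : ℝ, 0 < K ∧ ∀ r > 0, 1 - ft r ^ 2 ≤ K / r ^ 2 := by
  obtain ⟨K, hK, h⟩ := hC.nc.exists_decay hC.ne
  refine ⟨2 * K, by positivity, fun r hr => ?_⟩
  have h0 := hC.nc.pos r hr
  have h1 := hC.nc.lt_one hC.ne hr
  have h2 := h r hr
  have : 2 * K / r ^ 2 = 2 * (K / r ^ 2) := by ring
  rw [this]
  nlinarith

theorem CoreProfile.one_sub_sq_pos (hC : CoreProfile d ft) {r : ℝ} (hr : 0 < r) :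
    0 < 1 - ft r ^ 2 := by
  have h0 := hC.nc.pos r hr
  have h1 := hC.nc.lt_one hC.ne hr
  nlinarith

/-- The decay `1 - f̃² ≤ K/r²` makes the integrand `O(r⁻³)` at infinity. The potential is thus a
legitimate kernel for the weakly continuous forms on `H`. -/
theorem CoreProfile.memLp_one_sub_sq (hC : CoreProfile d ft) :
    MemLp (fun r => 1 - ft r ^ 2) 2 radialMeasure := by
  have hc : ContinuousOn (fun r => 1 - ft r ^ 2) (Ioi 0) :=
    continuousOn_const.sub (hC.nc.continuousOn.pow 2)
  refine memLp_two_radial_of_continuousOn hc ?_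
  obtain ⟨K, hK, h⟩ := hC.one_sub_sq_le
  have hcF : ContinuousOn (fun r => r * (1 - ft r ^ 2) ^ 2) (Ioi 0) :=
    continuousOn_id.mul (hc.pow 2)
  rw [← Ioc_union_Ioi_eq_Ioi (zero_le_one' ℝ)]
  refine IntegrableOn.union ?_ ?_
  · have hi : IntegrableOn (fun _ : ℝ => (1 : ℝ)) (Ioc 0 1) := integrableOn_const (by simp)
    refine hi.mono' ?_ ?_
    · exact (hcF.mono Ioc_subset_Ioi_self).aestronglyMeasurable measurableSet_Ioc
    · filter_upwards [ae_restrict_mem measurableSet_Ioc] with r hr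
      have h1 := hC.one_sub_sq_pos hr.1
      have h2 : (1 - ft r ^ 2) ^ 2 ≤ 1 := by nlinarith [sq_nonneg (ft r)]
      rw [Real.norm_of_nonneg (mul_nonneg hr.1.le (sq_nonneg _))]
      nlinarith [hr.1, hr.2, sq_nonneg (1 - ft r ^ 2)]
  · have hi : IntegrableOn (fun r : ℝ => K ^ 2 * r ^ (-3 : ℝ)) (Ioi 1) :=
      (integrableOn_Ioi_rpow_of_lt (by norm_num) one_pos).const_mul _
    refine hi.mono' ((hcF.mono (Ioi_subset_Ioi zero_le_one)).aestronglyMeasurable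
      measurableSet_Ioi) ?_
    filter_upwards [ae_restrict_mem measurableSet_Ioi] with r hr
    have hr0 : (0 : ℝ) < r := lt_trans one_pos hr
    have h1 := hC.one_sub_sq_pos hr0
    rw [Real.norm_of_nonneg (mul_nonneg hr0.le (sq_nonneg _))]
    have h2 : (1 - ft r ^ 2) ^ 2 ≤ (K / r ^ 2) ^ 2 := pow_le_pow_left₀ h1.le (h r hr0) 2
    have h3 : r ^ (-3 : ℝ) = (r ^ 3)⁻¹ := by
      rw [Real.rpow_neg hr0.le]; norm_cast
    rw [h3]
    calc r * (1 - ft r ^ 2) ^ 2 ≤ r * (K / r ^ 2) ^ 2 := by gcongr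
      _ = K ^ 2 * (r ^ 3)⁻¹ := by field_simp

/-- The potential `1 - f̃²` as an element of `L²_r`. -/
def CoreProfile.a0 (hC : CoreProfile d ft) : L2r := hC.memLp_one_sub_sq.toLp

theorem CoreProfile.coeFn_a0 (hC : CoreProfile d ft) :
    ∀ᵐ r ∂radialMeasure, hC.a0 r = 1 - ft r ^ 2 := MemLp.coeFn_toLp _

/-- The inner product of `L²_r` as a continuous bilinear map. -/
def ip : L2r →L[ℝ] L2r →L[ℝ] ℝ :=
  LinearMap.mkContinuous₂ (innerₗ L2r) 1 fun x y => by
    simpa using abs_real_inner_le_norm x y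

theorem ip_apply (x y : L2r) : ip x y = inner ℝ x y := rfl

/-- The bilinear form `(v, w) ↦ ∫ κ v w r dr` on `H`. -/
def pairH (κ : L2r) : H →L[ℝ] H →L[ℝ] ℝ :=
  (ContinuousLinearMap.compL ℝ H L2r ℝ (ip κ)).comp prodH

/-- The quadratic form `∫ [(u')² + (d²/r²) u² - κ u²] r dr` on `X`, as a bilinear form. -/
def QX (d : ℤ) (κ : L2r) : X →L[ℝ] X →L[ℝ] ℝ :=
  ip.bilinearComp X.derL X.derL + (d : ℝ) ^ 2 • ip.bilinearComp X.quoL X.quoL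
    - (pairH κ).bilinearComp inclXH inclXH

theorem QX_apply (κ : L2r) (u φ : X) : QX d κ u φ = inner ℝ (X.derL u) (X.derL φ)
    + (d : ℝ) ^ 2 * inner ℝ (X.quoL u) (X.quoL φ) - inner ℝ κ (prodH (inclXH u) (inclXH φ)) := rfl

/-- The quadratic form `∫ [(w')² + g w² - κ w²] r dr` on `H`, as a bilinear form. -/
def QH (g : ℝ) (κ : L2r) : H →L[ℝ] H →L[ℝ] ℝ :=
  ip.bilinearComp H.derL H.derL + g • ip.bilinearComp H.fnL H.fnL - pairH κ

theorem QH_apply (g : ℝ) (κ : L2r) (v w : H) : QH g κ v w = inner ℝ (H.derL v) (H.derL w)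
    + g * inner ℝ (H.fnL v) (H.fnL w) - inner ℝ κ (prodH v w) := rfl

theorem QX_symm (κ : L2r) (u φ : X) : QX d κ u φ = QX d κ φ u := by
  simp only [QX_apply, prodH_comm (inclXH u), real_inner_comm (X.derL u),
    real_inner_comm (X.quoL u)]

theorem QH_symm (g : ℝ) (κ : L2r) (v w : H) : QH g κ v w = QH g κ w v := by
  simp only [QH_apply, prodH_comm v, real_inner_comm (H.derL v), real_inner_comm (H.fnL v)]

theorem QX_sub (κ k : L2r) (u φ : X) : QX d (κ - k) u φ
    = QX d κ u φ + inner ℝ k (prodH (inclXH u) (inclXH φ)) := by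
  simp only [QX_apply, inner_sub_left]; ring

theorem QH_sub (g : ℝ) (κ k : L2r) (v w : H) : QH g (κ - k) v w
    = QH g κ v w + inner ℝ k (prodH v w) := by
  simp only [QH_apply, inner_sub_left]; ring

/-- The sum of the pointwise products of the components of two elements of `Z₀`. -/
def dotZ : Z₀ →L[ℝ] Z₀ →L[ℝ] L2r :=
  prodH.bilinearComp (inclXH.comp (ContinuousLinearMap.fst ℝ X H))
      (inclXH.comp (ContinuousLinearMap.fst ℝ X H))
    + prodH.bilinearComp (ContinuousLinearMap.snd ℝ X H) (ContinuousLinearMap.snd ℝ X H)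

theorem dotZ_apply (z ζ : Z₀) :
    dotZ z ζ = prodH (inclXH z.1) (inclXH ζ.1) + prodH z.2 ζ.2 := rfl

theorem dotZ_symm (z ζ : Z₀) : dotZ z ζ = dotZ ζ z := by
  simp only [dotZ_apply, prodH_comm (inclXH z.1), prodH_comm z.2]

/-- The quadratic form `QX ⊕ QH` on `Z₀`. -/
def QZ (d : ℤ) (g : ℝ) (κ : L2r) : Z₀ →L[ℝ] Z₀ →L[ℝ] ℝ :=
  (QX d κ).bilinearComp (ContinuousLinearMap.fst ℝ X H) (ContinuousLinearMap.fst ℝ X H)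
    + (QH g κ).bilinearComp (ContinuousLinearMap.snd ℝ X H) (ContinuousLinearMap.snd ℝ X H)

theorem QZ_apply (g : ℝ) (κ : L2r) (z ζ : Z₀) :
    QZ d g κ z ζ = QX d κ z.1 ζ.1 + QH g κ z.2 ζ.2 := rfl

theorem QZ_symm (g : ℝ) (κ : L2r) (z ζ : Z₀) : QZ d g κ z ζ = QZ d g κ ζ z := by
  rw [QZ_apply, QZ_apply, QX_symm, QH_symm]

theorem QZ_sub (g : ℝ) (κ k : L2r) (z ζ : Z₀) : QZ d g (κ - k) z ζ
    = QZ d g κ z ζ + inner ℝ k (dotZ z ζ) := by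
  rw [QZ_apply, QZ_apply, QX_sub, QH_sub, dotZ_apply, inner_add_right]; ring

namespace CoreProfile

variable (hC : CoreProfile d ft)

/-- Multiplication of the first component by the profile. -/
def T0 : Z₀ →L[ℝ] L2r := hC.T.comp (X.fnL.comp (ContinuousLinearMap.fst ℝ X H))

theorem T0_apply (z : Z₀) : hC.T0 z = hC.T (X.fnL z.1) := rfl

/-- `f² + m² - f̃²` for the pair `(f, m) = (f̃ + u, w)` represented by `(u, w)`. -/
def hh (z : Z₀) : L2r := (2 : ℝ) • hC.T0 z + dotZ z z

/-- The map `(φ, ψ) ↦ f φ + m ψ`. -/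
def N (z : Z₀) : Z₀ →L[ℝ] L2r := hC.T0 + dotZ z

theorem N_apply (z ζ : Z₀) : hC.N z ζ = hC.T0 ζ + dotZ z ζ := rfl

/-- The potential `1 - f² - m²`. -/
def aa (z : Z₀) : L2r := hC.a0 - hC.hh z

/-- The weak form of the Ginzburg–Landau system. -/
def eqn (g : ℝ) (z : Z₀) : Z₀ →L[ℝ] ℝ := QZ d g hC.a0 z + (ip (hC.hh z)).comp (hC.N z)

theorem eqn_apply (g : ℝ) (z ζ : Z₀) :
    hC.eqn g z ζ = QZ d g hC.a0 z ζ + inner ℝ (hC.hh z) (hC.N z ζ) := rfl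

theorem hh_add (z ζ : Z₀) : hC.hh (z + ζ) = hC.hh z + (2 : ℝ) • hC.N z ζ + dotZ ζ ζ := by
  simp only [hh, N_apply, map_add, add_apply, smul_add, dotZ_symm ζ z, two_smul]
  abel

theorem hh_zero : hC.hh 0 = 0 := by simp [hh]

theorem eqn_zero (g : ℝ) : hC.eqn g 0 = 0 := by
  refine ContinuousLinearMap.ext fun ζ => ?_
  simp [eqn_apply, hh_zero]

/-- The energy relative to the normal core. -/
def energy (g : ℝ) (z : Z₀) : ℝ := QZ d g hC.a0 z z / 2 + ‖hC.hh z‖ ^ 2 / 4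

/-- An exact Taylor expansion: the quadratic part has the potential `aa z` of the point itself, and
the remainder is a perfect square. Where that form is non-negative, a solution therefore minimizes
the energy. -/
theorem energy_add (g : ℝ) (z ζ : Z₀) : hC.energy g (z + ζ) = hC.energy g z + hC.eqn g z ζ
    + QZ d g (hC.aa z) ζ ζ / 2 + ‖hC.hh (z + ζ) - hC.hh z‖ ^ 2 / 4 := by
  have h1 : hC.hh (z + ζ) - hC.hh z = (2 : ℝ) • hC.N z ζ + dotZ ζ ζ := by
    rw [hh_add]; abel
  have h2 : ‖hC.hh (z + ζ)‖ ^ 2 = ‖hC.hh z‖ ^ 2 + 2 * inner ℝ (hC.hh z) (hC.hh (z + ζ) - hC.hh z)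
      + ‖hC.hh (z + ζ) - hC.hh z‖ ^ 2 := by
    rw [← norm_add_sq_real]; congr 2; abel
  rw [energy, h2, energy, aa, QZ_sub, eqn_apply, h1, inner_add_right, inner_smul_right]
  simp only [map_add, add_apply, QZ_symm g _ ζ z]
  ring

/-- Both equations are tested with `z₁ - z₂` and subtracted. The sum of `N z₁` and `N z₂` maps the
difference to `hh z₁ - hh z₂`, and the difference of the two maps sends it to its own square `dotZ`,
which shifts the potential from `a0` to `aa z₁` and `aa z₂`. Uniqueness, the bound `g < g*` and
monotonicity of the mass are all read off from the signs. -/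
theorem two_solution_identity {g₁ g₂ : ℝ} {z₁ z₂ : Z₀} (h₁ : hC.eqn g₁ z₁ = 0)
    (h₂ : hC.eqn g₂ z₂ = 0) :
    QZ d g₁ (hC.aa z₁) (z₁ - z₂) (z₁ - z₂) + QZ d g₂ (hC.aa z₂) (z₁ - z₂) (z₁ - z₂)
      + ‖hC.hh z₁ - hC.hh z₂‖ ^ 2
      + (g₁ - g₂) * (‖H.fnL z₁.2‖ ^ 2 - ‖H.fnL z₂.2‖ ^ 2) = 0 := by
  have e₁ := congrArg (fun L => L (z₁ - z₂)) h₁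
  have e₂ := congrArg (fun L => L (z₁ - z₂)) h₂
  simp only [eqn_apply, zero_apply] at e₁ e₂
  have hN : hC.N z₁ (z₁ - z₂) + hC.N z₂ (z₁ - z₂) = hC.hh z₁ - hC.hh z₂ := by
    simp only [N_apply, hh, map_sub, two_smul, dotZ_symm z₂ z₁]
    abel
  have hD : hC.N z₁ (z₁ - z₂) - hC.N z₂ (z₁ - z₂) = dotZ (z₁ - z₂) (z₁ - z₂) := by
    simp only [N_apply, map_sub, sub_apply]
    abel
  have h3 : inner ℝ (hC.hh z₁ - hC.hh z₂) (hC.N z₁ (z₁ - z₂) + hC.N z₂ (z₁ - z₂))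
      = ‖hC.hh z₁ - hC.hh z₂‖ ^ 2 := by rw [hN, real_inner_self_eq_norm_sq]
  have h4 : inner ℝ (hC.hh z₁ + hC.hh z₂) (hC.N z₁ (z₁ - z₂) - hC.N z₂ (z₁ - z₂))
      = inner ℝ (hC.hh z₁ + hC.hh z₂) (dotZ (z₁ - z₂) (z₁ - z₂)) := by rw [hD]
  simp only [inner_sub_left, inner_add_right] at h3
  simp only [inner_add_left, inner_sub_right] at h4
  have hq : ∀ g : ℝ, ∀ z ζ : Z₀, QZ d g hC.a0 z ζ = QZ d 0 hC.a0 z ζ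
      + g * inner ℝ (H.fnL z.2) (H.fnL ζ.2) := by
    intro g z ζ
    simp only [QZ_apply, QH_apply]; ring
  rw [hq] at e₁ e₂
  rw [aa, aa, QZ_sub, QZ_sub, hq g₁, hq g₂]
  simp only [map_sub, sub_apply, Prod.snd_sub, inner_sub_left, inner_sub_right,
    real_inner_self_eq_norm_sq] at e₁ e₂ h3 h4 ⊢
  rw [real_inner_comm (H.fnL z₁.2) (H.fnL z₂.2)] at *
  linear_combination 2 * e₁ - 2 * e₂ - h4 - h3

end CoreProfile

variable {d : ℤ} {ft : ℝ → ℝ}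

/-! ### Pointwise representation of `Z₀`, and Picone's inequality on `X` and `H` -/

/-- The function `f = f̃ + u` represented by `z = (u, w)`. -/
def fz (ft : ℝ → ℝ) (z : Z₀) (r : ℝ) : ℝ := ft r + ev (inclXH z.1) r

/-- The function `1 - f² - m²` for the pair represented by `z`. -/
def az (ft : ℝ → ℝ) (z : Z₀) (r : ℝ) : ℝ := 1 - fz ft z r ^ 2 - ev z.2 r ^ 2

theorem IsPrimitive.ae_eq_of_hasDerivAt {w v w' : ℝ → ℝ} (h : IsPrimitive w v)
    (hw : ∀ r > 0, HasDerivAt w (w' r) r) : ∀ᵐ r ∂radialMeasure, v r = w' r := by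
  rw [ae_radial_iff, ae_restrict_iff' measurableSet_Ioi]
  have h1 : ∀ n : ℕ, ∀ᵐ r, r ∈ uIoo (1 / ((n : ℝ) + 1)) ((n : ℝ) + 1) → HasDerivAt w (v r) r :=
    fun n => h.ae_hasDerivAt (by positivity) (by positivity)
  rw [← ae_all_iff] at h1
  filter_upwards [h1] with r hr hr0
  have hr0' : (0 : ℝ) < r := hr0
  obtain ⟨n, hn⟩ := exists_nat_gt (max r (1 / r))
  have h2 : r < (n : ℝ) + 1 := ((le_max_left _ _).trans_lt hn).trans (lt_add_one _)
  have h3 : 1 / r < (n : ℝ) + 1 := ((le_max_right _ _).trans_lt hn).trans (lt_add_one _)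
  have h4 : 1 / ((n : ℝ) + 1) < r := by
    rw [div_lt_iff₀ (by positivity)]
    rwa [div_lt_iff₀ hr0', mul_comm] at h3
  have h5 : r ∈ uIoo (1 / ((n : ℝ) + 1)) ((n : ℝ) + 1) := by
    rw [uIoo_of_lt (h4.trans h2)]
    exact ⟨h4, h2⟩
  exact (hr n h5).unique (hw r hr0')

theorem setIntegral_add_sub {s : Set ℝ} {f g h : ℝ → ℝ} (hf : IntegrableOn f s)
    (hg : IntegrableOn g s) (hh : IntegrableOn h s) :
    (∫ r in s, f r) + (∫ r in s, g r) - ∫ r in s, h r = ∫ r in s, (f r + g r - h r) := by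
  rw [← integral_add hf hg]
  exact (integral_sub (hf.add hg) hh).symm

/-- Both sides are continuous in `φ`, so density of test functions suffices. The term `d²/r²` of the
form is part of `c`, which is the coefficient in `y'' + y'/r = c y`. -/
theorem picone_X {κ : L2r} {y V c : ℝ → ℝ}
    (hκ : ∀ᵐ r ∂radialMeasure, κ r = (d : ℝ) ^ 2 / r ^ 2 - c r) (h : IsRadialSol y V c)
    (hc : ContinuousOn c (Ioi 0)) (hy : ∀ r > 0, 0 < y r) {α β : ℝ} (hα : 0 < α) (hαβ : α < β)
    (φ : X) : (ev (inclXH φ) β / y β - ev (inclXH φ) α / y α) ^ 2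
      ≤ piconeConst y α β * QX d κ φ φ := by
  have hβ : 0 < β := hα.trans hαβ
  refine X.induction_test (p := fun φ => (ev (inclXH φ) β / y β - ev (inclXH φ) α / y α) ^ 2
      ≤ piconeConst y α β * QX d κ φ φ) ?_ ?_ φ
  · refine isClosed_le ?_ ?_
    · have h1 : ∀ s (hs : 0 < s), Continuous fun u : X => ev (inclXH u) s := fun s hs => by
        simp only [← evL_apply hs]
        exact ((evL s hs).comp inclXH).continuous
      exact (((h1 β hβ).div_const _).sub ((h1 α hα).div_const _)).pow 2
    · exact continuous_const.mul ((QX d κ).continuous.clm_apply continuous_id)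
  · intro u φ hu
    have hder : ∀ᵐ r ∂radialMeasure, X.derL u r = deriv φ r := hu.der_eq
    have hquo : ∀ᵐ r ∂radialMeasure, X.quoL u r = φ r / r := by
      filter_upwards [quoL_ae u, ae_radial_pos] with r h1 h2
      rw [h1, hu.ev_eq r h2]
    have hpr : ∀ᵐ r ∂radialMeasure, prodH (inclXH u) (inclXH u) r = φ r ^ 2 := by
      filter_upwards [coeFn_prodH (inclXH u) (inclXH u), ae_radial_pos] with r h1 h2
      rw [h1, hu.ev_eq r h2, sq]
    have hQ : QX d κ u u = ∫ r in Ioi (0 : ℝ), r * (deriv φ r ^ 2 + c r * φ r ^ 2) := by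
      rw [QX_apply, inner_eq_setIntegral hder hder, inner_eq_setIntegral hquo hquo,
        inner_eq_setIntegral hκ hpr, ← integral_const_mul,
        setIntegral_add_sub (integrableOn_mul_of_ae hder hder)
          ((integrableOn_mul_of_ae hquo hquo).const_mul _) (integrableOn_mul_of_ae hκ hpr)]
      refine setIntegral_congr_fun measurableSet_Ioi fun r hr => ?_
      have hr0 : (0 : ℝ) < r := hr
      field_simp
      ring
    rw [hQ, hu.ev_eq β hβ, hu.ev_eq α hα]
    exact picone_test h hc hy hα hαβ hu.isTest

theorem picone_H {κ : L2r} {g : ℝ} {y V c : ℝ → ℝ}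
    (hκ : ∀ᵐ r ∂radialMeasure, κ r = g - c r) (h : IsRadialSol y V c)
    (hc : ContinuousOn c (Ioi 0)) (hy : ∀ r > 0, 0 < y r) {α β : ℝ} (hα : 0 < α) (hαβ : α < β)
    (φ : H) : (ev φ β / y β - ev φ α / y α) ^ 2 ≤ piconeConst y α β * QH g κ φ φ := by
  have hβ : 0 < β := hα.trans hαβ
  refine H.induction_test (p := fun φ => (ev φ β / y β - ev φ α / y α) ^ 2
      ≤ piconeConst y α β * QH g κ φ φ) ?_ ?_ φ
  · refine isClosed_le ?_ ?_
    · have h1 : ∀ s (hs : 0 < s), Continuous fun u : H => ev u s := fun s hs => by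
        simpa only [← evL_apply hs] using (evL s hs).continuous
      exact (((h1 β hβ).div_const _).sub ((h1 α hα).div_const _)).pow 2
    · exact continuous_const.mul ((QH g κ).continuous.clm_apply continuous_id)
  · intro u φ hu
    have hder : ∀ᵐ r ∂radialMeasure, H.derL u r = deriv φ r := hu.der_eq
    have hfn : ∀ᵐ r ∂radialMeasure, H.fnL u r = φ r := by
      filter_upwards [ae_eq_ev u, ae_radial_pos] with r h1 h2
      rw [h1, hu.ev_eq r h2]
    have hpr : ∀ᵐ r ∂radialMeasure, prodH u u r = φ r ^ 2 := by
      filter_upwards [coeFn_prodH u u, ae_radial_pos] with r h1 h2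
      rw [h1, hu.ev_eq r h2, sq]
    have hQ : QH g κ u u = ∫ r in Ioi (0 : ℝ), r * (deriv φ r ^ 2 + c r * φ r ^ 2) := by
      rw [QH_apply, inner_eq_setIntegral hder hder, inner_eq_setIntegral hfn hfn,
        inner_eq_setIntegral hκ hpr, ← integral_const_mul,
        setIntegral_add_sub (integrableOn_mul_of_ae hder hder)
          ((integrableOn_mul_of_ae hfn hfn).const_mul _) (integrableOn_mul_of_ae hκ hpr)]
      refine setIntegral_congr_fun measurableSet_Ioi fun r hr => ?_
      ring
    rw [hQ, hu.ev_eq β hβ, hu.ev_eq α hα]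
    exact picone_test h hc hy hα hαβ hu.isTest

theorem QX_nonneg {κ : L2r} {y V c : ℝ → ℝ}
    (hκ : ∀ᵐ r ∂radialMeasure, κ r = (d : ℝ) ^ 2 / r ^ 2 - c r) (h : IsRadialSol y V c)
    (hc : ContinuousOn c (Ioi 0)) (hy : ∀ r > 0, 0 < y r) (φ : X) : 0 ≤ QX d κ φ φ := by
  have h1 := picone_X hκ h hc hy one_pos one_lt_two φ
  exact (mul_nonneg_iff_of_pos_left (piconeConst_pos h hy one_pos one_lt_two)).1
    ((sq_nonneg _).trans h1)

theorem QH_nonneg {κ : L2r} {g : ℝ} {y V c : ℝ → ℝ}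
    (hκ : ∀ᵐ r ∂radialMeasure, κ r = g - c r) (h : IsRadialSol y V c)
    (hc : ContinuousOn c (Ioi 0)) (hy : ∀ r > 0, 0 < y r) (φ : H) : 0 ≤ QH g κ φ φ := by
  have h1 := picone_H hκ h hc hy one_pos one_lt_two φ
  exact (mul_nonneg_iff_of_pos_left (piconeConst_pos h hy one_pos one_lt_two)).1
    ((sq_nonneg _).trans h1)

/-- Equality in Picone's inequality makes `φ/y` constant; the constant is `0`, since `φ → 0` and `y
→ 1` at infinity. -/
theorem eq_zero_of_QX_eq_zero {κ : L2r} {y V c : ℝ → ℝ}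
    (hκ : ∀ᵐ r ∂radialMeasure, κ r = (d : ℝ) ^ 2 / r ^ 2 - c r) (h : IsRadialSol y V c)
    (hc : ContinuousOn c (Ioi 0)) (hy : ∀ r > 0, 0 < y r) (hy1 : Tendsto y atTop (𝓝 1)) {φ : X}
    (hφ : QX d κ φ φ = 0) : φ = 0 := by
  apply inclXH_injective
  rw [map_zero]
  refine eq_zero_of_ev fun α hα => ?_
  have h1 : ∀ β > α, ev (inclXH φ) β / y β = ev (inclXH φ) α / y α := fun β hβ => by
    have h1 := picone_X hκ h hc hy hα hβ φ
    rw [hφ, mul_zero] at h1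
    exact sub_eq_zero.1 (pow_eq_zero_iff two_ne_zero |>.1 (le_antisymm h1 (sq_nonneg _)))
  have h2 : Tendsto (fun β => ev (inclXH φ) β / y β) atTop (𝓝 (0 / 1)) :=
    (tendsto_ev_atTop _).div hy1 one_ne_zero
  have h3 : Tendsto (fun β => ev (inclXH φ) β / y β) atTop (𝓝 (ev (inclXH φ) α / y α)) :=
    tendsto_const_nhds.congr' ((eventually_gt_atTop α).mono fun β hβ => (h1 β hβ).symm)
  have h4 := tendsto_nhds_unique h3 h2
  rw [zero_div, div_eq_zero_iff] at h4
  exact h4.resolve_right (hy α hα).ne'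

/-- Here the positive solution belongs to `H` itself, so the constancy of `ψ/m` leaves a
one-dimensional kernel. -/
theorem eq_smul_of_QH_eq_zero {κ : L2r} {g : ℝ} {m : H} {V c : ℝ → ℝ}
    (hκ : ∀ᵐ r ∂radialMeasure, κ r = g - c r) (h : IsRadialSol (ev m) V c)
    (hc : ContinuousOn c (Ioi 0)) (hy : ∀ r > 0, 0 < ev m r) {ψ : H}
    (hψ : QH g κ ψ ψ = 0) : ∃ k : ℝ, ψ = k • m := by
  have h0 : ∀ α β : ℝ, 0 < α → α < β → ev ψ β / ev m β = ev ψ α / ev m α :=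
    fun α β hα hβ => by
    have h1 := picone_H hκ h hc hy hα hβ ψ
    rw [hψ, mul_zero] at h1
    exact sub_eq_zero.1 (pow_eq_zero_iff two_ne_zero |>.1 (le_antisymm h1 (sq_nonneg _)))
  have h1 : ∀ α > 0, ev ψ α / ev m α = ev ψ 1 / ev m 1 := fun α hα => by
    rcases lt_trichotomy α 1 with h | h | h
    · exact (h0 α 1 hα h).symm
    · rw [h]
    · exact h0 1 α one_pos h
  refine ⟨ev ψ 1 / ev m 1, ext_ev fun r hr => ?_⟩
  rw [ev_smul _ _ hr, ← h1 r hr, div_mul_cancel₀ _ (hy r hr).ne']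

/-! ### Pointwise form and interior regularity of weak solutions -/

namespace CoreProfile

variable (hC : CoreProfile d ft)

theorem continuousOn_fz (hC : CoreProfile d ft) (z : Z₀) : ContinuousOn (fz ft z) (Ioi 0) :=
  hC.nc.continuousOn.add (continuousOn_ev _)

theorem continuousOn_az (hC : CoreProfile d ft) (z : Z₀) : ContinuousOn (az ft z) (Ioi 0) :=
  (continuousOn_const.sub ((hC.continuousOn_fz z).pow 2)).sub ((continuousOn_ev _).pow 2)

theorem tendsto_fz_atTop (hC : CoreProfile d ft) (z : Z₀) : Tendsto (fz ft z) atTop (𝓝 1) := by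
  have h := hC.nc.at_infty.add (tendsto_ev_atTop (inclXH z.1))
  rwa [add_zero] at h

theorem coeFn_N (z ζ : Z₀) : ∀ᵐ r ∂radialMeasure,
    hC.N z ζ r = fz ft z r * ev (inclXH ζ.1) r + ev z.2 r * ev ζ.2 r := by
  filter_upwards [Lp.coeFn_add (hC.T0 ζ) (dotZ z ζ), hC.coeFn_T (X.fnL ζ.1),
    ae_eq_ev (inclXH ζ.1), Lp.coeFn_add (prodH (inclXH z.1) (inclXH ζ.1)) (prodH z.2 ζ.2),
    coeFn_prodH (inclXH z.1) (inclXH ζ.1), coeFn_prodH z.2 ζ.2] with r h1 h2 h3 h4 h5 h6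
  rw [N_apply, h1, Pi.add_apply, T0_apply, h2, dotZ_apply, h4, Pi.add_apply, h5, h6]
  rw [fnL_inclXH] at h3
  rw [h3, fz]
  ring

theorem coeFn_hh (z : Z₀) : ∀ᵐ r ∂radialMeasure,
    hC.hh z r = fz ft z r ^ 2 + ev z.2 r ^ 2 - ft r ^ 2 := by
  have e : hC.hh z = hC.T0 z + hC.N z z := by
    rw [hh, N_apply, two_smul]; abel
  filter_upwards [Lp.coeFn_add (hC.T0 z) (hC.N z z), hC.coeFn_T (X.fnL z.1),
    ae_eq_ev (inclXH z.1), hC.coeFn_N z z] with r h1 h2 h3 h4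
  rw [fnL_inclXH] at h3
  rw [e, h1, Pi.add_apply, h4, T0_apply, h2, h3, fz]
  ring

theorem coeFn_aa (z : Z₀) : ∀ᵐ r ∂radialMeasure, hC.aa z r = az ft z r := by
  filter_upwards [Lp.coeFn_sub hC.a0 (hC.hh z), hC.coeFn_a0, hC.coeFn_hh z] with r h1 h2 h3
  rw [aa, h1, Pi.sub_apply, h2, h3, az]
  ring

theorem aa_zero : hC.aa 0 = hC.a0 := by rw [aa, hh_zero, sub_zero]

/-- The first component of the weak equation, tested against `φ`. -/
theorem eqn_fst (g : ℝ) (z : Z₀) (φ : X) :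
    hC.eqn g z (φ, 0) = QX d hC.a0 z.1 φ + inner ℝ (hC.hh z) (hC.N z (φ, 0)) := by
  simp [eqn_apply, QZ_apply]

/-- The nonlinearity only changes the potential from `a0` to `aa z`: the second component solves a
linear equation once `aa z` is known. -/
theorem eqn_snd (g : ℝ) (z : Z₀) (ψ : H) : hC.eqn g z (0, ψ) = QH g (hC.aa z) z.2 ψ := by
  simp [eqn_apply, QZ_apply, aa, QH_sub, N_apply, T0_apply, dotZ_apply]

theorem exists_radialSol_snd {κ : L2r} {k : ℝ → ℝ} (hk : ContinuousOn k (Ioi 0))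
    (hκ : ∀ᵐ r ∂radialMeasure, κ r = k r) {g : ℝ} {m : H} (h : ∀ ψ, QH g κ m ψ = 0) :
    ∃ V : ℝ → ℝ, IsRadialSol (ev m) V (fun r => g - k r) ∧
      ∀ᵐ r ∂radialMeasure, H.derL m r = V r / r := by
  have hc : ContinuousOn (fun r => r * ((g - k r) * ev m r)) (Ioi 0) :=
    continuousOn_id.mul ((continuousOn_const.sub hk).mul (continuousOn_ev m))
  suffices hw : HasWeakDeriv (fun r => r * H.derL m r) _ by
    obtain ⟨V, h1, h2, h3⟩ := H.regularity hc hw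
    exact ⟨V, ⟨h2, h1⟩, h3⟩
  · intro φ hφ hφc hφs
    obtain ⟨w, hw⟩ := IsTest.exists_H ⟨hφ, hφc, hφs⟩
    have hder : ∀ᵐ r ∂radialMeasure, H.derL w r = deriv φ r := hw.der_eq
    have hfn : ∀ᵐ r ∂radialMeasure, H.fnL w r = φ r := by
      filter_upwards [ae_eq_ev w, ae_radial_pos] with r h1 h2
      rw [h1, hw.ev_eq r h2]
    have hpr : ∀ᵐ r ∂radialMeasure, prodH m w r = ev m r * φ r := by
      filter_upwards [coeFn_prodH m w, ae_radial_pos] with r h1 h2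
      rw [h1, hw.ev_eq r h2]
    have h0 := h w
    have hd0 : ∀ᵐ r ∂radialMeasure, H.derL m r = H.derL m r := ae_of_all _ fun _ => rfl
    rw [QH_apply, inner_eq_setIntegral hd0 hder, inner_eq_setIntegral (ae_eq_ev m) hfn,
      inner_eq_setIntegral hκ hpr, ← integral_const_mul] at h0
    have e1 : ∫ r in Ioi (0 : ℝ), r * H.derL m r * deriv φ r
        = ∫ r in Ioi (0 : ℝ), r * (H.derL m r * deriv φ r) := by
      simp only [mul_assoc]
    have e2 : ∫ r in Ioi (0 : ℝ), r * ((g - k r) * ev m r) * φ r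
        = (∫ r in Ioi (0 : ℝ), g * (r * (ev m r * φ r)))
          - ∫ r in Ioi (0 : ℝ), r * (k r * (ev m r * φ r)) := by
      rw [← integral_sub ((integrableOn_mul_of_ae (ae_eq_ev m) hfn).const_mul g)
        (integrableOn_mul_of_ae hκ hpr)]
      refine setIntegral_congr_fun measurableSet_Ioi fun r hr => ?_
      ring
    rw [e1, e2]
    linarith

/-- The right-hand side of the equation `(r u')' = k` for the first component. -/
def rhsFst (d : ℤ) (ft : ℝ → ℝ) (z : Z₀) (r : ℝ) : ℝ :=
  r * ((d : ℝ) ^ 2 / r ^ 2 * ev (inclXH z.1) r - (1 - ft r ^ 2) * ev (inclXH z.1) r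
    + (fz ft z r ^ 2 + ev z.2 r ^ 2 - ft r ^ 2) * fz ft z r)

theorem continuousOn_rhsFst (hC : CoreProfile d ft) (z : Z₀) :
    ContinuousOn (rhsFst d ft z) (Ioi 0) := by
  have hcu : ContinuousOn (ev (inclXH z.1)) (Ioi 0) := continuousOn_ev _
  refine continuousOn_id.mul ((((continuousOn_const.div (continuousOn_id.pow 2) ?_).mul hcu).sub
    ((continuousOn_const.sub (hC.nc.continuousOn.pow 2)).mul hcu)).add
    (((((hC.continuousOn_fz z).pow 2).add ((continuousOn_ev _).pow 2)).sub
      (hC.nc.continuousOn.pow 2)).mul (hC.continuousOn_fz z)))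
  intro r hr
  exact pow_ne_zero 2 (ne_of_gt hr)

theorem eqn_fst_test (g : ℝ) (z : Z₀) {w : X} {φ : ℝ → ℝ} (hw : IsTestRep (inclXH w) φ) :
    hC.eqn g z (w, 0) = (∫ r in Ioi (0 : ℝ), r * H.derL (inclXH z.1) r * deriv φ r)
      + ∫ r in Ioi (0 : ℝ), rhsFst d ft z r * φ r := by
  have hder : ∀ᵐ r ∂radialMeasure, X.derL w r = deriv φ r := hw.der_eq
  have hquo : ∀ᵐ r ∂radialMeasure, X.quoL w r = φ r / r := by
    filter_upwards [quoL_ae w, ae_radial_pos] with r h1 h2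
    rw [h1, hw.ev_eq r h2]
  have hpr : ∀ᵐ r ∂radialMeasure, prodH (inclXH z.1) (inclXH w) r = ev (inclXH z.1) r * φ r := by
    filter_upwards [coeFn_prodH (inclXH z.1) (inclXH w), ae_radial_pos] with r h1 h2
    rw [h1, hw.ev_eq r h2]
  have hN : ∀ᵐ r ∂radialMeasure, hC.N z (w, 0) r = fz ft z r * φ r := by
    filter_upwards [hC.coeFn_N z (w, 0), ae_radial_pos] with r h1 h2
    rw [h1, hw.ev_eq r h2, ev_zero h2, mul_zero, add_zero]
  have hd0 : ∀ᵐ r ∂radialMeasure, X.derL z.1 r = X.derL z.1 r := ae_of_all _ fun _ => rfl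
  rw [eqn_fst, QX_apply, inner_eq_setIntegral hd0 hder, inner_eq_setIntegral (quoL_ae z.1) hquo,
    inner_eq_setIntegral hC.coeFn_a0 hpr, inner_eq_setIntegral (hC.coeFn_hh z) hN,
    ← integral_const_mul]
  have e1 : ∫ r in Ioi (0 : ℝ), r * H.derL (inclXH z.1) r * deriv φ r
      = ∫ r in Ioi (0 : ℝ), r * (X.derL z.1 r * deriv φ r) := by
    simp only [mul_assoc, derL_inclXH]
  have i1 := (integrableOn_mul_of_ae (quoL_ae z.1) hquo).const_mul ((d : ℝ) ^ 2)
  have i2 := integrableOn_mul_of_ae hC.coeFn_a0 hpr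
  have i3 := integrableOn_mul_of_ae (hC.coeFn_hh z) hN
  have e2 := integral_add (i1.sub i2) i3
  simp only [Pi.sub_apply] at e2
  rw [integral_sub i1 i2] at e2
  have e3 : ∫ r in Ioi (0 : ℝ), rhsFst d ft z r * φ r = ∫ r in Ioi (0 : ℝ),
      ((d : ℝ) ^ 2 * (r * (ev (inclXH z.1) r / r * (φ r / r)))
        - r * ((1 - ft r ^ 2) * (ev (inclXH z.1) r * φ r))
        + r * ((fz ft z r ^ 2 + ev z.2 r ^ 2 - ft r ^ 2) * (fz ft z r * φ r))) := by
    refine setIntegral_congr_fun measurableSet_Ioi fun r hr => ?_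
    have hr0 : (0 : ℝ) < r := hr
    simp only [rhsFst]
    field_simp
  rw [e1, e3, e2]
  ring

/-- Adding the flux `r f̃'` of the core to that of `u` absorbs the inhomogeneous terms, so that `f =
f̃ + u` solves a linear homogeneous equation with potential `aa z`. -/
theorem exists_radialSol_fst {g : ℝ} {z : Z₀} (h : ∀ φ, hC.eqn g z (φ, 0) = 0) :
    ∃ V : ℝ → ℝ, IsRadialSol (fz ft z) V (fun r => (d : ℝ) ^ 2 / r ^ 2 - az ft z r) ∧
      ∀ᵐ r ∂radialMeasure, X.derL z.1 r = V r / r - deriv ft r := by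
  have hw : HasWeakDeriv (fun r => r * H.derL (inclXH z.1) r) (rhsFst d ft z) := by
    intro φ hφ hφc hφs
    obtain ⟨w, hw⟩ := IsTest.exists_X ⟨hφ, hφc, hφs⟩
    have h0 := h w
    rw [hC.eqn_fst_test g z hw] at h0
    linarith
  obtain ⟨V, h1, h2, h3⟩ := H.regularity (hC.continuousOn_rhsFst z) hw
  have hs := hC.nc.isRadialSol
  refine ⟨fun r => r * deriv ft r + V r, ⟨fun r hr => ?_, fun r hr => ?_⟩, ?_⟩
  · exact ((hs.hasDerivAt r hr).add (h2 r hr)).congr_deriv (by ring)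
  · refine ((hs.hasDerivAt' r hr).add (h1 r hr)).congr_deriv ?_
    simp only [rhsFst, az, fz]
    ring
  · filter_upwards [h3, ae_radial_pos] with r h4 hr
    rw [derL_inclXH] at h4
    rw [h4]
    field_simp
    ring

/-- A classical solution of the first equation is a weak solution. -/
theorem eqn_fst_of_isRadialSol (g : ℝ) {z : Z₀} {V : ℝ → ℝ}
    (h : IsRadialSol (fz ft z) V (fun r => (d : ℝ) ^ 2 / r ^ 2 - az ft z r)) (φ : X) :
    hC.eqn g z (φ, 0) = 0 := by
  refine X.induction_test (p := fun φ => hC.eqn g z (φ, 0) = 0)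
    (isClosed_eq ((hC.eqn g z).continuous.comp (by fun_prop)) continuous_const) ?_ φ
  intro w φ hw
  have hs := hC.nc.isRadialSol
  have hV : IsPrimitive (fun r => V r - r * deriv ft r) (rhsFst d ft z) := by
    refine IsPrimitive.of_hasDerivAt (fun r hr => ?_) (hC.continuousOn_rhsFst z)
    refine ((h.hasDerivAt' r hr).sub (hs.hasDerivAt' r hr)).congr_deriv ?_
    simp only [rhsFst, az, fz]
    ring
  have hd0 : ∀ᵐ r ∂radialMeasure, H.derL (inclXH z.1) r = V r / r - deriv ft r := by
    refine (ev_isPrimitive (inclXH z.1)).ae_eq_of_hasDerivAt fun r hr => ?_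
    have h1 := (h.hasDerivAt r hr).sub (hs.hasDerivAt r hr)
    refine (h1.congr_deriv (by field_simp)).congr_of_eventuallyEq ?_
    refine Eventually.of_forall fun s => ?_
    simp [fz]
  have h0 := hV.hasWeakDeriv φ hw.isTest.contDiff hw.isTest.compact hw.isTest.subset
  rw [hC.eqn_fst_test g z hw]
  have e1 : ∫ r in Ioi (0 : ℝ), r * H.derL (inclXH z.1) r * deriv φ r
      = ∫ r in Ioi (0 : ℝ), (V r - r * deriv ft r) * deriv φ r := by
    refine integral_congr_ae ?_
    filter_upwards [ae_restrict_of_ae_radial hd0, ae_restrict_mem measurableSet_Ioi] with r h1 h2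
    have hr0 : (0 : ℝ) < r := h2
    rw [h1]
    field_simp
  rw [e1, h0]
  ring

end CoreProfile

variable {d : ℤ} {ft : ℝ → ℝ}

/-! ### The bifurcation value and its ground state -/

theorem eq_zero_of_form_eq_zero {E : Type*} [NormedAddCommGroup E] [NormedSpace ℝ E]
    (B : E →L[ℝ] E →L[ℝ] ℝ) (hsymm : ∀ x y, B x y = B y x) (hB : ∀ x, 0 ≤ B x x) {x : E}
    (hx : B x x = 0) (y : E) : B x y = 0 := by
  by_contra hne
  have h1 : ∀ t : ℝ, 0 ≤ 2 * t * B x y + t ^ 2 * B y y := fun t => by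
    have h := hB (x + t • y)
    simp only [map_add, add_apply, map_smul, smul_apply, smul_eq_mul, hx, hsymm y x] at h
    linarith
  have hyy := hB y
  -- Nearly the minimizing value of `t`; the summand `1` avoids division by zero.
  have h2 := h1 (-(B x y) / (B y y + 1))
  have h3 : 0 < (B x y) ^ 2 := by positivity
  have h4 : 2 * (-(B x y) / (B y y + 1)) * B x y + (-(B x y) / (B y y + 1)) ^ 2 * B y y
      = -((B x y) ^ 2 * (B y y + 2) / (B y y + 1) ^ 2) := by
    field_simp; ring
  rw [h4] at h2
  have h5 : 0 < (B x y) ^ 2 * (B y y + 2) / (B y y + 1) ^ 2 := by positivity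
  linarith

theorem inner_prodH_self_eq {κ : L2r} {k : ℝ → ℝ} (hκ : ∀ᵐ r ∂radialMeasure, κ r = k r) (w : H) :
    inner ℝ κ (prodH w w) = ∫ r in Ioi (0 : ℝ), r * (k r * ev w r ^ 2) := by
  rw [inner_eq_setIntegral hκ (coeFn_prodH w w)]
  simp only [sq]

theorem integrableOn_mul_sq_ev {κ : L2r} {k : ℝ → ℝ} (hκ : ∀ᵐ r ∂radialMeasure, κ r = k r)
    (w : H) : IntegrableOn (fun r => r * (k r * ev w r ^ 2)) (Ioi 0) := by
  simpa only [sq] using integrableOn_mul_of_ae hκ (coeFn_prodH w w)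

theorem norm_fnL_pos {w : H} (hw : w ≠ 0) : 0 < ‖H.fnL w‖ := by
  rw [norm_pos_iff]
  intro h
  apply hw
  refine eq_zero_of_ev fun r hr => ?_
  refine ev_eq_of_ae (e := fun _ => 0) continuousOn_const ?_ hr
  filter_upwards [Lp.coeFn_zero ℝ 2 radialMeasure] with r hr
  rw [h, hr]; rfl

theorem coercive_norm_form (g : ℝ) (w : H) :
    min 1 g * ‖w‖ ^ 2 ≤ ‖H.derL w‖ ^ 2 + g * ‖H.fnL w‖ ^ 2 := by
  rw [H.norm_sq]
  have h1 := min_le_left 1 g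
  have h2 := min_le_right 1 g
  nlinarith [sq_nonneg ‖H.derL w‖, sq_nonneg ‖H.fnL w‖]

/-- Trial functions that are bounded below on `(0, 1]` while their Dirichlet energy `ε/4` is
arbitrarily small, an effect of the logarithmic capacity in two dimensions. The integrals are values
of the Gamma function. -/
theorem exists_exp_rpow {ε : ℝ} (hε : 0 < ε) : ∃ w : H, (∀ r > 0, ev w r = Real.exp (-r ^ ε)) ∧
    ‖H.derL w‖ ^ 2 = ε / 4 := by
  have hder : ∀ r > 0, HasDerivAt (fun r : ℝ => Real.exp (-r ^ ε))
      (-(ε * r ^ (ε - 1)) * Real.exp (-r ^ ε)) r := fun r hr => by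
    refine ((Real.hasDerivAt_rpow_const (Or.inl (ne_of_gt hr))).neg.exp).congr_deriv ?_
    simp only [Pi.neg_apply]
    ring
  have hpc : ∀ s : ℝ, ContinuousOn (fun r : ℝ => r ^ s) (Ioi 0) := fun s r hr =>
    (Real.continuousAt_rpow_const r s (Or.inl (ne_of_gt hr))).continuousWithinAt
  have hcw : ContinuousOn (fun r : ℝ => Real.exp (-r ^ ε)) (Ioi 0) :=
    Real.continuous_exp.comp_continuousOn (hpc ε).neg
  have hcv : ContinuousOn (fun r : ℝ => -(ε * r ^ (ε - 1)) * Real.exp (-r ^ ε)) (Ioi 0) :=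
    ((continuousOn_const.mul (hpc _)).neg).mul hcw
  have hE : ∀ q : ℝ, -1 < q → IntegrableOn (fun r : ℝ => r ^ q * Real.exp (-2 * r ^ ε)) (Ioi 0) ∧
      ∫ r in Ioi (0 : ℝ), r ^ q * Real.exp (-2 * r ^ ε)
        = 2 ^ (-(q + 1) / ε) * (1 / ε) * Real.Gamma ((q + 1) / ε) := fun q hq => by
    have h1 := integral_rpow_mul_exp_neg_mul_rpow hε hq (zero_lt_two' ℝ)
    refine ⟨?_, h1⟩
    by_contra hcon
    rw [integral_undef hcon] at h1
    have h2 : 0 < Real.Gamma ((q + 1) / ε) := Real.Gamma_pos_of_pos (div_pos (by linarith) hε)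
    have h3 : (0 : ℝ) < 2 ^ (-(q + 1) / ε) * (1 / ε) * Real.Gamma ((q + 1) / ε) := by positivity
    linarith
  have hsq : ∀ r : ℝ, Real.exp (-r ^ ε) ^ 2 = Real.exp (-2 * r ^ ε) := fun r => by
    rw [sq, ← Real.exp_add]; congr 1; ring
  have hw2 : IntegrableOn (fun r => r * Real.exp (-r ^ ε) ^ 2) (Ioi 0) := by
    refine (hE 1 (by norm_num)).1.congr_fun (fun r _ => ?_) measurableSet_Ioi
    simp only [hsq, Real.rpow_one]
  have hv : ∀ r > 0, r * (-(ε * r ^ (ε - 1)) * Real.exp (-r ^ ε)) ^ 2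
      = ε ^ 2 * (r ^ (2 * ε - 1) * Real.exp (-2 * r ^ ε)) := fun r hr => by
    have h1 : r ^ (2 * ε - 1) = r * (r ^ (ε - 1)) ^ 2 := by
      rw [← Real.rpow_natCast, ← Real.rpow_mul (le_of_lt hr)]
      conv_rhs => rw [← Real.rpow_one r, ← Real.rpow_mul (le_of_lt hr), ← Real.rpow_add hr]
      congr 1; push_cast; ring
    rw [mul_pow, hsq, h1]; ring
  have hv2 : IntegrableOn (fun r => r * (-(ε * r ^ (ε - 1)) * Real.exp (-r ^ ε)) ^ 2) (Ioi 0) :=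
    IntegrableOn.congr_fun ((hE (2 * ε - 1) (by linarith)).1.const_mul (ε ^ 2))
      (fun r hr => (hv r hr).symm) measurableSet_Ioi
  obtain ⟨w, hw, hw'⟩ := exists_H_of_isPrimitive (IsPrimitive.of_hasDerivAt hder hcv)
    (memLp_two_radial_of_continuousOn hcw hw2) (memLp_two_radial_of_continuousOn hcv hv2)
  refine ⟨w, hw, ?_⟩
  rw [← real_inner_self_eq_norm_sq, inner_eq_setIntegral hw' hw']
  have h1 : ∀ r ∈ Ioi (0 : ℝ), r * (-(ε * r ^ (ε - 1)) * Real.exp (-r ^ ε)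
      * (-(ε * r ^ (ε - 1)) * Real.exp (-r ^ ε)))
      = ε ^ 2 * (r ^ (2 * ε - 1) * Real.exp (-2 * r ^ ε)) := fun r hr => by
    rw [← hv r hr]; ring
  rw [setIntegral_congr_fun measurableSet_Ioi h1, integral_const_mul,
    (hE (2 * ε - 1) (by linarith)).2]
  have e1 : -(2 * ε - 1 + 1) / ε = -2 := by field_simp; ring
  have e2 : (2 * ε - 1 + 1) / ε = 2 := by field_simp; ring
  rw [e1, e2, Real.Gamma_two]
  have e3 : (2 : ℝ) ^ (-2 : ℝ) = 1 / 4 := by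
    rw [Real.rpow_neg (by norm_num)]; norm_num
  rw [e3]; field_simp

namespace CoreProfile

variable (hC : CoreProfile d ft)

theorem rayleigh_eq (w : H) : rayleigh ft w = QH 0 hC.a0 w w / ‖H.fnL w‖ ^ 2 := by
  have h1 : ∫ r, (H.fn w r) ^ 2 ∂radialMeasure = ‖H.fnL w‖ ^ 2 := by
    rw [integral_radial, ← L2r.integral_sq]; rfl
  have h2 : ∫ r, ((H.der w r) ^ 2 - (1 - ft r ^ 2) * (H.fn w r) ^ 2) ∂radialMeasure
      = QH 0 hC.a0 w w := by
    rw [integral_radial, QH_apply, zero_mul, add_zero, real_inner_self_eq_norm_sq,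
      ← L2r.integral_sq, inner_prodH_self_eq hC.coeFn_a0,
      ← integral_sub (L2r.integrableOn_sq _) (integrableOn_mul_sq_ev hC.coeFn_a0 w)]
    refine integral_congr_ae ?_
    filter_upwards [ae_restrict_of_ae_radial (ae_eq_ev w)] with r hr
    rw [H.fnL_apply] at hr
    rw [hr, H.derL_apply]
    ring
  rw [rayleigh, h1, h2]

theorem inner_a0_le (w : H) : inner ℝ hC.a0 (prodH w w) ≤ ‖H.fnL w‖ ^ 2 := by
  rw [inner_prodH_self_eq hC.coeFn_a0, ← H.integral_fn]
  refine setIntegral_mono_on (integrableOn_mul_sq_ev hC.coeFn_a0 w) (H.integrableOn_fn w)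
    measurableSet_Ioi fun r hr => ?_
  have hr0 : (0 : ℝ) < r := hr
  have : (1 - ft r ^ 2) * ev w r ^ 2 ≤ ev w r ^ 2 := by
    nlinarith [mul_nonneg (sq_nonneg (ft r)) (sq_nonneg (ev w r))]
  gcongr

theorem QH_eq (g : ℝ) (κ : L2r) (w : H) : QH g κ w w = QH 0 κ w w + g * ‖H.fnL w‖ ^ 2 := by
  rw [QH_apply, QH_apply, real_inner_self_eq_norm_sq (H.fnL w)]; ring

theorem bddBelow_rayleigh (hC : CoreProfile d ft) :
    BddBelow {q : ℝ | ∃ w : H, w ≠ 0 ∧ q = rayleigh ft w} := by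
  refine ⟨-1, ?_⟩
  rintro q ⟨w, hw, rfl⟩
  have h := norm_fnL_pos hw
  rw [hC.rayleigh_eq, le_div_iff₀ (by positivity), QH_apply, real_inner_self_eq_norm_sq]
  nlinarith [hC.inner_a0_le w, sq_nonneg ‖H.derL w‖]

theorem QH_gStar_nonneg (w : H) : 0 ≤ QH (gStar ft) hC.a0 w w := by
  by_cases hw : w = 0
  · simp [hw]
  have h := norm_fnL_pos hw
  have h1 : -gStar ft ≤ rayleigh ft w := by
    rw [gStar, neg_neg]
    exact csInf_le hC.bddBelow_rayleigh ⟨w, hw, rfl⟩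
  rw [hC.rayleigh_eq, le_div_iff₀ (by positivity)] at h1
  rw [QH_eq]; linarith

theorem exists_ne_zero : ∃ w : H, w ≠ 0 := by
  obtain ⟨w, hw, -⟩ := exists_exp_rpow one_pos
  refine ⟨w, fun h => ?_⟩
  have := hw 1 one_pos
  rw [h, ev_zero one_pos] at this
  exact (Real.exp_pos _).ne this

/-- In two dimensions any attractive potential produces a negative eigenvalue: the trial functions
make the kinetic energy negligible against the fixed gain on `(0, 1]`. -/
theorem exists_QH_neg : ∃ w : H, w ≠ 0 ∧ QH 0 hC.a0 w w < 0 := by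
  set δ : ℝ := ∫ r in (0 : ℝ)..1, r * (1 - ft r ^ 2) with hδ
  have hc : ContinuousOn (fun r => r * (1 - ft r ^ 2)) (Icc 0 1) := by
    have hft : ContinuousOn ft (Icc 0 1) := by
      intro r hr
      rcases hr.1.eq_or_lt with h | h
      · rw [← h]; exact hC.nc.continuous_zero.mono Icc_subset_Ici_self
      · exact (hC.nc.continuousOn.continuousAt (Ioi_mem_nhds h)).continuousWithinAt
    exact continuousOn_id.mul (continuousOn_const.sub (hft.pow 2))
  have hi : IntervalIntegrable (fun r => r * (1 - ft r ^ 2)) volume 0 1 :=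
    ContinuousOn.intervalIntegrable (by rwa [uIcc_of_le zero_le_one])
  have hδ0 : 0 < δ := by
    refine intervalIntegral.intervalIntegral_pos_of_pos_on hi (fun r hr => ?_) one_pos
    exact mul_pos hr.1 (hC.one_sub_sq_pos hr.1)
  have he := Real.exp_pos (-2)
  -- With this `ε` the Dirichlet energy is `exp(-2) δ / 2`, half of the lower bound `exp(-2) δ` for
  -- the potential energy, because `w² ≥ exp(-2)` on `(0, 1]`.
  obtain ⟨w, hw, hw'⟩ := exists_exp_rpow (ε := 2 * Real.exp (-2) * δ) (by positivity)
  set ε := 2 * Real.exp (-2) * δ with hε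
  have hε0 : 0 < ε := by positivity
  refine ⟨w, fun h => ?_, ?_⟩
  · have := hw 1 one_pos
    rw [h, ev_zero one_pos] at this
    exact (Real.exp_pos _).ne this
  rw [QH_apply, zero_mul, add_zero, real_inner_self_eq_norm_sq, hw',
    inner_prodH_self_eq hC.coeFn_a0]
  have h1 : Real.exp (-2) * δ ≤ ∫ r in Ioi (0 : ℝ), r * ((1 - ft r ^ 2) * ev w r ^ 2) := by
    have hI := integrableOn_mul_sq_ev hC.coeFn_a0 w
    calc Real.exp (-2) * δ = ∫ r in Ioc (0 : ℝ) 1, Real.exp (-2) * (r * (1 - ft r ^ 2)) := by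
          rw [hδ, intervalIntegral.integral_of_le zero_le_one, integral_const_mul]
      _ ≤ ∫ r in Ioc (0 : ℝ) 1, r * ((1 - ft r ^ 2) * ev w r ^ 2) := by
          refine setIntegral_mono_on (hi.1.const_mul _) (hI.mono_set Ioc_subset_Ioi_self)
            measurableSet_Ioc fun r hr => ?_
          rw [hw r hr.1]
          have h2 : Real.exp (-2) ≤ Real.exp (-r ^ ε) ^ 2 := by
            rw [sq, ← Real.exp_add, Real.exp_le_exp]
            have : r ^ ε ≤ 1 := Real.rpow_le_one hr.1.le hr.2 hε0.le
            linarith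
          have h3 := mul_pos hr.1 (hC.one_sub_sq_pos hr.1)
          nlinarith
      _ ≤ _ := by
          refine setIntegral_mono_set hI ?_ (ae_of_all _ fun r hr => hr.1)
          filter_upwards [ae_restrict_mem measurableSet_Ioi] with r hr
          have h3 := hC.one_sub_sq_pos hr
          have hr0 : (0 : ℝ) < r := hr
          simp only [Pi.zero_apply]
          positivity
  have : 0 < Real.exp (-2) * δ := by positivity
  linarith

theorem gStar_pos (hC : CoreProfile d ft) : 0 < gStar ft := by
  obtain ⟨w, hw, h⟩ := hC.exists_QH_neg
  by_contra hcon
  have h1 := hC.QH_gStar_nonneg w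
  rw [QH_eq] at h1
  nlinarith [sq_nonneg ‖H.fnL w‖]

theorem tendsto_inner_prodH_self {x : ℕ → H} {y : H} {C : ℝ} (hx : WeakTendsto x y)
    (hC : ∀ n, ‖x n‖ ≤ C) (κ : L2r) :
    Tendsto (fun n => inner ℝ κ (prodH (x n) (x n))) atTop (𝓝 (inner ℝ κ (prodH y y))) :=
  tendsto_inner_prodH hx hx hC hC κ

/-- For `g > 0` the form without potential is coercive, and a potential in `L²_r` is a weakly
continuous perturbation. -/
theorem coercive_QH {g : ℝ} (hg : 0 < g) (κ : L2r) (h : ∀ w, w ≠ 0 → 0 < QH g κ w w) :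
    ∃ c > 0, ∀ w, c * ‖w‖ ^ 2 ≤ QH g κ w w := by
  have hB : ∀ w, QH g 0 w w = ‖H.derL w‖ ^ 2 + g * ‖H.fnL w‖ ^ 2 := fun w => by
    rw [QH_apply, real_inner_self_eq_norm_sq, real_inner_self_eq_norm_sq, inner_zero_left,
      sub_zero]
  have hQ : ∀ w, QH g κ w w = QH g 0 w w - inner ℝ κ (prodH w w) := fun w => by
    simp only [QH_apply, inner_zero_left]; ring
  obtain ⟨c, hc, hcw⟩ := coercive_of_pos weakCompactBalls_H (QH g 0) (QH_symm g 0)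
    (lt_min one_pos hg) (fun w => (coercive_norm_form g w).trans_eq (hB w).symm)
    (fun w => inner ℝ κ (prodH w w))
    (fun t w => by simp only [map_smul, smul_apply, inner_smul_right]; ring)
    (fun x y C hx hC => tendsto_inner_prodH_self hx hC κ) (fun w hw => by
      rw [← hQ]; exact h w hw)
  exact ⟨c, hc, fun w => (hcw w).trans_eq (hQ w).symm⟩

/-- The normalised positive ground state of `-Δ - (1 - f̃²)`. -/
theorem exists_groundState : ∃ w : H, ‖H.fnL w‖ = 1 ∧ (∀ ψ, QH (gStar ft) hC.a0 w ψ = 0) ∧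
    (∀ r > 0, 0 < ev w r) := by
  have hg := hC.gStar_pos
  -- If the infimum were not attained, the form at `g*` would be positive definite, hence coercive,
  -- and the infimum of the Rayleigh quotient would be larger than `-g*`.
  obtain ⟨w, hw0, hw⟩ : ∃ w : H, w ≠ 0 ∧ QH (gStar ft) hC.a0 w w = 0 := by
    by_contra hcon
    push Not at hcon
    obtain ⟨c, hc, h⟩ := coercive_QH hg hC.a0 fun w hw =>
      (hC.QH_gStar_nonneg w).lt_of_ne (hcon w hw).symm
    have h1 : -gStar ft + c ≤ sInf {q : ℝ | ∃ w : H, w ≠ 0 ∧ q = rayleigh ft w} := by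
      obtain ⟨w, hw⟩ := exists_ne_zero
      refine le_csInf ⟨_, w, hw, rfl⟩ ?_
      rintro q ⟨w, hw, rfl⟩
      have h2 := norm_fnL_pos hw
      rw [hC.rayleigh_eq, le_div_iff₀ (by positivity)]
      have h3 := h w
      rw [QH_eq, H.norm_sq] at h3
      nlinarith [sq_nonneg ‖H.derL w‖]
    have h2 : sInf {q : ℝ | ∃ w : H, w ≠ 0 ∧ q = rayleigh ft w} = -gStar ft := by
      rw [gStar, neg_neg]
    linarith
  -- The modulus is again a null vector of the non-negative form, so it solves the equation, and the
  -- strong maximum principle makes it positive.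
  obtain ⟨v, hv, hvd⟩ := H.exists_abs w
  have hv2 : ∀ r > 0, ev v r ^ 2 = ev w r ^ 2 := fun r hr => by rw [hv r hr, sq_abs]
  have hvn : ‖H.fnL v‖ ^ 2 = ‖H.fnL w‖ ^ 2 := by
    rw [← H.integral_fn, ← H.integral_fn]
    exact setIntegral_congr_fun measurableSet_Ioi fun r hr => by simp only [hv2 r hr]
  have hva : inner ℝ hC.a0 (prodH v v) = inner ℝ hC.a0 (prodH w w) := by
    rw [inner_prodH_self_eq hC.coeFn_a0, inner_prodH_self_eq hC.coeFn_a0]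
    exact setIntegral_congr_fun measurableSet_Ioi fun r hr => by simp only [hv2 r hr]
  have hvQ : QH (gStar ft) hC.a0 v v = 0 := by
    refine le_antisymm ?_ (hC.QH_gStar_nonneg v)
    rw [← hw, QH_apply, QH_apply, hva]
    simp only [real_inner_self_eq_norm_sq, hvn]
    have := pow_le_pow_left₀ (norm_nonneg _) hvd 2
    linarith
  have hv0 : v ≠ 0 := fun h => by
    have := norm_fnL_pos hw0
    rw [h] at hvn
    simp only [map_zero, norm_zero] at hvn
    nlinarith
  have hn := norm_fnL_pos hv0
  have heq := eq_zero_of_form_eq_zero (QH (gStar ft) hC.a0) (QH_symm _ _) hC.QH_gStar_nonneg hvQ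
  have hk : ContinuousOn (fun r => 1 - ft r ^ 2) (Ioi 0) :=
    continuousOn_const.sub (hC.nc.continuousOn.pow 2)
  obtain ⟨V, hV, -⟩ := exists_radialSol_snd hk hC.coeFn_a0 heq
  have hpos : ∀ r > 0, 0 < ev v r := by
    refine hV.pos (continuousOn_const.sub hk) (fun r hr => ?_) ?_
    · rw [hv r hr]; exact abs_nonneg _
    · by_contra hcon
      push Not at hcon
      exact hv0 (eq_zero_of_ev hcon)
  refine ⟨‖H.fnL v‖⁻¹ • v, ?_, fun ψ => ?_, fun r hr => ?_⟩
  · rw [map_smul, norm_smul, norm_inv, norm_norm, inv_mul_cancel₀ hn.ne']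
  · rw [map_smul, smul_apply, heq, smul_zero]
  · rw [ev_smul _ _ hr]
    exact mul_pos (inv_pos.2 hn) (hpos r hr)

end CoreProfile

variable {d : ℤ} {ft : ℝ → ℝ}

/-! ### Weak limits, coercivity and a priori bounds -/

theorem WeakTendsto.tendsto_inner {x y : ℕ → L2r} {x' y' : L2r} (hx : WeakTendsto x x') {C : ℝ}
    (hC : ∀ n, ‖x n‖ ≤ C) (hy : Tendsto y atTop (𝓝 y')) :
    Tendsto (fun n => inner ℝ (x n) (y n)) atTop (𝓝 (inner ℝ x' y')) := by
  have h1 : Tendsto (fun n => inner ℝ (x n) y') atTop (𝓝 (inner ℝ x' y')) :=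
    hx (ip.flip y')
  have h2 : Tendsto (fun n => inner ℝ (x n) (y n - y')) atTop (𝓝 0) := by
    have h3 : Tendsto (fun n => C * ‖y n - y'‖) atTop (𝓝 (C * 0)) :=
      (tendsto_iff_norm_sub_tendsto_zero.1 hy).const_mul C
    rw [mul_zero] at h3
    refine squeeze_zero_norm (fun n => ?_) h3
    refine (norm_inner_le_norm _ _).trans ?_
    gcongr
    exact hC n
  have h3 := h1.add h2
  rw [add_zero] at h3
  refine h3.congr fun n => ?_
  rw [← inner_add_right]; congr 1; abel

/-- Multiplication by a fixed element of `H` is compact: `‖w (x_n - y)‖²` is the quadratic form with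
kernel `w²` at `x_n - y`, which tends to `0`. -/
theorem tendsto_prodH {x : ℕ → H} {y : H} (hx : WeakTendsto x y) {C : ℝ} (hC : ∀ n, ‖x n‖ ≤ C)
    (w : H) : Tendsto (fun n => prodH w (x n)) atTop (𝓝 (prodH w y)) := by
  rw [tendsto_iff_norm_sub_tendsto_zero]
  have h1 : Tendsto (fun n => ‖prodH w (x n) - prodH w y‖ ^ 2) atTop (𝓝 0) := by
    have h2 := tendsto_inner_prodH hx.sub_const hx.sub_const (C := C + ‖y‖)
      (fun n => (norm_sub_le _ _).trans (by gcongr; exact hC n))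
      (fun n => (norm_sub_le _ _).trans (by gcongr; exact hC n)) (prodH w w)
    rw [map_zero, inner_zero_right] at h2
    refine h2.congr fun n => ?_
    rw [← inner_prodH_prodH_swap, prodH_comm, real_inner_self_eq_norm_sq, map_sub]
  have h2 := h1.sqrt
  simpa using h2

theorem WeakTendsto.fst {x : ℕ → Z₀} {y : Z₀} (h : WeakTendsto x y) :
    WeakTendsto (fun n => (x n).1) y.1 := h.map (ContinuousLinearMap.fst ℝ X H)

theorem WeakTendsto.snd {x : ℕ → Z₀} {y : Z₀} (h : WeakTendsto x y) :
    WeakTendsto (fun n => (x n).2) y.2 := h.map (ContinuousLinearMap.snd ℝ X H)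

theorem exists_norm_incl_le {x : ℕ → Z₀} {C : ℝ} (hC : ∀ n, ‖x n‖ ≤ C) :
    ∃ C', (∀ n, ‖inclXH (x n).1‖ ≤ C') ∧ ∀ n, ‖(x n).2‖ ≤ C' := by
  refine ⟨max (‖inclXH‖ * C) C, fun n => le_max_of_le_left ?_, fun n => le_max_of_le_right ?_⟩
  · refine (inclXH.le_opNorm _).trans ?_
    gcongr
    exact (norm_fst_le _).trans (hC n)
  · exact (norm_snd_le _).trans (hC n)

theorem tendsto_dotZ {x : ℕ → Z₀} {y : Z₀} (hx : WeakTendsto x y) {C : ℝ} (hC : ∀ n, ‖x n‖ ≤ C)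
    (z : Z₀) : Tendsto (fun n => dotZ z (x n)) atTop (𝓝 (dotZ z y)) := by
  obtain ⟨C', h1, h2⟩ := exists_norm_incl_le hC
  exact (tendsto_prodH (hx.fst.map inclXH) h1 _).add (tendsto_prodH hx.snd h2 _)

theorem tendsto_inner_dotZ_self {x : ℕ → Z₀} {y : Z₀} (hx : WeakTendsto x y) {C : ℝ}
    (hC : ∀ n, ‖x n‖ ≤ C) (κ : L2r) :
    Tendsto (fun n => inner ℝ κ (dotZ (x n) (x n))) atTop (𝓝 (inner ℝ κ (dotZ y y))) := by
  obtain ⟨C', h1, h2⟩ := exists_norm_incl_le hC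
  simp only [dotZ_apply, inner_add_right]
  exact (tendsto_inner_prodH (hx.fst.map inclXH) (hx.fst.map inclXH) h1 h1 κ).add
    (tendsto_inner_prodH hx.snd hx.snd h2 h2 κ)

theorem norm_sq_le_prod (ζ : Z₀) : ‖ζ‖ ^ 2 ≤ ‖ζ.1‖ ^ 2 + ‖ζ.2‖ ^ 2 := by
  rw [Prod.norm_def]
  rcases max_cases ‖ζ.1‖ ‖ζ.2‖ with h | h <;> rw [h.1] <;>
    nlinarith [sq_nonneg ‖ζ.1‖, sq_nonneg ‖ζ.2‖]

namespace CoreProfile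

variable (hC : CoreProfile d ft)

theorem weakTendsto_hh {x : ℕ → Z₀} {y : Z₀} (hx : WeakTendsto x y) {C : ℝ}
    (hxC : ∀ n, ‖x n‖ ≤ C) : WeakTendsto (fun n => hC.hh (x n)) (hC.hh y) := by
  intro L
  obtain ⟨κ, rfl⟩ := (InnerProductSpace.toDual ℝ L2r).surjective L
  have h1 := hx.map hC.T0 (InnerProductSpace.toDual ℝ L2r κ)
  have h2 := tendsto_inner_dotZ_self hx hxC κ
  have h3 := (h1.const_mul 2).add h2
  simpa only [hh, map_add, map_smul, smul_eq_mul, InnerProductSpace.toDual_apply_apply] using h3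

theorem exists_norm_hh_le (C : ℝ) : ∃ C', ∀ z : Z₀, ‖z‖ ≤ C → ‖hC.hh z‖ ≤ C' := by
  refine ⟨2 * (‖hC.T0‖ * C) + (2 * (‖inclXH‖ * C) * (‖inclXH‖ * C) + 2 * C * C), fun z hz => ?_⟩
  have hC0 : 0 ≤ C := (norm_nonneg _).trans hz
  refine (norm_add_le _ _).trans (add_le_add ?_ ?_)
  · rw [norm_smul, Real.norm_two]
    gcongr
    exact (hC.T0.le_opNorm z).trans (by gcongr)
  · have h1 : ‖inclXH z.1‖ ≤ ‖inclXH‖ * C :=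
      (inclXH.le_opNorm _).trans (by gcongr; exact (norm_fst_le _).trans hz)
    have h2 : ‖z.2‖ ≤ C := (norm_snd_le _).trans hz
    rw [dotZ_apply]
    refine (norm_add_le _ _).trans (add_le_add ?_ ?_)
    · exact (norm_prodH_le _ _).trans (by gcongr)
    · exact (norm_prodH_le _ _).trans (by gcongr)

/-- The potentials `hh (x_n)` converge only weakly, but for a fixed test element `N (x_n) ζ`
converges strongly, which is enough for their inner product. -/
theorem eqn_of_weakTendsto {x : ℕ → Z₀} {y : Z₀} (hx : WeakTendsto x y) {C : ℝ}
    (hxC : ∀ n, ‖x n‖ ≤ C) {g : ℕ → ℝ} {g' : ℝ} (hg : Tendsto g atTop (𝓝 g'))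
    (h : ∀ n, hC.eqn (g n) (x n) = 0) : hC.eqn g' y = 0 := by
  refine ContinuousLinearMap.ext fun ζ => ?_
  rw [zero_apply]
  obtain ⟨C', hC'⟩ := hC.exists_norm_hh_le C
  have h1 : Tendsto (fun n => inner ℝ (hC.hh (x n)) (hC.N (x n) ζ)) atTop
      (𝓝 (inner ℝ (hC.hh y) (hC.N y ζ))) := by
    refine (hC.weakTendsto_hh hx hxC).tendsto_inner (fun n => hC' _ (hxC n)) ?_
    simp only [N_apply, dotZ_symm _ ζ]
    exact (tendsto_dotZ hx hxC ζ).const_add _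
  have hq : ∀ g : ℝ, ∀ z ζ : Z₀, QZ d g hC.a0 z ζ = (QZ d 0 hC.a0).flip ζ z
      + g * ip.flip (H.fnL ζ.2) (H.fnL z.2) := by
    intro g z ζ
    simp only [QZ_apply, QH_apply, ContinuousLinearMap.flip_apply, ip_apply]; ring
  have h2 : Tendsto (fun n => QZ d (g n) hC.a0 (x n) ζ) atTop (𝓝 (QZ d g' hC.a0 y ζ)) := by
    simp only [hq]
    exact (hx _).add (hg.mul (hx.snd.map H.fnL _))
  have h3 := h2.add h1
  refine tendsto_nhds_unique h3 (tendsto_const_nhds.congr fun n => ?_)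
  have := congrArg (fun L => L ζ) (h n)
  simpa [eqn_apply] using this.symm

/-- The form lacks the `L²` part of the norm of `X`; by `1 - f̃² ≤ K/r²` it is recovered from `u² ≤
f̃² u² + K u²/r²`. -/
theorem coercive_QX_zero : ∃ c > 0, ∀ u : X,
    c * ‖u‖ ^ 2 ≤ QX d 0 u u + 2 * ‖hC.T (X.fnL u)‖ ^ 2 := by
  obtain ⟨K, hK, h⟩ := hC.one_sub_sq_le
  refine ⟨1 / (K + 1), by positivity, fun u => ?_⟩
  have hw := inner_prodH_self_eq hC.coeFn_a0 (inclXH u)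
  have hfT : ∀ᵐ r ∂radialMeasure, hC.T (X.fnL u) r = ft r * ev (inclXH u) r := by
    filter_upwards [hC.coeFn_T (X.fnL u), ae_eq_ev (inclXH u)] with r h1 h2
    rw [fnL_inclXH] at h2
    rw [h1, h2]
  have hd1 := one_le_sq_int hC.ne
  have h1 : ‖X.fnL u‖ ^ 2 ≤ ‖hC.T (X.fnL u)‖ ^ 2 + K * ‖X.quoL u‖ ^ 2 := by
    rw [← fnL_inclXH, ← H.integral_fn, fnL_inclXH, ← real_inner_self_eq_norm_sq,
      ← real_inner_self_eq_norm_sq, inner_eq_setIntegral hfT hfT,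
      inner_eq_setIntegral (quoL_ae u) (quoL_ae u), ← integral_const_mul, ← integral_add
      (integrableOn_mul_of_ae hfT hfT) ((integrableOn_mul_of_ae (quoL_ae u) (quoL_ae u)).const_mul K)]
    refine setIntegral_mono_on (H.integrableOn_fn _) ((integrableOn_mul_of_ae hfT hfT).add
      ((integrableOn_mul_of_ae (quoL_ae u) (quoL_ae u)).const_mul K)) measurableSet_Ioi
      fun r hr => ?_
    have hr0 : (0 : ℝ) < r := hr
    have h2 := h r hr0
    have h3 : r * (ft r * ev (inclXH u) r * (ft r * ev (inclXH u) r))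
        + K * (r * (ev (inclXH u) r / r * (ev (inclXH u) r / r)))
        - r * ev (inclXH u) r ^ 2 = r * ev (inclXH u) r ^ 2 * (K / r ^ 2 - (1 - ft r ^ 2)) := by
      field_simp; ring
    have h4 : 0 ≤ r * ev (inclXH u) r ^ 2 * (K / r ^ 2 - (1 - ft r ^ 2)) :=
      mul_nonneg (by positivity) (by linarith)
    linarith
  have h2 : QX d 0 u u = ‖X.derL u‖ ^ 2 + (d : ℝ) ^ 2 * ‖X.quoL u‖ ^ 2 := by
    simp only [QX_apply, inner_zero_left, real_inner_self_eq_norm_sq, sub_zero]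
  rw [h2, div_mul_eq_mul_div, one_mul, div_le_iff₀ (by positivity), X.norm_sq]
  have a1 := sq_nonneg ‖X.derL u‖
  have a2 := sq_nonneg ‖X.quoL u‖
  have a3 := sq_nonneg ‖hC.T (X.fnL u)‖
  have a4 : ‖X.quoL u‖ ^ 2 ≤ (d : ℝ) ^ 2 * ‖X.quoL u‖ ^ 2 := le_mul_of_one_le_left a2 hd1
  nlinarith [mul_nonneg hK.le a1, mul_nonneg hK.le a3, mul_le_mul_of_nonneg_left a4 hK.le]

/-- The linearisation of the system at `z`. -/
def lin (g : ℝ) (z : Z₀) : Z₀ →L[ℝ] Z₀ →L[ℝ] ℝ :=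
  QZ d g (hC.aa z) + (2 : ℝ) • ip.bilinearComp (hC.N z) (hC.N z)

theorem lin_apply (g : ℝ) (z ζ ξ : Z₀) : hC.lin g z ζ ξ
    = QZ d g (hC.aa z) ζ ξ + 2 * inner ℝ (hC.N z ζ) (hC.N z ξ) := rfl

theorem lin_self (g : ℝ) (z ζ : Z₀) : hC.lin g z ζ ζ
    = QZ d g (hC.aa z) ζ ζ + 2 * ‖hC.N z ζ‖ ^ 2 := by
  rw [lin_apply, real_inner_self_eq_norm_sq]

/-- The linearisation splits into the coercive form `QZ d g 0 + 2‖T0‖²` and terms that are weakly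
continuous because they contain `aa z` or products with the fixed `z`. -/
theorem coercive_lin {g : ℝ} (hg : 0 < g) (z : Z₀) (h : ∀ ζ, ζ ≠ 0 → 0 < hC.lin g z ζ ζ) :
    ∃ c > 0, ∀ ζ, c * ‖ζ‖ ^ 2 ≤ hC.lin g z ζ ζ := by
  obtain ⟨c, hc, hcu⟩ := hC.coercive_QX_zero
  set B : Z₀ →L[ℝ] Z₀ →L[ℝ] ℝ := QZ d g 0 + (2 : ℝ) • ip.bilinearComp hC.T0 hC.T0 with hB
  have hBa : ∀ ζ ξ, B ζ ξ = QZ d g 0 ζ ξ + 2 * inner ℝ (hC.T0 ζ) (hC.T0 ξ) := fun _ _ => rfl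
  set K : Z₀ → ℝ := fun ζ => inner ℝ (hC.aa z) (dotZ ζ ζ) - 4 * inner ℝ (hC.T0 ζ) (dotZ z ζ)
    - 2 * inner ℝ (dotZ z ζ) (dotZ z ζ) with hK
  have hQ : ∀ ζ, hC.lin g z ζ ζ = B ζ ζ - K ζ := fun ζ => by
    have h1 : QZ d g (hC.aa z) ζ ζ = QZ d g 0 ζ ζ - inner ℝ (hC.aa z) (dotZ ζ ζ) := by
      simp only [QZ_apply, QX_apply, QH_apply, inner_zero_left, dotZ_apply, inner_add_right]
      ring
    rw [lin_apply, h1, hBa]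
    simp only [hK, N_apply, inner_add_left, inner_add_right, real_inner_comm (hC.T0 ζ)]
    ring
  obtain ⟨c', hc', h'⟩ := coercive_of_pos (weakCompactBalls_prod weakCompactBalls_X
    weakCompactBalls_H) B (fun ζ ξ => by rw [hBa, hBa, QZ_symm, real_inner_comm])
    (c := min c (min 1 g)) (lt_min hc (lt_min one_pos hg)) (fun ζ => by
      have h1 := hcu ζ.1
      have h2 := coercive_norm_form g ζ.2
      have h3 : QH g 0 ζ.2 ζ.2 = ‖H.derL ζ.2‖ ^ 2 + g * ‖H.fnL ζ.2‖ ^ 2 := by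
        simp only [QH_apply, inner_zero_left, real_inner_self_eq_norm_sq, sub_zero]
      rw [hBa, QZ_apply, h3, T0_apply, real_inner_self_eq_norm_sq]
      have h4 := norm_sq_le_prod ζ
      have h5 := min_le_left c (min 1 g)
      have h6 := min_le_right c (min 1 g)
      have h7 : 0 < min c (min 1 g) := lt_min hc (lt_min one_pos hg)
      nlinarith [sq_nonneg ‖ζ.1‖, sq_nonneg ‖ζ.2‖])
    K (fun t ζ => by
      simp only [hK, map_smul, smul_apply, inner_smul_left, inner_smul_right, conj_trivial]
      ring)
    (fun x y C hx hxC => by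
      have h1 := tendsto_inner_dotZ_self hx hxC (hC.aa z)
      have h2 := tendsto_dotZ hx hxC z
      have h3 := (hx.map hC.T0).tendsto_inner (C := ‖hC.T0‖ * C) (fun n =>
        (hC.T0.le_opNorm _).trans (by gcongr; exact hxC n)) h2
      exact (h1.sub (h3.const_mul 4)).sub ((h2.inner h2).const_mul 2))
    (fun ζ hζ => by rw [← hQ]; exact h ζ hζ)
  exact ⟨c', hc', fun ζ => (h' ζ).trans_eq (hQ ζ).symm⟩

theorem a0_eq : ∀ᵐ r ∂radialMeasure,
    hC.a0 r = (d : ℝ) ^ 2 / r ^ 2 - ((d : ℝ) ^ 2 / r ^ 2 - (1 - ft r ^ 2)) := by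
  filter_upwards [hC.coeFn_a0] with r hr
  rw [hr]; ring

theorem continuousOn_core_potential (hC : CoreProfile d ft) :
    ContinuousOn (fun r => (d : ℝ) ^ 2 / r ^ 2 - (1 - ft r ^ 2)) (Ioi 0) :=
  (continuousOn_const.div (continuousOn_id.pow 2) fun _ hr => pow_ne_zero 2 (ne_of_gt hr)).sub
    (continuousOn_const.sub (hC.nc.continuousOn.pow 2))

theorem QX_a0_nonneg (u : X) : 0 ≤ QX d hC.a0 u u :=
  QX_nonneg hC.a0_eq hC.nc.isRadialSol hC.continuousOn_core_potential hC.nc.pos u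

theorem eq_zero_of_QX_a0 {u : X} (h : QX d hC.a0 u u = 0) : u = 0 :=
  eq_zero_of_QX_eq_zero hC.a0_eq hC.nc.isRadialSol hC.continuousOn_core_potential hC.nc.pos
    hC.nc.at_infty h

/-- This is the first block of the linearisation at the normal core. That linearisation is positive
definite for every `g > g*`; the choice `g* + 1` is arbitrary, since `g` does not enter the block.
-/
theorem coercive_QX_a0 : ∃ c > 0, ∀ u : X,
    c * ‖u‖ ^ 2 ≤ QX d hC.a0 u u + 2 * ‖hC.T (X.fnL u)‖ ^ 2 := by
  have hg : 0 < gStar ft + 1 := by linarith [hC.gStar_pos]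
  obtain ⟨c, hc, h⟩ := hC.coercive_lin hg 0 fun ζ hζ => by
    rw [lin_self, aa_zero, QZ_apply, QH_eq]
    have h1 := hC.QX_a0_nonneg ζ.1
    have h2 := hC.QH_gStar_nonneg ζ.2
    rw [QH_eq] at h2
    have h3 := sq_nonneg ‖hC.N 0 ζ‖
    by_cases h4 : ζ.2 = 0
    · have h5 : ζ.1 ≠ 0 := fun h5 => hζ (Prod.ext h5 h4)
      have h6 := h1.lt_of_ne fun h7 => h5 (hC.eq_zero_of_QX_a0 h7.symm)
      nlinarith [sq_nonneg ‖H.fnL ζ.2‖]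
    · have := norm_fnL_pos h4
      nlinarith
  refine ⟨c, hc, fun u => ?_⟩
  have h1 := h (u, 0)
  have h2 : hC.N 0 (u, 0) = hC.T (X.fnL u) := by
    rw [N_apply, map_zero, zero_apply, add_zero, T0_apply]
  rw [lin_self, aa_zero, QZ_apply, h2] at h1
  simpa using h1

/-- The only negative term in `m` of the energy. For `r > R` the potential is at most `ε`; for `r ≤
R` the mass is bounded by the quartic term, up to a constant. -/
theorem exists_inner_a0_le {ε : ℝ} (hε : 0 < ε) : ∃ C : ℝ, ∀ z : Z₀,
    inner ℝ hC.a0 (prodH z.2 z.2) ≤ ε * ‖H.fnL z.2‖ ^ 2 + ‖hC.hh z‖ ^ 2 / 8 + C := by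
  obtain ⟨K, hK, h⟩ := hC.one_sub_sq_le
  obtain ⟨R, hR0, hR⟩ : ∃ R : ℝ, 0 < R ∧ ∀ r > R, K / r ^ 2 ≤ ε := by
    refine ⟨Real.sqrt (K / ε), Real.sqrt_pos.2 (by positivity), fun r hr => ?_⟩
    have h1 : K / ε < r ^ 2 := (Real.sqrt_lt' ((Real.sqrt_nonneg _).trans_lt hr)).1 hr
    rw [div_lt_iff₀ hε] at h1
    rw [div_le_iff₀ (by nlinarith)]
    linarith
  refine ⟨3 * R * R, fun z => ?_⟩
  have hi : IntegrableOn ((Ioc 0 R).indicator fun _ : ℝ => 3 * R) (Ioi 0) :=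
    ((integrable_indicator_iff measurableSet_Ioc).2 (integrableOn_const (by simp))).integrableOn
  have hI : ∫ r in Ioi (0 : ℝ), (Ioc 0 R).indicator (fun _ : ℝ => 3 * R) r = 3 * R * R := by
    rw [setIntegral_indicator measurableSet_Ioc, inter_eq_self_of_subset_right Ioc_subset_Ioi_self]
    simp [hR0.le]; ring
  have i1 := (H.integrableOn_fn z.2).const_mul ε
  have i2 := (L2r.integrableOn_sq (hC.hh z)).div_const 8
  rw [inner_prodH_self_eq hC.coeFn_a0, ← H.integral_fn, ← L2r.integral_sq, ← hI,
    ← integral_const_mul, ← integral_div, ← integral_add i1 i2]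
  refine le_trans ?_ (integral_add (i1.add i2) hi).le
  refine integral_mono_ae (integrableOn_mul_sq_ev hC.coeFn_a0 z.2) ((i1.add i2).add hi) ?_
  filter_upwards [ae_restrict_mem measurableSet_Ioi, ae_restrict_of_ae_radial (hC.coeFn_hh z)]
    with r hr h1
  have hr0 : (0 : ℝ) < r := hr
  have h2 := hC.one_sub_sq_pos hr0
  have h3 := sq_nonneg (ev z.2 r)
  simp only [Pi.add_apply]
  by_cases hrR : r ≤ R
  · rw [indicator_of_mem (show r ∈ Ioc 0 R from ⟨hr0, hrR⟩)]
    -- Indeed `m² ≤ hh + f̃² ≤ hh + 1`, and `hh ≤ hh²/8 + 2`.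
    have h4 : ev z.2 r ^ 2 ≤ hC.hh z r ^ 2 / 8 + 3 := by
      nlinarith [sq_nonneg (fz ft z r), sq_nonneg (hC.hh z r - 4)]
    have h5 : (1 - ft r ^ 2) * ev z.2 r ^ 2 ≤ ev z.2 r ^ 2 := by
      nlinarith [mul_nonneg (sq_nonneg (ft r)) h3]
    have h6 : r * ((1 - ft r ^ 2) * ev z.2 r ^ 2) ≤ r * (hC.hh z r ^ 2 / 8 + 3) := by
      gcongr
      linarith
    have h7 : 0 ≤ ε * (r * ev z.2 r ^ 2) := by positivity
    linarith
  · rw [indicator_of_notMem (fun h => hrR h.2), add_zero]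
    have h4 := (h r hr0).trans (hR r (not_le.1 hrR))
    have h5 : (1 - ft r ^ 2) * ev z.2 r ^ 2 ≤ ε * ev z.2 r ^ 2 := by gcongr
    have h6 : r * ((1 - ft r ^ 2) * ev z.2 r ^ 2) ≤ r * (ε * ev z.2 r ^ 2) := by gcongr
    have h7 : 0 ≤ r * hC.hh z r ^ 2 / 8 := by positivity
    linarith

/-- Where `f ≥ 0`, one has `f̃ |u| ≤ (f + f̃) |u| = |f² - f̃²| = |hh - m²|`. -/
theorem norm_T_le {z : Z₀} (hf : ∀ r > 0, 0 ≤ fz ft z r) :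
    ‖hC.T (X.fnL z.1)‖ ≤ ‖hC.hh z‖ + 2 * ‖z.2‖ * ‖z.2‖ := by
  refine le_trans ?_ ((norm_sub_le (hC.hh z) (prodH z.2 z.2)).trans
    (add_le_add_right (norm_prodH_le z.2 z.2) _))
  refine Lp.norm_le_norm_of_ae_le ?_
  filter_upwards [Lp.coeFn_sub (hC.hh z) (prodH z.2 z.2), hC.coeFn_hh z, coeFn_prodH z.2 z.2,
    hC.coeFn_T (X.fnL z.1), ae_eq_ev (inclXH z.1), ae_radial_pos] with r h1 h2 h3 h4 h5 hr
  rw [fnL_inclXH] at h5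
  have hf0 := hf r hr
  have ht := hC.nc.pos r hr
  rw [h1, Pi.sub_apply, h2, h3, h4, h5, Real.norm_eq_abs, Real.norm_eq_abs]
  have e : fz ft z r ^ 2 + ev z.2 r ^ 2 - ft r ^ 2 - ev z.2 r * ev z.2 r
      = (fz ft z r + ft r) * ev (inclXH z.1) r := by
    rw [fz]; ring
  rw [e, abs_mul, abs_mul, abs_of_pos ht, abs_of_pos (by linarith : 0 < fz ft z r + ft r)]
  gcongr
  linarith

/-- With `ε = g₀/2` in `exists_inner_a0_le`, non-positive energy bounds `m` in `H`, `hh` in `L²_r`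
and the form of `u`. Then `f̃ u` is bounded by `norm_T_le`, and `u` by `coercive_QX_a0`. The bound
depends on `g₀` only and deteriorates as `g₀` tends to `0`. -/
theorem exists_norm_le {g₀ : ℝ} (hg₀ : 0 < g₀) : ∃ C : ℝ, ∀ g ≥ g₀, ∀ z : Z₀,
    hC.energy g z ≤ 0 → (∀ r > 0, 0 ≤ fz ft z r) → ‖z‖ ≤ C := by
  obtain ⟨C, hCz⟩ := hC.exists_inner_a0_le (half_pos hg₀)
  obtain ⟨c, hc, hcu⟩ := hC.coercive_QX_a0
  set M := 2 * |C| / min 1 (g₀ / 2) with hM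
  have hmin : 0 < min 1 (g₀ / 2) := lt_min one_pos (half_pos hg₀)
  have hM0 : 0 ≤ M := by positivity
  refine ⟨Real.sqrt ((|C| + 2 * (Real.sqrt (4 * |C|) + 2 * M) ^ 2) / c + M), ?_⟩
  intro g hg z hJ hf
  refine Real.le_sqrt_of_sq_le ?_
  have h1 := hCz z
  have h2 := hC.QX_a0_nonneg z.1
  have h3 := le_abs_self C
  rw [energy, QZ_apply, QH_apply, real_inner_self_eq_norm_sq, real_inner_self_eq_norm_sq] at hJ
  have h4 : g₀ * ‖H.fnL z.2‖ ^ 2 ≤ g * ‖H.fnL z.2‖ ^ 2 := by gcongr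
  have a1 := sq_nonneg ‖H.derL z.2‖
  have a2 := sq_nonneg ‖H.fnL z.2‖
  have a3 := sq_nonneg ‖hC.hh z‖
  have a4 : 0 ≤ g₀ * ‖H.fnL z.2‖ ^ 2 := by positivity
  have h5 : ‖z.2‖ ^ 2 ≤ M := by
    rw [hM, le_div_iff₀ hmin]
    have := coercive_norm_form (g₀ / 2) z.2
    nlinarith
  have h6 : ‖hC.hh z‖ ≤ Real.sqrt (4 * |C|) := Real.le_sqrt_of_sq_le (by nlinarith)
  have h7 : QX d hC.a0 z.1 z.1 ≤ |C| := by nlinarith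
  have h8 := hC.norm_T_le hf
  have h9 : ‖hC.T (X.fnL z.1)‖ ≤ Real.sqrt (4 * |C|) + 2 * M := by nlinarith
  have h10 : ‖hC.T (X.fnL z.1)‖ ^ 2 ≤ (Real.sqrt (4 * |C|) + 2 * M) ^ 2 :=
    pow_le_pow_left₀ (norm_nonneg _) h9 2
  have h11 : ‖z.1‖ ^ 2 ≤ (|C| + 2 * (Real.sqrt (4 * |C|) + 2 * M) ^ 2) / c := by
    rw [le_div_iff₀ hc]
    linarith [hcu z.1]
  linarith [norm_sq_le_prod z]

end CoreProfile

variable {d : ℤ} {ft : ℝ → ℝ}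

/-! ### Positive solutions: non-degeneracy, uniqueness, monotonicity and limits -/

namespace CoreProfile

variable (hC : CoreProfile d ft)

/-- `z` is a weak solution for the parameter `g`, both components of which are positive. -/
structure IsPosSol (g : ℝ) (z : Z₀) : Prop where
  eqn : hC.eqn g z = 0
  f_pos : ∀ r > 0, 0 < fz ft z r
  m_pos : ∀ r > 0, 0 < ev z.2 r

theorem continuousOn_potential_fst (hC : CoreProfile d ft) (z : Z₀) :
    ContinuousOn (fun r => (d : ℝ) ^ 2 / r ^ 2 - az ft z r) (Ioi 0) :=
  (continuousOn_const.div (continuousOn_id.pow 2) fun _ hr => pow_ne_zero 2 (ne_of_gt hr)).sub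
    (hC.continuousOn_az z)

theorem continuousOn_potential_snd (hC : CoreProfile d ft) (g : ℝ) (z : Z₀) :
    ContinuousOn (fun r => g - az ft z r) (Ioi 0) := continuousOn_const.sub (hC.continuousOn_az z)

variable {hC}

theorem eqn_fst_eq_zero {g : ℝ} {z : Z₀} (h : hC.eqn g z = 0) (φ : X) :
    hC.eqn g z (φ, 0) = 0 := by rw [h]; rfl

theorem eqn_snd_eq_zero {g : ℝ} {z : Z₀} (h : hC.eqn g z = 0) (ψ : H) :
    QH g (hC.aa z) z.2 ψ = 0 := by rw [← eqn_snd, h]; rfl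

theorem aa_eq_fst (z : Z₀) : ∀ᵐ r ∂radialMeasure,
    hC.aa z r = (d : ℝ) ^ 2 / r ^ 2 - ((d : ℝ) ^ 2 / r ^ 2 - az ft z r) := by
  filter_upwards [hC.coeFn_aa z] with r hr
  rw [hr]; ring

theorem aa_eq_snd (g : ℝ) (z : Z₀) : ∀ᵐ r ∂radialMeasure,
    hC.aa z r = g - (g - az ft z r) := by
  filter_upwards [hC.coeFn_aa z] with r hr
  rw [hr]; ring

theorem QX_aa_nonneg {g : ℝ} {z : Z₀} (h : hC.eqn g z = 0) (hf : ∀ r > 0, 0 < fz ft z r)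
    (φ : X) : 0 ≤ QX d (hC.aa z) φ φ := by
  obtain ⟨V, hV, -⟩ := hC.exists_radialSol_fst (eqn_fst_eq_zero h)
  exact QX_nonneg (aa_eq_fst z) hV (hC.continuousOn_potential_fst z) hf φ

namespace IsPosSol

theorem QX_nonneg {g : ℝ} {z : Z₀} (h : hC.IsPosSol g z) (φ : X) : 0 ≤ QX d (hC.aa z) φ φ :=
  QX_aa_nonneg h.eqn h.f_pos φ

theorem eq_zero_of_QX {g : ℝ} {z : Z₀} (h : hC.IsPosSol g z) {φ : X}
    (hφ : QX d (hC.aa z) φ φ = 0) : φ = 0 := by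
  obtain ⟨V, hV, -⟩ := hC.exists_radialSol_fst (eqn_fst_eq_zero h.eqn)
  exact eq_zero_of_QX_eq_zero (aa_eq_fst z) hV (hC.continuousOn_potential_fst z) h.f_pos
    (hC.tendsto_fz_atTop z) hφ

theorem QH_nonneg {g : ℝ} {z : Z₀} (h : hC.IsPosSol g z) (ψ : H) :
    0 ≤ QH g (hC.aa z) ψ ψ := by
  obtain ⟨V, hV, -⟩ := exists_radialSol_snd (hC.continuousOn_az z) (hC.coeFn_aa z)
    (eqn_snd_eq_zero h.eqn)
  exact VortexGL.QH_nonneg (aa_eq_snd g z) hV (hC.continuousOn_potential_snd g z) h.m_pos ψ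

theorem eq_smul_of_QH {g : ℝ} {z : Z₀} (h : hC.IsPosSol g z) {ψ : H}
    (hψ : QH g (hC.aa z) ψ ψ = 0) : ∃ k : ℝ, ψ = k • z.2 := by
  obtain ⟨V, hV, -⟩ := exists_radialSol_snd (hC.continuousOn_az z) (hC.coeFn_aa z)
    (eqn_snd_eq_zero h.eqn)
  exact eq_smul_of_QH_eq_zero (aa_eq_snd g z) hV (hC.continuousOn_potential_snd g z) h.m_pos hψ

theorem QZ_nonneg {g : ℝ} {z : Z₀} (h : hC.IsPosSol g z) (ζ : Z₀) :
    0 ≤ QZ d g (hC.aa z) ζ ζ := add_nonneg (h.QX_nonneg _) (h.QH_nonneg _)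

theorem snd_ne_zero {g : ℝ} {z : Z₀} (h : hC.IsPosSol g z) : z.2 ≠ 0 := fun h0 => by
  have := h.m_pos 1 one_pos
  rw [h0, ev_zero one_pos] at this
  exact lt_irrefl _ this

/-- If all terms vanish, then `φ = 0` and `ψ = k m`, the kernels found by Picone; the remaining
square `‖N z ζ‖²` is then that of `m ψ`, which forces `ψ = 0`. -/
theorem lin_pos {g : ℝ} {z : Z₀} (h : hC.IsPosSol g z) {ζ : Z₀} (hζ : ζ ≠ 0) :
    0 < hC.lin g z ζ ζ := by
  rw [lin_self, QZ_apply]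
  have h1 := h.QX_nonneg ζ.1
  have h2 := h.QH_nonneg ζ.2
  have h3 := sq_nonneg ‖hC.N z ζ‖
  refine lt_of_le_of_ne (by positivity) fun h0 => hζ ?_
  have e1 : ζ.1 = 0 := h.eq_zero_of_QX (by linarith)
  obtain ⟨k, hk⟩ := h.eq_smul_of_QH (ψ := ζ.2) (by linarith)
  have e2 : hC.N z ζ = 0 := by
    rw [← norm_eq_zero, ← sq_eq_zero_iff]; linarith
  have e3 : prodH z.2 ζ.2 = 0 := by
    simpa [N_apply, T0_apply, dotZ_apply, e1] using e2
  refine Prod.ext e1 (eq_zero_of_ev fun r hr => ?_)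
  have hc : ContinuousOn (fun r => ev z.2 r * ev ζ.2 r) (Ioi 0) :=
    (continuousOn_ev _).mul (continuousOn_ev _)
  have e4 := eq_of_ae_eq_of_continuousOn hc (continuousOn_const (c := 0)) (by
    apply ae_restrict_of_ae_radial
    filter_upwards [coeFn_prodH z.2 ζ.2, Lp.coeFn_zero ℝ 2 radialMeasure] with r h4 h5
    rw [← h4, e3, h5]; rfl) hr
  exact (mul_eq_zero.1 e4).resolve_left (h.m_pos r hr).ne'

theorem coercive {g : ℝ} (hg : 0 < g) {z : Z₀} (h : hC.IsPosSol g z) :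
    ∃ c > 0, ∀ ζ, c * ‖ζ‖ ^ 2 ≤ hC.lin g z ζ ζ :=
  hC.coercive_lin hg z fun _ hζ => h.lin_pos hζ

/-- For equal `g` every term of `two_solution_identity` is non-negative, hence zero: `f₁ = f₂`, and
`f² + m²` is the same for both, so `m₁ = m₂` by positivity. -/
theorem unique {g : ℝ} {z₁ z₂ : Z₀} (h₁ : hC.IsPosSol g z₁) (h₂ : hC.IsPosSol g z₂) :
    z₁ = z₂ := by
  have h := hC.two_solution_identity h₁.eqn h₂.eqn
  rw [sub_self, zero_mul, add_zero, QZ_apply, QZ_apply] at h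
  have a1 := h₁.QX_nonneg (z₁ - z₂).1
  have a2 := h₂.QX_nonneg (z₁ - z₂).1
  have a3 := h₁.QH_nonneg (z₁ - z₂).2
  have a4 := h₂.QH_nonneg (z₁ - z₂).2
  have a5 := sq_nonneg ‖hC.hh z₁ - hC.hh z₂‖
  have e1 : (z₁ - z₂).1 = 0 := h₁.eq_zero_of_QX (by linarith)
  have e1' : z₁.1 = z₂.1 := sub_eq_zero.1 e1
  have e2 : hC.hh z₁ - hC.hh z₂ = 0 := by
    rw [← norm_eq_zero, ← sq_eq_zero_iff]; linarith
  refine Prod.ext e1' (ext_ev fun r hr => ?_)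
  have hc : ∀ z : Z₀, ContinuousOn (fun r => ev z.2 r ^ 2) (Ioi 0) :=
    fun z => (continuousOn_ev _).pow 2
  have e3 := eq_of_ae_eq_of_continuousOn (hc z₁) (hc z₂) (by
    apply ae_restrict_of_ae_radial
    filter_upwards [hC.coeFn_hh z₁, hC.coeFn_hh z₂] with r h3 h4
    rw [sub_eq_zero.1 e2, h4] at h3
    simp only [fz, e1'] at h3
    linarith) hr
  exact (pow_left_inj₀ (h₁.m_pos r hr).le (h₂.m_pos r hr).le two_ne_zero).1 e3

/-- Comparison with the normal core at `g*`, where the form `QH` is non-negative as well. For `g ≥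
g*` all terms of the identity would have the same sign, and `m` would vanish. -/
theorem lt_gStar {g : ℝ} {z : Z₀} (h : hC.IsPosSol g z) : g < gStar ft := by
  by_contra hcon
  have h0 := hC.two_solution_identity h.eqn (hC.eqn_zero (gStar ft))
  rw [sub_zero, hh_zero, sub_zero, aa_zero, QZ_apply, QZ_apply] at h0
  simp only [Prod.snd_zero, map_zero, norm_zero] at h0
  have a1 := h.QX_nonneg z.1
  have a2 := h.QH_nonneg z.2
  have a3 := hC.QX_a0_nonneg z.1
  have a4 := hC.QH_gStar_nonneg z.2
  have a5 := sq_nonneg ‖hC.hh z‖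
  have a6 : 0 ≤ (g - gStar ft) * (‖H.fnL z.2‖ ^ 2 - 0 ^ 2) :=
    mul_nonneg (by linarith) (by nlinarith [sq_nonneg ‖H.fnL z.2‖])
  have e1 : z.1 = 0 := h.eq_zero_of_QX (by linarith)
  have e2 : hC.hh z = 0 := by
    rw [← norm_eq_zero, ← sq_eq_zero_iff]; linarith
  have hc : ContinuousOn (fun r => ev z.2 r ^ 2) (Ioi 0) := (continuousOn_ev _).pow 2
  have e3 := eq_of_ae_eq_of_continuousOn hc (continuousOn_const (c := 0)) (by
    apply ae_restrict_of_ae_radial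
    filter_upwards [hC.coeFn_hh z, Lp.coeFn_zero ℝ 2 radialMeasure, ae_radial_pos] with r h3 h4 hr
    rw [e2, h4] at h3
    simp only [fz, e1, map_zero, ev_zero hr, Pi.zero_apply] at h3
    linarith) (mem_Ioi.2 (one_pos (α := ℝ)))
  have := h.m_pos 1 one_pos
  simp only [ne_eq, OfNat.ofNat_ne_zero, not_false_eq_true, pow_eq_zero_iff] at e3
  linarith

/-- In `two_solution_identity` only the term `(g₁ - g₂)(‖m₁‖² - ‖m₂‖²)` can be negative, and it has
to compensate the others. -/
theorem norm_mono {g₁ g₂ : ℝ} {z₁ z₂ : Z₀} (h₁ : hC.IsPosSol g₁ z₁) (h₂ : hC.IsPosSol g₂ z₂)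
    (hg : g₁ ≤ g₂) : ‖H.fnL z₂.2‖ ≤ ‖H.fnL z₁.2‖ := by
  rcases hg.eq_or_lt with rfl | hg
  · rw [h₁.unique h₂]
  have h := hC.two_solution_identity h₁.eqn h₂.eqn
  have a1 := h₁.QZ_nonneg (z₁ - z₂)
  have a2 := h₂.QZ_nonneg (z₁ - z₂)
  have a3 := sq_nonneg ‖hC.hh z₁ - hC.hh z₂‖
  have a4 : ‖H.fnL z₂.2‖ ^ 2 ≤ ‖H.fnL z₁.2‖ ^ 2 := by
    by_contra hcon
    push Not at hcon
    nlinarith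
  exact (pow_le_pow_iff_left₀ (norm_nonneg _) (norm_nonneg _) two_ne_zero).1 a4

/-- By `energy_add` a positive solution has at most the energy of the normal core, which is `0`. -/
theorem energy_nonpos {g : ℝ} {z : Z₀} (h : hC.IsPosSol g z) : hC.energy g z ≤ 0 := by
  have h1 := hC.energy_add g z (-z)
  have h2 := h.QZ_nonneg (-z)
  have h3 : hC.energy g 0 = 0 := by simp [energy, hh_zero]
  rw [add_neg_cancel, h3, h.eqn, zero_apply] at h1
  have := sq_nonneg ‖hC.hh 0 - hC.hh z‖
  linarith

end IsPosSol

theorem f_pos_of_nonneg {g : ℝ} {z : Z₀} (h : hC.eqn g z = 0) (hf : ∀ r > 0, 0 ≤ fz ft z r) :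
    ∀ r > 0, 0 < fz ft z r := by
  obtain ⟨V, hV, -⟩ := hC.exists_radialSol_fst (eqn_fst_eq_zero h)
  refine hV.pos (hC.continuousOn_potential_fst z) hf ?_
  obtain ⟨r, h1, h2⟩ := (((hC.tendsto_fz_atTop z).eventually (lt_mem_nhds one_pos)).and
    (eventually_gt_atTop 0)).exists
  exact ⟨r, h2, h1.ne'⟩

theorem m_pos_of_nonneg {g : ℝ} {κ : L2r} {k : ℝ → ℝ} (hk : ContinuousOn k (Ioi 0))
    (hκ : ∀ᵐ r ∂radialMeasure, κ r = k r) {m : H} (h : ∀ ψ, QH g κ m ψ = 0)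
    (hm : ∀ r > 0, 0 ≤ ev m r) (hm0 : m ≠ 0) : ∀ r > 0, 0 < ev m r := by
  obtain ⟨V, hV, -⟩ := exists_radialSol_snd hk hκ h
  refine hV.pos (continuousOn_const.sub hk) hm ?_
  by_contra hcon
  push Not at hcon
  exact hm0 (eq_zero_of_ev hcon)

/-- The a priori bound gives a weak limit that solves the limiting problem, with `f > 0` and `m ≥
0`. What has to be excluded is `m = 0`; here the sequence lies above `g'` and below its first term,
and monotonicity of the mass keeps `‖m_n‖` away from `0`. -/
theorem exists_isPosSol_of_tendsto {g' : ℝ} (hg' : 0 < g') {g : ℕ → ℝ} {x : ℕ → Z₀}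
    (hx : ∀ n, hC.IsPosSol (g n) (x n)) (hg : Tendsto g atTop (𝓝 g')) (hle : ∀ n, g' ≤ g n)
    (hle0 : ∀ n, g n ≤ g 0) : ∃ z, hC.IsPosSol g' z := by
  obtain ⟨C, hCz⟩ := hC.exists_norm_le hg'
  have hxC : ∀ n, ‖x n‖ ≤ C := fun n =>
    hCz (g n) (hle n) (x n) (hx n).energy_nonpos fun r hr => ((hx n).f_pos r hr).le
  obtain ⟨z, φ, hφ, hz⟩ := weakCompactBalls_prod weakCompactBalls_X weakCompactBalls_H x C hxC
  have heq : hC.eqn g' z = 0 := hC.eqn_of_weakTendsto hz (fun n => hxC _)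
    (hg.comp hφ.tendsto_atTop) fun n => (hx _).eqn
  have hf : ∀ r > 0, 0 < fz ft z r := by
    refine f_pos_of_nonneg heq fun r hr => ?_
    exact ge_of_tendsto' (((hz.fst.map inclXH).ev hr).const_add (ft r))
      fun n => ((hx (φ n)).f_pos r hr).le
  have hm0 : ∀ r > 0, 0 ≤ ev z.2 r := fun r hr =>
    ge_of_tendsto' (hz.snd.ev hr) fun n => ((hx (φ n)).m_pos r hr).le
  by_cases hz2 : z.2 = 0
  · exfalso
    have h1 := hC.two_solution_identity heq (hC.eqn_zero g')
    rw [sub_zero, hh_zero, sub_zero, aa_zero, sub_self, zero_mul, add_zero, QZ_apply, QZ_apply,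
      hz2] at h1
    simp only [map_zero, add_zero] at h1
    have h2 := QX_aa_nonneg heq hf z.1
    have h3 := hC.QX_a0_nonneg z.1
    have h4 := sq_nonneg ‖hC.hh z‖
    have e1 : z.1 = 0 := hC.eq_zero_of_QX_a0 (by linarith)
    obtain ⟨C', -, hC'⟩ := exists_norm_incl_le hxC
    have h5 := tendsto_inner_prodH_self hz.snd (fun n => hC' (φ n)) hC.a0
    rw [hz2, map_zero, inner_zero_right] at h5
    have hδ := norm_fnL_pos (hx 0).snd_ne_zero
    have hmin : 0 < min 1 g' := lt_min one_pos hg'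
    -- Comparing each `x_n` with the normal core at `g'` gives `QH g' a0 ≤ 0` at `m_n`, so the
    -- weakly continuous term with kernel `a0` dominates the norm and cannot tend to `0`.
    have h6 : ∀ n, min 1 g' * ‖H.fnL (x 0).2‖ ^ 2
        ≤ inner ℝ hC.a0 (prodH (x (φ n)).2 (x (φ n)).2) := fun n => by
      have h7 := hC.two_solution_identity (hx (φ n)).eqn (hC.eqn_zero g')
      rw [sub_zero, hh_zero, sub_zero, aa_zero, QZ_apply, QZ_apply, QH_apply g'] at h7
      simp only [Prod.snd_zero, map_zero, norm_zero, real_inner_self_eq_norm_sq] at h7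
      have a1 := (hx (φ n)).QX_nonneg (x (φ n)).1
      have a2 := (hx (φ n)).QH_nonneg (x (φ n)).2
      have a3 := hC.QX_a0_nonneg (x (φ n)).1
      have a4 := sq_nonneg ‖hC.hh (x (φ n))‖
      have a5 := coercive_norm_form g' (x (φ n)).2
      have a6 := (hx (φ n)).norm_mono (hx 0) (hle0 _)
      have a7 : ‖H.fnL (x 0).2‖ ^ 2 ≤ ‖H.fnL (x (φ n)).2‖ ^ 2 :=
        pow_le_pow_left₀ (norm_nonneg _) a6 2
      have a8 : 0 ≤ (g (φ n) - g') * (‖H.fnL (x (φ n)).2‖ ^ 2 - 0 ^ 2) :=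
        mul_nonneg (by linarith [hle (φ n)]) (by nlinarith [sq_nonneg ‖H.fnL (x (φ n)).2‖])
      have a9 : ‖H.fnL (x (φ n)).2‖ ^ 2 ≤ ‖(x (φ n)).2‖ ^ 2 := by
        rw [H.norm_sq]; linarith [sq_nonneg ‖H.derL (x (φ n)).2‖]
      have a10 := mul_le_mul_of_nonneg_left (a7.trans a9) hmin.le
      linarith
    have h8 : min 1 g' * ‖H.fnL (x 0).2‖ ^ 2 ≤ 0 := ge_of_tendsto' h5 h6
    have : 0 < min 1 g' * ‖H.fnL (x 0).2‖ ^ 2 := by positivity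
    linarith
  · exact ⟨z, heq, hf, m_pos_of_nonneg (hC.continuousOn_az z) (hC.coeFn_aa z)
      (eqn_snd_eq_zero heq) hm0 hz2⟩

/-- Elements of `X` are bounded by their norm, so `f` stays positive for `r ≥ 1/2`. On `(0, 1/2)`
the repulsion `d²/r² > 1 ≥ 1 - f² - m²` excludes a negative minimum. -/
theorem exists_f_pos_of_near {z₀ : Z₀} (h₀ : ∀ r > 0, 0 < fz ft z₀ r) : ∃ δ > 0, ∀ g z,
    hC.eqn g z = 0 → ‖z - z₀‖ < δ → ∀ r > 0, 0 < fz ft z r := by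
  obtain ⟨R, hR⟩ : ∃ R, ∀ r ≥ R, (1 / 2 : ℝ) < fz ft z₀ r := eventually_atTop.1
    ((hC.tendsto_fz_atTop z₀).eventually (lt_mem_nhds (by norm_num)))
  obtain ⟨x, hx, hmin⟩ := (isCompact_Icc (a := (1 / 2 : ℝ)) (b := max R 1)).exists_isMinOn
    ⟨1, by constructor <;> norm_num⟩ ((hC.continuousOn_fz z₀).mono fun r hr => by
      have : (1 / 2 : ℝ) ≤ r := hr.1
      exact lt_of_lt_of_le (by norm_num) this)
  have hx0 : 0 < x := lt_of_lt_of_le (by norm_num) hx.1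
  refine ⟨min (1 / 2) (fz ft z₀ x), lt_min (by norm_num) (h₀ x hx0), fun g z hz hδ => ?_⟩
  have h1 : ∀ r ≥ 1 / 2, 0 < fz ft z r := fun r hr => by
    have hr0 : 0 < r := lt_of_lt_of_le (by norm_num) hr
    have h2 : min (1 / 2) (fz ft z₀ x) ≤ fz ft z₀ r := by
      by_cases h : r ≤ max R 1
      · exact (min_le_right _ _).trans (hmin ⟨hr, h⟩)
      · exact (min_le_left _ _).trans (hR r ((le_max_left _ _).trans (not_le.1 h).le)).le
    have h3 : |ev (inclXH (z - z₀).1) r| ≤ ‖z - z₀‖ :=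
      (X.abs_ev_le _ hr0).trans (norm_fst_le _)
    rw [Prod.fst_sub, map_sub, ev_sub _ _ hr0] at h3
    have h4 := (abs_le.1 h3).1
    have h5 : fz ft z r - fz ft z₀ r = ev (inclXH z.1) r - ev (inclXH z₀.1) r := by
      simp only [fz]; ring
    linarith
  refine f_pos_of_nonneg hz fun p hp => ?_
  by_contra hneg
  push Not at hneg
  have hp2 : p < 1 / 2 := by
    by_contra h
    exact absurd (h1 p (not_lt.1 h)) (not_lt.2 hneg.le)
  obtain ⟨V, hV, -⟩ := hC.exists_radialSol_fst (eqn_fst_eq_zero hz)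
  have ht : Tendsto (fz ft z) (𝓝[>] 0) (𝓝 0) := by
    have h := hC.nc.tendsto_zero.add (X.tendsto_ev_zero z.1)
    rwa [add_zero] at h
  obtain ⟨a, ⟨h2, h3⟩, ha⟩ := (((ht.eventually (lt_mem_nhds hneg)).and
    (mem_nhdsWithin_of_mem_nhds (gt_mem_nhds hp) : ∀ᶠ r in 𝓝[>] (0 : ℝ), r < p)).and
    self_mem_nhdsWithin).exists
  obtain ⟨y, hy, h4, h5⟩ := exists_min_point hV.hasDerivAt hV.hasDerivAt' ha h3 hp2 h2
    (hneg.trans (h1 _ le_rfl))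
  have hy0 : 0 < y := lt_trans ha hy.1
  have h6 : fz ft z y < 0 := h4.trans_lt hneg
  have h7 : 1 < (d : ℝ) ^ 2 / y ^ 2 := by
    rw [lt_div_iff₀ (by positivity)]
    nlinarith [one_le_sq_int hC.ne, hy.2]
  have h8 : az ft z y ≤ 1 := by
    rw [az]; nlinarith [sq_nonneg (fz ft z y), sq_nonneg (ev z.2 y)]
  have h9 : y * (((d : ℝ) ^ 2 / y ^ 2 - az ft z y) * fz ft z y) < 0 :=
    mul_neg_of_pos_of_neg hy0 (mul_neg_of_pos_of_neg (by linarith) h6)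
  linarith

/-- Closeness in `H` gives no uniform pointwise control, so positivity is obtained from the form.
Twice the negative part, `n = |m| - m`, satisfies `QH g κ n n ≤ 0` and `0 ≤ ⟨y, n⟩ ≤ ‖y - m‖ ‖n‖`,
because `⟨m, n⟩ ≤ 0`. Coercivity modulo the direction of `y` then forces `n = 0`. -/
theorem exists_m_nonneg_of_near {g₀ : ℝ} {κ₀ : L2r} {y : H} {c : ℝ} (hc : 0 < c)
    (hy : ∀ r > 0, 0 < ev y r) (hco : ∀ ψ : H, c * ‖ψ‖ ^ 2
      ≤ QH g₀ κ₀ ψ ψ + inner ℝ (H.fnL y) (H.fnL ψ) ^ 2) :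
    ∃ δ > 0, ∀ g κ, ∀ m : H, |g - g₀| < δ → ‖κ - κ₀‖ < δ → ‖m - y‖ < δ →
      (∀ ψ, QH g κ m ψ = 0) → ∀ r > 0, 0 ≤ ev m r := by
  -- The perturbations of `g` and `κ` cost at most `δ` and `2 δ`, the inner product with `y` another
  -- `δ` (for `δ ≤ 1`): altogether `4c/5 < c`.
  refine ⟨min 1 (c / 5), lt_min one_pos (by positivity), fun g κ m hg hκ hm h => ?_⟩
  obtain ⟨v, hv, hvd⟩ := H.exists_abs m
  set n := v - m with hn
  have hev : ∀ r > 0, ev n r = |ev m r| - ev m r := fun r hr => by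
    rw [hn, ev_sub _ _ hr, hv r hr]
  have hv2 : ∀ r > 0, ev v r ^ 2 = ev m r ^ 2 := fun r hr => by rw [hv r hr, sq_abs]
  have hvn : ‖H.fnL v‖ ^ 2 = ‖H.fnL m‖ ^ 2 := by
    rw [← H.integral_fn, ← H.integral_fn]
    exact setIntegral_congr_fun measurableSet_Ioi fun r hr => by simp only [hv2 r hr]
  have hr : ∀ᵐ r ∂radialMeasure, κ r = κ r := ae_of_all _ fun _ => rfl
  have hva : inner ℝ κ (prodH v v) = inner ℝ κ (prodH m m) := by
    rw [inner_prodH_self_eq hr, inner_prodH_self_eq hr]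
    exact setIntegral_congr_fun measurableSet_Ioi fun r hr => by simp only [hv2 r hr]
  have hvQ : QH g κ v v ≤ 0 := by
    rw [← h m, QH_apply, QH_apply, hva]
    simp only [real_inner_self_eq_norm_sq, hvn]
    have := pow_le_pow_left₀ (norm_nonneg _) hvd 2
    linarith
  -- As `m` is a null solution, the mixed terms vanish and the form at `|m| - m` equals that at
  -- `|m|`, which does not exceed that at `m`.
  have hnQ : QH g κ n n ≤ 0 := by
    have : QH g κ n n = QH g κ v v - 2 * QH g κ m v + QH g κ m m := by
      rw [hn]
      simp only [map_sub, sub_apply, QH_symm g κ v m]; ring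
    rw [this, h, h]; linarith
  have hfn : ‖H.fnL n‖ ^ 2 ≤ ‖n‖ ^ 2 := by
    rw [H.norm_sq]; nlinarith [sq_nonneg ‖H.derL n‖]
  have hpert : QH g₀ κ₀ n n ≤ 3 * min 1 (c / 5) * ‖n‖ ^ 2 := by
    have e1 : QH g₀ κ₀ n n = QH g κ n n - (g - g₀) * ‖H.fnL n‖ ^ 2
        + inner ℝ (κ - κ₀) (prodH n n) := by
      simp only [QH_apply, inner_sub_left, real_inner_self_eq_norm_sq]; ring
    have e2 : |inner ℝ (κ - κ₀) (prodH n n)| ≤ min 1 (c / 5) * (2 * ‖n‖ * ‖n‖) :=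
      (abs_real_inner_le_norm _ _).trans (mul_le_mul hκ.le (norm_prodH_le n n) (norm_nonneg _)
        (lt_min one_pos (by positivity)).le)
    have e3 := (abs_le.1 e2).2
    have e4 := (abs_lt.1 hg).1
    have e5 : 0 < min 1 (c / 5) := lt_min one_pos (by positivity)
    have e6 : -(g - g₀) * ‖H.fnL n‖ ^ 2 ≤ min 1 (c / 5) * ‖n‖ ^ 2 :=
      (mul_le_mul_of_nonneg_right (by linarith) (sq_nonneg _)).trans
        (mul_le_mul_of_nonneg_left hfn e5.le)
    nlinarith
  have hin0 : 0 ≤ inner ℝ (H.fnL y) (H.fnL n) := by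
    rw [inner_eq_setIntegral (ae_eq_ev y) (ae_eq_ev n)]
    refine setIntegral_nonneg measurableSet_Ioi fun r hr => ?_
    rw [hev r hr]
    have hr0 : (0 : ℝ) < r := hr
    have := le_abs_self (ev m r)
    exact mul_nonneg hr0.le (mul_nonneg (hy r hr).le (by linarith))
  have hin1 : inner ℝ (H.fnL m) (H.fnL n) ≤ 0 := by
    rw [inner_eq_setIntegral (ae_eq_ev m) (ae_eq_ev n)]
    refine setIntegral_nonpos measurableSet_Ioi fun r hr => ?_
    rw [hev r hr]
    have hr0 : (0 : ℝ) < r := hr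
    refine mul_nonpos_of_nonneg_of_nonpos hr0.le ?_
    rcases abs_cases (ev m r) with h | h <;> rw [h.1] <;> nlinarith
  have hin2 : inner ℝ (H.fnL y) (H.fnL n) ≤ min 1 (c / 5) * ‖n‖ := by
    have e1 : inner ℝ (H.fnL (y - m)) (H.fnL n) ≤ ‖y - m‖ * ‖n‖ := by
      have e2 : ∀ w : H, ‖H.fnL w‖ ≤ ‖w‖ := fun w => by
        refine (pow_le_pow_iff_left₀ (norm_nonneg _) (norm_nonneg _) two_ne_zero).1 ?_
        rw [H.norm_sq]; nlinarith [sq_nonneg ‖H.derL w‖]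
      exact (real_inner_le_norm _ _).trans (mul_le_mul (e2 _) (e2 _) (norm_nonneg _)
        (norm_nonneg _))
    rw [map_sub, inner_sub_left] at e1
    rw [norm_sub_rev] at e1
    have := mul_le_mul_of_nonneg_right hm.le (norm_nonneg n)
    linarith
  have hin3 : inner ℝ (H.fnL y) (H.fnL n) ^ 2 ≤ min 1 (c / 5) * ‖n‖ ^ 2 := by
    have e1 := pow_le_pow_left₀ hin0 hin2 2
    have e2 : 0 < min 1 (c / 5) := lt_min one_pos (by positivity)
    have e3 : min 1 (c / 5) ≤ 1 := min_le_left _ _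
    rw [mul_pow] at e1
    refine e1.trans ?_
    gcongr
    nlinarith
  have hn0 : ‖n‖ ^ 2 ≤ 0 := by
    have e1 := hco n
    have e2 : min 1 (c / 5) ≤ c / 5 := min_le_right _ _
    have e3 : min 1 (c / 5) * ‖n‖ ^ 2 ≤ c / 5 * ‖n‖ ^ 2 := by gcongr
    nlinarith [sq_nonneg ‖n‖]
  have hn1 : n = 0 := by
    rw [← norm_eq_zero, ← sq_eq_zero_iff]
    exact le_antisymm hn0 (sq_nonneg _)
  intro r hr
  have := hev r hr
  rw [hn1, ev_zero hr] at this
  have h2 := abs_nonneg (ev m r)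
  linarith

end CoreProfile

variable {d : ℤ} {ft : ℝ → ℝ}

/-! ### Local continuation of positive solutions by the implicit function theorem -/

theorem hasDerivAt_cubic {E : Type*} [NormedAddCommGroup E] [NormedSpace ℝ E] {F : ℝ → E}
    {A L B D : E} (h : ∀ t, F t = A + t • L + t ^ 2 • B + t ^ 3 • D) : HasDerivAt F L 0 := by
  have h1 : HasDerivAt (fun t : ℝ => A + t • L + t ^ 2 • B + t ^ 3 • D)
      (((1 : ℝ) • L + ((2 : ℕ) * (0 : ℝ) ^ 1) • B) + ((3 : ℕ) * (0 : ℝ) ^ 2) • D) 0 :=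
    ((((hasDerivAt_id (0 : ℝ)).smul_const L).const_add A).add
      ((hasDerivAt_pow 2 (0 : ℝ)).smul_const B)).add ((hasDerivAt_pow 3 (0 : ℝ)).smul_const D)
  rw [show F = _ from funext h]
  simpa using h1

theorem contDiff_cubic_form {E F : Type*} [NormedAddCommGroup E] [NormedSpace ℝ E]
    [NormedAddCommGroup F] [NormedSpace ℝ F] (q m : E →L[ℝ] E →L[ℝ] ℝ) (T : E →L[ℝ] F)
    (D : E →L[ℝ] E →L[ℝ] F) (b : F →L[ℝ] F →L[ℝ] ℝ) : ContDiff ℝ 1 fun p : ℝ × E =>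
      (q p.2 + p.1 • m p.2) + (b ((2 : ℝ) • T p.2 + D p.2 p.2)).comp (T + D p.2) := by
  have h1 : ContDiff ℝ 1 fun p : ℝ × E => q p.2 + p.1 • m p.2 := by fun_prop
  have h2 : ContDiff ℝ 1 fun p : ℝ × E => b ((2 : ℝ) • T p.2 + D p.2 p.2) := by fun_prop
  have h3 : ContDiff ℝ 1 fun p : ℝ × E => T + D p.2 := by fun_prop
  exact h1.add (h2.clm_comp h3)

/-- A non-negative form whose kernel lies in the line of `y` becomes positive definite after adding
the square of the pairing with `y`; this rank-one term is weakly continuous, so coercivity follows.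
-/
theorem coercive_QH_of_ker {g : ℝ} (hg : 0 < g) {κ : L2r} {y : H} (hy : y ≠ 0)
    (hnn : ∀ ψ, 0 ≤ QH g κ ψ ψ) (hker : ∀ ψ, QH g κ ψ ψ = 0 → ∃ k : ℝ, ψ = k • y) :
    ∃ c > 0, ∀ ψ : H, c * ‖ψ‖ ^ 2 ≤ QH g κ ψ ψ + inner ℝ (H.fnL y) (H.fnL ψ) ^ 2 := by
  have hB : ∀ w, QH g 0 w w = ‖H.derL w‖ ^ 2 + g * ‖H.fnL w‖ ^ 2 := fun w => by
    rw [QH_apply, real_inner_self_eq_norm_sq, real_inner_self_eq_norm_sq, inner_zero_left,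
      sub_zero]
  set K : H → ℝ := fun w => inner ℝ κ (prodH w w) - ip (H.fnL y) (H.fnL w) ^ 2 with hK
  have hQ : ∀ w, QH g κ w w + inner ℝ (H.fnL y) (H.fnL w) ^ 2 = QH g 0 w w - K w := fun w => by
    simp only [QH_apply, inner_zero_left, hK, ip_apply]; ring
  obtain ⟨c, hc, hcw⟩ := coercive_of_pos weakCompactBalls_H (QH g 0) (QH_symm g 0)
    (lt_min one_pos hg) (fun w => (coercive_norm_form g w).trans_eq (hB w).symm) K
    (fun t w => by
      simp only [hK, map_smul, smul_apply, smul_eq_mul, inner_smul_right]; ring)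
    (fun x y' C hx hxC => (CoreProfile.tendsto_inner_prodH_self hx hxC κ).sub
      (((hx.map H.fnL) (ip (H.fnL y))).pow 2)) (fun w hw => by
      rw [← hQ]
      refine lt_of_le_of_ne (add_nonneg (hnn w) (sq_nonneg _)) fun h0 => hw ?_
      have h1 := hnn w
      have h2 := sq_nonneg (inner ℝ (H.fnL y) (H.fnL w))
      obtain ⟨k, rfl⟩ := hker w (by linarith)
      have h3 : inner ℝ (H.fnL y) (H.fnL (k • y)) = 0 := by
        rw [← sq_eq_zero_iff]; linarith
      rw [map_smul, inner_smul_right, real_inner_self_eq_norm_sq] at h3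
      have h4 := norm_fnL_pos hy
      rcases mul_eq_zero.1 h3 with h5 | h5
      · rw [h5, zero_smul]
      · exact absurd h5 (by positivity))
  exact ⟨c, hc, fun w => (hcw w).trans_eq (hQ w).symm⟩

/-- The bilinear form `(z, ζ) ↦ ∫ z₂ ζ₂ r dr` on `Z₀`. -/
def massZ : Z₀ →L[ℝ] Z₀ →L[ℝ] ℝ :=
  ip.bilinearComp (H.fnL.comp (ContinuousLinearMap.snd ℝ X H))
    (H.fnL.comp (ContinuousLinearMap.snd ℝ X H))

namespace CoreProfile

variable (hC : CoreProfile d ft)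

theorem contDiff_hh : ContDiff ℝ 1 hC.hh :=
  (hC.T0.contDiff.const_smul (2 : ℝ)).add (dotZ.contDiff.clm_apply contDiff_id)

theorem QZ_eq_add_mass (g : ℝ) (z : Z₀) :
    QZ d g hC.a0 z = QZ d 0 hC.a0 z + g • massZ z := by
  refine ContinuousLinearMap.ext fun ζ => ?_
  rw [add_apply, smul_apply]
  change _ = _ + g * inner ℝ (H.fnL z.2) (H.fnL ζ.2)
  simp only [QZ_apply, QH_apply]; ring

theorem contDiff_eqn : ContDiff ℝ 1 fun p : ℝ × Z₀ => hC.eqn p.1 p.2 := by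
  have h1 : (fun p : ℝ × Z₀ => hC.eqn p.1 p.2) = fun p : ℝ × Z₀ =>
      (QZ d 0 hC.a0 p.2 + p.1 • massZ p.2) + (ip (hC.hh p.2)).comp (hC.T0 + dotZ p.2) := by
    funext p
    rw [← QZ_eq_add_mass]; rfl
  rw [h1]
  exact contDiff_cubic_form _ massZ hC.T0 dotZ ip

/-- Along a line the equation is a cubic polynomial in `t`, and the linearisation is its linear
coefficient. -/
theorem hasDerivAt_eqn (g : ℝ) (z v : Z₀) :
    HasDerivAt (fun t : ℝ => hC.eqn g (z + t • v)) (hC.lin g z v) 0 := by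
  refine hasDerivAt_cubic (A := hC.eqn g z)
    (B := (2 : ℝ) • (ip (hC.N z v)).comp (dotZ v) + (ip (dotZ v v)).comp (hC.N z))
    (D := (ip (dotZ v v)).comp (dotZ v)) fun t => ?_
  refine ContinuousLinearMap.ext fun ζ => ?_
  simp only [add_apply, smul_apply, ContinuousLinearMap.comp_apply, ip_apply, eqn_apply, lin_apply,
    hh_add, aa, QZ_sub, N_apply, map_add, map_smul, inner_add_left, inner_add_right,
    inner_smul_left, inner_smul_right, conj_trivial, smul_eq_mul]
  ring

variable {hC}

/-- Coercivity of the linearisation makes it invertible. The zeros produced by the implicit function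
theorem are positive for nearby `g` by the two perturbation lemmas, followed by the strong maximum
principle. -/
theorem IsPosSol.exists_branch {g₀ : ℝ} (hg₀ : 0 < g₀) {z₀ : Z₀} (h : hC.IsPosSol g₀ z₀) :
    ∃ ζ : ℝ → Z₀, ContDiffAt ℝ 1 ζ g₀ ∧ ζ g₀ = z₀ ∧ ∀ᶠ g in 𝓝 g₀, hC.IsPosSol g (ζ g) := by
  obtain ⟨c, hc, hcl⟩ := h.coercive hg₀
  obtain ⟨ζ, h1, h2, h3⟩ := exists_implicit hC.contDiff_eqn h.eqn (hC.lin g₀ z₀)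
    (hC.hasDerivAt_eqn g₀ z₀) (bijective_of_coercive_prod _ hc hcl)
  refine ⟨ζ, h1, h2, ?_⟩
  obtain ⟨δ, hδ, hf⟩ := exists_f_pos_of_near (hC := hC) h.f_pos
  obtain ⟨c', hc', hco⟩ := coercive_QH_of_ker hg₀ h.snd_ne_zero h.QH_nonneg
    fun ψ hψ => h.eq_smul_of_QH hψ
  obtain ⟨δ', hδ', hm⟩ := exists_m_nonneg_of_near hc' h.m_pos hco
  have hcont : Tendsto ζ (𝓝 g₀) (𝓝 z₀) := by
    have := h1.continuousAt.tendsto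
    rwa [h2] at this
  have e1 : ∀ᶠ g in 𝓝 g₀, ‖ζ g - z₀‖ < δ := by
    have := (tendsto_iff_norm_sub_tendsto_zero.1 hcont).eventually (gt_mem_nhds hδ)
    exact this
  have e2 : ∀ᶠ g in 𝓝 g₀, ‖(ζ g).2 - z₀.2‖ < δ' :=
    (tendsto_iff_norm_sub_tendsto_zero.1 ((continuous_snd.tendsto z₀).comp hcont)).eventually
      (gt_mem_nhds hδ')
  have e3 : ∀ᶠ g in 𝓝 g₀, ‖hC.aa (ζ g) - hC.aa z₀‖ < δ' := by
    have hca : Continuous hC.aa := continuous_const.sub hC.contDiff_hh.continuous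
    exact (tendsto_iff_norm_sub_tendsto_zero.1 ((hca.tendsto z₀).comp hcont)).eventually
      (gt_mem_nhds hδ')
  have e4 : ∀ᶠ g in 𝓝 g₀, |g - g₀| < δ' :=
    (tendsto_iff_norm_sub_tendsto_zero.1 tendsto_id).eventually (gt_mem_nhds hδ')
  have e5 : ∀ᶠ g in 𝓝 g₀, (ζ g).2 ≠ 0 :=
    ((continuous_snd.tendsto z₀).comp hcont).eventually_ne h.snd_ne_zero
  filter_upwards [h3, e1, e2, e3, e4, e5] with g a0 a1 a2 a3 a4 a5
  exact ⟨a0, hf g _ a0 a1, m_pos_of_nonneg (hC.continuousOn_az _) (hC.coeFn_aa _)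
    (eqn_snd_eq_zero a0) (hm g _ _ a4 a3 a2 (eqn_snd_eq_zero a0)) a5⟩

end CoreProfile

variable {d : ℤ} {ft : ℝ → ℝ}

/-! ### Bifurcation from the normal core -/

section Bifurcation

variable {E₁ E₂ F : Type*} [NormedAddCommGroup E₁] [InnerProductSpace ℝ E₁]
  [NormedAddCommGroup E₂] [InnerProductSpace ℝ E₂]
  [NormedAddCommGroup F] [NormedSpace ℝ F]

/-- The reduced unknown of the bifurcation problem, normalised by `ℓ (bifDir w ℓ v) = ℓ w`
if `ℓ w = 1`. -/
def bifDir (w : E₂) (ℓ : E₂ →L[ℝ] ℝ) (v : E₂) : E₂ := w + v - ℓ v • w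

/-- The potential in the reduced bifurcation problem. -/
def bifPot (T : E₁ →L[ℝ] F) (PX : E₁ →L[ℝ] E₁ →L[ℝ] F) (PH : E₂ →L[ℝ] E₂ →L[ℝ] F) (w : E₂)
    (ℓ : E₂ →L[ℝ] ℝ) (p : ℝ × (E₁ × E₂)) : F :=
  (2 : ℝ) • T p.2.1 + PX p.2.1 p.2.1 + p.1 ^ 2 • PH (bifDir w ℓ p.2.2) (bifDir w ℓ p.2.2)

/-- The reduced bifurcation problem. -/
def bifMap (qX : E₁ →L[ℝ] E₁ →L[ℝ] ℝ) (qH mH : E₂ →L[ℝ] E₂ →L[ℝ] ℝ) (T : E₁ →L[ℝ] F)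
    (PX : E₁ →L[ℝ] E₁ →L[ℝ] F) (PH : E₂ →L[ℝ] E₂ →L[ℝ] F) (b : F →L[ℝ] F →L[ℝ] ℝ) (w : E₂)
    (ℓ : E₂ →L[ℝ] ℝ) (p : ℝ × (E₁ × E₂)) : (E₁ →L[ℝ] ℝ) × (E₂ →L[ℝ] ℝ) :=
  (qX p.2.1 + (b (bifPot T PX PH w ℓ p)).comp (T + PX p.2.1),
    qH (bifDir w ℓ p.2.2) + ℓ p.2.2 • mH (bifDir w ℓ p.2.2)
      + (b (bifPot T PX PH w ℓ p)).comp (PH (bifDir w ℓ p.2.2)))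

theorem contDiff_bifDir (w : E₂) (ℓ : E₂ →L[ℝ] ℝ) : ContDiff ℝ 1 (bifDir w ℓ) := by
  unfold bifDir
  fun_prop

theorem contDiff_bifMap (qX : E₁ →L[ℝ] E₁ →L[ℝ] ℝ) (qH mH : E₂ →L[ℝ] E₂ →L[ℝ] ℝ)
    (T : E₁ →L[ℝ] F) (PX : E₁ →L[ℝ] E₁ →L[ℝ] F) (PH : E₂ →L[ℝ] E₂ →L[ℝ] F)
    (b : F →L[ℝ] F →L[ℝ] ℝ) (w : E₂) (ℓ : E₂ →L[ℝ] ℝ) :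
    ContDiff ℝ 1 (bifMap qX qH mH T PX PH b w ℓ) := by
  have h0 : ContDiff ℝ 1 fun p : ℝ × (E₁ × E₂) => bifDir w ℓ p.2.2 :=
    (contDiff_bifDir w ℓ).comp (contDiff_snd.comp contDiff_snd)
  have h1 : ContDiff ℝ 1 (bifPot T PX PH w ℓ) := by
    have h2 : ContDiff ℝ 1 fun p : ℝ × (E₁ × E₂) => (2 : ℝ) • T p.2.1 + PX p.2.1 p.2.1 := by
      fun_prop
    have h3 : ContDiff ℝ 1 fun p : ℝ × (E₁ × E₂) => PH (bifDir w ℓ p.2.2) (bifDir w ℓ p.2.2) :=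
      (PH.contDiff.comp h0).clm_apply h0
    exact h2.add ((contDiff_fst.pow 2).smul h3)
  have h2 : ContDiff ℝ 1 fun p => b (bifPot T PX PH w ℓ p) := b.contDiff.comp h1
  have h3 : ContDiff ℝ 1 fun p : ℝ × (E₁ × E₂) => qX p.2.1 := by fun_prop
  have h4 : ContDiff ℝ 1 fun p : ℝ × (E₁ × E₂) => T + PX p.2.1 := by fun_prop
  have h5 : ContDiff ℝ 1 fun p : ℝ × (E₁ × E₂) => ℓ p.2.2 := by fun_prop
  exact (h3.add (h2.clm_comp h4)).prodMk (((qH.contDiff.comp h0).add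
    (h5.smul (mH.contDiff.comp h0))).add (h2.clm_comp (PH.contDiff.comp h0)))

/-- The map arises from `m = s (w + v - ℓ(v) w)` and `g = g* + ℓ(v)` after dividing the second
equation by `s`: the single unknown `v` encodes the transversal correction of `w` as well as the
shift of the parameter, and `u` remains free. At `s = 0` the linearisation is block triangular with
the diagonal blocks `B` and `L`, both coercive, and hence invertible. -/
theorem exists_bifMap_eq_zero [CompleteSpace E₁] [CompleteSpace E₂]
    (qX : E₁ →L[ℝ] E₁ →L[ℝ] ℝ) (qH mH : E₂ →L[ℝ] E₂ →L[ℝ] ℝ)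
    (T : E₁ →L[ℝ] F) (PX : E₁ →L[ℝ] E₁ →L[ℝ] F) (PH : E₂ →L[ℝ] E₂ →L[ℝ] F)
    (b : F →L[ℝ] F →L[ℝ] ℝ) (w : E₂) (ℓ : E₂ →L[ℝ] ℝ) (hw : qH w = 0) {c c' : ℝ} (hc : 0 < c)
    (hc' : 0 < c') (hX : ∀ u, c * ‖u‖ ^ 2 ≤ qX u u + 2 * b (T u) (T u))
    (hH : ∀ v, c' * ‖v‖ ^ 2 ≤ qH v v + ℓ v * mH w v) :
    ∃ ζ : ℝ → E₁ × E₂, ContDiffAt ℝ 1 ζ 0 ∧ ζ 0 = 0 ∧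
      ∀ᶠ s in 𝓝 0, bifMap qX qH mH T PX PH b w ℓ (s, ζ s) = 0 := by
  set B : E₁ →L[ℝ] E₁ →L[ℝ] ℝ := qX + (2 : ℝ) • b.bilinearComp T T with hB
  set L : E₂ →L[ℝ] E₂ →L[ℝ] ℝ := qH + ℓ.smulRight (mH w) with hL
  set K : E₁ →L[ℝ] E₂ →L[ℝ] ℝ :=
    (2 : ℝ) • ((ContinuousLinearMap.compL ℝ E₂ F ℝ).flip (PH w)).comp (b.comp T) with hK
  have hBa : ∀ u v, B u v = qX u v + 2 * b (T u) (T v) := fun _ _ => rfl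
  have hLa : ∀ u v, L u v = qH u v + ℓ u * mH w v := fun _ _ => rfl
  have hKa : ∀ u v, K u v = 2 * b (T u) (PH w v) := fun _ _ => rfl
  have hBb : Function.Bijective B := bijective_of_coercive B hc hX
  have hLb : Function.Bijective L := bijective_of_coercive L hc' hH
  refine exists_implicit (contDiff_bifMap qX qH mH T PX PH b w ℓ) ?_
    ((B.comp (ContinuousLinearMap.fst ℝ E₁ E₂)).prod
      (L.comp (ContinuousLinearMap.snd ℝ E₁ E₂) + K.comp (ContinuousLinearMap.fst ℝ E₁ E₂))) ?_ ?_
  · refine Prod.ext ?_ ?_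
    · simp [bifMap, bifPot, bifDir]
    · simp [bifMap, bifPot, bifDir, hw]
  · rintro ⟨u, v⟩
    set ν := v - ℓ v • w with hν
    have hdir : ∀ t : ℝ, bifDir w ℓ (t • v) = w + t • ν := fun t => by
      rw [bifDir, hν, map_smul, smul_sub, smul_smul, smul_eq_mul]; abel
    have hpot : ∀ t : ℝ, bifPot T PX PH w ℓ (0, 0 + t • (u, v))
        = t • (2 : ℝ) • T u + t ^ 2 • PX u u := fun t => by
      simp only [bifPot, zero_add, Prod.smul_mk, map_smul, smul_apply, smul_smul]
      simp [mul_comm, sq]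
    have hqν : qH ν = qH v := by rw [hν, map_sub, map_smul, hw, smul_zero, sub_zero]
    refine HasDerivAt.prodMk (f₁ := fun t : ℝ => (bifMap qX qH mH T PX PH b w ℓ
      (0, 0 + t • (u, v))).1) (f₂ := fun t : ℝ => (bifMap qX qH mH T PX PH b w ℓ
      (0, 0 + t • (u, v))).2) (f₁' := B u) (f₂' := L v + K u) ?_ ?_
    · refine hasDerivAt_cubic (A := 0)
        (B := (2 : ℝ) • (b (T u)).comp (PX u) + (b (PX u u)).comp T)
        (D := (b (PX u u)).comp (PX u)) fun t => ?_
      refine ContinuousLinearMap.ext fun ζ => ?_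
      simp only [bifMap, hpot]
      simp only [add_apply, smul_apply, ContinuousLinearMap.comp_apply, hBa, map_add, map_smul,
        smul_eq_mul, zero_add, Prod.smul_mk]
      ring
    · refine hasDerivAt_cubic (A := 0)
        (B := ℓ v • mH ν + (2 : ℝ) • (b (T u)).comp (PH ν) + (b (PX u u)).comp (PH w))
        (D := (b (PX u u)).comp (PH ν)) fun t => ?_
      refine ContinuousLinearMap.ext fun ζ => ?_
      simp only [bifMap, hpot]
      simp only [zero_add, Prod.smul_mk, hdir]
      simp only [add_apply, smul_apply, ContinuousLinearMap.comp_apply, hLa, hKa,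
        map_add, map_smul, smul_eq_mul, zero_apply, hw, hqν]
      ring
  · constructor
    · rw [injective_iff_map_eq_zero]
      rintro ⟨u, v⟩ h
      have h1 : B u = 0 := congrArg Prod.fst h
      have hu : u = 0 := hBb.1 (h1.trans (map_zero B).symm)
      have h2 : L v + K u = 0 := congrArg Prod.snd h
      rw [hu, map_zero, add_zero] at h2
      have hv : v = 0 := hLb.1 (h2.trans (map_zero L).symm)
      rw [hu, hv]; rfl
    · rintro ⟨f, g⟩
      obtain ⟨u, hu⟩ := hBb.2 f
      obtain ⟨v, hv⟩ := hLb.2 (g - K u)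
      refine ⟨(u, v), Prod.ext hu ?_⟩
      change L v + K u = g
      rw [hv, sub_add_cancel]

end Bifurcation

namespace CoreProfile

variable (hC : CoreProfile d ft)

/-- The branch of positive solutions which bifurcates from the normal core. -/
theorem exists_bifurcation : ∃ (w : H) (β : ℝ → Z₀ × ℝ), ContDiffAt ℝ 1 β 0 ∧
    β 0 = bifurcationPoint ft ∧ (∀ᶠ s in 𝓝[>] 0, hC.IsPosSol (β s).2 (β s).1) ∧
    ∀ s, inner ℝ (H.fnL w) (H.fnL (β s).1.2) = s := by
  obtain ⟨w, hw1, hw0, hwpos⟩ := hC.exists_groundState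
  have hg := hC.gStar_pos
  have hwne : w ≠ 0 := fun h => by rw [h, map_zero, norm_zero] at hw1; exact zero_ne_one hw1
  obtain ⟨V, hV, -⟩ := exists_radialSol_snd (k := fun r => 1 - ft r ^ 2)
    (continuousOn_const.sub (hC.nc.continuousOn.pow 2)) hC.coeFn_a0 hw0
  obtain ⟨c', hc', hco⟩ := coercive_QH_of_ker hg hwne hC.QH_gStar_nonneg fun ψ hψ =>
    eq_smul_of_QH_eq_zero (c := fun r => gStar ft - (1 - ft r ^ 2)) (by
      filter_upwards [hC.coeFn_a0] with r hr
      rw [hr]; ring) hV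
      (continuousOn_const.sub (continuousOn_const.sub (hC.nc.continuousOn.pow 2))) hwpos hψ
  obtain ⟨c, hc, hcX⟩ := hC.coercive_QX_a0
  set ℓ : H →L[ℝ] ℝ := (ip (H.fnL w)).comp H.fnL with hℓ
  have hℓa : ∀ v, ℓ v = inner ℝ (H.fnL w) (H.fnL v) := fun _ => rfl
  have hℓw : ℓ w = 1 := by rw [hℓa, real_inner_self_eq_norm_sq, hw1, one_pow]
  set mH : H →L[ℝ] H →L[ℝ] ℝ := ip.bilinearComp H.fnL H.fnL with hmH
  have hmHa : ∀ u v, mH u v = inner ℝ (H.fnL u) (H.fnL v) := fun _ _ => rfl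
  set PX : X →L[ℝ] X →L[ℝ] L2r := prodH.bilinearComp inclXH inclXH with hPX
  obtain ⟨ζ, h1, h2, h3⟩ := exists_bifMap_eq_zero (QX d hC.a0) (QH (gStar ft) hC.a0) mH
    (hC.T.comp X.fnL) PX prodH ip w ℓ (ContinuousLinearMap.ext fun ψ => hw0 ψ) hc hc'
    (fun u => by
      have := hcX u
      rwa [← real_inner_self_eq_norm_sq (hC.T (X.fnL u))] at this)
    (fun v => by
      rw [hℓa, hmHa, ← sq]
      exact hco v)
  set μ : ℝ → H := fun s => bifDir w ℓ (ζ s).2 with hμ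
  -- As `ℓ (μ s) = 1`, the pairing of the second component with `w` equals `s`. The parameter can
  -- thus be recovered from the point of the branch, which later gives injectivity and a
  -- non-vanishing derivative.
  set β : ℝ → Z₀ × ℝ := fun s => (((ζ s).1, s • μ s), gStar ft + ℓ (ζ s).2) with hβ
  have hℓμ : ∀ s, ℓ (μ s) = 1 := fun s => by
    simp only [hμ, bifDir, map_add, map_sub, map_smul, hℓw, smul_eq_mul]; ring
  have hμc : ContDiffAt ℝ 1 μ 0 := (contDiff_bifDir w ℓ).contDiffAt.comp 0
    (contDiffAt_snd.comp 0 h1)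
  have hβc : ContDiffAt ℝ 1 β 0 :=
    ((contDiffAt_fst.comp 0 h1).prodMk (contDiffAt_id.smul hμc)).prodMk
      (contDiffAt_const.add (ℓ.contDiff.contDiffAt.comp 0 (contDiffAt_snd.comp 0 h1)))
  have hβ0 : β 0 = bifurcationPoint ft := by
    simp only [hβ, h2, bifurcationPoint, Prod.fst_zero, Prod.snd_zero, map_zero, add_zero, zero_smul]
    rfl
  refine ⟨w, β, hβc, hβ0, ?_, fun s => ?_⟩
  swap
  · simp only [hβ, map_smul, inner_smul_right]
    rw [← hℓa, hℓμ, mul_one]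
  have hμ0 : μ 0 = w := by simp [hμ, h2, bifDir]
  obtain ⟨δ, hδ, hf⟩ := exists_f_pos_of_near (hC := hC) (z₀ := 0) (fun r hr => by
    simp only [fz, Prod.fst_zero, map_zero, ev_zero hr, add_zero]
    exact hC.nc.pos r hr)
  obtain ⟨δ', hδ', hm⟩ := exists_m_nonneg_of_near hc' hwpos hco
  have hz : Tendsto (fun s => (β s).1) (𝓝 0) (𝓝 0) := by
    have := (continuous_fst.tendsto _).comp hβc.continuousAt.tendsto
    rwa [hβ0] at this
  have hg2 : Tendsto (fun s => (β s).2) (𝓝 0) (𝓝 (gStar ft)) := by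
    have := (continuous_snd.tendsto _).comp hβc.continuousAt.tendsto
    rwa [hβ0] at this
  have hμt : Tendsto μ (𝓝 0) (𝓝 w) := by
    have := hμc.continuousAt.tendsto
    rwa [hμ0] at this
  have hca : Tendsto (fun s => hC.aa (β s).1) (𝓝 0) (𝓝 hC.a0) := by
    have hca : Continuous hC.aa := continuous_const.sub hC.contDiff_hh.continuous
    have := (hca.tendsto 0).comp hz
    rwa [aa_zero] at this
  have e1 := (tendsto_iff_norm_sub_tendsto_zero.1 hz).eventually (gt_mem_nhds hδ)
  have e2 := (tendsto_iff_norm_sub_tendsto_zero.1 hμt).eventually (gt_mem_nhds hδ')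
  have e3 := (tendsto_iff_norm_sub_tendsto_zero.1 hca).eventually (gt_mem_nhds hδ')
  have e4 := (tendsto_iff_norm_sub_tendsto_zero.1 hg2).eventually (gt_mem_nhds hδ')
  have hn : (𝓝[>] (0 : ℝ)) ≤ 𝓝 0 := nhdsWithin_le_nhds
  filter_upwards [hn h3, hn e1, hn e2, hn e3, hn e4, self_mem_nhdsWithin] with s a0 a1 a2 a3 a4 hs
  have hs0 : (0 : ℝ) < s := hs
  have hpot : bifPot (hC.T.comp X.fnL) PX prodH w ℓ (s, ζ s) = hC.hh (β s).1 := by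
    simp only [bifPot, hh, T0_apply, dotZ_apply, hβ, map_smul, smul_apply, smul_smul, ← sq]
    rw [← add_assoc]; rfl
  have b1 : ∀ φ, QX d hC.a0 (ζ s).1 φ + inner ℝ (hC.hh (β s).1) (hC.N (β s).1 (φ, 0)) = 0 :=
    fun φ => by
    have h4 := congrArg (fun q => q.1 φ) a0
    simp only [bifMap, hpot] at h4
    have h5 : hC.N (β s).1 (φ, 0) = hC.T (X.fnL φ) + PX (ζ s).1 φ := by
      simp only [N_apply, T0_apply, dotZ_apply, map_zero, add_zero]; rfl
    rw [h5]
    exact h4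
  have b2 : ∀ ψ, QH (β s).2 (hC.aa (β s).1) (μ s) ψ = 0 := fun ψ => by
    have h4 := congrArg (fun q => q.2 ψ) a0
    simp only [bifMap, hpot] at h4
    have h5 : QH (β s).2 (hC.aa (β s).1) (μ s) ψ = QH (gStar ft) hC.a0 (μ s) ψ
        + ℓ (ζ s).2 * mH (μ s) ψ + ip (hC.hh (β s).1) (prodH (μ s) ψ) := by
      rw [aa, QH_sub, hmHa, ip_apply]
      simp only [QH_apply, hβ]; ring
    rw [h5]
    exact h4
  have heq : hC.eqn (β s).2 (β s).1 = 0 := by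
    refine ContinuousLinearMap.ext fun ξ => ?_
    have h4 : ξ = (ξ.1, 0) + (0, ξ.2) := by simp
    rw [h4, map_add, eqn_fst, eqn_snd, zero_apply]
    have h5 := b1 ξ.1
    have h6 : QH (β s).2 (hC.aa (β s).1) (β s).1.2 ξ.2 = 0 := by
      change QH (β s).2 (hC.aa (β s).1) (s • μ s) ξ.2 = 0
      rw [map_smul, smul_apply, b2, smul_zero]
    rw [h6, add_zero]
    exact h5
  refine ⟨heq, hf _ _ heq a1, fun r hr => ?_⟩
  have hμne : μ s ≠ 0 := fun h => by
    have := hℓμ s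
    rw [h, map_zero] at this
    exact zero_ne_one this
  -- Positivity is proved for the rescaled component `μ s`, which is close to `w > 0`; the component
  -- `s μ s` itself tends to `0`.
  have := m_pos_of_nonneg (hC.continuousOn_az _) (hC.coeFn_aa _) b2 (hm _ _ _ a4 a3 a2 b2) hμne
  change 0 < ev (s • μ s) r
  rw [ev_smul _ _ hr]
  exact mul_pos hs0 (this r hr)

end CoreProfile

/-! ### From local branches to one global curve -/

theorem hasDerivAt_glue {g k : ℝ → ℝ} {a g' k' t : ℝ} (hg : t ≤ a → HasDerivAt g g' t)
    (hk : a ≤ t → HasDerivAt k k' t) (h0 : g a = k a) (h1 : t = a → g' = k') :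
    HasDerivAt (fun t => if t ≤ a then g t else k t) (if t ≤ a then g' else k') t := by
  rcases lt_trichotomy t a with h | h | h
  · rw [if_pos h.le]
    refine (hg h.le).congr_of_eventuallyEq ?_
    filter_upwards [gt_mem_nhds h] with s hs
    rw [if_pos (le_of_lt hs)]
  · subst h
    rw [if_pos le_rfl]
    have hl : HasDerivWithinAt (fun s => if s ≤ t then g s else k s) g' (Iic t) t :=
      (hg le_rfl).hasDerivWithinAt.congr (fun s hs => if_pos hs) (if_pos le_rfl)
    have hr : HasDerivWithinAt (fun s => if s ≤ t then g s else k s) g' (Ici t) t := by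
      rw [h1 rfl]
      refine (hk le_rfl).hasDerivWithinAt.congr (fun s hs => ?_) ?_
      · rcases (mem_Ici.1 hs).eq_or_lt with h | h
        · rw [if_pos h.symm.le, ← h, h0]
        · rw [if_neg (not_le.2 h)]
      · rw [if_pos le_rfl, h0]
    have := hl.union hr
    rwa [Iic_union_Ici, hasDerivWithinAt_univ] at this
  · rw [if_neg (not_le.2 h)]
    refine (hk h.le).congr_of_eventuallyEq ?_
    filter_upwards [lt_mem_nhds h] with s hs
    rw [if_neg (not_le.2 hs)]

theorem continuousAt_glue {g k : ℝ → ℝ} {a t : ℝ} (hg : t ≤ a → ContinuousAt g t)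
    (hk : a ≤ t → ContinuousAt k t) (h0 : g a = k a) :
    ContinuousAt (fun t => if t ≤ a then g t else k t) t := by
  rcases lt_trichotomy t a with h | h | h
  · refine (hg h.le).congr ?_
    filter_upwards [gt_mem_nhds h] with s hs
    rw [if_pos (le_of_lt hs)]
  · subst h
    rw [continuousAt_iff_continuous_left_right]
    refine ⟨(hg le_rfl).continuousWithinAt.congr (fun s hs => if_pos hs) (if_pos le_rfl),
      (hk le_rfl).continuousWithinAt.congr (fun s hs => ?_) ?_⟩
    · rcases (mem_Ici.1 hs).eq_or_lt with h | h
      · rw [if_pos h.symm.le, ← h, h0]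
      · rw [if_neg (not_le.2 h)]
    · rw [if_pos le_rfl, h0]
  · refine (hk h.le).congr ?_
    filter_upwards [lt_mem_nhds h] with s hs
    rw [if_neg (not_le.2 hs)]

theorem contDiffOn_one_of_hasDerivAt {f f' : ℝ → ℝ} {s : Set ℝ} (hs : IsOpen s)
    (h : ∀ t ∈ s, HasDerivAt f (f' t) t) (hf' : ContinuousOn f' s) : ContDiffOn ℝ 1 f s := by
  rw [contDiffOn_one_iff_derivWithin hs.uniqueDiffOn]
  refine ⟨fun t ht => (h t ht).differentiableAt.differentiableWithinAt, hf'.congr fun t ht => ?_⟩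
  rw [derivWithin_of_isOpen hs ht, (h t ht).deriv]

/-- A family `S` of solutions with parameter `g` which bifurcates at `(0, b)`: the branch `β`
emanates there, all solutions can be continued locally, and limits of solutions from above
exist. -/
structure IsBranch {E : Type*} [NormedAddCommGroup E] [NormedSpace ℝ E] (b : ℝ) (S : ℝ → E → Prop)
    (lam : E → ℝ) (β : ℝ → E × ℝ) : Prop where
  b_pos : 0 < b
  unique : ∀ g z z', S g z → S g z' → z = z'
  lt : ∀ g z, S g z → g < b
  branch : ∀ g z, 0 < g → S g z → ∃ ζ : ℝ → E, ContDiffAt ℝ 1 ζ g ∧ ζ g = z ∧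
    ∀ᶠ g' in 𝓝 g, S g' (ζ g')
  limit : ∀ (g' : ℝ) (g : ℕ → ℝ), 0 < g' → (∀ n, ∃ z, S (g n) z) → Tendsto g atTop (𝓝 g') →
    (∀ n, g' ≤ g n) → (∀ n, g n ≤ g 0) → ∃ z, S g' z
  contDiffAt : ContDiffAt ℝ 1 β 0
  start : β 0 = (0, b)
  sol : ∀ᶠ s in 𝓝[>] 0, S (β s).2 (β s).1
  lam_deriv : ∀ (f : ℝ → E) (v : E) (s : Set ℝ) (t : ℝ), HasDerivWithinAt f v s t →
    HasDerivWithinAt (fun t => lam (f t)) (lam v) s t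
  lam_eq : ∀ s, lam (β s).1 = s

namespace IsBranch

variable {E : Type*} [NormedAddCommGroup E] [NormedSpace ℝ E] {b : ℝ} {S : ℝ → E → Prop}
  {lam : E → ℝ} {β : ℝ → E × ℝ}

theorem exists_radius (h : IsBranch b S lam β) : ∃ s₀ > 0,
    (∀ s, |s| < s₀ → ContDiffAt ℝ 1 β s) ∧ (∀ s, 0 < s → s < s₀ → S (β s).2 (β s).1) ∧
    ∀ s, |s| < s₀ → 0 < (β s).2 := by
  have h1 := h.contDiffAt.eventually (by simp)
  have h2 : ∀ᶠ s in 𝓝 0, 0 < (β s).2 := by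
    have := (continuous_snd.tendsto _).comp h.contDiffAt.continuousAt.tendsto
    rw [h.start] at this
    exact this.eventually (lt_mem_nhds h.b_pos)
  have h3 := eventually_nhdsWithin_iff.1 h.sol
  obtain ⟨s₀, hs₀, hs⟩ := Metric.eventually_nhds_iff.1 (h1.and (h2.and h3))
  simp only [Real.dist_eq, sub_zero] at hs
  exact ⟨s₀, hs₀, fun s hs' => (hs hs').1,
    fun s h0 hs' => (hs (by rwa [abs_of_pos h0])).2.2 h0, fun s hs' => (hs hs').2.1⟩

/-- The intermediate value theorem along the branch: its parameter values cover a whole interval to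
the left of `b`, with solutions close to the bifurcation point. -/
theorem exists_near (h : IsBranch b S lam β) {ε : ℝ} (hε : 0 < ε) : ∃ g₁ < b, 0 < g₁ ∧
    ∀ g, g₁ ≤ g → g < b → ∃ s, 0 < s ∧ s < ε ∧ (β s).2 = g ∧ S g (β s).1 := by
  obtain ⟨s₀, hs₀, h1, h2, h3⟩ := h.exists_radius
  set s₁ := min ε s₀ / 2 with hs₁
  have hm : 0 < min ε s₀ := lt_min hε hs₀
  have h4 : 0 < s₁ := by positivity
  have h5 : s₁ < ε := lt_of_lt_of_le (half_lt_self hm) (min_le_left _ _)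
  have h6 : s₁ < s₀ := lt_of_lt_of_le (half_lt_self hm) (min_le_right _ _)
  have hc : ContinuousOn (fun s => (β s).2) (Icc 0 s₁) := fun s hs =>
    (continuous_snd.continuousAt.comp (h1 s (by rw [abs_of_nonneg hs.1]; linarith [hs.2])).continuousAt).continuousWithinAt
  have h0 : (β 0).2 = b := by rw [h.start]
  refine ⟨(β s₁).2, h.lt _ _ (h2 s₁ h4 h6), h3 s₁ (by rwa [abs_of_pos h4]), fun g hg hgb => ?_⟩
  obtain ⟨s, hs, hsg⟩ := intermediate_value_Icc' h4.le hc ⟨hg, by simp only [h0]; exact hgb.le⟩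
  simp only at hsg
  have hs0 : 0 < s := by
    rcases hs.1.eq_or_lt with h7 | h7
    · rw [← h7, h0] at hsg
      exact absurd hsg hgb.ne'
    · exact h7
  exact ⟨s, hs0, hs.2.trans_lt h5, hsg, hsg ▸ h2 s hs0 (hs.2.trans_lt h6)⟩

/-- A continuity argument downwards from `b`. If the solutions stopped at a level `c > 0`, there
would be a solution at `c` by the limit property, and its local continuation would reach below `c`.
-/
theorem exists_sol (h : IsBranch b S lam β) {g : ℝ} (hg : 0 < g) (hgb : g < b) : ∃ z, S g z := by
  obtain ⟨g₁, hg₁b, hg₁, hnear⟩ := h.exists_near one_pos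
  set A : Set ℝ := {a | 0 < a ∧ ∀ g', a ≤ g' → g' < b → ∃ z, S g' z} with hA
  have hA1 : g₁ ∈ A := ⟨hg₁, fun g' h1 h2 => by
    obtain ⟨s, -, -, -, h3⟩ := hnear g' h1 h2
    exact ⟨_, h3⟩⟩
  have hbdd : BddBelow A := ⟨0, fun a ha => ha.1.le⟩
  set c := sInf A with hc
  have hc0 : 0 ≤ c := le_csInf ⟨_, hA1⟩ fun a ha => ha.1.le
  have hcb : c < b := (csInf_le hbdd hA1).trans_lt hg₁b
  have hgt : ∀ g', c < g' → g' < b → ∃ z, S g' z := fun g' h1 h2 => by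
    obtain ⟨a, ha, hag⟩ := exists_lt_of_csInf_lt ⟨_, hA1⟩ h1
    exact ha.2 g' hag.le h2
  rcases hc0.eq_or_lt with hc0 | hc0
  · exact hgt g (by rw [← hc0]; exact hg) hgb
  exfalso
  have hcs : ∃ z, S c z := by
    have hq : ∀ n : ℕ, 0 < (b - c) / ((n : ℝ) + 2) := fun n =>
      div_pos (by linarith) (by positivity)
    have hq1 : ∀ n : ℕ, (b - c) / ((n : ℝ) + 2) < b - c := fun n =>
      div_lt_self (by linarith) (by have : (0 : ℝ) ≤ n := Nat.cast_nonneg n; linarith)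
    -- The denominators start at `2`, so every term lies strictly between `c` and `b`; the sequence
    -- decreases, which is what the limit property asks for.
    refine h.limit c (fun n => c + (b - c) / ((n : ℝ) + 2)) hc0 (fun n => hgt _ ?_ ?_) ?_ ?_ ?_
    · linarith [hq n]
    · linarith [hq1 n]
    · have h1 : Tendsto (fun n : ℕ => (n : ℝ) + 2) atTop atTop :=
        tendsto_natCast_atTop_atTop.atTop_add tendsto_const_nhds
      simpa using (h1.const_div_atTop (b - c)).const_add c
    · intro n; linarith [hq n]
    · intro n
      have : (b - c) / ((n : ℝ) + 2) ≤ (b - c) / (((0 : ℕ) : ℝ) + 2) := by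
        apply div_le_div_of_nonneg_left (by linarith) (by norm_num)
        have : (0 : ℝ) ≤ n := Nat.cast_nonneg n
        push_cast; linarith
      linarith
  obtain ⟨z, hz⟩ := hcs
  obtain ⟨ζ, -, -, h1⟩ := h.branch c z hc0 hz
  obtain ⟨ε, hε, h2⟩ := Metric.eventually_nhds_iff.1 h1
  simp only [Real.dist_eq] at h2
  set δ := min (ε / 2) (c / 2) with hδ
  have hδ0 : 0 < δ := lt_min (by positivity) (by positivity)
  have hδ1 : δ ≤ ε / 2 := min_le_left _ _
  have hδ2 : δ ≤ c / 2 := min_le_right _ _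
  have h3 : c - δ ∈ A := by
    refine ⟨by linarith, fun g' h4 h5 => ?_⟩
    by_cases h6 : c < g'
    · exact hgt g' h6 h5
    · push Not at h6
      exact ⟨_, h2 (abs_lt.2 ⟨by linarith, by linarith⟩)⟩
  have := csInf_le hbdd h3
  linarith

/-- Uniqueness identifies the chosen solutions with the local `C¹` branches inside `(0, b)`. Only
continuity is claimed at `b`, where the branch may be tangent to the direction of constant `g`. -/
theorem exists_graph (h : IsBranch b S lam β) : ∃ Φ : ℝ → E, Φ b = 0 ∧
    (∀ g, 0 < g → g < b → S g (Φ g)) ∧ ContDiffOn ℝ 1 Φ (Ioo 0 b) ∧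
    ContinuousOn Φ (Ioc 0 b) := by
  classical
  -- The default value `0` is the bifurcation point, and is taken in particular at `g = b`.
  set Φ : ℝ → E := fun g => if hg : 0 < g ∧ g < b then (h.exists_sol hg.1 hg.2).choose else 0
    with hΦ
  have hΦb : Φ b = 0 := dif_neg fun h => lt_irrefl _ h.2
  have hS : ∀ g, 0 < g → g < b → S g (Φ g) := fun g h1 h2 => by
    simp only [hΦ, dif_pos (And.intro h1 h2)]
    exact (h.exists_sol h1 h2).choose_spec
  have hcd : ∀ g ∈ Ioo 0 b, ContDiffAt ℝ 1 Φ g := fun g hg => by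
    obtain ⟨ζ, h1, h2, h3⟩ := h.branch g _ hg.1 (hS g hg.1 hg.2)
    refine h1.congr_of_eventuallyEq ?_
    filter_upwards [h3, Ioo_mem_nhds hg.1 hg.2] with g' h4 h5
    exact h.unique _ _ _ (hS g' h5.1 h5.2) h4
  refine ⟨Φ, hΦb, hS, fun g hg => (hcd g hg).contDiffWithinAt, fun g hg => ?_⟩
  rcases hg.2.eq_or_lt with hgb | hgb
  · rw [hgb, ContinuousWithinAt, hΦb, Metric.tendsto_nhdsWithin_nhds]
    intro ε hε
    have hb1 := (continuous_fst.tendsto _).comp h.contDiffAt.continuousAt.tendsto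
    rw [h.start] at hb1
    obtain ⟨δ, hδ, h1⟩ := Metric.tendsto_nhds_nhds.1 hb1 ε hε
    obtain ⟨g₁, hg₁b, hg₁, hnear⟩ := h.exists_near hδ
    refine ⟨b - g₁, by linarith, fun {g'} h2 h3 => ?_⟩
    rcases h2.2.eq_or_lt with h4 | h4
    · rw [h4, hΦb, dist_self]; exact hε
    · rw [Real.dist_eq] at h3
      obtain ⟨s, hs0, hsδ, hs, hsS⟩ := hnear g' (by linarith [(abs_lt.1 h3).1]) h4
      rw [h.unique _ _ _ (hS g' h2.1 h4) hsS]
      exact h1 (by rwa [Real.dist_eq, sub_zero, abs_of_pos hs0])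
  · exact (hcd g ⟨hg.1, hgb⟩).continuousAt.continuousWithinAt

/-- The set of all solutions together with the bifurcation point. -/
def curve (b : ℝ) (S : ℝ → E → Prop) : Set (E × ℝ) := {p | 0 < p.2 ∧ S p.2 p.1} ∪ {(0, b)}

theorem curve_eq (h : IsBranch b S lam β) {Φ : ℝ → E} (hb : Φ b = 0)
    (hS : ∀ g, 0 < g → g < b → S g (Φ g)) :
    curve b S = (fun g => (Φ g, g)) '' Ioc 0 b := by
  ext ⟨z, g⟩
  constructor
  · rintro (⟨h1, h2⟩ | h1)
    · have h3 := h.lt _ _ h2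
      exact ⟨g, ⟨h1, h3.le⟩, Prod.ext (h.unique _ _ _ (hS g h1 h3) h2) rfl⟩
    · obtain ⟨rfl, rfl⟩ := Prod.mk.inj h1
      exact ⟨g, ⟨h.b_pos, le_rfl⟩, Prod.ext hb rfl⟩
  · rintro ⟨g', hg', h1⟩
    obtain ⟨rfl, rfl⟩ := Prod.mk.inj h1
    rcases hg'.2.eq_or_lt with h2 | h2
    · right
      rw [h2, hb]; rfl
    · exact Or.inl ⟨hg'.1, hS _ hg'.1 h2⟩

theorem isGraphOver (h : IsBranch b S lam β) : IsGraphOver b (curve b S) := by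
  obtain ⟨Φ, h1, h2, h3, h4⟩ := h.exists_graph
  exact ⟨Φ, h4, h3, h.curve_eq h1 h2⟩

theorem isConnected (h : IsBranch b S lam β) : IsConnected (curve b S) := by
  obtain ⟨Φ, h1, h2, h3, h4⟩ := h.exists_graph
  rw [h.curve_eq h1 h2]
  exact (isConnected_Ioc h.b_pos).image _ (h4.prodMk continuousOn_id)

/-- Above `g₀` the set is the continuous image of `[g₀, b]`; the compactness of families of
solutions has already been used in constructing the graph. -/
theorem isCompact (h : IsBranch b S lam β) {g₀ : ℝ} (hg₀ : 0 < g₀) :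
    IsCompact (curve b S ∩ {p | g₀ ≤ p.2}) := by
  obtain ⟨Φ, h1, h2, h3, h4⟩ := h.exists_graph
  have h5 : curve b S ∩ {p | g₀ ≤ p.2} = (fun g => (Φ g, g)) '' Icc g₀ b := by
    rw [h.curve_eq h1 h2]
    ext p
    constructor
    · rintro ⟨⟨g, hg, rfl⟩, h6⟩
      exact ⟨g, ⟨h6, hg.2⟩, rfl⟩
    · rintro ⟨g, hg, rfl⟩
      exact ⟨⟨g, ⟨hg₀.trans_le hg.1, hg.2⟩, rfl⟩, hg.1⟩
  rw [h5]
  exact isCompact_Icc.image_of_continuousOn ((h4.mono fun g hg => ⟨hg₀.trans_le hg.1, hg.2⟩).prodMk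
    continuousOn_id)

/-- The graph over `g` need not be `C¹` at `b`, so the curve starts as the bifurcating branch on
`[0, a]` and continues as the graph with `g` decaying exponentially from `g(a)` to `0`. Value and
slope of `g` agree at `a`; near the junction both pieces are the graph over the glued `C¹` function
`G`, by uniqueness. -/
theorem isC1CurveFrom (h : IsBranch b S lam β) : IsC1CurveFrom (0, b) (curve b S) := by
  obtain ⟨Φ, hΦb, hΦS, hΦ1, hΦc⟩ := h.exists_graph
  obtain ⟨s₀, hs₀, hβ, hβS, hβ0⟩ := h.exists_radius
  set g : ℝ → ℝ := fun s => (β s).2 with hg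
  have hgd : ∀ s, |s| < s₀ → ContDiffAt ℝ 1 g s := fun s hs => contDiffAt_snd.comp s (hβ s hs)
  have hg0 : g 0 = b := by simp only [hg, h.start]
  have hglt : ∀ s, 0 < s → s < s₀ → g s < b := fun s h1 h2 => h.lt _ _ (hβS s h1 h2)
  have habs : ∀ s, 0 ≤ s → s < s₀ → |s| < s₀ := fun s h1 h2 => by rwa [abs_of_nonneg h1]
  -- Since `g < b` for `s > 0`, the mean value theorem supplies a point with negative slope, where
  -- the change of parametrization is regular.
  obtain ⟨a, ha, hda⟩ := exists_deriv_eq_slope g (half_pos hs₀)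
    (fun s hs => (hgd s (habs s hs.1 (by linarith [hs.2]))).continuousAt.continuousWithinAt)
    (fun s hs => ((hgd s (habs s hs.1.le (by linarith [hs.2]))).differentiableAt
      (by simp)).differentiableWithinAt)
  have ha0 := ha.1
  have has : a < s₀ := by linarith [ha.2]
  have hda0 : deriv g a < 0 := by
    rw [hda, hg0]
    exact div_neg_of_neg_of_pos (by linarith [hglt (s₀ / 2) (by linarith) (by linarith)])
      (by linarith)
  have hga : 0 < g a := hβ0 a (habs a ha0.le has)
  have hgab : g a < b := hglt a ha0 has
  -- The decay rate for which the exponential has slope `g'(a)` at `a`.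
  set κ : ℝ := -deriv g a / g a with hκ
  have hκ0 : 0 < κ := div_pos (by linarith) hga
  set k : ℝ → ℝ := fun t => g a * Real.exp (-κ * (t - a)) with hk
  set k' : ℝ → ℝ := fun t => -κ * k t with hk'
  have hkd : ∀ t, HasDerivAt k (k' t) t := fun t => by
    have h1 : HasDerivAt (fun t => -κ * (t - a)) (-κ) t := by
      simpa using ((hasDerivAt_id t).sub_const a).const_mul (-κ)
    refine ((h1.exp).const_mul (g a)).congr_deriv ?_
    simp only [hk', hk]; ring
  have hkpos : ∀ t, 0 < k t := fun t => mul_pos hga (Real.exp_pos _)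
  have hka : k a = g a := by simp [hk]
  have hk'a : k' a = deriv g a := by
    simp only [hk', hka, hκ]; field_simp
  have hk'neg : ∀ t, k' t < 0 := fun t => by
    have := mul_pos hκ0 (hkpos t)
    simp only [hk']; linarith
  have hkanti : StrictAnti k := strictAnti_of_deriv_neg fun t => by
    rw [(hkd t).deriv]; exact hk'neg t
  set G : ℝ → ℝ := fun t => if t ≤ a then g t else k t with hG
  set G' : ℝ → ℝ := fun t => if t ≤ a then deriv g t else k' t with hG'
  have hGd : ∀ t > 0, HasDerivAt G (G' t) t := fun t ht =>
    hasDerivAt_glue (fun h1 => ((hgd t (habs t ht.le (by linarith))).differentiableAt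
      (by simp)).hasDerivAt) (fun _ => hkd t) hka.symm (fun h1 => by rw [h1, hk'a])
  have hG'c : ContinuousOn G' (Ioi 0) := fun t ht => by
    have ht0 : (0 : ℝ) < t := ht
    refine (continuousAt_glue (fun h1 => ?_) (fun _ => ?_) hk'a.symm).continuousWithinAt
    · have h2 : ContDiffOn ℝ 1 g (Ioo 0 s₀) := fun s hs =>
        (hgd s (habs s hs.1.le hs.2)).contDiffWithinAt
      have h3 := h2.continuousOn_deriv_of_isOpen isOpen_Ioo le_rfl
      exact h3.continuousAt (Ioo_mem_nhds ht0 (by linarith))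
    · exact (continuous_const.mul (continuous_iff_continuousAt.2 fun s =>
        (hkd s).continuousAt)).continuousAt
  have hG1 : ContDiffOn ℝ 1 G (Ioi 0) := contDiffOn_one_of_hasDerivAt isOpen_Ioi hGd hG'c
  have hG0 : G 0 = b := by simp only [hG, if_pos ha0.le, hg0]
  have hGpos : ∀ t ≥ 0, 0 < G t := fun t ht => by
    by_cases h1 : t ≤ a
    · simp only [hG, if_pos h1]; exact hβ0 t (habs t ht (by linarith))
    · simp only [hG, if_neg h1]; exact hkpos t
  have hanti : StrictAntiOn G (Ici 0) := by
    have h1 : StrictAntiOn G (Icc 0 a) := by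
      -- Equal parameters mean equal solutions, and `lam` reads off `s` from the solution. A
      -- continuous injective function is strictly monotone, here decreasing because `g(0) = b`.
      have hinj : InjOn g (Icc 0 a) := by
        have key : ∀ s t, 0 ≤ s → s < t → t ≤ a → g s ≠ g t := fun s t h2 h3 h4 h5 => by
          rcases h2.eq_or_lt with h6 | h6
          · rw [← h6, hg0] at h5
            have := hglt t (by linarith) (by linarith)
            linarith
          · have h7 := hβS s h6 (by linarith)
            have h8 := hβS t (by linarith) (by linarith)
            have h9 : (β s).1 = (β t).1 := h.unique (g s) _ _ h7 (h5 ▸ h8)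
            have := congrArg lam h9
            rw [h.lam_eq, h.lam_eq] at this
            linarith
        intro s hs t ht hst
        rcases lt_trichotomy s t with h2 | h2 | h2
        · exact absurd hst (key s t hs.1 h2 ht.2)
        · exact h2
        · exact absurd hst.symm (key t s ht.1 h2 hs.2)
      have hcg : ContinuousOn g (Icc 0 a) := fun s hs =>
        (hgd s (habs s hs.1 (by linarith [hs.2]))).continuousAt.continuousWithinAt
      have h2 : StrictAntiOn g (Icc 0 a) := by
        rcases hcg.strictMonoOn_of_injOn_Icc' ha0.le hinj with h2 | h2
        · have := h2 ⟨le_rfl, ha0.le⟩ ⟨ha0.le, le_rfl⟩ ha0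
          rw [hg0] at this
          linarith
        · exact h2
      exact h2.congr fun s hs => by simp only [hG, if_pos hs.2]
    have h2 : StrictAntiOn G (Ici a) := by
      refine (hkanti.strictAntiOn (Ici a)).congr fun s hs => ?_
      rcases (mem_Ici.1 hs).eq_or_lt with h3 | h3
      · simp only [hG, ← h3, if_pos le_rfl, hka]
      · simp only [hG, if_neg (not_le.2 h3)]
    have := h1.union h2 (isGreatest_Icc ha0.le) isLeast_Ici
    rwa [Icc_union_Ici_eq_Ici ha0.le] at this
  have hGlt : ∀ t > 0, G t < b := fun t ht => by
    rw [← hG0]; exact hanti self_mem_Ici (mem_Ici.2 (le_of_lt ht)) ht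
  set γ : ℝ → E × ℝ := fun t => if t ≤ a then β t else (Φ (G t), G t) with hγ
  have hγ2 : ∀ t, (γ t).2 = G t := fun t => by
    by_cases h1 : t ≤ a
    · simp only [hγ, hG, if_pos h1, hg]
    · simp only [hγ, if_neg h1]
  have hγΦ : ∀ t > 0, γ t = (Φ (G t), G t) := fun t ht => by
    by_cases h1 : t ≤ a
    · refine Prod.ext ?_ (hγ2 t)
      have h2 : γ t = β t := if_pos h1
      have h3 : G t = g t := if_pos h1
      rw [h2]
      exact h.unique (g t) _ _ (hβS t ht (by linarith)) (h3 ▸ hΦS (G t) (hGpos t (le_of_lt ht))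
        (hGlt t ht))
    · exact if_neg h1
  have hγβ : ∀ t < a, γ =ᶠ[𝓝 t] β := fun t ht => by
    filter_upwards [gt_mem_nhds ht] with s hs
    exact if_pos (le_of_lt hs)
  have hγ1 : ∀ t > 0, ContDiffAt ℝ 1 γ t := fun t ht => by
    have h1 : ContDiffAt ℝ 1 G t := hG1.contDiffAt (Ioi_mem_nhds ht)
    have h2 : ContDiffAt ℝ 1 Φ (G t) :=
      hΦ1.contDiffAt (Ioo_mem_nhds (hGpos t (le_of_lt ht)) (hGlt t ht))
    refine ((h2.comp t h1).prodMk h1).congr_of_eventuallyEq ?_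
    filter_upwards [lt_mem_nhds ht] with s hs
    exact hγΦ s hs
  have hγc : ContDiffOn ℝ 1 γ (Ici 0) := fun t ht => by
    rcases (mem_Ici.1 ht).eq_or_lt with h1 | h1
    · rw [← h1]
      exact (h.contDiffAt.congr_of_eventuallyEq (hγβ 0 ha0)).contDiffWithinAt
    · exact (hγ1 t h1).contDiffWithinAt
  have hγ0 : γ 0 = (0, b) := by simp only [hγ, if_pos ha0.le, h.start]
  have hGc : ContinuousOn G (Ici 0) :=
    (continuous_snd.comp_continuousOn hγc.continuousOn).congr fun t _ => (hγ2 t).symm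
  refine ⟨γ, hγc, fun t ht h0 => ?_, ?_, hγ0, ?_⟩
  · have hud : UniqueDiffWithinAt ℝ (Ici (0 : ℝ)) t := uniqueDiffOn_Ici 0 t ht
    have hd : HasDerivWithinAt γ 0 (Ici 0) t := by
      have := (hγc.differentiableOn (by simp) t ht).hasDerivWithinAt
      rwa [h0] at this
    by_cases h1 : t < a
    · have hd0 : HasDerivWithinAt (fun t => (γ t).1) 0 (Ici 0) t :=
        (ContinuousLinearMap.fst ℝ E ℝ).hasFDerivAt.comp_hasDerivWithinAt t hd
      have hd1 := h.lam_deriv _ _ _ _ hd0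
      have hd2 : HasDerivWithinAt (fun t => lam (γ t).1) 1 (Ici 0) t := by
        refine (hasDerivWithinAt_id t (Ici 0)).congr_of_eventuallyEq ?_ ?_
        · filter_upwards [nhdsWithin_le_nhds (hγβ t h1)] with s hs
          rw [hs, h.lam_eq]; rfl
        · rw [(hγβ t h1).self_of_nhds, h.lam_eq]; rfl
      have h3 := hud.eq_deriv _ hd1 hd2
      -- `lam` is not assumed linear; applying its derivative rule to a constant map gives `lam 0 =
      -- 0`, which contradicts the derivative `1` of `lam` along the branch.
      have h4 := h.lam_deriv (fun _ => (0 : E)) 0 univ 0 (hasDerivWithinAt_const _ _ _)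
      have h5 := (hasDerivWithinAt_const (0 : ℝ) univ (lam (0 : E)))
      have h6 := uniqueDiffWithinAt_univ.eq_deriv _ h4 h5
      rw [h6] at h3
      exact zero_ne_one h3
    · push Not at h1
      have ht0 : 0 < t := ha0.trans_le h1
      have hd1 : HasDerivWithinAt (fun t => (γ t).2) 0 (Ici 0) t :=
        (ContinuousLinearMap.snd ℝ E ℝ).hasFDerivAt.comp_hasDerivWithinAt t hd
      have hd2 : HasDerivWithinAt G 0 (Ici 0) t :=
        hd1.congr (fun s _ => (hγ2 s).symm) (hγ2 t).symm
      have h3 := hud.eq_deriv _ hd2 (hGd t ht0).hasDerivWithinAt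
      have h4 : G' t < 0 := by
        rcases h1.eq_or_lt with h5 | h5
        · simp only [hG', ← h5, if_pos le_rfl]; exact hda0
        · simp only [hG', if_neg (not_le.2 h5)]; exact hk'neg t
      linarith
  · have hemb : IsEmbedding ((Ici (0 : ℝ)).domRestrict fun t => -G t) := by
      refine StrictMono.isEmbedding_of_ordConnected (fun s t hst => ?_) ?_
      · exact neg_lt_neg (hanti s.2 t.2 hst)
      · rw [range_domRestrict]
        exact (isPreconnected_Ici.image _ hGc.neg).ordConnected
    refine IsEmbedding.of_comp (g := fun p : E × ℝ => -p.2) ?_ (by fun_prop) ?_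
    · exact continuousOn_iff_continuous_domRestrict.1 hγc.continuousOn
    · convert hemb using 1
      funext t
      simp only [Function.comp_apply, domRestrict_apply, hγ2]
  · apply Subset.antisymm
    · rintro _ ⟨t, ht, rfl⟩
      rcases (mem_Ici.1 ht).eq_or_lt with h1 | h1
      · rw [← h1, hγ0]; exact Or.inr rfl
      · rw [hγΦ t h1]
        exact Or.inl ⟨hGpos t ht, hΦS _ (hGpos t ht) (hGlt t h1)⟩
    · rintro ⟨z, c⟩ (⟨h1, h2⟩ | h1)
      · simp only at h1 h2
        have hcb := h.lt _ _ h2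
        have hpre := (isPreconnected_Ici (a := (0 : ℝ))).image _ hGc
        have hlim : Tendsto k atTop (𝓝 (g a * 0)) := by
          refine Tendsto.const_mul _ (Real.tendsto_exp_atBot.comp ?_)
          have h3 : Tendsto (fun t : ℝ => t - a) atTop atTop := tendsto_atTop_add_const_right _ _ tendsto_id
          exact h3.const_mul_atTop_of_neg (by linarith)
        rw [mul_zero] at hlim
        obtain ⟨t, ht, hta⟩ := ((hlim.eventually (gt_mem_nhds h1)).and (eventually_gt_atTop a)).exists
        have hGt : G t < c := by simp only [hG, if_neg (not_le.2 hta)]; exact ht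
        obtain ⟨s, hs, hsc⟩ := hpre.ordConnected.out (mem_image_of_mem G (mem_Ici.2
          (ha0.trans hta).le)) (mem_image_of_mem G self_mem_Ici) ⟨hGt.le, by rw [hG0]; exact hcb.le⟩
        have hs0 : 0 < s := by
          rcases (mem_Ici.1 hs).eq_or_lt with h3 | h3
          · rw [← h3, hG0] at hsc; linarith
          · exact h3
        refine ⟨s, hs, ?_⟩
        rw [hγΦ s hs0, hsc]
        exact Prod.ext (h.unique _ _ _ (hΦS c h1 hcb) h2) rfl
      · rw [h1]
        exact ⟨0, self_mem_Ici, hγ0⟩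

end IsBranch

variable {d : ℤ} {ft : ℝ → ℝ}

/-! ### Classical solutions as weak ones, and regularity at the origin -/

theorem QH_eq_zero_of_isRadialSol {κ : L2r} {k : ℝ → ℝ} (hk : ContinuousOn k (Ioi 0))
    (hκ : ∀ᵐ r ∂radialMeasure, κ r = k r) {g : ℝ} {m : H} {V : ℝ → ℝ}
    (h : IsRadialSol (ev m) V (fun r => g - k r)) (ψ : H) : QH g κ m ψ = 0 := by
  refine H.induction_test (p := fun ψ => QH g κ m ψ = 0)
    (isClosed_eq (QH g κ m).continuous continuous_const) ?_ ψ
  intro w φ hw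
  have hV : IsPrimitive V (fun r => r * ((g - k r) * ev m r)) :=
    IsPrimitive.of_hasDerivAt h.hasDerivAt' (continuousOn_id.mul
      ((continuousOn_const.sub hk).mul (continuousOn_ev m)))
  have hder : ∀ᵐ r ∂radialMeasure, H.derL w r = deriv φ r := hw.der_eq
  have hfn : ∀ᵐ r ∂radialMeasure, H.fnL w r = φ r := by
    filter_upwards [ae_eq_ev w, ae_radial_pos] with r h1 h2
    rw [h1, hw.ev_eq r h2]
  have hpr : ∀ᵐ r ∂radialMeasure, prodH m w r = ev m r * φ r := by
    filter_upwards [coeFn_prodH m w, ae_radial_pos] with r h1 h2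
    rw [h1, hw.ev_eq r h2]
  have hd0 : ∀ᵐ r ∂radialMeasure, H.derL m r = V r / r :=
    (ev_isPrimitive m).ae_eq_of_hasDerivAt h.hasDerivAt
  have h0 := hV.hasWeakDeriv φ hw.isTest.contDiff hw.isTest.compact hw.isTest.subset
  rw [QH_apply, inner_eq_setIntegral hd0 hder, inner_eq_setIntegral (ae_eq_ev m) hfn,
    inner_eq_setIntegral hκ hpr, ← integral_const_mul]
  have e1 : ∫ r in Ioi (0 : ℝ), r * (V r / r * deriv φ r)
      = ∫ r in Ioi (0 : ℝ), V r * deriv φ r := by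
    refine setIntegral_congr_fun measurableSet_Ioi fun r hr => ?_
    have hr0 : (0 : ℝ) < r := hr
    field_simp
  have e2 : ∫ r in Ioi (0 : ℝ), r * ((g - k r) * ev m r) * φ r
      = (∫ r in Ioi (0 : ℝ), g * (r * (ev m r * φ r)))
        - ∫ r in Ioi (0 : ℝ), r * (k r * (ev m r * φ r)) := by
    rw [← integral_sub ((integrableOn_mul_of_ae (ae_eq_ev m) hfn).const_mul g)
      (integrableOn_mul_of_ae hκ hpr)]
    refine setIntegral_congr_fun measurableSet_Ioi fun r hr => ?_
    ring
  rw [e1, h0, e2]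
  ring

/-- The bound `|F'| ≤ φ'` makes `F + φ` non-decreasing and `F - φ` non-increasing, which squeezes a
limit at `0` and gives the rate of approach. -/
theorem exists_limit_zero {F F' φ φ' : ℝ → ℝ} (hF : ∀ r ∈ Ioc (0 : ℝ) 1, HasDerivAt F (F' r) r)
    (hφ : ∀ r ∈ Ioc (0 : ℝ) 1, HasDerivAt φ (φ' r) r) (h : ∀ r ∈ Ioc (0 : ℝ) 1, |F' r| ≤ φ' r)
    (h0 : ∀ r ∈ Ioc (0 : ℝ) 1, 0 ≤ φ r) : ∃ F₀, ∀ r ∈ Ioc (0 : ℝ) 1, |F r - F₀| ≤ φ r := by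
  have hmono : MonotoneOn (fun r => F r + φ r) (Ioc 0 1) := by
    refine monotoneOn_of_deriv_nonneg (convex_Ioc 0 1) (fun r hr =>
      ((hF r hr).add (hφ r hr)).continuousAt.continuousWithinAt) (fun r hr =>
      ((hF r (interior_subset hr)).add (hφ r (interior_subset hr))).differentiableAt.differentiableWithinAt)
      fun r hr => ?_
    have hr' := interior_subset hr
    have e : deriv (fun r => F r + φ r) r = F' r + φ' r := ((hF r hr').add (hφ r hr')).deriv
    rw [e]
    linarith [(abs_le.1 (h r hr')).1]
  have hanti : AntitoneOn (fun r => F r - φ r) (Ioc 0 1) := by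
    refine antitoneOn_of_deriv_nonpos (convex_Ioc 0 1) (fun r hr =>
      ((hF r hr).sub (hφ r hr)).continuousAt.continuousWithinAt) (fun r hr =>
      ((hF r (interior_subset hr)).sub (hφ r (interior_subset hr))).differentiableAt.differentiableWithinAt)
      fun r hr => ?_
    have hr' := interior_subset hr
    have e : deriv (fun r => F r - φ r) r = F' r - φ' r := ((hF r hr').sub (hφ r hr')).deriv
    rw [e]
    linarith [(abs_le.1 (h r hr')).2]
  have key : ∀ r ∈ Ioc (0 : ℝ) 1, ∀ s ∈ Ioc (0 : ℝ) 1, F r - φ r ≤ F s + φ s := by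
    intro r hr s hs
    rcases le_total s r with hsr | hsr
    · have h1 := hanti hs hr hsr
      have h2 := h0 s hs
      simp only at h1
      linarith
    · have h1 := hmono hr hs hsr
      have h2 := h0 r hr
      simp only at h1
      linarith
  have hne : ((fun r => F r + φ r) '' Ioc 0 1).Nonempty := ⟨_, 1, ⟨one_pos, le_rfl⟩, rfl⟩
  refine ⟨sInf ((fun r => F r + φ r) '' Ioc 0 1), fun r hr => abs_le.2 ⟨?_, ?_⟩⟩
  · have : sInf ((fun r => F r + φ r) '' Ioc 0 1) ≤ F r + φ r := by
      refine csInf_le ⟨F r - φ r, ?_⟩ ⟨r, hr, rfl⟩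
      rintro _ ⟨s, hs, rfl⟩
      exact key r hr s hs
    linarith
  · have : F r - φ r ≤ sInf ((fun r => F r + φ r) '' Ioc 0 1) := by
      refine le_csInf hne ?_
      rintro _ ⟨s, hs, rfl⟩
      exact key r hr s hs
    linarith

theorem eq_zero_of_abs_le_sqrt {a C : ℝ} (h : ∀ r ∈ Ioc (0 : ℝ) 1, |a| ≤ C * Real.sqrt r) :
    a = 0 := by
  have h1 : Tendsto (fun r => C * Real.sqrt r) (𝓝[>] 0) (𝓝 (C * Real.sqrt 0)) :=
    ((Real.continuous_sqrt.tendsto 0).const_mul C).mono_left nhdsWithin_le_nhds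
  rw [Real.sqrt_zero, mul_zero] at h1
  have h2 : |a| ≤ 0 := ge_of_tendsto h1 (by
    filter_upwards [Ioc_mem_nhdsGT (one_pos (α := ℝ))] with r hr
    exact h r hr)
  exact abs_eq_zero.1 (le_antisymm h2 (abs_nonneg _))

/-- A non-zero flux at the origin would make `r m'² = V²/r` comparable with `1/r`, which is not
integrable. -/
theorem H.eq_zero_of_flux_limit {m : H} {V : ℝ → ℝ} {V₀ C : ℝ}
    (hm : ∀ᵐ r ∂radialMeasure, H.derL m r = V r / r)
    (hV : ∀ r ∈ Ioc (0 : ℝ) 1, |V r - V₀| ≤ C * Real.sqrt r) : V₀ = 0 := by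
  by_contra hne
  have hpos : 0 < |V₀| := abs_pos.2 hne
  have h1 : Tendsto (fun r => C * Real.sqrt r) (𝓝[>] 0) (𝓝 (C * Real.sqrt 0)) :=
    ((Real.continuous_sqrt.tendsto 0).const_mul C).mono_left nhdsWithin_le_nhds
  rw [Real.sqrt_zero, mul_zero] at h1
  have h2 := h1.eventually (gt_mem_nhds (half_pos hpos))
  obtain ⟨ε, hε, h3⟩ := mem_nhdsGT_iff_exists_Ioc_subset.1
    (h2.and (Ioc_mem_nhdsGT (one_pos (α := ℝ))))
  have hε0 : (0 : ℝ) < ε := hε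
  have hI : IntegrableOn (fun r : ℝ => r⁻¹) (Ioc 0 ε) := by
    have hi := ((L2r.integrableOn_sq (H.derL m)).mono_set (Ioc_subset_Ioi_self : Ioc (0 : ℝ) ε ⊆ Ioi 0)).const_mul
      (4 / V₀ ^ 2)
    refine hi.mono' (measurable_inv.aestronglyMeasurable) ?_
    have hm' := ae_mono (Measure.restrict_mono (Ioc_subset_Ioi_self : Ioc (0 : ℝ) ε ⊆ Ioi 0) le_rfl)
      (ae_restrict_of_ae_radial hm)
    filter_upwards [hm', ae_restrict_mem measurableSet_Ioc] with r h4 hr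
    have h5 := h3 hr
    have h6 := hV r h5.2
    have hr0 : 0 < r := hr.1
    have h7 : |V₀| / 2 ≤ |V r| := by
      have := abs_sub_abs_le_abs_sub V₀ (V r)
      rw [abs_sub_comm] at this
      have h8 : C * Real.sqrt r < |V₀| / 2 := h5.1
      linarith
    have h9 : V₀ ^ 2 / 4 ≤ V r ^ 2 := by
      rw [← sq_abs V₀, ← sq_abs (V r)]
      nlinarith
    rw [h4, norm_inv, Real.norm_of_nonneg hr0.le]
    have hV2 : 0 < V₀ ^ 2 := by positivity
    have e : 4 / V₀ ^ 2 * (r * (V r / r) ^ 2) = r⁻¹ * (V r ^ 2 / (V₀ ^ 2 / 4)) := by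
      field_simp
    rw [e]
    refine le_mul_of_one_le_right (by positivity) ?_
    rw [le_div_iff₀ (by positivity)]
    linarith
  have h4 : IntervalIntegrable (fun r : ℝ => r⁻¹) volume 0 ε := by
    rwa [intervalIntegrable_iff_integrableOn_Ioc_of_le hε0.le]
  rw [intervalIntegrable_inv_iff] at h4
  rcases h4 with h4 | h4
  · exact hε0.ne h4
  · exact h4 left_mem_uIcc

theorem hasDerivAt_sqrt_mul (C : ℝ) {r : ℝ} (hr : 0 < r) :
    HasDerivAt (fun r => 2 * C * Real.sqrt r) (C / Real.sqrt r) r := by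
  refine ((Real.hasDerivAt_sqrt hr.ne').const_mul (2 * C)).congr_deriv ?_
  have := Real.sqrt_pos.2 hr
  field_simp

set_option maxHeartbeats 800000 in
/-- Regularity at the origin: `m` extends continuously to `0`, with `m'(0) = 0`. -/
theorem H.exists_value_zero {m : H} {V c : ℝ → ℝ} (h : IsRadialSol (ev m) V c)
    (hV : ∀ᵐ r ∂radialMeasure, H.derL m r = V r / r) {K : ℝ}
    (hc : ∀ r ∈ Ioc (0 : ℝ) 1, |c r| ≤ K + ev m r ^ 2) (hpos : ∀ r > 0, 0 < ev m r) :
    ∃ m₀ > 0, ∃ C, ∀ r ∈ Ioc (0 : ℝ) 1, |ev m r - m₀| ≤ C * r ^ 2 := by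
  set M := ‖m‖ with hM
  have hM0 : 0 ≤ M := norm_nonneg m
  have hdV : ∀ r ∈ Ioc (0 : ℝ) 1, HasDerivAt V (r * (c r * ev m r)) r :=
    fun r hr => h.hasDerivAt' r hr.1
  have hdm : ∀ r ∈ Ioc (0 : ℝ) 1, HasDerivAt (ev m) (V r / r) r :=
    fun r hr => h.hasDerivAt r hr.1
  have hs : ∀ r ∈ Ioc (0 : ℝ) 1, 0 < Real.sqrt r := fun r hr => Real.sqrt_pos.2 hr.1
  -- Start of a bootstrap. From `r m² ≤ ‖m‖²` one has `r |c| = O(1)` and `m = O(r^(-1/2))`, so the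
  -- flux has a limit, which is `0` by finite energy, with rate `√r`.
  obtain ⟨V₀, hV₀⟩ := exists_limit_zero hdV
    (fun r hr => hasDerivAt_sqrt_mul ((|K| + M ^ 2) * M) hr.1) (fun r hr => by
      have h1 := hc r hr
      have h2 := H.mul_sq_ev_le m hr.1
      have h3 : |ev m r| ≤ M / Real.sqrt r := VortexGL.abs_ev_le m hr.1
      rw [abs_mul, abs_mul, abs_of_pos hr.1, ← mul_assoc]
      have h4 : r * |c r| ≤ |K| + M ^ 2 := by
        have h5 : r * |c r| ≤ r * (K + ev m r ^ 2) := mul_le_mul_of_nonneg_left h1 hr.1.le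
        have h6 : r * K ≤ |K| := by
          have := le_abs_self K
          have h7 := abs_nonneg K
          nlinarith [hr.1, hr.2]
        linarith
      calc r * |c r| * |ev m r| ≤ (|K| + M ^ 2) * (M / Real.sqrt r) := by gcongr
        _ = (|K| + M ^ 2) * M / Real.sqrt r := by ring) (fun r hr => by positivity)
  have hV₀0 : V₀ = 0 := H.eq_zero_of_flux_limit hV hV₀
  rw [hV₀0] at hV₀
  set C₁ := 2 * ((|K| + M ^ 2) * M) with hC₁
  have hC₁0 : 0 ≤ C₁ := by positivity
  -- A flux of order `√r` gives `m' = O(r^(-1/2))`; hence `m`, and then `c`, is bounded on `(0, 1]`.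
  obtain ⟨m₁, hm₁⟩ := exists_limit_zero hdm (fun r hr => hasDerivAt_sqrt_mul C₁ hr.1)
    (fun r hr => by
      have h1 := hV₀ r hr
      rw [sub_zero] at h1
      have h2 := hs r hr
      rw [abs_div, abs_of_pos hr.1, div_le_div_iff₀ hr.1 h2]
      calc |V r| * Real.sqrt r ≤ C₁ * Real.sqrt r * Real.sqrt r := by gcongr
        _ = C₁ * r := by rw [mul_assoc, Real.mul_self_sqrt hr.1.le])
    (fun r hr => by positivity)
  set M₂ := |m₁| + 2 * C₁ with hM₂
  have hM₂0 : 0 ≤ M₂ := by positivity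
  have hmb : ∀ r ∈ Ioc (0 : ℝ) 1, |ev m r| ≤ M₂ := fun r hr => by
    have h1 := hm₁ r hr
    have h2 : Real.sqrt r ≤ 1 := Real.sqrt_le_one.2 hr.2
    have h3 := abs_sub_abs_le_abs_sub (ev m r) m₁
    have h4 : 2 * C₁ * Real.sqrt r ≤ 2 * C₁ * 1 := by gcongr
    linarith
  set K₂ := |K| + M₂ ^ 2 with hK₂
  have hK₂0 : 0 ≤ K₂ := by positivity
  have hcb : ∀ r ∈ Ioc (0 : ℝ) 1, |c r| ≤ K₂ := fun r hr => by
    have h1 := hc r hr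
    have h2 := hmb r hr
    have h3 : ev m r ^ 2 ≤ M₂ ^ 2 := by rw [← sq_abs]; gcongr
    linarith [le_abs_self K]
  -- Second round: with bounded coefficients the flux is of order `r²`.
  obtain ⟨V₁, hV₁⟩ := exists_limit_zero (φ := fun r => K₂ * M₂ * r ^ 2)
    (φ' := fun r => 2 * (K₂ * M₂) * r) hdV
    (fun r _ => ((hasDerivAt_pow 2 r).const_mul (K₂ * M₂)).congr_deriv (by push_cast; ring))
    (fun r hr => by
      rw [abs_mul, abs_mul, abs_of_pos hr.1]
      have h1 : |c r| * |ev m r| ≤ K₂ * M₂ :=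
        mul_le_mul (hcb r hr) (hmb r hr) (abs_nonneg _) hK₂0
      have h2 : 0 ≤ K₂ * M₂ := by positivity
      nlinarith [hr.1])
    (fun r hr => by positivity)
  have hV₁0 : V₁ = 0 := by
    refine eq_zero_of_abs_le_sqrt (C := C₁ + K₂ * M₂) fun r hr => ?_
    have h1 := hV₀ r hr
    have h2 := hV₁ r hr
    rw [sub_zero] at h1
    have h3 : r ^ 2 ≤ Real.sqrt r := by
      have h4 : r ≤ Real.sqrt r := Real.le_sqrt_of_sq_le (by nlinarith [hr.1, hr.2])
      nlinarith [hr.1, hr.2]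
    have h4 := abs_sub_abs_le_abs_sub V₁ (V r)
    rw [abs_sub_comm] at h4
    have h5 : K₂ * M₂ * r ^ 2 ≤ K₂ * M₂ * Real.sqrt r := by gcongr
    have h6 : (C₁ + K₂ * M₂) * Real.sqrt r = C₁ * Real.sqrt r + K₂ * M₂ * Real.sqrt r := by ring
    linarith
  rw [hV₁0] at hV₁
  set C₂ := K₂ * M₂ with hC₂
  have hC₂0 : 0 ≤ C₂ := by positivity
  have hp : ∀ r ∈ Ioc (0 : ℝ) 1, |V r / r| ≤ C₂ * r := fun r hr => by
    have h1 := hV₁ r hr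
    rw [sub_zero] at h1
    rw [abs_div, abs_of_pos hr.1, div_le_iff₀ hr.1]
    calc |V r| ≤ C₂ * r ^ 2 := h1
      _ = C₂ * r * r := by ring
  -- Now `m' = O(r)`, so `m` has a limit at `0` with quadratic rate, which contains `m'(0) = 0`.
  obtain ⟨m₀, hm₀⟩ := exists_limit_zero (φ := fun r => C₂ * r ^ 2) (φ' := fun r => 2 * C₂ * r) hdm
    (fun r _ => ((hasDerivAt_pow 2 r).const_mul C₂).congr_deriv (by push_cast; ring))
    (fun r hr => (hp r hr).trans (by nlinarith [hr.1])) (fun r hr => by positivity)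
  have hlim2 : Tendsto (fun r : ℝ => C₂ * r ^ 2) (𝓝[>] 0) (𝓝 0) := by
    have h1 : Tendsto (fun r : ℝ => C₂ * r ^ 2) (𝓝 0) (𝓝 (C₂ * 0 ^ 2)) :=
      (by fun_prop : Continuous fun r : ℝ => C₂ * r ^ 2).tendsto 0
    rw [zero_pow two_ne_zero, mul_zero] at h1
    exact h1.mono_left nhdsWithin_le_nhds
  have hIoc := Ioc_mem_nhdsGT (one_pos (α := ℝ))
  have hmlim : Tendsto (ev m) (𝓝[>] 0) (𝓝 m₀) := by
    rw [tendsto_iff_norm_sub_tendsto_zero]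
    exact squeeze_zero' (Eventually.of_forall fun _ => norm_nonneg _)
      (by filter_upwards [hIoc] with r hr using hm₀ r hr) hlim2
  have hm₀nn : 0 ≤ m₀ := ge_of_tendsto hmlim (by
    filter_upwards [self_mem_nhdsWithin] with r hr using (hpos r hr).le)
  refine ⟨m₀, hm₀nn.lt_of_ne fun hz => ?_, C₂, hm₀⟩
  rw [← hz] at hmlim
  have hplim : Tendsto (fun r => V r / r) (𝓝[>] 0) (𝓝 0) := by
    have h1 : Tendsto (fun r : ℝ => C₂ * r) (𝓝[>] 0) (𝓝 0) := by
      have h1 : Tendsto (fun r : ℝ => C₂ * r) (𝓝 0) (𝓝 (C₂ * 0)) :=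
        (by fun_prop : Continuous fun r : ℝ => C₂ * r).tendsto 0
      rw [mul_zero] at h1
      exact h1.mono_left nhdsWithin_le_nhds
    rw [tendsto_zero_iff_norm_tendsto_zero]
    exact squeeze_zero' (Eventually.of_forall fun _ => norm_nonneg _)
      (by filter_upwards [hIoc] with r hr using hp r hr) h1
  set L := 1 + K₂ with hL
  -- If the limit were `0`, the data `(m, m')` would vanish at the origin. The singular term `-m'/r`
  -- has a favourable sign, so Grönwall's inequality still holds up to `0` and contradicts `m(1) >
  -- 0`.
  set W : ℝ → ℝ := fun r => (ev m r ^ 2 + (V r / r) ^ 2) * Real.exp (-L * r) with hW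
  have hWd : ∀ r ∈ Ioc (0 : ℝ) 1, ∃ W', HasDerivAt W W' r ∧ W' ≤ 0 := fun r hr => by
    have hr0 := hr.1
    have e1 : HasDerivAt (fun r => V r / r) (c r * ev m r - V r / r / r) r :=
      ((hdV r hr).div (hasDerivAt_id r) hr0.ne').congr_deriv (by simp; field_simp)
    have e2 : HasDerivAt (fun r => Real.exp (-L * r)) (-L * Real.exp (-L * r)) r := by
      have : HasDerivAt (fun r : ℝ => -L * r) (-L) r := by
        simpa using (hasDerivAt_id r).const_mul (-L)
      exact this.exp.congr_deriv (by ring)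
    refine ⟨_, (((hdm r hr).pow 2).add (e1.pow 2)).mul e2, ?_⟩
    set p := V r / r with hpdef
    set y := ev m r with hy
    have h1 := abs_le.1 (hcb r hr)
    have h2 : 0 ≤ p ^ 2 / r := by positivity
    have h3 : 2 * y * p + 2 * p * (c r * y - p / r) - L * (y ^ 2 + p ^ 2) ≤ 0 := by
      have e3 : 2 * p * (c r * y - p / r) = 2 * c r * (p * y) - 2 * (p ^ 2 / r) := by ring
      have e4 : 2 * c r * (p * y) ≤ K₂ * (y ^ 2 + p ^ 2) := by
        have a1 : |2 * (p * y)| ≤ y ^ 2 + p ^ 2 :=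
          abs_le.2 ⟨by nlinarith [sq_nonneg (p + y)], by nlinarith [sq_nonneg (p - y)]⟩
        calc 2 * c r * (p * y) = c r * (2 * (p * y)) := by ring
          _ ≤ |c r * (2 * (p * y))| := le_abs_self _
          _ = |c r| * |2 * (p * y)| := abs_mul _ _
          _ ≤ K₂ * (y ^ 2 + p ^ 2) := mul_le_mul (hcb r hr) a1 (abs_nonneg _) hK₂0
      have e5 : L * (y ^ 2 + p ^ 2) = (y ^ 2 + p ^ 2) + K₂ * (y ^ 2 + p ^ 2) := by
        rw [hL]; ring
      nlinarith [sq_nonneg (y - p)]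
    have h4 := Real.exp_pos (-L * r)
    simp only [Nat.cast_ofNat, Nat.add_one_sub_one, pow_one, Pi.add_apply, Pi.pow_apply]
    have e6 : (2 * y * p + 2 * p * (c r * y - p / r)) * Real.exp (-L * r)
        + (y ^ 2 + p ^ 2) * (-L * Real.exp (-L * r))
        = (2 * y * p + 2 * p * (c r * y - p / r) - L * (y ^ 2 + p ^ 2)) * Real.exp (-L * r) := by
      ring
    refine le_trans (le_of_eq ?_) (mul_nonpos_of_nonpos_of_nonneg h3 h4.le)
    rw [← e6]
  have hWanti : AntitoneOn W (Ioc 0 1) := by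
    refine antitoneOn_of_deriv_nonpos (convex_Ioc 0 1) (fun r hr => ?_) (fun r hr => ?_)
      fun r hr => ?_
    · obtain ⟨W', h1, -⟩ := hWd r hr
      exact h1.continuousAt.continuousWithinAt
    · obtain ⟨W', h1, -⟩ := hWd r (interior_subset hr)
      exact h1.differentiableAt.differentiableWithinAt
    · obtain ⟨W', h1, h2⟩ := hWd r (interior_subset hr)
      rwa [h1.deriv]
  have hWlim : Tendsto W (𝓝[>] 0) (𝓝 0) := by
    have h1 : Tendsto (fun r => Real.exp (-L * r)) (𝓝[>] 0) (𝓝 (Real.exp (-L * 0))) :=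
      ((by fun_prop : Continuous fun r => Real.exp (-L * r)).tendsto 0).mono_left nhdsWithin_le_nhds
    have h2 := ((hmlim.pow 2).add (hplim.pow 2)).mul h1
    have e : ((0 : ℝ) ^ 2 + 0 ^ 2) * Real.exp (-L * 0) = 0 := by simp
    rwa [e] at h2
  have h1 : W 1 ≤ 0 := ge_of_tendsto hWlim (by
    filter_upwards [hIoc] with r hr using hWanti hr ⟨one_pos, le_rfl⟩ hr.2)
  have h2 : 0 < W 1 := by
    have := hpos 1 one_pos
    have h3 := Real.exp_pos (-L * 1)
    simp only [hW]
    positivity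
  linarith

variable {d : ℤ} {ft : ℝ → ℝ}

/-! ### Admissible solutions correspond to positive weak solutions -/

theorem IsRadialSol.congr_fun {y y' V c : ℝ → ℝ} (h : IsRadialSol y V c)
    (hy : ∀ r > 0, y' r = y r) : IsRadialSol y' V c := by
  refine ⟨fun r hr => (h.hasDerivAt r hr).congr_of_eventuallyEq ?_, fun r hr => ?_⟩
  · filter_upwards [Ioi_mem_nhds hr] with s hs using hy s hs
  · rw [hy r hr]
    exact h.hasDerivAt' r hr

theorem integrableOn_of_le {F G : ℝ → ℝ} (hF : ContinuousOn F (Ioi 0))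
    (hG : IntegrableOn G (Ioi 0)) (h : ∀ r > 0, |F r| ≤ G r) : IntegrableOn F (Ioi 0) := by
  refine hG.mono' (hF.aestronglyMeasurable measurableSet_Ioi) ?_
  filter_upwards [ae_restrict_mem measurableSet_Ioi] with r hr using h r hr

theorem continuousOn_deriv_of_contDiffOn {f : ℝ → ℝ} (hf : ContDiffOn ℝ 2 f (Ioi 0)) :
    ContinuousOn (deriv f) (Ioi 0) :=
  hf.continuousOn_deriv_of_isOpen isOpen_Ioi (by norm_num)

theorem isPrimitive_of_contDiffOn {f : ℝ → ℝ} (hf : ContDiffOn ℝ 2 f (Ioi 0)) :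
    IsPrimitive f (deriv f) :=
  IsPrimitive.of_hasDerivAt (fun r hr => ((hf.differentiableOn (by norm_num) r hr).differentiableAt
    (Ioi_mem_nhds hr)).hasDerivAt) (continuousOn_deriv_of_contDiffOn hf)

theorem integrableOn_one_add_sq (C : ℝ) :
    IntegrableOn (fun r : ℝ => C * (1 + r ^ 2)⁻¹) (Ioi 0) :=
  (integrable_inv_one_add_sq.const_mul C).integrableOn

namespace IsAdmissible

variable {g : ℝ} {f m : ℝ → ℝ}

/-- The finite energy of an admissible solution controls the gradients, the mass of `m`, the
potential, and the mass of `f / r` on bounded sets. -/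
theorem exists_bound (hC : CoreProfile d ft) (hg : 0 < g) (h : IsAdmissible d ft g f m) :
    ∃ (R : ℝ) (E : ℝ → ℝ), 1 ≤ R ∧ (∀ r ≥ R, 1 / 2 ≤ ft r) ∧ IntegrableOn E (Ioi 0) ∧
      (∀ r > 0, r * deriv f r ^ 2 ≤ E r ∧ r * deriv m r ^ 2 ≤ E r ∧ g / 2 * (r * m r ^ 2) ≤ E r ∧
        1 / 4 * (r * (1 - f r ^ 2 - m r ^ 2) ^ 2) ≤ E r) ∧
      ∀ r > 0, r ≤ R → f r ^ 2 / r ≤ E r := by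
  have hd1 := one_le_sq_int hC.ne
  obtain ⟨R₀, hR₀⟩ := ((hC.nc.at_infty.eventually_const_lt
    (show (1 / 2 : ℝ) < 1 by norm_num))).exists_forall_of_atTop
  set D : ℝ := (d : ℝ) ^ 2 with hD
  -- Beyond `R` one has `2 D ≤ g r²`, so half of the mass term absorbs `D m²/r`.
  set R := max R₀ (1 + 2 * D / g) with hR
  have hR1 : 1 + 2 * D / g ≤ R := le_max_right _ _
  have hDg : 0 < 2 * D / g := by positivity
  have hR1' : 1 ≤ R := by linarith
  set e : ℝ → ℝ := fun r => energyDensity d ft g f m r * r with he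
  set CB : ℝ := 4 * D * (1 + R ^ 2) + 2 * D ^ 2 with hCB
  have key : ∀ r > 0, r * deriv f r ^ 2 + r * deriv m r ^ 2 + g / 2 * (r * m r ^ 2)
      + 1 / 4 * (r * (1 - f r ^ 2 - m r ^ 2) ^ 2) + (if r ≤ R then f r ^ 2 / r else 0)
      ≤ e r + CB * (1 + r ^ 2)⁻¹ := by
    intro r hr
    set a := 1 - f r ^ 2 - m r ^ 2 with ha
    have hm2 : 0 ≤ r * m r ^ 2 := by positivity
    have ha2 : 0 ≤ r * a ^ 2 := by positivity
    have e1 : e r = r * deriv f r ^ 2 + r * deriv m r ^ 2 + g * (r * m r ^ 2)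
        + D * ((f r ^ 2 - ft r ^ 2) / r) + 1 / 2 * (r * a ^ 2) := by
      simp only [he, energyDensity, ← ha, ← hD]
      field_simp
    have hpos : 0 < 1 + r ^ 2 := by positivity
    split_ifs with hrR
    · have h1 : ft r ^ 2 / r ≤ 4 := by
        rw [div_le_iff₀ hr]; exact hC.nc.sq_le hC.ne hr
      have h2 : 4 * D ≤ CB * (1 + r ^ 2)⁻¹ := by
        rw [← div_eq_mul_inv, le_div_iff₀ hpos, hCB]
        have : 4 * D * (1 + r ^ 2) ≤ 4 * D * (1 + R ^ 2) := by gcongr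
        nlinarith [sq_nonneg D]
      have h3 : D * ((f r ^ 2 - ft r ^ 2) / r) = D * (f r ^ 2 / r) - D * (ft r ^ 2 / r) := by ring
      have h4 : f r ^ 2 / r ≤ D * (f r ^ 2 / r) := le_mul_of_one_le_left (by positivity) hd1
      have h5 : D * (ft r ^ 2 / r) ≤ D * 4 := by gcongr
      have h6 : 0 ≤ g * (r * m r ^ 2) := by positivity
      rw [e1]
      linarith
    · rw [not_le] at hrR
      have hr1 : 1 < r := hR1'.trans_lt hrR
      have h0 := hC.one_sub_sq_pos hr
      -- For large `r` the indefinite term is rewritten through the potential `a`: the part with `1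
      -- - f̃²` is positive, the part with `a` is absorbed by half of the quartic term at the cost
      -- of `D²/r³`, and the part with `m²` by the mass term.
      have h1 : f r ^ 2 - ft r ^ 2 = (1 - ft r ^ 2) - a - m r ^ 2 := by rw [ha]; ring
      have h2 : D * ((f r ^ 2 - ft r ^ 2) / r) ≥ - (D * a / r) - D * m r ^ 2 / r := by
        have : 0 ≤ D * (1 - ft r ^ 2) / r := by positivity
        have e2 : D * ((f r ^ 2 - ft r ^ 2) / r)
            = D * (1 - ft r ^ 2) / r - D * a / r - D * m r ^ 2 / r := by rw [h1]; ring
        linarith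
      have h3 : D * m r ^ 2 / r ≤ g / 2 * (r * m r ^ 2) := by
        rw [div_le_iff₀ hr]
        have h4 : 2 * D ≤ g * r ^ 2 := by
          have : 2 * D / g ≤ r := by linarith
          rw [div_le_iff₀ hg] at this
          nlinarith
        nlinarith [sq_nonneg (m r)]
      have h4 : D * a / r ≤ 1 / 4 * (r * a ^ 2) + D ^ 2 / r ^ 3 := by
        have : 1 / 4 * (r * a ^ 2) + D ^ 2 / r ^ 3 - D * a / r
            = r * (a / 2 - D / r ^ 2) ^ 2 := by field_simp; ring
        have h5 : 0 ≤ r * (a / 2 - D / r ^ 2) ^ 2 := by positivity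
        linarith
      have h5 : D ^ 2 / r ^ 3 ≤ CB * (1 + r ^ 2)⁻¹ := by
        rw [← div_eq_mul_inv, div_le_div_iff₀ (by positivity) hpos]
        have h6 : 1 + r ^ 2 ≤ 2 * r ^ 3 := by nlinarith [sq_nonneg (r - 1)]
        have h7 : 2 * D ^ 2 ≤ CB := by
          have : 0 ≤ 4 * D * (1 + R ^ 2) := by positivity
          linarith
        calc D ^ 2 * (1 + r ^ 2) ≤ D ^ 2 * (2 * r ^ 3) := by gcongr
          _ = 2 * D ^ 2 * r ^ 3 := by ring
          _ ≤ CB * r ^ 3 := by gcongr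
      rw [e1]
      linarith
  have hn : ∀ r > 0, 0 ≤ r * deriv f r ^ 2 ∧ 0 ≤ r * deriv m r ^ 2 ∧ 0 ≤ g / 2 * (r * m r ^ 2) ∧
      0 ≤ 1 / 4 * (r * (1 - f r ^ 2 - m r ^ 2) ^ 2) ∧ 0 ≤ f r ^ 2 / r := fun r hr => by
    refine ⟨?_, ?_, ?_, ?_, ?_⟩ <;> positivity
  refine ⟨R, fun r => e r + CB * (1 + r ^ 2)⁻¹, hR1', fun r hr =>
    (hR₀ r ((le_max_left _ _).trans hr)).le, h.finite_energy.add (integrableOn_one_add_sq CB),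
    fun r hr => ?_, fun r hr hrR => ?_⟩
  · obtain ⟨n1, n2, n3, n4, n5⟩ := hn r hr
    have hk := key r hr
    have n6 : 0 ≤ (if r ≤ R then f r ^ 2 / r else 0) := by split_ifs <;> simp [n5]
    refine ⟨?_, ?_, ?_, ?_⟩ <;> linarith
  · obtain ⟨n1, n2, n3, n4, n5⟩ := hn r hr
    have hk := key r hr
    rw [if_pos hrR] at hk
    linarith

/-- Finite energy controls `m` and the gradients directly; what remains is `u = f - f̃` in `L²_r`,
together with `u/r`. For large `r`, where `f + f̃ ≥ 1/2`, it follows from `u (f + f̃) = f² - f̃²`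
and the bounds for `1 - f² - m²`, `1 - f̃²` and `m²`; on bounded sets from those for `f²/r` and
`f̃²/r`. -/
theorem exists_represents (hC : CoreProfile d ft) (hg : 0 < g) (h : IsAdmissible d ft g f m) :
    ∃ z : Z₀, Represents ft z f m := by
  obtain ⟨R, E, hR, hft, hE, hb, hb'⟩ := h.exists_bound hC hg
  have hcf := h.contDiffOn_f.continuousOn
  have hcm := h.contDiffOn_m.continuousOn
  have hcdf := continuousOn_deriv_of_contDiffOn h.contDiffOn_f
  have hcdm := continuousOn_deriv_of_contDiffOn h.contDiffOn_m
  have hmemm : MemLp m 2 radialMeasure := by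
    refine memLp_two_radial_of_continuousOn hcm
      (integrableOn_of_le (continuousOn_id.mul (hcm.pow 2)) (hE.const_mul (2 / g)) fun r hr => ?_)
    rw [abs_of_nonneg (by positivity)]
    have := (hb r hr).2.2.1
    calc r * m r ^ 2 = 2 / g * (g / 2 * (r * m r ^ 2)) := by field_simp
      _ ≤ 2 / g * E r := by gcongr
  have hmemdm : MemLp (deriv m) 2 radialMeasure := by
    refine memLp_two_radial_of_continuousOn hcdm
      (integrableOn_of_le (continuousOn_id.mul (hcdm.pow 2)) hE fun r hr => ?_)
    rw [abs_of_nonneg (by positivity)]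
    exact (hb r hr).2.1
  have hmemdf : MemLp (deriv f) 2 radialMeasure := by
    refine memLp_two_radial_of_continuousOn hcdf
      (integrableOn_of_le (continuousOn_id.mul (hcdf.pow 2)) hE fun r hr => ?_)
    rw [abs_of_nonneg (by positivity)]
    exact (hb r hr).1
  have hmemdft : MemLp (deriv ft) 2 radialMeasure := memLp_two_radial_of_continuousOn
    (continuousOn_deriv_of_contDiffOn hC.nc.contDiffOn) (hC.nc.integrableOn_deriv hC.ne)
  obtain ⟨w, hw, -⟩ := exists_H_of_isPrimitive (isPrimitive_of_contDiffOn h.contDiffOn_m)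
    hmemm hmemdm
  set u : ℝ → ℝ := fun r => f r - ft r with hu
  have hcu : ContinuousOn u (Ioi 0) := hcf.sub hC.nc.continuousOn
  -- A common majorant of `r u²` and `u²/r`: the first summand serves for `r ≤ R`, the second for `r
  -- > R`. In the latter, `m²` is written with `ev w`, whose square is known to lie in `L²_r`.
  set G : ℝ → ℝ := fun r => R ^ 2 * (2 * E r + 8 * (1 + R ^ 2) * (1 + r ^ 2)⁻¹)
    + 12 * (r * (1 - ft r ^ 2) ^ 2 + 4 * E r + r * (ev w r * ev w r) ^ 2) with hG
  have hGi : IntegrableOn G (Ioi 0) := by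
    have i1 := MemLp.integrableOn_sq_radial hC.memLp_one_sub_sq
    have i2 := MemLp.integrableOn_sq_radial (memLp_ev_mul w w)
    exact (((hE.const_mul 2).add (integrableOn_one_add_sq _)).const_mul _).add
      (((i1.add (hE.const_mul 4)).add i2).const_mul 12)
  have hE0 : ∀ r > 0, 0 ≤ E r := fun r hr => le_trans (by positivity) (hb r hr).1
  have hGb : ∀ r > 0, r * u r ^ 2 ≤ G r ∧ u r ^ 2 / r ≤ G r := by
    intro r hr
    have hEr := hE0 r hr
    rcases le_or_gt r R with hrR | hrR
    · have h1 := hb' r hr hrR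
      have h2 : u r ^ 2 / r ≤ 2 * E r + 8 * (1 + R ^ 2) * (1 + r ^ 2)⁻¹ := by
        have h3 : ft r ^ 2 / r ≤ 4 := by
          rw [div_le_iff₀ hr]; exact hC.nc.sq_le hC.ne hr
        have h4 : u r ^ 2 ≤ 2 * f r ^ 2 + 2 * ft r ^ 2 := by
          simp only [hu]; nlinarith [sq_nonneg (f r + ft r)]
        have h5 : u r ^ 2 / r ≤ 2 * (f r ^ 2 / r) + 2 * (ft r ^ 2 / r) := by
          calc u r ^ 2 / r ≤ (2 * f r ^ 2 + 2 * ft r ^ 2) / r := by gcongr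
            _ = _ := by ring
        have h6 : 8 ≤ 8 * (1 + R ^ 2) * (1 + r ^ 2)⁻¹ := by
          rw [← div_eq_mul_inv, le_div_iff₀ (by positivity)]
          have : r ^ 2 ≤ R ^ 2 := by gcongr
          linarith
        linarith
      have h3 : 0 ≤ u r ^ 2 / r := by positivity
      have h4 : R ^ 2 * (u r ^ 2 / r) ≤ G r := by
        have h5 : 0 ≤ 12 * (r * (1 - ft r ^ 2) ^ 2 + 4 * E r + r * (ev w r * ev w r) ^ 2) := by
          positivity
        have h6 := mul_le_mul_of_nonneg_left h2 (sq_nonneg R)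
        simp only [hG]
        linarith
      refine ⟨le_trans ?_ h4, le_trans (le_mul_of_one_le_left h3 (by nlinarith)) h4⟩
      have : r * u r ^ 2 = r ^ 2 * (u r ^ 2 / r) := by field_simp
      rw [this]
      gcongr
    · have hr1 : 1 < r := hR.trans_lt hrR
      have h1 := hft r hrR.le
      have h2 := h.nonneg_f r hr.le
      set a := 1 - f r ^ 2 - m r ^ 2 with ha
      have h3 : u r ^ 2 ≤ 12 * ((1 - ft r ^ 2) ^ 2 + a ^ 2 + (ev w r * ev w r) ^ 2) := by
        rw [hw r hr]
        set x := (1 - ft r ^ 2) with hx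
        have e1 : u r * (f r + ft r) = x - a - m r * m r := by
          simp only [hu, hx, ha]; ring
        have e2 : 1 / 4 ≤ (f r + ft r) ^ 2 := by nlinarith
        have e3 : u r ^ 2 ≤ 4 * (u r * (f r + ft r)) ^ 2 := by
          rw [mul_pow]; nlinarith [sq_nonneg (u r)]
        rw [e1] at e3
        have e4 : (x - a - m r * m r) ^ 2 ≤ 3 * (x ^ 2 + a ^ 2 + (m r * m r) ^ 2) := by
          nlinarith [sq_nonneg (x + a), sq_nonneg (x + m r * m r), sq_nonneg (a - m r * m r)]
        linarith
      have h4 := (hb r hr).2.2.2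
      have h5 : r * u r ^ 2 ≤ G r := by
        have h6 : 0 ≤ R ^ 2 * (2 * E r + 8 * (1 + R ^ 2) * (1 + r ^ 2)⁻¹) := by positivity
        have h7 := mul_le_mul_of_nonneg_left h3 hr.le
        simp only [hG]
        linarith
      refine ⟨h5, le_trans ?_ h5⟩
      rw [div_le_iff₀ hr]
      nlinarith [mul_nonneg (sq_nonneg (u r)) (show (0 : ℝ) ≤ r ^ 2 - 1 by nlinarith)]
  have hmemu : MemLp u 2 radialMeasure := memLp_two_radial_of_continuousOn hcu
    (integrableOn_of_le (continuousOn_id.mul (hcu.pow 2)) hGi fun r hr => by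
      rw [abs_of_nonneg (by positivity)]; exact (hGb r hr).1)
  have hp : IsPrimitive u (fun r => deriv f r - deriv ft r) :=
    IsPrimitive.of_hasDerivAt (fun r hr => (((isPrimitive_of_contDiffOn h.contDiffOn_f).hasDerivAt
      hr hcdf).sub ((isPrimitive_of_contDiffOn hC.nc.contDiffOn).hasDerivAt hr
      (continuousOn_deriv_of_contDiffOn hC.nc.contDiffOn))))
      (hcdf.sub (continuousOn_deriv_of_contDiffOn hC.nc.contDiffOn))
  obtain ⟨v, hv, -⟩ := exists_H_of_isPrimitive hp hmemu (hmemdf.sub hmemdft)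
  have hcq : ContinuousOn (fun r => ev v r / r) (Ioi 0) :=
    (continuousOn_ev v).div continuousOn_id fun x hx => ne_of_gt hx
  obtain ⟨U, hU⟩ := exists_X_of_H (w := v) (memLp_two_radial_of_continuousOn hcq
    (integrableOn_of_le (continuousOn_id.mul (hcq.pow 2)) hGi fun r hr => by
      rw [abs_of_nonneg (by positivity), hv r hr]
      refine le_trans (le_of_eq ?_) (hGb r hr).2
      field_simp))
  refine ⟨(U, w), ?_, ?_⟩
  · filter_upwards [ae_eq_ev (inclXH U), ae_radial_pos] with r h1 h2
    rw [← X.fnL_apply, ← fnL_inclXH, h1, hU, hv r h2, hu]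
    ring
  · filter_upwards [ae_eq_ev w, ae_radial_pos] with r h1 h2
    rw [← H.fnL_apply, h1, hw r h2]

/-- The classical equations hold weakly against test functions, hence against all of `X` and `H` by
density, without conditions at the origin. Positivity of `f` comes from the strong maximum
principle. -/
theorem isPosSol (hC : CoreProfile d ft) (h : IsAdmissible d ft g f m) (hm : ∀ r ≥ 0, 0 < m r)
    {z : Z₀} (hz : Represents ft z f m) : hC.IsPosSol g z := by
  have hm' : ∀ r > 0, ev z.2 r = m r := fun r hr =>
    ev_eq_of_ae h.contDiffOn_m.continuousOn (hz.2.mono fun s hs => hs.symm) hr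
  have hu : ∀ r > 0, ev (inclXH z.1) r = f r - ft r := fun r hr =>
    ev_eq_of_ae (h.contDiffOn_f.continuousOn.sub hC.nc.continuousOn) (by
      filter_upwards [hz.1] with s hs
      rw [Pi.sub_apply, hs, fnL_inclXH, X.fnL_apply]
      ring) hr
  have hf' : ∀ r > 0, fz ft z r = f r := fun r hr => by rw [fz, hu r hr]; ring
  have s1 : IsRadialSol f (fun r => r * deriv f r) (fun r => (d : ℝ) ^ 2 / r ^ 2 - az ft z r) := by
    refine IsRadialSol.of_contDiffOn h.contDiffOn_f fun r hr => ?_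
    have := h.eqn_f r hr
    rw [az, hf' r hr, hm' r hr]
    linarith
  have s2 : IsRadialSol m (fun r => r * deriv m r) (fun r => g - az ft z r) := by
    refine IsRadialSol.of_contDiffOn h.contDiffOn_m fun r hr => ?_
    have := h.eqn_m r hr
    rw [az, hf' r hr, hm' r hr]
    linarith
  have he : hC.eqn g z = 0 := by
    refine ContinuousLinearMap.ext fun ξ => ?_
    have e : ξ = (ξ.1, 0) + (0, ξ.2) := by simp
    rw [e, map_add, hC.eqn_fst_of_isRadialSol g (s1.congr_fun hf'), hC.eqn_snd,
      QH_eq_zero_of_isRadialSol (hC.continuousOn_az z) (hC.coeFn_aa z) (s2.congr_fun hm')]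
    simp
  exact ⟨he, CoreProfile.f_pos_of_nonneg he fun r hr => by rw [hf' r hr]; exact h.nonneg_f r hr.le,
    fun r hr => by rw [hm' r hr]; exact hm r hr.le⟩

end IsAdmissible

theorem hasDerivWithinAt_zero_of_abs_le {m : ℝ → ℝ} {C : ℝ}
    (h : ∀ r ∈ Ioc (0 : ℝ) 1, |m r - m 0| ≤ C * r ^ 2) : HasDerivWithinAt m 0 (Ici 0) 0 := by
  rw [hasDerivWithinAt_iff_tendsto]
  have h1 : Tendsto (fun r : ℝ => C * r) (𝓝[Ici 0] 0) (𝓝 0) := by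
    have h1 : Tendsto (fun r : ℝ => C * r) (𝓝 0) (𝓝 (C * 0)) :=
      (by fun_prop : Continuous fun r : ℝ => C * r).tendsto 0
    rw [mul_zero] at h1
    exact h1.mono_left nhdsWithin_le_nhds
  refine squeeze_zero' (Eventually.of_forall fun _ => by positivity) ?_ h1
  filter_upwards [self_mem_nhdsWithin, mem_nhdsWithin_of_mem_nhds (Iio_mem_nhds one_pos)]
    with r hr hr1
  have hr0 : (0 : ℝ) ≤ r := hr
  rcases hr0.eq_or_lt with h0 | h0
  · rw [← h0]; simp
  · have h2 := h r ⟨h0, le_of_lt hr1⟩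
    rw [smul_zero, sub_zero, sub_zero, Real.norm_of_nonneg hr0, Real.norm_eq_abs,
      inv_mul_le_iff₀ h0]
    linarith

/-- Interior regularity makes the representatives classical solutions; at the origin `m` is assigned
its limit, which is positive and approached quadratically. -/
theorem CoreProfile.IsPosSol.exists_isAdmissible {hC : CoreProfile d ft} {g : ℝ} (hg : 0 < g)
    {z : Z₀} (h : hC.IsPosSol g z) : ∃ f m : ℝ → ℝ, IsAdmissible d ft g f m ∧
      (∀ r ≥ 0, 0 < m r) ∧ Represents ft z f m := by
  obtain ⟨V, hV, hV'⟩ := hC.exists_radialSol_fst (CoreProfile.eqn_fst_eq_zero h.eqn)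
  obtain ⟨W, hW, hW'⟩ := CoreProfile.exists_radialSol_snd (hC.continuousOn_az z) (hC.coeFn_aa z)
    (CoreProfile.eqn_snd_eq_zero h.eqn)
  set u := ev (inclXH z.1) with hu
  have hub : ∀ r > 0, |u r| ≤ ‖z.1‖ := fun r hr => X.abs_ev_le z.1 hr
  have hft : ∀ r > 0, 0 < ft r ∧ ft r < 1 := fun r hr => ⟨hC.nc.pos r hr, hC.nc.lt_one hC.ne hr⟩
  obtain ⟨m₀, hm₀, C, hC'⟩ := H.exists_value_zero hW hW' (K := g + 1 + (1 + ‖z.1‖) ^ 2)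
    (fun r hr => by
      have h1 := abs_le.1 (hub r hr.1)
      have h2 := hft r hr.1
      have h3 : fz ft z r ^ 2 ≤ (1 + ‖z.1‖) ^ 2 := by
        refine sq_le_sq' ?_ ?_ <;> simp only [fz, ← hu] <;> linarith
      have h4 := sq_nonneg (fz ft z r)
      have h5 := sq_nonneg (ev z.2 r)
      rw [az, abs_le]
      constructor <;> linarith) h.m_pos
  set f : ℝ → ℝ := fun r => if 0 < r then fz ft z r else 0 with hf
  set m : ℝ → ℝ := fun r => if 0 < r then ev z.2 r else m₀ with hm
  have hfe : ∀ r > 0, f r = fz ft z r := fun r hr => if_pos hr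
  have hme : ∀ r > 0, m r = ev z.2 r := fun r hr => if_pos hr
  have s1 := hV.congr_fun hfe
  have s2 := hW.congr_fun hme
  have c1 := s1.contDiffOn (hC.continuousOn_potential_fst z)
  have c2 := s2.contDiffOn (hC.continuousOn_potential_snd g z)
  have hm0 : m 0 = m₀ := if_neg (lt_irrefl _)
  have hmpos : ∀ r ≥ 0, 0 < m r := fun r hr => by
    rcases (ge_iff_le.1 hr).eq_or_lt with h0 | h0
    · rw [← h0, hm0]; exact hm₀
    · rw [hme r h0]; exact h.m_pos r h0
  refine ⟨f, m, ⟨c1, c2, fun r hr => ?_, fun r hr => ?_, ?_, fun r hr => ?_,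
    fun r hr => (hmpos r hr).le, hasDerivWithinAt_zero_of_abs_le (C := C) fun r hr => ?_⟩, hmpos,
    ?_, ?_⟩
  · rw [(s1.hasDerivAt_deriv hr).deriv, az, hfe r hr, hme r hr]
    ring
  · rw [(s2.hasDerivAt_deriv hr).deriv, az, hfe r hr, hme r hr]
    ring
  · have i1 : IntegrableOn (fun r => r * deriv f r ^ 2) (Ioi 0) := by
      refine MemLp.integrableOn_sq_radial ?_
      have hmemdft : MemLp (deriv ft) 2 radialMeasure := memLp_two_radial_of_continuousOn
        (continuousOn_deriv_of_contDiffOn hC.nc.contDiffOn) (hC.nc.integrableOn_deriv hC.ne)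
      refine ((Lp.memLp (X.derL z.1)).add hmemdft).ae_eq ?_
      filter_upwards [hV', ae_radial_pos] with r h1 h2
      rw [s1.deriv_eq h2, Pi.add_apply, h1]
      ring
    have i2 : IntegrableOn (fun r => r * deriv m r ^ 2) (Ioi 0) := by
      refine MemLp.integrableOn_sq_radial ((Lp.memLp (H.derL z.2)).ae_eq ?_)
      filter_upwards [hW', ae_radial_pos] with r h1 h2
      rw [s2.deriv_eq h2, h1]
    have i3 := (H.integrableOn_fn z.2).const_mul g
    have i4 : IntegrableOn (fun r => r * az ft z r ^ 2) (Ioi 0) := by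
      refine MemLp.integrableOn_sq_radial ((Lp.memLp (hC.aa z)).ae_eq (hC.coeFn_aa z))
    -- The renormalized term `(f² - f̃²)/r`. Near `0` the cross term is controlled by `f̃² ≤ 4 r`
    -- and `u²/r`, at infinity by `2 |u|/r ≤ 1/r³ + r u²`.
    have i5 : IntegrableOn (fun r => (2 * ft r * u r + u r ^ 2) / r) (Ioi 0) := by
      have j1 : IntegrableOn (fun r => r * (u r / r) ^ 2) (Ioi 0) :=
        MemLp.integrableOn_sq_radial ((Lp.memLp (X.quoL z.1)).ae_eq (quoL_ae z.1))
      have j2 := H.integrableOn_fn (inclXH z.1)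
      refine integrableOn_of_le ?_ (((integrableOn_one_add_sq 8).add (j1.const_mul 2)).add j2)
        fun r hr => ?_
      · have hcu : ContinuousOn u (Ioi 0) := continuousOn_ev _
        exact (((continuousOn_const.mul hC.nc.continuousOn).mul hcu).add (hcu.pow 2)).div
          continuousOn_id fun x hx => ne_of_gt hx
      · obtain ⟨h1, h2⟩ := hft r hr
        have h3 : |2 * ft r * u r + u r ^ 2| / r ≤ 2 * ft r * |u r| / r + u r ^ 2 / r := by
          rw [← add_div]
          gcongr
          refine (abs_add_le _ _).trans ?_
          rw [abs_mul, abs_of_pos (by positivity : 0 < 2 * ft r), abs_of_nonneg (sq_nonneg (u r))]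
        have e1 : r * (u r / r) ^ 2 = u r ^ 2 / r := by field_simp
        rw [abs_div, abs_of_pos hr]
        simp only [Pi.add_apply]
        rw [e1, ← hu]
        have hq : 0 ≤ u r ^ 2 / r := by positivity
        have hq' : 0 ≤ r * u r ^ 2 := by positivity
        rcases le_or_gt r 1 with hr1 | hr1
        · have h4 : 2 * ft r * |u r| / r ≤ ft r ^ 2 / r + u r ^ 2 / r := by
            rw [← add_div]
            gcongr
            rw [← sq_abs (u r)]
            nlinarith [sq_nonneg (ft r - |u r|)]
          have h5 : ft r ^ 2 / r ≤ 4 := by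
            rw [div_le_iff₀ hr]; exact hC.nc.sq_le hC.ne hr
          have h6 : 4 ≤ 8 * (1 + r ^ 2)⁻¹ := by
            rw [← div_eq_mul_inv, le_div_iff₀ (by positivity)]
            nlinarith
          linarith
        · have h4 : 2 * ft r * |u r| / r ≤ 1 / r ^ 3 + r * u r ^ 2 := by
            have h7 : 2 * ft r * |u r| / r ≤ 2 * 1 * |u r| / r := by gcongr
            have h8 : 1 / r ^ 3 + r * u r ^ 2 - 2 * 1 * |u r| / r = r * (|u r| - 1 / r ^ 2) ^ 2 := by
              rw [← sq_abs (u r)]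
              field_simp
              ring
            have h9 : 0 ≤ r * (|u r| - 1 / r ^ 2) ^ 2 := by positivity
            linarith
          have h5 : 1 / r ^ 3 ≤ 8 * (1 + r ^ 2)⁻¹ := by
            rw [← div_eq_mul_inv, div_le_div_iff₀ (by positivity) (by positivity)]
            nlinarith [sq_nonneg (r - 1), pow_pos hr 3]
          linarith
    refine ((((i1.add i2).add i3).add (i5.const_mul ((d : ℝ) ^ 2))).add
      (i4.const_mul (1 / 2))).congr_fun (fun r hr => ?_) measurableSet_Ioi
    have hr0 : (0 : ℝ) < r := hr
    simp only [Pi.add_apply, energyDensity, hme r hr0, hfe r hr0, az]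
    have e1 : fz ft z r ^ 2 - ft r ^ 2 = 2 * ft r * u r + u r ^ 2 := by
      simp only [fz, ← hu]; ring
    rw [e1]
    field_simp
  · rcases (ge_iff_le.1 hr).eq_or_lt with h0 | h0
    · rw [← h0]; exact (if_neg (lt_irrefl _)).ge
    · rw [hfe r h0]; exact (h.f_pos r h0).le
  · rw [hm0, hme r hr.1]; exact hC' r hr
  · filter_upwards [ae_eq_ev (inclXH z.1), ae_radial_pos] with r h1 h2
    rw [hfe r h2, fz, ← h1, fnL_inclXH, X.fnL_apply]
  · filter_upwards [ae_eq_ev z.2, ae_radial_pos] with r h1 h2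
    rw [hme r h2, ← h1, H.fnL_apply]

theorem CoreProfile.solutionCurve_eq (hC : CoreProfile d ft) :
    solutionCurve d ft = IsBranch.curve (gStar ft) hC.IsPosSol := by
  rw [solutionCurve, IsBranch.curve, bifurcationPoint]
  congr 1
  ext p
  constructor
  · rintro ⟨hg, f, m, hA, hm, hr⟩
    exact ⟨hg, hA.isPosSol hC hm hr⟩
  · rintro ⟨hg, h⟩
    exact ⟨hg, h.exists_isAdmissible hg⟩

/-- The functional that recovers the branch parameter is the pairing of the second component with
the ground state. -/
theorem CoreProfile.exists_isBranch (hC : CoreProfile d ft) :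
    ∃ lam β, IsBranch (gStar ft) hC.IsPosSol lam β := by
  obtain ⟨w, β, h1, h2, h3, h4⟩ := hC.exists_bifurcation
  set L : Z₀ →L[ℝ] ℝ :=
    (ip (H.fnL w)).comp (H.fnL.comp (ContinuousLinearMap.snd ℝ X H)) with hL
  refine ⟨L, β, hC.gStar_pos, fun g z z' h h' => h.unique h', fun g z h => h.lt_gStar,
    fun g z hg h => h.exists_branch hg, fun g' g hg' h hg hle hle0 => ?_, h1, h2, h3,
    fun f v s t hf => L.hasFDerivAt.comp_hasDerivWithinAt t hf, h4⟩
  choose x hx using h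
  exact CoreProfile.exists_isPosSol_of_tendsto hg' hx hg hle hle0

variable {d : ℤ}

/-! ### Existence of the normal core -/

/-- A reference profile with the behaviour of a vortex at `0` and at infinity. -/
def cut (r : ℝ) : ℝ := r ^ 2 / (1 + r ^ 2)

theorem cut_nonneg (r : ℝ) : 0 ≤ cut r := by unfold cut; positivity

theorem cut_eq (r : ℝ) : cut r = 1 - (1 + r ^ 2)⁻¹ := by
  unfold cut
  field_simp
  ring

theorem inv_one_add_sq_le (r : ℝ) : (1 + r ^ 2)⁻¹ ≤ 1 := inv_le_one_of_one_le₀ (by nlinarith)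

theorem abs_cut_le (r : ℝ) : |cut r| ≤ 1 := by
  rw [abs_of_nonneg (cut_nonneg r), cut_eq]
  linarith [inv_nonneg.2 (show (0 : ℝ) ≤ 1 + r ^ 2 by positivity)]

theorem continuous_cut : Continuous cut := by
  unfold cut
  exact (by fun_prop : Continuous fun r : ℝ => r ^ 2).div (by fun_prop) fun r => by positivity

theorem hasDerivAt_cut (r : ℝ) : HasDerivAt cut (2 * r / (1 + r ^ 2) ^ 2) r := by
  have h0 : (1 : ℝ) + r ^ 2 ≠ 0 := by positivity
  refine ((hasDerivAt_pow 2 r).div ((hasDerivAt_pow 2 r).const_add 1) h0).congr_deriv ?_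
  field_simp
  simp
  ring

theorem continuous_deriv_cut : Continuous fun r : ℝ => 2 * r / (1 + r ^ 2) ^ 2 :=
  (by fun_prop : Continuous fun r : ℝ => 2 * r).div (by fun_prop) fun r => by positivity

theorem memLp_of_sq_le {F : ℝ → ℝ} (hF : Continuous F) {C : ℝ}
    (h : ∀ r > 0, r * F r ^ 2 ≤ C * (1 + r ^ 2)⁻¹) : MemLp F 2 radialMeasure :=
  memLp_two_radial_of_continuousOn hF.continuousOn
    (integrableOn_of_le (continuousOn_id.mul (hF.continuousOn.pow 2)) (integrableOn_one_add_sq C)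
      fun r hr => by rw [abs_of_nonneg (by positivity)]; exact h r hr)

theorem memLp_deriv_cut : MemLp (fun r : ℝ => 2 * r / (1 + r ^ 2) ^ 2) 2 radialMeasure := by
  refine memLp_of_sq_le (C := 4) continuous_deriv_cut fun r hr => ?_
  rw [← div_eq_mul_inv, div_pow, mul_div_assoc', div_le_div_iff₀ (by positivity) (by positivity)]
  have h1 : r ^ 3 ≤ (1 + r ^ 2) ^ 3 := pow_le_pow_left₀ hr.le (by nlinarith) 3
  have h2 : 0 < 1 + r ^ 2 := by positivity
  nlinarith

theorem continuous_inv_one_add_sq : Continuous fun r : ℝ => (1 + r ^ 2)⁻¹ :=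
  (by fun_prop : Continuous fun r : ℝ => 1 + r ^ 2).inv₀ fun r => by positivity

theorem mul_inv_sq_le {r : ℝ} (hr : 0 < r) : r * (1 + r ^ 2)⁻¹ ^ 2 ≤ (1 + r ^ 2)⁻¹ := by
  have h1 : r * (1 + r ^ 2)⁻¹ ≤ 1 := by
    rw [← div_eq_mul_inv, div_le_one (by positivity)]; nlinarith
  have h2 : 0 ≤ (1 + r ^ 2)⁻¹ := by positivity
  nlinarith

theorem memLp_inv_one_add_sq : MemLp (fun r : ℝ => (1 + r ^ 2)⁻¹) 2 radialMeasure :=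
  memLp_of_sq_le (C := 1) continuous_inv_one_add_sq fun r hr => by
    rw [one_mul]; exact mul_inv_sq_le hr

theorem memLp_one_sub_cut_sq : MemLp (fun r : ℝ => 1 - cut r ^ 2) 2 radialMeasure := by
  refine memLp_of_sq_le (C := 4) (continuous_const.sub (continuous_cut.pow 2)) fun r hr => ?_
  have h1 := mul_inv_sq_le hr
  have h2 : 0 ≤ (1 + r ^ 2)⁻¹ := by positivity
  have h3 := inv_one_add_sq_le r
  have h4 : 1 - cut r ^ 2 = (1 + r ^ 2)⁻¹ * (2 - (1 + r ^ 2)⁻¹) := by rw [cut_eq]; ring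
  have h5 : (2 - (1 + r ^ 2)⁻¹) ^ 2 ≤ 4 := by nlinarith
  rw [h4, mul_pow, ← mul_assoc]
  calc r * (1 + r ^ 2)⁻¹ ^ 2 * (2 - (1 + r ^ 2)⁻¹) ^ 2 ≤ r * (1 + r ^ 2)⁻¹ ^ 2 * 4 := by gcongr
    _ ≤ 4 * (1 + r ^ 2)⁻¹ := by linarith

/-- The derivative of `cut` in `L²_r`. -/
def cutDer : L2r := memLp_deriv_cut.toLp

/-- The function `1 - cut = cut / r²` in `L²_r`. -/
def cutInv : L2r := memLp_inv_one_add_sq.toLp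

/-- The function `1 - cut²` in `L²_r`. -/
def cutPot : L2r := memLp_one_sub_cut_sq.toLp

theorem coeFn_cutDer : ∀ᵐ r ∂radialMeasure, cutDer r = 2 * r / (1 + r ^ 2) ^ 2 :=
  MemLp.coeFn_toLp _

theorem coeFn_cutInv : ∀ᵐ r ∂radialMeasure, cutInv r = (1 + r ^ 2)⁻¹ := MemLp.coeFn_toLp _

theorem coeFn_cutPot : ∀ᵐ r ∂radialMeasure, cutPot r = 1 - cut r ^ 2 := MemLp.coeFn_toLp _

/-- Multiplication by `cut` on `L²_r`. -/
def cutT : L2r →L[ℝ] L2r :=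
  mulOne cut continuous_cut.aestronglyMeasurable (ae_of_all _ abs_cut_le)

/-- The function `(cut + u) φ`. -/
def cutN (u φ : X) : L2r := cutT (X.fnL φ) + prodH (inclXH u) (inclXH φ)

/-- The function `1 - (cut + u)²`. -/
def corePot (u : X) : L2r := cutPot - (cutT (X.fnL u) + cutN u u)

theorem coeFn_cutN (u φ : X) : ∀ᵐ r ∂radialMeasure,
    cutN u φ r = (cut r + ev (inclXH u) r) * ev (inclXH φ) r := by
  filter_upwards [Lp.coeFn_add (cutT (X.fnL φ)) (prodH (inclXH u) (inclXH φ)),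
    coeFn_mulOne continuous_cut.aestronglyMeasurable (ae_of_all _ abs_cut_le) (X.fnL φ),
    coeFn_prodH (inclXH u) (inclXH φ), ae_eq_ev (inclXH φ)] with r h1 h2 h3 h4
  rw [fnL_inclXH] at h4
  rw [cutN, h1, Pi.add_apply, cutT, h2, h3, h4]
  ring

theorem coeFn_corePot (u : X) : ∀ᵐ r ∂radialMeasure,
    corePot u r = 1 - (cut r + ev (inclXH u) r) ^ 2 := by
  filter_upwards [Lp.coeFn_sub cutPot (cutT (X.fnL u) + cutN u u),
    Lp.coeFn_add (cutT (X.fnL u)) (cutN u u), coeFn_cutPot, coeFn_cutN u u,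
    coeFn_mulOne continuous_cut.aestronglyMeasurable (ae_of_all _ abs_cut_le) (X.fnL u),
    ae_eq_ev (inclXH u)] with r h1 h2 h3 h4 h5 h6
  rw [fnL_inclXH] at h6
  rw [corePot, h1, Pi.sub_apply, h2, Pi.add_apply, h3, h4, cutT, h5, h6]
  ring

/-- The linear part of the energy. -/
def coreLin (d : ℤ) : X →L[ℝ] ℝ :=
  (ip cutDer).comp X.derL + (d : ℝ) ^ 2 • (ip cutInv).comp X.fnL

theorem coreLin_apply (u : X) : coreLin d u = inner ℝ cutDer (X.derL u)
    + (d : ℝ) ^ 2 * inner ℝ cutInv (X.fnL u) := rfl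

/-- The energy of the profile `cut + u`, relative to that of `cut`. -/
def coreEnergy (d : ℤ) (u : X) : ℝ := QX d 0 u u / 2 + coreLin d u + ‖corePot u‖ ^ 2 / 4

theorem QX_zero_apply (u φ : X) : QX d 0 u φ = inner ℝ (X.derL u) (X.derL φ)
    + (d : ℝ) ^ 2 * inner ℝ (X.quoL u) (X.quoL φ) := by
  rw [QX_apply, inner_zero_left, sub_zero]

theorem corePot_add_smul (u φ : X) (t : ℝ) : corePot (u + t • φ)
    = corePot u - (2 * t) • cutN u φ - t ^ 2 • prodH (inclXH φ) (inclXH φ) := by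
  simp only [corePot, cutN, map_add, map_smul, add_apply, smul_apply,
    prodH_comm (inclXH φ) (inclXH u)]
  module

theorem norm_sq_quadratic {E : Type*} [NormedAddCommGroup E] [InnerProductSpace ℝ E] (y n p : E)
    (t : ℝ) : ‖y - (2 * t) • n - t ^ 2 • p‖ ^ 2 = ‖y‖ ^ 2 - 4 * t * inner ℝ y n
      + t ^ 2 * (4 * ‖n‖ ^ 2 - 2 * inner ℝ y p) + t ^ 3 * (4 * inner ℝ n p) + t ^ 4 * ‖p‖ ^ 2 := by
  simp only [← real_inner_self_eq_norm_sq, inner_sub_left, inner_sub_right, inner_smul_left,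
    inner_smul_right, conj_trivial, real_inner_comm y n, real_inner_comm y p,
    real_inner_comm n p]
  ring

theorem eq_zero_of_quartic_nonneg {a b c e : ℝ}
    (h : ∀ t : ℝ, 0 ≤ t * a + t ^ 2 * b + t ^ 3 * c + t ^ 4 * e) : a = 0 := by
  set P : ℝ → ℝ := fun t => t * a + t ^ 2 * b + t ^ 3 * c + t ^ 4 * e with hP
  have h1 : HasDerivAt P a 0 := by
    refine (((((hasDerivAt_id (0 : ℝ)).mul_const a).add ((hasDerivAt_pow 2 (0 : ℝ)).mul_const b)).add
      ((hasDerivAt_pow 3 (0 : ℝ)).mul_const c)).add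
      ((hasDerivAt_pow 4 (0 : ℝ)).mul_const e)).congr_deriv ?_
    norm_num
  refine IsLocalMin.hasDerivAt_eq_zero (f := P) (a := 0) (Eventually.of_forall fun t => ?_) h1
  have h2 : P 0 = 0 := by simp [hP]
  rw [h2]
  exact h t

/-- The Euler–Lagrange equation of a minimizer. -/
theorem euler_lagrange {u : X} (hmin : ∀ v, coreEnergy d u ≤ coreEnergy d v) (φ : X) :
    QX d 0 u φ + coreLin d φ - inner ℝ (corePot u) (cutN u φ) = 0 := by
  refine eq_zero_of_quartic_nonneg (b := QX d 0 φ φ / 2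
    + (4 * ‖cutN u φ‖ ^ 2 - 2 * inner ℝ (corePot u) (prodH (inclXH φ) (inclXH φ))) / 4)
    (c := inner ℝ (cutN u φ) (prodH (inclXH φ) (inclXH φ)))
    (e := ‖prodH (inclXH φ) (inclXH φ)‖ ^ 2 / 4) fun t => ?_
  have h1 := hmin (u + t • φ)
  rw [coreEnergy, coreEnergy, corePot_add_smul, norm_sq_quadratic] at h1
  simp only [map_add, map_smul, add_apply, smul_apply, smul_eq_mul, QX_symm 0 φ u] at h1
  nlinarith

/-- Replacing the profile by its absolute value does not increase the energy. -/
theorem exists_nonneg_profile (u : X) : ∃ v : X, (∀ r > 0, 0 ≤ cut r + ev (inclXH v) r) ∧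
    coreEnergy d v ≤ coreEnergy d u := by
  set U := ev (inclXH u) with hU
  have hcp : IsPrimitive cut fun r => 2 * r / (1 + r ^ 2) ^ 2 :=
    IsPrimitive.of_hasDerivAt (fun r _ => hasDerivAt_cut r) continuous_deriv_cut.continuousOn
  have hfp : IsPrimitive (fun r => cut r + U r)
      (fun r => 2 * r / (1 + r ^ 2) ^ 2 + X.derL u r) := fun a b ha hb => by
    obtain ⟨i1, e1⟩ := hcp a b ha hb
    obtain ⟨i2, e2⟩ := ev_isPrimitive (inclXH u) a b ha hb
    rw [derL_inclXH] at i2 e2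
    refine ⟨i1.add i2, ?_⟩
    rw [intervalIntegral.integral_add i1 i2, ← e1, ← e2]
    ring
  obtain ⟨v', hm, hp, hle⟩ := hfp.abs
  have hvp : IsPrimitive (fun r => |cut r + U r| - cut r)
      (fun r => v' r - 2 * r / (1 + r ^ 2) ^ 2) := fun a b ha hb => by
    obtain ⟨i1, e1⟩ := hcp a b ha hb
    obtain ⟨i2, e2⟩ := hp a b ha hb
    refine ⟨i2.sub i1, ?_⟩
    rw [intervalIntegral.integral_sub i2 i1, ← e1, ← e2]
    ring
  have hvm : MemLp v' 2 radialMeasure :=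
    (memLp_deriv_cut.add (Lp.memLp (X.derL u))).of_le hm.aestronglyMeasurable hle
  have habs : ∀ r, abs (|cut r + U r| - cut r) ≤ |U r| := fun r => by
    have h1 := abs_abs_sub_abs_le (cut r + U r) (cut r)
    rwa [abs_of_nonneg (cut_nonneg r), add_sub_cancel_left] at h1
  have hUc : ContinuousOn U (Ioi 0) := continuousOn_ev _
  have hcont : ContinuousOn (fun r => |cut r + U r| - cut r) (Ioi 0) :=
    (continuous_cut.continuousOn.add hUc).abs.sub continuous_cut.continuousOn
  obtain ⟨w, hw, hw'⟩ := exists_H_of_isPrimitive hvp ((Lp.memLp (X.fnL u)).of_le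
    (aestronglyMeasurable_radial (hcont.aestronglyMeasurable measurableSet_Ioi)) (by
      filter_upwards [ae_eq_ev (inclXH u)] with r hr
      rw [← fnL_inclXH, hr]
      exact habs r)) (hvm.sub memLp_deriv_cut)
  obtain ⟨v, hv⟩ := exists_X_of_H (w := w) ((Lp.memLp (X.quoL u)).of_le
    (aestronglyMeasurable_radial (((continuousOn_ev w).div continuousOn_id fun x hx =>
      ne_of_gt hx).aestronglyMeasurable measurableSet_Ioi)) (by
      filter_upwards [quoL_ae u, ae_radial_pos] with r h1 h2
      rw [h1, hw r h2, norm_div, norm_div]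
      exact div_le_div_of_nonneg_right (habs r) (norm_nonneg _)))
  have hve : ∀ r > 0, cut r + ev (inclXH v) r = |cut r + U r| := fun r hr => by
    rw [hv, hw r hr]; ring
  refine ⟨v, fun r hr => by rw [hve r hr]; exact abs_nonneg _, ?_⟩
  -- The energy is recombined into three expressions: the potential and the angular part depend only
  -- on the square of the profile, and the gradient part does not increase when the modulus is
  -- taken.
  have e1 : corePot v = corePot u := by
    refine Lp.ext ?_
    filter_upwards [coeFn_corePot u, coeFn_corePot v, ae_radial_pos] with r h1 h2 h3
    rw [h1, h2, hve r h3, sq_abs]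
  have e2 : ‖X.derL v + cutDer‖ ≤ ‖X.derL u + cutDer‖ := by
    refine Lp.norm_le_norm_of_ae_le ?_
    filter_upwards [Lp.coeFn_add (X.derL v) cutDer, Lp.coeFn_add (X.derL u) cutDer, hw', hle,
      coeFn_cutDer] with r h1 h2 h3 h4 h5
    rw [← hv, derL_inclXH] at h3
    rw [h1, h2, Pi.add_apply, Pi.add_apply, h3, h5, sub_add_cancel, add_comm (X.derL u r)]
    exact h4
  -- Since `cutInv = cut/r²` away from the origin, the quadratic and the linear angular terms
  -- combine to the integral of `((cut + u)² - cut²)/(2 r)`.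
  have e3 : ∀ x : X, inner ℝ (X.quoL x) (X.quoL x) / 2 + inner ℝ cutInv (X.fnL x)
      = ∫ r in Ioi (0 : ℝ), ((cut r + ev (inclXH x) r) ^ 2 - cut r ^ 2) / (2 * r) := fun x => by
    have h1 := quoL_ae x
    have h2 := ae_eq_ev (inclXH x)
    rw [fnL_inclXH] at h2
    rw [inner_eq_setIntegral h1 h1, inner_eq_setIntegral coeFn_cutInv h2, ← integral_div,
      ← integral_add ((integrableOn_mul_of_ae h1 h1).div_const 2)
        (integrableOn_mul_of_ae coeFn_cutInv h2)]
    refine setIntegral_congr_fun measurableSet_Ioi fun r hr => ?_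
    have hr0 : (0 : ℝ) < r := hr
    simp only [cut]
    field_simp
    ring
  have e4 : inner ℝ (X.quoL v) (X.quoL v) / 2 + inner ℝ cutInv (X.fnL v)
      = inner ℝ (X.quoL u) (X.quoL u) / 2 + inner ℝ cutInv (X.fnL u) := by
    rw [e3, e3]
    refine setIntegral_congr_fun measurableSet_Ioi fun r hr => ?_
    simp only [hve r hr, sq_abs, hU]
  have e5 : ∀ x : X, inner ℝ (X.derL x) (X.derL x) + 2 * inner ℝ cutDer (X.derL x)
      = ‖X.derL x + cutDer‖ ^ 2 - ‖cutDer‖ ^ 2 := fun x => by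
    rw [norm_add_sq_real, real_inner_self_eq_norm_sq, real_inner_comm]; ring
  have e6 := pow_le_pow_left₀ (norm_nonneg _) e2 2
  have e7 := e5 v
  have e8 := e5 u
  have e9 : (d : ℝ) ^ 2 * (inner ℝ (X.quoL v) (X.quoL v) / 2 + inner ℝ cutInv (X.fnL v))
    = (d : ℝ) ^ 2 * (inner ℝ (X.quoL u) (X.quoL u) / 2 + inner ℝ cutInv (X.fnL u)) := by rw [e4]
  rw [coreEnergy, coreEnergy, e1, QX_zero_apply, QX_zero_apply, coreLin_apply, coreLin_apply]
  linarith

/-- The energy controls the norm for non-negative profiles. -/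
theorem exists_coreEnergy_bound (hd : d ≠ 0) : ∃ K : ℝ, ∀ u : X,
    (∀ r > 0, 0 ≤ cut r + ev (inclXH u) r) → ‖u‖ ^ 2 ≤ 16 * (coreEnergy d u + K) := by
  set D : ℝ := (d : ℝ) ^ 2 with hD
  have hD1 : 1 ≤ D := one_le_sq_int hd
  set p := ‖cutInv‖ with hp
  set q := ‖cutDer‖ with hq
  refine ⟨q ^ 2 + 4 * D ^ 2 * p ^ 2 + p ^ 2 / 4, fun u hu => ?_⟩
  -- For a profile `f ≥ 0` one has `|1 - f| ≤ |1 - f²|`, so the potential term controls the `L²`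
  -- norm of `u`, about which the quadratic part says nothing.
  have h1 : ‖cutInv - X.fnL u‖ ≤ ‖corePot u‖ := by
    refine Lp.norm_le_norm_of_ae_le ?_
    filter_upwards [Lp.coeFn_sub cutInv (X.fnL u), coeFn_corePot u, coeFn_cutInv,
      ae_eq_ev (inclXH u), ae_radial_pos] with r h1 h2 h3 h4 h5
    rw [fnL_inclXH] at h4
    have h6 := hu r h5
    have e : (1 + r ^ 2)⁻¹ - ev (inclXH u) r = 1 - (cut r + ev (inclXH u) r) := by
      rw [cut_eq]; ring
    have e' : 1 - (cut r + ev (inclXH u) r) ^ 2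
        = (1 - (cut r + ev (inclXH u) r)) * (1 + (cut r + ev (inclXH u) r)) := by ring
    rw [h1, h2, Pi.sub_apply, h3, h4, e, e', norm_mul]
    refine le_mul_of_one_le_right (norm_nonneg _) ?_
    rw [Real.norm_of_nonneg (by linarith)]
    linarith
  have h2 : ‖X.fnL u‖ ≤ ‖corePot u‖ + p := by
    have := norm_sub_norm_le (X.fnL u) cutInv
    rw [norm_sub_rev] at this
    linarith
  set a := ‖X.derL u‖ with ha
  set b := ‖X.quoL u‖ with hb
  set c := ‖X.fnL u‖ with hc
  set y := ‖corePot u‖ with hy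
  have hn : ‖u‖ ^ 2 = c ^ 2 + a ^ 2 + b ^ 2 := X.norm_sq u
  have l1 : -(q * a) ≤ inner ℝ cutDer (X.derL u) := (abs_le.1 (abs_real_inner_le_norm _ _)).1
  have l2 : -(p * c) ≤ inner ℝ cutInv (X.fnL u) := (abs_le.1 (abs_real_inner_le_norm _ _)).1
  have hE : coreEnergy d u = (a ^ 2 + D * b ^ 2) / 2 + (inner ℝ cutDer (X.derL u)
      + D * inner ℝ cutInv (X.fnL u)) + y ^ 2 / 4 := by
    rw [coreEnergy, QX_zero_apply, coreLin_apply, real_inner_self_eq_norm_sq,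
      real_inner_self_eq_norm_sq]
  have l3 : D * -(p * c) ≤ D * inner ℝ cutInv (X.fnL u) :=
    mul_le_mul_of_nonneg_left l2 (by linarith)
  have l4 : b ^ 2 ≤ D * b ^ 2 := le_mul_of_one_le_left (sq_nonneg _) hD1
  have l5 : c ^ 2 ≤ 2 * y ^ 2 + 2 * p ^ 2 := by
    have hc0 : 0 ≤ c := norm_nonneg _
    nlinarith [sq_nonneg (y - p)]
  have l6 : q * a ≤ a ^ 2 / 4 + q ^ 2 := by nlinarith [sq_nonneg (a / 2 - q)]
  have l7 : D * (p * c) ≤ c ^ 2 / 16 + 4 * D ^ 2 * p ^ 2 := by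
    nlinarith [sq_nonneg (c / 4 - 2 * (D * p))]
  rw [hn, hE]
  nlinarith [sq_nonneg a, sq_nonneg b]

/-- The direct method among non-negative profiles, where the energy is coercive. The minimizer is
global because passing to the modulus does not increase the energy; this permits two-sided
variations. -/
theorem exists_minimizer (hd : d ≠ 0) : ∃ u : X, (∀ r > 0, 0 ≤ cut r + ev (inclXH u) r) ∧
    ∀ v, coreEnergy d u ≤ coreEnergy d v := by
  obtain ⟨K, hK⟩ := exists_coreEnergy_bound hd
  set S : Set ℝ := coreEnergy d '' {u | ∀ r > 0, 0 ≤ cut r + ev (inclXH u) r} with hS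
  have hne : S.Nonempty := by
    obtain ⟨v, hv, -⟩ := exists_nonneg_profile (d := d) 0
    exact ⟨_, v, hv, rfl⟩
  have hbdd : BddBelow S := by
    refine ⟨-K, ?_⟩
    rintro _ ⟨u, hu, rfl⟩
    have := hK u hu
    nlinarith [sq_nonneg ‖u‖]
  obtain ⟨s, hs, hs', hsS⟩ := exists_seq_tendsto_sInf hne hbdd
  choose x hx hxs using hsS
  have hxC : ∀ n, ‖x n‖ ≤ Real.sqrt (16 * (s 0 + K)) := fun n => by
    refine Real.le_sqrt_of_sq_le ((hK _ (hx n)).trans ?_)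
    rw [hxs n]
    linarith [hs (Nat.zero_le n)]
  obtain ⟨u, ψ, hψ, hu⟩ := weakCompactBalls_X x _ hxC
  refine ⟨u, fun r hr => ge_of_tendsto' (((hu.map inclXH).ev hr).const_add (cut r))
    fun n => hx (ψ n) r hr, fun v => ?_⟩
  have hmin : coreEnergy d u ≤ sInf S := by
    have t1 := hu (QX d 0 u)
    have t2 := hu (coreLin d)
    have t3 : Tendsto (fun n => inner ℝ (corePot u) (corePot (x (ψ n)))) atTop
        (𝓝 (inner ℝ (corePot u) (corePot u))) := by
      have hl := hu ((2 : ℝ) • (ip (corePot u)).comp (cutT.comp X.fnL))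
      have hq := tendsto_inner_prodH (hu.map inclXH) (hu.map inclXH)
        (C := ‖inclXH‖ * Real.sqrt (16 * (s 0 + K)))
        (fun n => (inclXH.le_opNorm _).trans (by gcongr; exact hxC _))
        (fun n => (inclXH.le_opNorm _).trans (by gcongr; exact hxC _)) (corePot u)
      have e : ∀ y : X, inner ℝ (corePot u) (corePot y) = inner ℝ (corePot u) cutPot
          - (((2 : ℝ) • (ip (corePot u)).comp (cutT.comp X.fnL)) y
            + inner ℝ (corePot u) (prodH (inclXH y) (inclXH y))) := fun y => by
        have e1 : ((2 : ℝ) • (ip (corePot u)).comp (cutT.comp X.fnL)) y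
          = 2 * inner ℝ (corePot u) (cutT (X.fnL y)) := rfl
        rw [e1, corePot.eq_1 y, cutN, inner_sub_right, inner_add_right, inner_add_right]
        ring
      have := (hl.add hq).const_sub (inner ℝ (corePot u) cutPot)
      rw [← e u] at this
      exact this.congr fun n => (e _).symm
    -- Lower semicontinuity by completing squares: each quadratic term at `x_n` is at least twice
    -- its pairing with `u` minus its value at `u`, and the pairings converge.
    have t4 := ((((t1.const_mul 2).sub_const (QX d 0 u u)).div_const 2).add t2).add
      (((t3.const_mul 2).sub_const (‖corePot u‖ ^ 2)).div_const 4)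
    have t5 : Tendsto (fun n => coreEnergy d (x (ψ n))) atTop (𝓝 (sInf S)) :=
      (hs'.comp hψ.tendsto_atTop).congr fun n => (hxs _).symm
    have t6 := le_of_tendsto_of_tendsto' t4 t5 fun n => by
      have a1 : 0 ≤ QX d 0 (x (ψ n) - u) (x (ψ n) - u) := by
        rw [QX_zero_apply]
        have := real_inner_self_nonneg (x := X.derL (x (ψ n) - u))
        have := real_inner_self_nonneg (x := X.quoL (x (ψ n) - u))
        positivity
      simp only [map_sub, sub_apply, QX_symm 0 (x (ψ n)) u] at a1
      have a2 := norm_sub_sq_real (corePot u) (corePot (x (ψ n)))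
      have a3 := sq_nonneg ‖corePot u - corePot (x (ψ n))‖
      simp only [coreEnergy, Function.comp_apply]
      linarith
    rw [real_inner_self_eq_norm_sq] at t6
    rw [coreEnergy]
    linarith
  obtain ⟨v', hv', hle⟩ := exists_nonneg_profile (d := d) v
  exact (hmin.trans (csInf_le hbdd ⟨v', hv', rfl⟩)).trans hle

theorem hasDerivAt_flux_cut {r : ℝ} : HasDerivAt (fun r : ℝ => r * (2 * r / (1 + r ^ 2) ^ 2))
    (4 * r * (1 - r ^ 2) / (1 + r ^ 2) ^ 3) r := by
  have h0 : ((1 : ℝ) + r ^ 2) ^ 2 ≠ 0 := by positivity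
  have h1 := (hasDerivAt_id r).mul (((hasDerivAt_id r).const_mul 2).div
    (((hasDerivAt_pow 2 r).const_add 1).pow 2) h0)
  refine h1.congr_deriv ?_
  simp
  field_simp
  ring

/-- The Euler-Lagrange equation says that `u` solves a linear equation with a source; adding the
flux of `cut` turns it into the vortex equation for `f = cut + u`. The boundary values hold since
elements of `X` tend to `0` at both ends, and `f > 0` by the strong maximum principle. -/
theorem exists_isNormalCore (hd : d ≠ 0) : ∃ ft : ℝ → ℝ, IsNormalCore d ft := by
  obtain ⟨u, hu0, hmin⟩ := exists_minimizer hd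
  set U := ev (inclXH u) with hU
  have hUc : ContinuousOn U (Ioi 0) := continuousOn_ev _
  set f : ℝ → ℝ := fun r => cut r + U r with hf
  have hfc : ContinuousOn f (Ioi 0) := continuous_cut.continuousOn.add hUc
  set c : ℝ → ℝ := fun r => (d : ℝ) ^ 2 / r ^ 2 - (1 - f r ^ 2) with hc
  have hcc : ContinuousOn c (Ioi 0) := (continuousOn_const.div (continuousOn_id.pow 2)
    fun _ hr => pow_ne_zero 2 (ne_of_gt hr)).sub (continuousOn_const.sub (hfc.pow 2))
  set s : ℝ → ℝ := fun r => 4 * r * (1 - r ^ 2) / (1 + r ^ 2) ^ 3 with hs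
  have hsc : Continuous s := (by fun_prop : Continuous fun r : ℝ => 4 * r * (1 - r ^ 2)).div
    (by fun_prop) fun r => by positivity
  have hw : HasWeakDeriv (fun r => r * H.derL (inclXH u) r) (fun r => r * (c r * f r) - s r) := by
    intro φ hφ hφc hφs
    obtain ⟨w, hw⟩ := IsTest.exists_X ⟨hφ, hφc, hφs⟩
    have hder : ∀ᵐ r ∂radialMeasure, X.derL w r = deriv φ r := hw.der_eq
    have hfn : ∀ᵐ r ∂radialMeasure, X.fnL w r = φ r := by
      filter_upwards [ae_eq_ev (inclXH w), ae_radial_pos] with r h1 h2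
      rw [← fnL_inclXH, h1, hw.ev_eq r h2]
    have hquo : ∀ᵐ r ∂radialMeasure, X.quoL w r = φ r / r := by
      filter_upwards [quoL_ae w, ae_radial_pos] with r h1 h2
      rw [h1, hw.ev_eq r h2]
    have hN : ∀ᵐ r ∂radialMeasure, cutN u w r = f r * φ r := by
      filter_upwards [coeFn_cutN u w, ae_radial_pos] with r h1 h2
      rw [h1, hw.ev_eq r h2]
    have hd0 : ∀ᵐ r ∂radialMeasure, X.derL u r = X.derL u r := ae_of_all _ fun _ => rfl
    have h0 := euler_lagrange hmin w
    have hcut := (IsPrimitive.of_hasDerivAt (fun r _ => hasDerivAt_flux_cut)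
      hsc.continuousOn).hasWeakDeriv φ hφ hφc hφs
    have is : IntegrableOn (fun r => s r * φ r) (Ioi 0) :=
      ((hsc.mul hφ.continuous).integrable_of_hasCompactSupport hφc.mul_left).integrableOn
    rw [QX_zero_apply, coreLin_apply, inner_eq_setIntegral hd0 hder,
      inner_eq_setIntegral (quoL_ae u) hquo, inner_eq_setIntegral coeFn_cutDer hder,
      inner_eq_setIntegral coeFn_cutInv hfn, inner_eq_setIntegral (coeFn_corePot u) hN,
      ← integral_const_mul, ← integral_const_mul] at h0
    have i1 := (integrableOn_mul_of_ae (quoL_ae u) hquo).const_mul ((d : ℝ) ^ 2)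
    have i2 := (integrableOn_mul_of_ae coeFn_cutInv hfn).const_mul ((d : ℝ) ^ 2)
    have i3 := integrableOn_mul_of_ae (coeFn_corePot u) hN
    have e1 : ∫ r in Ioi (0 : ℝ), r * H.derL (inclXH u) r * deriv φ r
        = ∫ r in Ioi (0 : ℝ), r * (X.derL u r * deriv φ r) := by
      simp only [mul_assoc, derL_inclXH]
    have e2 : ∫ r in Ioi (0 : ℝ), r * (2 * r / (1 + r ^ 2) ^ 2 * deriv φ r)
        = ∫ r in Ioi (0 : ℝ), r * (2 * r / (1 + r ^ 2) ^ 2) * deriv φ r := by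
      simp only [mul_assoc]
    have e3 := integral_sub ((i1.add i2).sub i3) is
    have e4 := integral_sub (i1.add i2) i3
    have e5 := integral_add i1 i2
    simp only [Pi.add_apply, Pi.sub_apply] at e3 e4 e5
    rw [e4, e5] at e3
    have e6 : ∫ r in Ioi (0 : ℝ), (r * (c r * f r) - s r) * φ r = ∫ r in Ioi (0 : ℝ),
        ((d : ℝ) ^ 2 * (r * (ev (inclXH u) r / r * (φ r / r)))
          + (d : ℝ) ^ 2 * (r * ((1 + r ^ 2)⁻¹ * φ r))
          - r * ((1 - (cut r + ev (inclXH u) r) ^ 2) * (f r * φ r)) - s r * φ r) := by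
      refine setIntegral_congr_fun measurableSet_Ioi fun r hr => ?_
      have hr0 : (0 : ℝ) < r := hr
      have e7 : r * ((d : ℝ) ^ 2 / r ^ 2 * f r) = (d : ℝ) ^ 2 * (U r / r)
          + (d : ℝ) ^ 2 * (r * (1 + r ^ 2)⁻¹) := by
        simp only [hf, cut]
        field_simp
        ring
      have e8 : (r * (c r * f r) - s r) * φ r = (r * ((d : ℝ) ^ 2 / r ^ 2 * f r)) * φ r
          - r * ((1 - f r ^ 2) * (f r * φ r)) - s r * φ r := by
        simp only [hc]; ring
      have e9 : (d : ℝ) ^ 2 * (r * (ev (inclXH u) r / r * (φ r / r)))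
          = (d : ℝ) ^ 2 * (U r / r) * φ r := by
        rw [← hU]
        field_simp
      have e10 : cut r + ev (inclXH u) r = f r := rfl
      change (r * (c r * f r) - s r) * φ r = _
      rw [e8, e7, e9, e10]
      ring
    rw [e1, e6, e3]
    rw [e2, hcut] at h0
    linarith
  obtain ⟨V, h1, h2, -⟩ := H.regularity ((continuousOn_id.mul (hcc.mul hfc)).sub hsc.continuousOn) hw
  have hsol : IsRadialSol f (fun r => r * (2 * r / (1 + r ^ 2) ^ 2) + V r) c := by
    refine ⟨fun r hr => ((hasDerivAt_cut r).add (h2 r hr)).congr_deriv ?_, fun r hr =>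
      (hasDerivAt_flux_cut.add (h1 r hr)).congr_deriv ?_⟩
    · field_simp
    · simp only [hs, Pi.sub_apply, Pi.mul_apply, id]
      ring
  have hcut0 : Tendsto cut (𝓝[>] 0) (𝓝 0) := by
    have := continuous_cut.tendsto 0
    rw [show cut 0 = 0 by simp [cut]] at this
    exact this.mono_left nhdsWithin_le_nhds
  have hcut1 : Tendsto cut atTop (𝓝 1) := by
    have h3 : Tendsto (fun r : ℝ => 1 + r ^ 2) atTop atTop :=
      tendsto_atTop_add_const_left _ _ (tendsto_pow_atTop two_ne_zero)
    have h4 := (tendsto_inv_atTop_zero.comp h3).const_sub 1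
    rw [sub_zero] at h4
    exact h4.congr fun r => (cut_eq r).symm
  have hf1 : Tendsto f atTop (𝓝 1) := by
    have := hcut1.add (tendsto_ev_atTop (inclXH u))
    rwa [add_zero] at this
  have hf0 : Tendsto f (𝓝[>] 0) (𝓝 0) := by
    have := hcut0.add (X.tendsto_ev_zero u)
    rwa [add_zero] at this
  have hpos : ∀ r > 0, 0 < f r := by
    refine hsol.pos hcc hu0 ?_
    obtain ⟨r, h3, h4⟩ := ((hf1.eventually (lt_mem_nhds one_pos)).and
      (eventually_gt_atTop 0)).exists
    exact ⟨r, h4, h3.ne'⟩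
  set F : ℝ → ℝ := fun r => if 0 < r then f r else 0 with hF
  have hFe : ∀ r > 0, F r = f r := fun r hr => if_pos hr
  have hF0 : F 0 = 0 := if_neg (lt_irrefl _)
  have hS := hsol.congr_fun hFe
  refine ⟨F, hS.contDiffOn hcc, fun r hr => ?_, fun r hr => by rw [hFe r hr]; exact hpos r hr,
    hF0, ?_, ?_⟩
  · rw [(hS.hasDerivAt_deriv hr).deriv, hFe r hr]
    simp only [hc]
    ring
  · rw [← continuousWithinAt_Ioi_iff_Ici, ContinuousWithinAt, hF0]
    refine hf0.congr' ?_
    filter_upwards [self_mem_nhdsWithin] with r hr using (hFe r hr).symm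
  · refine hf1.congr' ?_
    filter_upwards [eventually_gt_atTop 0] with r hr using (hFe r hr).symm

end VortexGL

end

/-! ### Assembly of the result -/

theorem proposition4p4 (d : ℤ) (hd : d ≠ 0) :
    (∃ ft : ℝ → ℝ, VortexGL.IsNormalCore d ft) ∧
    ∀ ft : ℝ → ℝ, VortexGL.IsNormalCore d ft →
      0 < VortexGL.gStar ft ∧
      (∀ (g : ℝ) (f m : ℝ → ℝ), 0 < g → VortexGL.IsAdmissible d ft g f m →
        (∀ r ≥ 0, 0 < m r) → ∃ z : VortexGL.Z₀, VortexGL.Represents ft z f m) ∧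
      IsConnected (VortexGL.solutionCurve d ft) ∧
      VortexGL.IsC1CurveFrom (VortexGL.bifurcationPoint ft) (VortexGL.solutionCurve d ft) ∧
      VortexGL.IsGraphOver (VortexGL.gStar ft) (VortexGL.solutionCurve d ft) ∧
      ∀ g₀ : ℝ, 0 < g₀ →
        IsCompact (VortexGL.solutionCurve d ft ∩ {p | g₀ ≤ p.2}) := by
  refine ⟨VortexGL.exists_isNormalCore hd, fun ft hft => ?_⟩
  have hC : VortexGL.CoreProfile d ft := ⟨hd, hft⟩
  obtain ⟨lam, β, hB⟩ := hC.exists_isBranch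
  rw [hC.solutionCurve_eq]
  exact ⟨hC.gStar_pos, fun g f m hg h _ => h.exists_represents hC hg, hB.isConnected,
    hB.isC1CurveFrom, hB.isGraphOver, fun g₀ hg₀ => hB.isCompact hg₀⟩
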